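/- Setting. Let $\mathbb K$ be an algebraically closed field of characteristic $0$, $I=\{1,\dots,r\}$, $A=(A_{ij})_{i,j\in I}$ an invertible generalised Cartan matrix (not necessarily indecomposable), and $\epsilon_i\in\mathbb K^\times$ ($i\in I$) such that $D^{-1}A$ is symmetric, $D=\mathrm{diag}(\epsilon_i)$. Let $\mathfrak g=\mathfrak g(A)$ be the Kac–Moody algebra with generators $e_i,f_i,h_i$, where $[h_i,e_j]=A_{ij}e_j$, with Cartan subalgebra $\mathfrak h=\langle h_i\rangle$ and simple roots $\alpha_j$, $\alpha_j(h_i)=A_{ij}$. Let $\kappa$ be the invariant symmetric form on $\mathfrak g$ with $\kappa(e_i,f_j)=\delta_{ij}\epsilon_j$, and $(-,-)$ the form on $\mathfrak h^*$ induced by $\kappa|_{\mathfrak h}$. Let $\Lambda_i$ be the basis of $\mathfrak h^*$ dual to the $h_i$, and let $\lambda=\sum_i\lambda_i\Lambda_i$ with $\lambda_i\in\mathbb Z_{\ge0}$. For a weight $\mu=\sum_i\mu_i\Lambda_i$ put $\mu^{\blacktriangle}=\sum_i\epsilon_i^{-1}\mu_i\Lambda_i$ and $\mu^{\blacktriangledown}=\sum_i\epsilon_i\mu_i\Lambda_i$.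 A weight $\mu$ is *pseudo-minuscule* if it is dominant integral and $(\mu^{\blacktriangledown},\alpha)\in\{0,1\}$ for every positive root $\alpha$ of $\mathfrak g$. Let $\mathfrak g^-\subseteq\mathfrak g$ be the subalgebra generated by $e_k,f_k,h_k$ for those $k\in I$ with $\lambda_k=0$. Let $B=(B_{ij})_{i,j\in\{0\}\cup I}$ be given by $B_{00}=0$, $B_{i0}=-\lambda_i$, $B_{0j}=-\epsilon_j^{-1}\lambda_j$, $B_{ij}=A_{ij}$ ($i,j\in I$), and assume that $B$ is invertible. Let $\tilde{\mathscr B}$ be the Lie superalgebra with generators $e_i,f_i,h_i$ ($i\in\{0\}\cup I$), where $e_0,f_0$ are odd and the others even, and relations $[h_i,e_j]=B_{ij}e_j$, $[h_i,f_j]=-B_{ij}f_j$, $[e_i,f_j]=\delta_{ij}h_j$; let $\mathscr B$ be its quotient by the maximal ideal that is graded and intersects the local part trivially, for the grading $\deg e_i=1$, $\deg f_i=-1$, $\deg h_i=0$. From now on grade $\mathscr B=\bigoplus_k\mathscr B_k$ by $\deg e_0=1$, $\deg f_0=-1$, all other generators having degree $0$. Then $\mathfrak g$ is the subalgebra of $\mathscr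 B_0$ generated by $e_i,f_i,h_i$, $i\in I$. Write $\llbracket-,-\rrbracket$ for the bracket of $\mathscr B$, let $L=\sum_i(B^{-1})_{0i}h_i$, and let $\langle x|y\rangle=-\langle y|x\rangle$ ($x\in\mathscr B_{-1}$, $y\in\mathscr B_1$) be the unique pairing with $\langle\llbracket x,z\rrbracket|y\rangle=\langle x|\llbracket z,y\rrbracket\rangle$ for $z\in\mathscr B_0$ and $\langle e_0|f_0\rangle=1$. On $\mathscr B_{-1}U(\mathscr B_0)\oplus U(\mathscr B_0)\oplus\mathscr B_1U(\mathscr B_0)$, where $\mathscr B_{\pm1}U(\mathscr B_0)=\mathscr B_{\pm1}\otimes U(\mathscr B_0)$ is the degree $\pm1$ part of the enveloping algebra of the semidirect product of $\mathscr B_0$ and the free Lie superalgebra on $\mathscr B_{\pm1}$, define products of elements of degrees $\pm1$ and $\mp1$ by $(Xx)(yY)=X(xy)Y$ for $X,Y\in U(\mathscr B_0)$, where for $x\in\mathscr B_{-1}$, $y\in\mathscr B_1$ $$xy=-\llbracket y,x\rrbracket+\langle x|y\rangle L,\qquad yx=\llbracket x,y\rrbracket+\langle y|x\rangle L+\langle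 y|x\rangle .$$ With the supercommutator as bracket (the summands of degree $\pm1$ being odd) this is a local Lie superalgebra. Take its subalgebra generated by $\mathscr B_{-1}\mathscr B_0$ and $\mathscr B_1$, and factor out the maximal ideal that intersects the subspace of degree $0$ trivially. The result is the local part of the *cartanification* $\mathscr B^W$ of $\mathscr B$ (the minimal $\mathbb Z$-graded Lie superalgebra with this local part). Thus $(\mathscr B^W)_{-1}$ is a quotient of $\mathscr B_{-1}\mathscr B_0$, and it is a $\mathfrak g$-module. **Theorem.** Let $\lambda^{\blacktriangle}$ be pseudo-minuscule and $\lambda=\lambda^{\blacktriangle}$. Then the submodule $U(\mathfrak g)(f_0h_0)$ of the $\mathfrak g$-module $(\mathscr B^W)_{-1}$ is irreducible with highest weight $\lambda$, and for every highest root $\vartheta$ of a simple component of $\mathfrak g^-$ (equivalently, every maximal root $\vartheta$ of $\mathfrak g^-$), with root vector $e_\vartheta$, the submodule $U(\mathfrak g)(f_0e_\vartheta)$ is irreducible with highest weight $\vartheta+\lambda$. If $\mathfrak g$ is simple, then $(\mathscr B^W)_{-1}$ is the direct sum of $U(\mathfrak g)(f_0h_0)$ and of the submodules $U(\mathfrak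 g)(f_0e_\vartheta)$, one for each such $\vartheta$. -/

import Mathlib

noncomputable section

namespace Cartanification

/-! ### Two-sided ideals and quotients of non-associative algebras -/

section Algebra

variable (K : Type*) [Field K] (A : Type*) [NonUnitalNonAssocRing A] [Module K A]

/-- A two-sided ideal of a (non-associative) `K`-algebra. -/
structure AlgIdeal extends Submodule K A where
  mul_mem_left' : ∀ x y : A, y ∈ carrier → x * y ∈ carrier
  mul_mem_right' : ∀ x y : A, x ∈ carrier → x * y ∈ carrier

variable {K A}

/-- The underlying vector space of the quotient by a two-sided ideal. -/
def AlgIdeal.Quotient (I : AlgIdeal K A) : Type _ := A ⧸ I.toSubmodule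

namespace AlgIdeal

/-- The two-sided ideal generated by a set. -/
def span (s : Set A) : AlgIdeal K A where
  toSubmodule := sInf {N | s ⊆ N ∧ ∀ x y : A, (y ∈ N → x * y ∈ N) ∧ (x ∈ N → x * y ∈ N)}
  mul_mem_left' x y hy := by
    simp only [AddSubsemigroup.mem_carrier, AddSubmonoid.mem_toSubsemigroup,
      Submodule.mem_toAddSubmonoid, Submodule.mem_sInf] at hy ⊢
    exact fun N hN => (hN.2 x y).1 (hy N hN)
  mul_mem_right' x y hx := by
    simp only [AddSubsemigroup.mem_carrier, AddSubmonoid.mem_toSubsemigroup,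
      Submodule.mem_toAddSubmonoid, Submodule.mem_sInf] at hx ⊢
    exact fun N hN => (hN.2 x y).2 (hx N hN)

theorem subset_span (s : Set A) : s ⊆ (span (K := K) s).toSubmodule := by
  intro x hx
  simp only [span, SetLike.mem_coe, Submodule.mem_sInf]
  exact fun N hN => hN.1 hx

/-- The sum of a set of two-sided ideals. -/
def sum [IsScalarTower K A A] [SMulCommClass K A A] (S : Set (AlgIdeal K A)) : AlgIdeal K A where
  toSubmodule := ⨆ I : S, (I : AlgIdeal K A).toSubmodule
  mul_mem_left' x y hy := by
    have h : (⨆ I : S, (I : AlgIdeal K A).toSubmodule) ≤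
        (⨆ I : S, (I : AlgIdeal K A).toSubmodule).comap (LinearMap.mulLeft K x) :=
      iSup_le fun I z hz => Submodule.mem_iSup_of_mem (p := fun I : S =>
        (I : AlgIdeal K A).toSubmodule) I (I.1.mul_mem_left' x z hz)
    exact h hy
  mul_mem_right' x y hx := by
    have h : (⨆ I : S, (I : AlgIdeal K A).toSubmodule) ≤
        (⨆ I : S, (I : AlgIdeal K A).toSubmodule).comap (LinearMap.mulRight K y) :=
      iSup_le fun I z hz => Submodule.mem_iSup_of_mem (p := fun I : S =>
        (I : AlgIdeal K A).toSubmodule) I (I.1.mul_mem_right' z y hz)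
    exact h hx

variable (I : AlgIdeal K A)

instance : AddCommGroup I.Quotient := inferInstanceAs (AddCommGroup (A ⧸ I.toSubmodule))
instance : Module K I.Quotient := inferInstanceAs (Module K (A ⧸ I.toSubmodule))

/-- The projection to the quotient. -/
def proj : A →ₗ[K] I.Quotient := I.toSubmodule.mkQ

theorem proj_surjective : Function.Surjective I.proj := Submodule.mkQ_surjective _

theorem proj_eq_zero {x : A} : I.proj x = 0 ↔ x ∈ I.toSubmodule :=
  Submodule.Quotient.mk_eq_zero _

variable [IsScalarTower K A A] [SMulCommClass K A A]

/-- The product of the quotient algebra. -/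
def mulQ : I.Quotient →ₗ[K] I.Quotient →ₗ[K] I.Quotient :=
  I.toSubmodule.liftQ
    { toFun := fun x => I.toSubmodule.mapQ I.toSubmodule (LinearMap.mulLeft K x)
        (fun y hy => I.mul_mem_left' x y hy)
      map_add' := fun x y => by
        refine Submodule.linearMap_qext _ (LinearMap.ext fun z => ?_)
        exact congrArg I.toSubmodule.mkQ (add_mul x y z)
      map_smul' := fun c x => by
        refine Submodule.linearMap_qext _ (LinearMap.ext fun z => ?_)
        exact congrArg I.toSubmodule.mkQ (smul_mul_assoc c x z) }
    (fun x hx => by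
      refine Submodule.linearMap_qext _ (LinearMap.ext fun z => ?_)
      exact (Submodule.Quotient.mk_eq_zero _).2 (I.mul_mem_right' x z hx))

instance : NonUnitalNonAssocRing I.Quotient where
  mul x y := I.mulQ x y
  left_distrib x y z := map_add (I.mulQ x) y z
  right_distrib x y z := LinearMap.map_add₂ I.mulQ x y z
  zero_mul x := LinearMap.map_zero₂ I.mulQ x
  mul_zero x := map_zero (I.mulQ x)

theorem proj_mul (x y : A) : I.proj (x * y) = I.proj x * I.proj y := rfl

instance : IsScalarTower K I.Quotient I.Quotient where
  smul_assoc c x y := LinearMap.map_smul₂ I.mulQ c x y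

instance : SMulCommClass K I.Quotient I.Quotient where
  smul_comm c x y := (map_smul (I.mulQ x) c y).symm

end AlgIdeal

end Algebra

/-! ### The contragredient Lie superalgebra of a matrix -/

section Contragredient

/-- The generators `e_i, f_i, h_i`, where `i` runs over the nodes `I` and the extra node `0`,
which is written `none`. -/
inductive Gen (I : Type) : Type
  | e (i : Option I)
  | f (i : Option I)
  | h (i : Option I)

/-- The degree of the generators in the grading where every `e_i` has degree `1` and every `f_i`
has degree `-1`. -/
def Gen.height {I : Type} : Gen I → ℤ
  | .e _ => 1
  | .f _ => -1
  | .h _ => 0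

/-- The degree of the generators in the consistent grading, where only `e_0` and `f_0` have
nonzero degree. -/
def Gen.level {I : Type} : Gen I → ℤ
  | .e none => 1
  | .f none => -1
  | _ => 0

/-- The degree of a non-associative word in the generators. -/
def wordDeg {I : Type} (d : Gen I → ℤ) : FreeMagma (Gen I) → ℤ
  | .of x => d x
  | .mul a b => wordDeg d a + wordDeg d b

variable (K : Type*) [Field K] {I : Type}

/-- The sign `(-1)^{pq}`. -/
def sgn (p q : ℤ) : K := if Odd p ∧ Odd q then -1 else 1

/-- A non-associative word as an element of the free non-associative algebra. -/
def word (w : FreeMagma (Gen I)) : FreeNonUnitalNonAssocAlgebra K (Gen I) :=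
  MonoidAlgebra.ofMagma K _ w

variable {K}

/-- The relations. A word is odd if it contains an odd number of letters `e_0`, `f_0`, that is, if
its degree in the consistent grading is odd. The first two families say that the product is a Lie
superalgebra bracket, the others are the Chevalley relations. -/
inductive Relator (B : Matrix (Option I) (Option I) K) :
    FreeNonUnitalNonAssocAlgebra K (Gen I) → Prop
  | skew (a b : FreeMagma (Gen I)) : Relator B
      (word K a * word K b + sgn K (wordDeg Gen.level a) (wordDeg Gen.level b) •
        (word K b * word K a))
  | jacobi (a b c : FreeMagma (Gen I)) : Relator B
      (word K a * (word K b * word K c) - (word K a * word K b) * word K c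
        - sgn K (wordDeg Gen.level a) (wordDeg Gen.level b) •
          (word K b * (word K a * word K c)))
  | he (i j : Option I) : Relator B
      (word K (.of (.h i)) * word K (.of (.e j)) - B i j • word K (.of (.e j)))
  | hf (i j : Option I) : Relator B
      (word K (.of (.h i)) * word K (.of (.f j)) + B i j • word K (.of (.f j)))
  | ef (i : Option I) : Relator B
      (word K (.of (.e i)) * word K (.of (.f i)) - word K (.of (.h i)))
  | ef_ne (i j : Option I) (hij : i ≠ j) : Relator B
      (word K (.of (.e i)) * word K (.of (.f j)))

/-- The Lie superalgebra with generators `e_i, f_i, h_i` and the Chevalley relations, its bracket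
being written as a product. -/
abbrev TildeAlg (B : Matrix (Option I) (Option I) K) : Type _ :=
  (AlgIdeal.span (K := K) {x | Relator B x}).Quotient

/-- The component of degree `k` of `TildeAlg B`, for the grading in which the generators have
degrees `d`. -/
def tildeComp (B : Matrix (Option I) (Option I) K) (d : Gen I → ℤ) (k : ℤ) :
    Submodule K (TildeAlg B) :=
  Submodule.span K {x | ∃ w, wordDeg d w = k ∧ AlgIdeal.proj _ (word K w) = x}

/-- The maximal ideal of `TildeAlg B` which is graded and intersects the local part trivially (with
respect to the grading in which all `e_i` have degree `1` and all `f_i` have degree `-1`): the sum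
of all such ideals. -/
def maxIdeal (B : Matrix (Option I) (Option I) K) : AlgIdeal K (TildeAlg B) :=
  AlgIdeal.sum {J |
    (J.toSubmodule ≤ ⨆ k : ℤ, J.toSubmodule ⊓ tildeComp B Gen.height k) ∧
    J.toSubmodule ⊓ (tildeComp B Gen.height (-1) ⊔ tildeComp B Gen.height 0 ⊔
      tildeComp B Gen.height 1) = ⊥}

/-- The contragredient Lie superalgebra `𝓑` with Cartan matrix `B`, in which `e_0` and `f_0` are
odd; its bracket is written as a product. -/
abbrev ContrAlg (B : Matrix (Option I) (Option I) K) : Type _ := (maxIdeal B).Quotient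

variable (B : Matrix (Option I) (Option I) K)

/-- The value of a non-associative word in `𝓑`. -/
def val (w : FreeMagma (Gen I)) : ContrAlg B := (maxIdeal B).proj (AlgIdeal.proj _ (word K w))

/-- The component `𝓑_k` in the consistent grading. -/
def comp (k : ℤ) : Submodule K (ContrAlg B) :=
  Submodule.span K {x | ∃ w, wordDeg Gen.level w = k ∧ val B w = x}

variable {B}

theorem word_mul (a b : FreeMagma (Gen I)) : word K (a.mul b) = word K a * word K b :=
  map_mul (MonoidAlgebra.ofMagma K _) a b

theorem val_mul (a b : FreeMagma (Gen I)) : val B (a.mul b) = val B a * val B b := by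
  simp only [val, word_mul, AlgIdeal.proj_mul]

theorem val_mem (w : FreeMagma (Gen I)) : val B w ∈ comp B (wordDeg Gen.level w) :=
  Submodule.subset_span ⟨w, rfl, rfl⟩

theorem relator_eq_zero {x : FreeNonUnitalNonAssocAlgebra K (Gen I)} (hx : Relator B x) :
    (maxIdeal B).proj (AlgIdeal.proj (AlgIdeal.span (K := K) {x | Relator B x}) x) = 0 := by
  have h : AlgIdeal.proj (AlgIdeal.span (K := K) {x | Relator B x}) x = 0 :=
    (AlgIdeal.proj_eq_zero _).2 (AlgIdeal.subset_span _ hx)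
  rw [h, map_zero]

theorem mul_mem_comp {j k : ℤ} {x y : ContrAlg B} (hx : x ∈ comp B j) (hy : y ∈ comp B k) :
    x * y ∈ comp B (j + k) := by
  induction hx, hy using Submodule.span_induction₂ with
  | mem_mem x y hx hy =>
    obtain ⟨a, rfl, rfl⟩ := hx
    obtain ⟨b, rfl, rfl⟩ := hy
    rw [← val_mul]
    exact val_mem (a.mul b)
  | zero_left y hy => simp
  | zero_right x hx => simp
  | add_left x y z hx hy hz h₁ h₂ => rw [add_mul]; exact add_mem h₁ h₂
  | add_right x y z hx hy hz h₁ h₂ => rw [mul_add]; exact add_mem h₁ h₂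
  | smul_left r x y hx hy h => rw [smul_mul_assoc]; exact Submodule.smul_mem _ _ h
  | smul_right r x y hx hy h => rw [mul_smul_comm]; exact Submodule.smul_mem _ _ h

theorem super_skew {j k : ℤ} {x y : ContrAlg B} (hx : x ∈ comp B j) (hy : y ∈ comp B k) :
    x * y + sgn K j k • (y * x) = 0 := by
  induction hx, hy using Submodule.span_induction₂ with
  | mem_mem x y hx hy =>
    obtain ⟨a, rfl, rfl⟩ := hx
    obtain ⟨b, rfl, rfl⟩ := hy
    have h := relator_eq_zero (Relator.skew (B := B) a b)
    simp only [map_add, map_smul, AlgIdeal.proj_mul] at h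
    exact h
  | zero_left y hy => simp
  | zero_right x hx => simp
  | add_left x y z hx hy hz h₁ h₂ =>
    rw [add_mul, mul_add, smul_add, add_add_add_comm, h₁, h₂, add_zero]
  | add_right x y z hx hy hz h₁ h₂ =>
    rw [add_mul, mul_add, smul_add, add_add_add_comm, h₁, h₂, add_zero]
  | smul_left r x y hx hy h =>
    rw [smul_mul_assoc, mul_smul_comm, smul_comm _ r, ← smul_add, h, smul_zero]
  | smul_right r x y hx hy h =>
    rw [smul_mul_assoc, mul_smul_comm, smul_comm _ r, ← smul_add, h, smul_zero]

theorem super_jacobi {j k l : ℤ} {x y z : ContrAlg B} (hx : x ∈ comp B j) (hy : y ∈ comp B k)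
    (hz : z ∈ comp B l) :
    x * (y * z) - (x * y) * z - sgn K j k • (y * (x * z)) = 0 := by
  induction hz using Submodule.span_induction with
  | mem z hz =>
    obtain ⟨c, rfl, rfl⟩ := hz
    induction hx, hy using Submodule.span_induction₂ with
    | mem_mem x y hx hy =>
      obtain ⟨a, rfl, rfl⟩ := hx
      obtain ⟨b, rfl, rfl⟩ := hy
      have h := relator_eq_zero (Relator.jacobi (B := B) a b c)
      simp only [map_sub, map_smul, AlgIdeal.proj_mul] at h
      exact h
    | zero_left y hy => simp
    | zero_right x hx => simp
    | add_left x y z hx hy hz h₁ h₂ =>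
      have e := congrArg₂ (· + ·) h₁ h₂
      simp only [add_zero] at e
      rw [← e]
      simp only [add_mul, mul_add, smul_add]
      abel
    | add_right x y z hx hy hz h₁ h₂ =>
      have e := congrArg₂ (· + ·) h₁ h₂
      simp only [add_zero] at e
      rw [← e]
      simp only [add_mul, mul_add, smul_add]
      abel
    | smul_left r x y hx hy h =>
      simp only [smul_mul_assoc, mul_smul_comm, smul_comm _ r, ← smul_sub, h, smul_zero]
    | smul_right r x y hx hy h =>
      simp only [smul_mul_assoc, mul_smul_comm, smul_comm _ r, ← smul_sub, h, smul_zero]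
  | zero => simp
  | add z w hz hw h₁ h₂ =>
    have e := congrArg₂ (· + ·) h₁ h₂
    simp only [add_zero] at e
    rw [← e]
    simp only [mul_add, smul_add]
    abel
  | smul r z hz h =>
    simp only [mul_smul_comm, smul_comm _ r, ← smul_sub, h, smul_zero]

theorem level_zero_skew {k : ℤ} {x y : ContrAlg B} (hx : x ∈ comp B 0) (hy : y ∈ comp B k) :
    x * y = -(y * x) := by
  have h := super_skew hx hy
  rw [sgn, if_neg (by simp), one_smul] at h
  exact eq_neg_of_add_eq_zero_left h

theorem level_zero_jacobi {k l : ℤ} {x y z : ContrAlg B} (hx : x ∈ comp B 0)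
    (hy : y ∈ comp B k) (hz : z ∈ comp B l) : x * (y * z) = (x * y) * z + y * (x * z) := by
  have h := super_jacobi hx hy hz
  rw [sgn, if_neg (by simp), one_smul, sub_sub, sub_eq_zero] at h
  exact h

variable (B)

/-- `𝓑_0`. -/
abbrev B₀ : Type _ := ↥(comp B 0)
/-- `𝓑_1`. -/
abbrev Bp : Type _ := ↥(comp B 1)
/-- `𝓑_{-1}`. -/
abbrev Bm : Type _ := ↥(comp B (-1))

variable {B}

instance [CharZero K] : LieRing (B₀ B) where
  bracket x y := ⟨(x : ContrAlg B) * y, by simpa using mul_mem_comp x.2 y.2⟩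
  add_lie x y z := Subtype.ext (add_mul _ _ _)
  lie_add x y z := Subtype.ext (mul_add _ _ _)
  lie_self x := Subtype.ext (by
    have h := eq_neg_iff_add_eq_zero.1 (level_zero_skew x.2 x.2)
    rw [← two_smul K] at h
    exact (smul_eq_zero.1 h).resolve_left two_ne_zero)
  leibniz_lie x y z := Subtype.ext (level_zero_jacobi x.2 y.2 z.2)

instance [CharZero K] : LieAlgebra K (B₀ B) where
  lie_smul _ _ _ := Subtype.ext (mul_smul_comm _ _ _)

instance [CharZero K] : LieRingModule (B₀ B) (Bp B) where
  bracket x y := ⟨(x : ContrAlg B) * y, by simpa using mul_mem_comp x.2 y.2⟩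
  add_lie x y z := Subtype.ext (add_mul _ _ _)
  lie_add x y z := Subtype.ext (mul_add _ _ _)
  leibniz_lie x y z := Subtype.ext (level_zero_jacobi x.2 y.2 z.2)

instance [CharZero K] : LieModule K (B₀ B) (Bp B) where
  smul_lie _ _ _ := Subtype.ext (smul_mul_assoc _ _ _)
  lie_smul _ _ _ := Subtype.ext (mul_smul_comm _ _ _)

instance [CharZero K] : LieRingModule (B₀ B) (Bm B) where
  bracket x y := ⟨(x : ContrAlg B) * y, by simpa using mul_mem_comp x.2 y.2⟩
  add_lie x y z := Subtype.ext (add_mul _ _ _)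
  lie_add x y z := Subtype.ext (mul_add _ _ _)
  leibniz_lie x y z := Subtype.ext (level_zero_jacobi x.2 y.2 z.2)

instance [CharZero K] : LieModule K (B₀ B) (Bm B) where
  smul_lie _ _ _ := Subtype.ext (smul_mul_assoc _ _ _)
  lie_smul _ _ _ := Subtype.ext (mul_smul_comm _ _ _)

variable (B)

/-- The bracket `⟦y, x⟧ ∈ 𝓑_0` of `y ∈ 𝓑_1` and `x ∈ 𝓑_{-1}`. -/
def pairing : Bp B →ₗ[K] Bm B →ₗ[K] B₀ B :=
  LinearMap.mk₂ K (fun y x => ⟨(y : ContrAlg B) * x, by simpa using mul_mem_comp y.2 x.2⟩)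
    (fun _ _ _ => Subtype.ext (add_mul _ _ _)) (fun _ _ _ => Subtype.ext (smul_mul_assoc _ _ _))
    (fun _ _ _ => Subtype.ext (mul_add _ _ _)) (fun _ _ _ => Subtype.ext (mul_smul_comm _ _ _))

theorem pairing_lie [CharZero K] (z : B₀ B) (y : Bp B) (x : Bm B) :
    ⁅z, pairing B y x⁆ = pairing B ⁅z, y⁆ x + pairing B y ⁅z, x⁆ :=
  Subtype.ext (level_zero_jacobi z.2 y.2 x.2)

/-- `e_0 ∈ 𝓑_1`. -/
def e0 : Bp B := ⟨val B (.of (.e none)), val_mem (.of (.e none))⟩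
/-- `f_0 ∈ 𝓑_{-1}`. -/
def f0 : Bm B := ⟨val B (.of (.f none)), val_mem (.of (.f none))⟩
/-- `e_i ∈ 𝓑_0` for `i ∈ I`. -/
def eG (i : I) : B₀ B := ⟨val B (.of (.e (some i))), val_mem (.of (.e (some i)))⟩
/-- `f_i ∈ 𝓑_0` for `i ∈ I`. -/
def fG (i : I) : B₀ B := ⟨val B (.of (.f (some i))), val_mem (.of (.f (some i)))⟩
/-- `h_i ∈ 𝓑_0` for `i ∈ {0} ∪ I`. -/
def hG (i : Option I) : B₀ B := ⟨val B (.of (.h i)), val_mem (.of (.h i))⟩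

/-- The subalgebra of `𝓑_0` generated by `e_i, f_i, h_i` for `i` in a set `S` of nodes of `I`. -/
def subalg [CharZero K] (S : Set I) : LieSubalgebra K (B₀ B) :=
  LieSubalgebra.lieSpan K (B₀ B) {x | ∃ i ∈ S, x = eG B i ∨ x = fG B i ∨ x = hG B (some i)}

/-- The grading element `L = ∑_i (B⁻¹)_{0i} h_i`. -/
def gradingElt [Fintype I] [DecidableEq I] : B₀ B := ∑ i, B⁻¹ none i • hG B i

variable {B}

/-- A bilinear form `⟨x|y⟩`, `x ∈ 𝓑_{-1}`, `y ∈ 𝓑_1`, is invariant if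
`⟨⟦x,z⟧|y⟩ = ⟨x|⟦z,y⟧⟩` for all `z ∈ 𝓑_0` (note that `⟦x,z⟧ = -⟦z,x⟧`). -/
def IsInvariantForm [CharZero K] (φ : Bm B →ₗ[K] Bp B →ₗ[K] K) : Prop :=
  ∀ (x : Bm B) (z : B₀ B) (y : Bp B), φ (-⁅z, x⁆) y = φ x ⁅z, y⁆

variable (B)

open Classical in
/-- The form `⟨x|y⟩`, `x ∈ 𝓑_{-1}`, `y ∈ 𝓑_1`: the unique invariant form normalised by
`⟨f_0|e_0⟩ = -⟨e_0|f_0⟩ = -1`. -/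
def form [CharZero K] : Bm B →ₗ[K] Bp B →ₗ[K] K :=
  if h : ∃ φ : Bm B →ₗ[K] Bp B →ₗ[K] K, IsInvariantForm φ ∧ φ (f0 B) (e0 B) = -1 then h.choose
  else 0

theorem form_invariant [CharZero K] : IsInvariantForm (form B) := by
  unfold form
  split_ifs with h
  · exact h.choose_spec.1
  · intro x z y
    simp

theorem val_h_mul_e (i j : Option I) :
    val B (.of (.h i)) * val B (.of (.e j)) = B i j • val B (.of (.e j)) := by
  have h := relator_eq_zero (Relator.he (B := B) i j)
  simp only [map_sub, map_smul, AlgIdeal.proj_mul] at h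
  exact sub_eq_zero.1 h

theorem val_h_mul_f (i j : Option I) :
    val B (.of (.h i)) * val B (.of (.f j)) = -(B i j • val B (.of (.f j))) := by
  have h := relator_eq_zero (Relator.hf (B := B) i j)
  simp only [map_add, map_smul, AlgIdeal.proj_mul] at h
  exact eq_neg_of_add_eq_zero_left h

theorem val_e_mul_f (i : Option I) :
    val B (.of (.e i)) * val B (.of (.f i)) = val B (.of (.h i)) := by
  have h := relator_eq_zero (Relator.ef (B := B) i)
  simp only [map_sub, AlgIdeal.proj_mul] at h
  exact sub_eq_zero.1 h

section Grading

variable [Fintype I] [DecidableEq I]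

theorem gradingElt_mul (hB : IsUnit B.det) (w : FreeMagma (Gen I)) :
    (gradingElt B : ContrAlg B) * val B w = (wordDeg Gen.level w : K) • val B w := by
  have hL : (gradingElt B : ContrAlg B) = ∑ i, B⁻¹ none i • val B (.of (.h i)) := by
    simp [gradingElt, hG]
  have hd : ∀ j, ∑ i, B⁻¹ none i * B i j = if none = j then 1 else 0 := fun j => by
    rw [← Matrix.mul_apply, Matrix.nonsing_inv_mul _ hB, Matrix.one_apply]
  have he : ∀ j, (gradingElt B : ContrAlg B) * val B (.of (.e j)) =
      (Gen.level (.e j) : K) • val B (.of (.e j)) := fun j => by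
    simp only [hL, Finset.sum_mul, smul_mul_assoc, val_h_mul_e, smul_smul, ← Finset.sum_smul, hd]
    cases j <;> simp [Gen.level]
  have hf : ∀ j, (gradingElt B : ContrAlg B) * val B (.of (.f j)) =
      (Gen.level (.f j) : K) • val B (.of (.f j)) := fun j => by
    simp only [hL, Finset.sum_mul, smul_mul_assoc, val_h_mul_f, smul_neg, smul_smul,
      Finset.sum_neg_distrib, ← Finset.sum_smul, hd]
    cases j <;> simp [Gen.level]
  have hm : ∀ a b : FreeMagma (Gen I), (gradingElt B : ContrAlg B) * (val B a * val B b) =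
      (gradingElt B : ContrAlg B) * val B a * val B b +
        val B a * ((gradingElt B : ContrAlg B) * val B b) := fun a b =>
    level_zero_jacobi (gradingElt B).2 (val_mem a) (val_mem b)
  induction w with
  | ih1 x =>
    rcases x with j | j | j
    · exact he j
    · exact hf j
    · have h := hm (.of (.e j)) (.of (.f j))
      rw [val_e_mul_f, he, hf] at h
      rw [h, smul_mul_assoc, mul_smul_comm, ← add_smul, val_e_mul_f]
      cases j <;> simp [wordDeg, Gen.level]
  | ih2 a b iha ihb =>
    rw [show a * b = a.mul b from rfl, val_mul, hm, iha, ihb, smul_mul_assoc, mul_smul_comm, ← add_smul]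
    simp [wordDeg]

theorem gradingElt_central [CharZero K] (z : B₀ B) : ⁅gradingElt B, z⁆ = 0 := by
  by_cases hB : IsUnit B.det
  · have h : comp B 0 ≤ LinearMap.ker (LinearMap.mulLeft K (gradingElt B : ContrAlg B)) := by
      refine Submodule.span_le.2 ?_
      rintro _ ⟨w, hw, rfl⟩
      simp [gradingElt_mul B hB w, hw]
    exact Subtype.ext (h z.2)
  · have : gradingElt B = 0 := by
      simp [gradingElt, Matrix.nonsing_inv_apply_not_isUnit B hB]
    rw [this, zero_lie]

end Grading

end Contragredient

/-! ### The degree-one parts `V U(G)` -/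

section Env

attribute [local instance] LieRing.ofAssociativeRing

open scoped TensorProduct

variable (K : Type*) [Field K] (G : Type*) [LieRing G] [LieAlgebra K G]
  (V : Type*) [AddCommGroup V] [Module K V] [LieRingModule G V] [LieModule K G V]

/-- The universal enveloping algebra of `G`. -/
local notation "UU" => UniversalEnvelopingAlgebra

/-- The space `V U(G)`, that is, the part of degree one of the enveloping algebra of the semidirect
product of `G` and the free Lie superalgebra on the `G`-module `V`. It is a free right
`U(G)`-module; `x ⊗ u` stands for the product `x u`. -/
abbrev Env : Type _ := V ⊗[K] UU K G

/-- Left multiplication by elements of `G`, which is given by `z (x u) = ⟦z, x⟧ u + x (z u)`. -/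
def leftMul₀ : G →ₗ⁅K⁆ Module.End K (Env K G V) where
  toFun z := (LieModule.toEnd K G V z).rTensor (UU K G) +
    (LinearMap.mulLeft K (UniversalEnvelopingAlgebra.ι K z)).lTensor V
  map_add' y z := by
    ext x u
    simp [add_mul, TensorProduct.tmul_add]
    abel
  map_smul' c z := by
    ext x u
    simp [TensorProduct.smul_tmul']
  map_lie' {y z} := by
    refine TensorProduct.ext' fun x u => ?_
    simp [LieRing.of_associative_ring_bracket, sub_mul, mul_assoc, TensorProduct.tmul_sub]
    abel

/-- Left multiplication by elements of `U(G)` on `V U(G)`. -/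
def leftMul : UU K G →ₐ[K] Module.End K (Env K G V) :=
  UniversalEnvelopingAlgebra.lift K (leftMul₀ K G V)

/-- Right multiplication by elements of `U(G)` on `V U(G)`, `(x v) u = x (v u)`. -/
def rightMul : UU K G →ₗ[K] Module.End K (Env K G V) :=
  LinearMap.lTensorHom V ∘ₗ (LinearMap.mul K (UU K G)).flip

variable {K G V}

theorem leftMul_ι (z : G) : leftMul K G V (UniversalEnvelopingAlgebra.ι K z) =
    leftMul₀ K G V z := UniversalEnvelopingAlgebra.lift_ι_apply K _ z

theorem leftMul_ι_tmul (z : G) (x : V) (u : UU K G) :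
    leftMul K G V (UniversalEnvelopingAlgebra.ι K z) (x ⊗ₜ u) =
      ⁅z, x⁆ ⊗ₜ u + x ⊗ₜ (UniversalEnvelopingAlgebra.ι K z * u) := by
  rw [leftMul_ι]
  rfl

theorem rightMul_tmul (u v : UU K G) (x : V) :
    rightMul K G V u (x ⊗ₜ v) = x ⊗ₜ (v * u) := rfl

theorem rightMul_mul (u v : UU K G) (m : Env K G V) :
    rightMul K G V (u * v) m = rightMul K G V v (rightMul K G V u m) := by
  induction m using TensorProduct.induction_on with
  | zero => simp
  | tmul x w => simp [rightMul_tmul, mul_assoc]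
  | add m n hm hn => simp [hm, hn]

theorem leftMul_rightMul_ι (z : G) (v : UU K G) (m : Env K G V) :
    leftMul K G V (UniversalEnvelopingAlgebra.ι K z) (rightMul K G V v m) =
      rightMul K G V v (leftMul K G V (UniversalEnvelopingAlgebra.ι K z) m) := by
  induction m using TensorProduct.induction_on with
  | zero => simp
  | tmul x w => simp only [rightMul_tmul, leftMul_ι_tmul, map_add, mul_assoc]
  | add m n hm hn => simp only [map_add, hm, hn]

theorem leftMul_rightMul (u v : UU K G) (m : Env K G V) :
    leftMul K G V u (rightMul K G V v m) = rightMul K G V v (leftMul K G V u m) := by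
  let S : Subalgebra K (Module.End K (Env K G V)) := Subalgebra.centralizer K {rightMul K G V v}
  have hS : ∀ z, leftMul₀ K G V z ∈ S := fun z => by
    refine Subalgebra.mem_centralizer_iff K |>.2 fun r hr => ?_
    rw [Set.mem_singleton_iff.1 hr, ← leftMul_ι]
    exact LinearMap.ext fun m => (leftMul_rightMul_ι z v m).symm
  let g : G →ₗ⁅K⁆ S :=
    { toFun := fun z => ⟨leftMul₀ K G V z, hS z⟩
      map_add' := fun _ _ => Subtype.ext (map_add _ _ _)
      map_smul' := fun _ _ => Subtype.ext (map_smul _ _ _)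
      map_lie' := fun {_ _} => Subtype.ext (LieHom.map_lie _ _ _) }
  have h : leftMul K G V = S.val.comp (UniversalEnvelopingAlgebra.lift K g) := by
    refine ((UniversalEnvelopingAlgebra.lift_unique K _ _).1 (funext fun z => ?_)).symm
    exact congrArg Subtype.val (UniversalEnvelopingAlgebra.lift_ι_apply K g z)
  have hu : leftMul K G V u ∈ S := by
    rw [h]
    exact (UniversalEnvelopingAlgebra.lift K g u).2
  exact (LinearMap.congr_fun ((Subalgebra.mem_centralizer_iff K).1 hu _ rfl) m).symm

variable (K V) in
/-- The commutator `[u, m] = u m - m u` of `u ∈ U(G)` and `m ∈ V U(G)`. -/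
def comm (u : UU K G) (m : Env K G V) : Env K G V := leftMul K G V u m - rightMul K G V u m

theorem comm_ι_tmul (z : G) (x : V) (u : UU K G) :
    comm K V (UniversalEnvelopingAlgebra.ι K z) (x ⊗ₜ u) = ⁅z, x⁆ ⊗ₜ u +
      x ⊗ₜ (UniversalEnvelopingAlgebra.ι K z * u - u * UniversalEnvelopingAlgebra.ι K z) := by
  rw [comm, leftMul_ι_tmul, rightMul_tmul, TensorProduct.tmul_sub, add_sub_assoc]

theorem comm_comm (z : G) (u : UU K G) (m : Env K G V) :
    comm K V (UniversalEnvelopingAlgebra.ι K z) (comm K V u m) =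
      comm K V (UniversalEnvelopingAlgebra.ι K z * u - u * UniversalEnvelopingAlgebra.ι K z) m +
      comm K V u (comm K V (UniversalEnvelopingAlgebra.ι K z) m) := by
  simp only [comm, map_sub, map_mul, rightMul_mul, leftMul_rightMul,
    LinearMap.sub_apply, Module.End.mul_apply]
  abel

/-- The action of `G` on `V U(G)` by commutators. -/
instance : LieRingModule G (Env K G V) where
  bracket z m := comm K V (UniversalEnvelopingAlgebra.ι K z) m
  add_lie y z m := by
    simp only [comm, map_add, LinearMap.add_apply]
    abel
  lie_add z m n := by
    simp only [comm, map_add]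
    abel
  leibniz_lie y z m := by
    rw [LieHom.map_lie, LieRing.of_associative_ring_bracket]
    exact comm_comm y _ m

theorem lie_def (z : G) (m : Env K G V) :
    ⁅z, m⁆ = comm K V (UniversalEnvelopingAlgebra.ι K z) m := rfl

instance : LieModule K G (Env K G V) where
  smul_lie c z m := by
    simp only [lie_def, comm, map_smul, LinearMap.smul_apply, smul_sub]
  lie_smul c z m := by
    simp only [lie_def, comm, map_smul, smul_sub]

theorem lie_comm (z : G) (u : UU K G) (m : Env K G V) :
    ⁅z, comm K V u m⁆ = comm K V
      (UniversalEnvelopingAlgebra.ι K z * u - u * UniversalEnvelopingAlgebra.ι K z) m +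
        comm K V u ⁅z, m⁆ := comm_comm z u m

variable {W : Type*} [AddCommGroup W] [Module K W] [LieRingModule G W] [LieModule K G W]

/-- The product `V × W U(G) → U(G)`, `x (y v) = (x y) v`, determined by a map `V × W → U(G)`,
`(x, y) ↦ x y`. -/
def envProdOne (b : V →ₗ[K] W →ₗ[K] UU K G) : V →ₗ[K] Env K G W →ₗ[K] UU K G :=
  TensorProduct.uncurry (RingHom.id K) W (UU K G) (UU K G) ∘ₗ
    LinearMap.llcomp K W (UU K G) (UU K G →ₗ[K] UU K G) (LinearMap.mul K (UU K G)) ∘ₗ b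

theorem envProdOne_tmul (b : V →ₗ[K] W →ₗ[K] UU K G) (x : V) (y : W) (v : UU K G) :
    envProdOne b x (y ⊗ₜ v) = b x y * v := rfl

/-- The product `V U(G) × W U(G) → U(G)`, `(x u) n = x (u n)`, determined by a map
`V × W → U(G)`, `(x, y) ↦ x y`. In combination with `x (y v) = (x y) v` this is the rule
`(X x) (y Y) = (X (x y)) Y` for `X, Y ∈ U(G)`. -/
def envProd (b : V →ₗ[K] W →ₗ[K] UU K G) : Env K G V →ₗ[K] Env K G W →ₗ[K] UU K G :=
  TensorProduct.lift (LinearMap.mk₂ K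
    (fun x u => envProdOne b x ∘ₗ leftMul K G W u)
    (fun x y u => by rw [map_add, LinearMap.add_comp])
    (fun c x u => by rw [map_smul, LinearMap.smul_comp])
    (fun x u v => by rw [map_add, LinearMap.comp_add])
    (fun c x u => by rw [map_smul, LinearMap.comp_smul]))

theorem envProd_tmul (b : V →ₗ[K] W →ₗ[K] UU K G) (x : V) (u : UU K G) (n : Env K G W) :
    envProd b (x ⊗ₜ u) n = envProdOne b x (leftMul K G W u n) := rfl

/-- `[z, x y] = ⟦z, x⟧ y + x ⟦z, y⟧`. -/
def IsEquivariant (b : V →ₗ[K] W →ₗ[K] UU K G) : Prop :=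
  ∀ (z : G) (x : V) (y : W), UniversalEnvelopingAlgebra.ι K z * b x y -
    b x y * UniversalEnvelopingAlgebra.ι K z = b ⁅z, x⁆ y + b x ⁅z, y⁆

theorem envProdOne_equivariant {b : V →ₗ[K] W →ₗ[K] UU K G} (hb : IsEquivariant b) (z : G) (x : V)
    (n : Env K G W) : UniversalEnvelopingAlgebra.ι K z * envProdOne b x n = envProdOne b ⁅z, x⁆ n +
      envProdOne b x (leftMul K G W (UniversalEnvelopingAlgebra.ι K z) n) := by
  induction n using TensorProduct.induction_on with
  | zero => simp
  | tmul y v =>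
    rw [leftMul_ι_tmul, map_add, envProdOne_tmul, envProdOne_tmul, envProdOne_tmul, envProdOne_tmul,
      ← mul_assoc, ← mul_assoc, ← add_assoc, ← add_mul, ← add_mul, ← hb z x y, sub_add_cancel]
  | add m n hm hn => simp only [map_add, mul_add, hm, hn]; abel

theorem envProdOne_rightMul (b : V →ₗ[K] W →ₗ[K] UU K G) (x : V) (n : Env K G W) (u : UU K G) :
    envProdOne b x (rightMul K G W u n) = envProdOne b x n * u := by
  induction n using TensorProduct.induction_on with
  | zero => simp
  | tmul y v => rw [rightMul_tmul, envProdOne_tmul, envProdOne_tmul, mul_assoc]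
  | add m n hm hn => simp only [map_add, add_mul, hm, hn]

theorem envProd_equivariant {b : V →ₗ[K] W →ₗ[K] UU K G} (hb : IsEquivariant b) (z : G)
    (m : Env K G V) (n : Env K G W) : UniversalEnvelopingAlgebra.ι K z * envProd b m n -
      envProd b m n * UniversalEnvelopingAlgebra.ι K z = envProd b ⁅z, m⁆ n + envProd b m ⁅z, n⁆ := by
  induction m using TensorProduct.induction_on with
  | zero => simp
  | tmul x u =>
    rw [lie_def, lie_def, comm_ι_tmul, map_add, LinearMap.add_apply]
    simp only [envProd_tmul, map_sub, map_mul, LinearMap.sub_apply, Module.End.mul_apply,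
      envProdOne_equivariant hb, comm, leftMul_rightMul, envProdOne_rightMul]
    abel
  | add m m' hm hm' =>
    simp only [lie_add, map_add, mul_add, add_mul, LinearMap.add_apply]
    rw [add_sub_add_comm, hm, hm']
    abel

end Env

/-! ### The cartanification -/

section Cartan

open scoped TensorProduct

variable {K : Type*} [Field K] [CharZero K] {I : Type} [Fintype I] [DecidableEq I]
  (B : Matrix (Option I) (Option I) K)

/-- `U(𝓑_0)`. -/
abbrev U₀ : Type _ := UniversalEnvelopingAlgebra K (B₀ B)
/-- `𝓑_1 U(𝓑_0)`. -/
abbrev Up : Type _ := Env K (B₀ B) (Bp B)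
/-- `𝓑_{-1} U(𝓑_0)`. -/
abbrev Um : Type _ := Env K (B₀ B) (Bm B)

section

attribute [local instance] LieRing.ofAssociativeRing

/-- The canonical map from `𝓑_0` to `U(𝓑_0)`. -/
def inU : B₀ B →ₗ[K] U₀ B := (UniversalEnvelopingAlgebra.ι K : B₀ B →ₗ⁅K⁆ U₀ B)

theorem inU_lie (y z : B₀ B) : inU B ⁅y, z⁆ = inU B y * inU B z - inU B z * inU B y :=
  LieHom.map_lie (UniversalEnvelopingAlgebra.ι K) y z

end

/-- The product `x y = -⟦y, x⟧ + ⟨x|y⟩ L` of `x ∈ 𝓑_{-1}` and `y ∈ 𝓑_1`. -/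
def mulMP : Bm B →ₗ[K] Bp B →ₗ[K] U₀ B :=
  LinearMap.mk₂ K (fun x y => -inU B (pairing B y x) + form B x y • inU B (gradingElt B))
    (fun _ _ _ => by simp only [map_add, LinearMap.add_apply, add_smul, neg_add]; abel)
    (fun _ _ _ => by simp only [map_smul, LinearMap.smul_apply, smul_add, smul_neg, smul_assoc])
    (fun _ _ _ => by simp only [map_add, LinearMap.add_apply, add_smul, neg_add]; abel)
    (fun _ _ _ => by simp only [map_smul, LinearMap.smul_apply, smul_add, smul_neg, smul_assoc])

/-- The product `y x = ⟦x, y⟧ + ⟨y|x⟩ L + ⟨y|x⟩` of `y ∈ 𝓑_1` and `x ∈ 𝓑_{-1}`, where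
`⟦x, y⟧ = ⟦y, x⟧` and `⟨y|x⟩ = -⟨x|y⟩` since `x` and `y` are odd. -/
def mulPM : Bp B →ₗ[K] Bm B →ₗ[K] U₀ B :=
  LinearMap.mk₂ K (fun y x => inU B (pairing B y x) - form B x y • (inU B (gradingElt B) + 1))
    (fun _ _ _ => by simp only [map_add, LinearMap.add_apply, add_smul]; abel)
    (fun _ _ _ => by simp only [map_smul, LinearMap.smul_apply, smul_sub, smul_assoc])
    (fun _ _ _ => by simp only [map_add, LinearMap.add_apply, add_smul]; abel)
    (fun _ _ _ => by simp only [map_smul, LinearMap.smul_apply, smul_sub, smul_assoc])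

/-- The bracket `[m, p] = m p + p m` of `m ∈ 𝓑_{-1} U(𝓑_0)` and `p ∈ 𝓑_1 U(𝓑_0)` (both are odd). -/
def commMP (m : Um B) (p : Up B) : U₀ B := envProd (mulMP B) m p + envProd (mulPM B) p m

/-- The three spaces form a subalgebra of the local Lie superalgebra
`𝓑_{-1} U(𝓑_0) ⊕ U(𝓑_0) ⊕ 𝓑_1 U(𝓑_0)` with the commutator as bracket. -/
structure IsLocalSubalgebra (Sm : Submodule K (Um B)) (So : Submodule K (U₀ B))
    (Sp : Submodule K (Up B)) : Prop where
  comm_zero : ∀ u ∈ So, ∀ v ∈ So, u * v - v * u ∈ So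
  comm_neg : ∀ u ∈ So, ∀ m ∈ Sm, comm K (Bm B) u m ∈ Sm
  comm_pos : ∀ u ∈ So, ∀ p ∈ Sp, comm K (Bp B) u p ∈ Sp
  comm_neg_pos : ∀ m ∈ Sm, ∀ p ∈ Sp, commMP B m p ∈ So

/-- The three spaces form a subalgebra that contains `𝓑_{-1} 𝓑_0` and `𝓑_1`. -/
structure IsAdmissible (Sm : Submodule K (Um B)) (So : Submodule K (U₀ B))
    (Sp : Submodule K (Up B)) : Prop extends IsLocalSubalgebra B Sm So Sp where
  mul_mem : ∀ (x : Bm B) (z : B₀ B), x ⊗ₜ[K] inU B z ∈ Sm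
  mem : ∀ y : Bp B, y ⊗ₜ[K] (1 : U₀ B) ∈ Sp

/-- The part of degree `-1` of the subalgebra generated by `𝓑_{-1} 𝓑_0` and `𝓑_1`. -/
def genM : Submodule K (Um B) := sInf {Sm | ∃ So Sp, IsAdmissible B Sm So Sp}
/-- The part of degree `0` of the subalgebra generated by `𝓑_{-1} 𝓑_0` and `𝓑_1`. -/
def genO : Submodule K (U₀ B) := sInf {So | ∃ Sm Sp, IsAdmissible B Sm So Sp}
/-- The part of degree `1` of the subalgebra generated by `𝓑_{-1} 𝓑_0` and `𝓑_1`. -/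
def genP : Submodule K (Up B) := sInf {Sp | ∃ Sm So, IsAdmissible B Sm So Sp}

/-- `Im ⊕ 0 ⊕ Ip` is an ideal of the subalgebra generated by `𝓑_{-1} 𝓑_0` and `𝓑_1`; such ideals,
which intersect the subspace of degree `0` trivially, are called peripheral. -/
structure IsPeripheral (Im : Submodule K (Um B)) (Ip : Submodule K (Up B)) : Prop where
  le_neg : Im ≤ genM B
  le_pos : Ip ≤ genP B
  comm_neg : ∀ u ∈ genO B, ∀ m ∈ Im, comm K (Bm B) u m ∈ Im
  comm_pos : ∀ u ∈ genO B, ∀ p ∈ Ip, comm K (Bp B) u p ∈ Ip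
  neg_eq_zero : ∀ m ∈ Im, ∀ p ∈ genP B, commMP B m p = 0
  pos_eq_zero : ∀ m ∈ genM B, ∀ p ∈ Ip, commMP B m p = 0

/-- The part of degree `-1` of the maximal peripheral ideal. -/
def maxPeripheral : Submodule K (Um B) := sSup {Im | ∃ Ip, IsPeripheral B Im Ip}

/-! The two subspaces are stable under the action of `𝓑_0` by commutators. -/

theorem form_lie (x : Bm B) (z : B₀ B) (y : Bp B) : form B ⁅z, x⁆ y + form B x ⁅z, y⁆ = 0 := by
  rw [← form_invariant B x z y, map_neg, LinearMap.neg_apply, add_neg_cancel]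

theorem gradingElt_comm (z : B₀ B) : inU B z * inU B (gradingElt B) =
    inU B (gradingElt B) * inU B z := by
  have h := inU_lie B (gradingElt B) z
  rw [gradingElt_central, map_zero] at h
  exact (sub_eq_zero.1 h.symm).symm

theorem mulMP_equivariant : IsEquivariant (mulMP B) := by
  intro z x y
  change inU B z * (-inU B (pairing B y x) + form B x y • inU B (gradingElt B)) -
      (-inU B (pairing B y x) + form B x y • inU B (gradingElt B)) * inU B z =
    (-inU B (pairing B y ⁅z, x⁆) + form B ⁅z, x⁆ y • inU B (gradingElt B)) +
    (-inU B (pairing B ⁅z, y⁆ x) + form B x ⁅z, y⁆ • inU B (gradingElt B))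
  have h := inU_lie B z (pairing B y x)
  rw [pairing_lie, map_add] at h
  have hf : form B ⁅z, x⁆ y = -form B x ⁅z, y⁆ := eq_neg_of_add_eq_zero_left (form_lie B x z y)
  rw [hf, mul_add, add_mul, mul_smul_comm, smul_mul_assoc, gradingElt_comm, neg_smul, mul_neg,
    neg_mul]
  rw [eq_sub_iff_add_eq] at h
  rw [← h]
  abel

theorem mulPM_equivariant : IsEquivariant (mulPM B) := by
  intro z y x
  change inU B z * (inU B (pairing B y x) - form B x y • (inU B (gradingElt B) + 1)) -
      (inU B (pairing B y x) - form B x y • (inU B (gradingElt B) + 1)) * inU B z =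
    (inU B (pairing B ⁅z, y⁆ x) - form B x ⁅z, y⁆ • (inU B (gradingElt B) + 1)) +
    (inU B (pairing B y ⁅z, x⁆) - form B ⁅z, x⁆ y • (inU B (gradingElt B) + 1))
  have h := inU_lie B z (pairing B y x)
  rw [pairing_lie, map_add] at h
  have hf : form B ⁅z, x⁆ y = -form B x ⁅z, y⁆ := eq_neg_of_add_eq_zero_left (form_lie B x z y)
  rw [hf, mul_sub, sub_mul, mul_smul_comm, smul_mul_assoc, mul_add, add_mul, gradingElt_comm,
    neg_smul, mul_one, one_mul]
  rw [eq_sub_iff_add_eq] at h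
  rw [← h]
  abel

theorem commMP_equivariant (z : B₀ B) (m : Um B) (p : Up B) :
    inU B z * commMP B m p - commMP B m p * inU B z = commMP B ⁅z, m⁆ p + commMP B m ⁅z, p⁆ := by
  have h₁ : inU B z * envProd (mulMP B) m p - envProd (mulMP B) m p * inU B z = _ :=
    envProd_equivariant (mulMP_equivariant B) z m p
  have h₂ : inU B z * envProd (mulPM B) p m - envProd (mulPM B) p m * inU B z = _ :=
    envProd_equivariant (mulPM_equivariant B) z p m
  simp only [commMP, mul_add, add_mul]
  rw [add_sub_add_comm, h₁, h₂]
  abel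

variable {B} in
theorem IsAdmissible.genM_le {Sm So Sp} (h : IsAdmissible B Sm So Sp) : genM B ≤ Sm :=
  sInf_le ⟨So, Sp, h⟩

variable {B} in
theorem IsAdmissible.genO_le {Sm So Sp} (h : IsAdmissible B Sm So Sp) : genO B ≤ So :=
  sInf_le ⟨Sm, Sp, h⟩

variable {B} in
theorem IsAdmissible.genP_le {Sm So Sp} (h : IsAdmissible B Sm So Sp) : genP B ≤ Sp :=
  sInf_le ⟨Sm, So, h⟩

theorem isAdmissible_gen : IsAdmissible B (genM B) (genO B) (genP B) where
  comm_zero u hu v hv := (Submodule.mem_sInf).2 fun _ ⟨_, _, h⟩ =>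
    h.comm_zero u (h.genO_le hu) v (h.genO_le hv)
  comm_neg u hu m hm := (Submodule.mem_sInf).2 fun _ ⟨_, _, h⟩ =>
    h.comm_neg u (h.genO_le hu) m (h.genM_le hm)
  comm_pos u hu p hp := (Submodule.mem_sInf).2 fun _ ⟨_, _, h⟩ =>
    h.comm_pos u (h.genO_le hu) p (h.genP_le hp)
  comm_neg_pos m hm p hp := (Submodule.mem_sInf).2 fun _ ⟨_, _, h⟩ =>
    h.comm_neg_pos m (h.genM_le hm) p (h.genP_le hp)
  mul_mem x z := (Submodule.mem_sInf).2 fun _ ⟨_, _, h⟩ => h.mul_mem x z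
  mem y := (Submodule.mem_sInf).2 fun _ ⟨_, _, h⟩ => h.mem y

theorem lie_inU_tmul {V : Type*} [AddCommGroup V] [Module K V] [LieRingModule (B₀ B) V]
    [LieModule K (B₀ B) V] (z : B₀ B) (x : V) (u : U₀ B) :
    ⁅z, (x ⊗ₜ[K] u : Env K (B₀ B) V)⁆ = ⁅z, x⁆ ⊗ₜ u + x ⊗ₜ (inU B z * u - u * inU B z) :=
  comm_ι_tmul z x u

theorem lie_comm_inU {V : Type*} [AddCommGroup V] [Module K V] [LieRingModule (B₀ B) V]
    [LieModule K (B₀ B) V] (z : B₀ B) (u : U₀ B) (m : Env K (B₀ B) V) :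
    ⁅z, comm K V u m⁆ = comm K V (inU B z * u - u * inU B z) m + comm K V u ⁅z, m⁆ :=
  lie_comm z u m

/-- The commutator with an element of `𝓑_0`. -/
def adU (z : B₀ B) : U₀ B →ₗ[K] U₀ B :=
  LinearMap.mulLeft K (inU B z) - LinearMap.mulRight K (inU B z)

theorem isAdmissible_stable (z : B₀ B) : IsAdmissible B
    (genM B ⊓ (genM B).comap (LieModule.toEnd K (B₀ B) (Um B) z))
    (genO B ⊓ (genO B).comap (adU B z))
    (genP B ⊓ (genP B).comap (LieModule.toEnd K (B₀ B) (Up B) z)) := by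
  have hg := isAdmissible_gen B
  constructor
  · constructor
    · rintro u ⟨hu, hu'⟩ v ⟨hv, hv'⟩
      refine ⟨hg.comm_zero u hu v hv, ?_⟩
      have h : adU B z (u * v - v * u) =
          (adU B z u * v - v * adU B z u) + (u * adU B z v - adU B z v * u) := by
        simp only [adU, LinearMap.sub_apply, LinearMap.mulLeft_apply, LinearMap.mulRight_apply]
        noncomm_ring
      change adU B z (u * v - v * u) ∈ genO B
      rw [h]
      exact add_mem (hg.comm_zero _ hu' v hv) (hg.comm_zero u hu _ hv')
    · rintro u ⟨hu, hu'⟩ m ⟨hm, hm'⟩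
      refine ⟨hg.comm_neg u hu m hm, ?_⟩
      change ⁅z, comm K (Bm B) u m⁆ ∈ genM B
      rw [lie_comm_inU]
      exact add_mem (hg.comm_neg _ hu' m hm) (hg.comm_neg u hu _ hm')
    · rintro u ⟨hu, hu'⟩ m ⟨hm, hm'⟩
      refine ⟨hg.comm_pos u hu m hm, ?_⟩
      change ⁅z, comm K (Bp B) u m⁆ ∈ genP B
      rw [lie_comm_inU]
      exact add_mem (hg.comm_pos _ hu' m hm) (hg.comm_pos u hu _ hm')
    · rintro m ⟨hm, hm'⟩ p ⟨hp, hp'⟩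
      refine ⟨hg.comm_neg_pos m hm p hp, ?_⟩
      change inU B z * commMP B m p - commMP B m p * inU B z ∈ genO B
      rw [commMP_equivariant]
      exact add_mem (hg.comm_neg_pos _ hm' p hp) (hg.comm_neg_pos m hm _ hp')
  · intro x w
    refine ⟨hg.mul_mem x w, ?_⟩
    change ⁅z, (x ⊗ₜ[K] inU B w : Um B)⁆ ∈ genM B
    rw [lie_inU_tmul, ← inU_lie]
    exact add_mem (hg.mul_mem _ _) (hg.mul_mem _ _)
  · intro y
    refine ⟨hg.mem y, ?_⟩
    change ⁅z, (y ⊗ₜ[K] (1 : U₀ B) : Up B)⁆ ∈ genP B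
    rw [lie_inU_tmul, mul_one, one_mul, sub_self, TensorProduct.tmul_zero, add_zero]
    exact hg.mem _

theorem lie_mem_genM (z : B₀ B) {m : Um B} (hm : m ∈ genM B) : ⁅z, m⁆ ∈ genM B :=
  ((isAdmissible_stable B z).genM_le hm).2

theorem lie_mem_genP (z : B₀ B) {p : Up B} (hp : p ∈ genP B) : ⁅z, p⁆ ∈ genP B :=
  ((isAdmissible_stable B z).genP_le hp).2

theorem adU_mem_genO (z : B₀ B) {u : U₀ B} (hu : u ∈ genO B) :
    inU B z * u - u * inU B z ∈ genO B :=
  ((isAdmissible_stable B z).genO_le hu).2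

theorem lie_mem_maxPeripheral (z : B₀ B) {m : Um B} (hm : m ∈ maxPeripheral B) :
    ⁅z, m⁆ ∈ maxPeripheral B := by
  have key : maxPeripheral B ≤
      (maxPeripheral B).comap (LieModule.toEnd K (B₀ B) (Um B) z) := by
    refine sSup_le ?_
    rintro Im ⟨Ip, h⟩ m hm
    have hc : ∀ (u : U₀ B) (m n : Um B), comm K (Bm B) u (m + n) = comm K (Bm B) u m + comm K (Bm B) u n := by
      intro u m n
      simp only [comm, map_add]
      abel
    have hp : IsPeripheral B (Im ⊔ Im.map (LieModule.toEnd K (B₀ B) (Um B) z)) Ip := by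
      constructor
      · refine sup_le h.le_neg ?_
        rintro _ ⟨n, hn, rfl⟩
        exact lie_mem_genM B z (h.le_neg hn)
      · exact h.le_pos
      · intro u hu n hn
        obtain ⟨n₁, hn₁, _, ⟨n₂, hn₂, rfl⟩, rfl⟩ := Submodule.mem_sup.1 hn
        rw [hc]
        refine add_mem (Submodule.mem_sup_left (h.comm_neg u hu n₁ hn₁)) ?_
        have e := lie_comm_inU B z u n₂
        change comm K (Bm B) u ⁅z, n₂⁆ ∈ _
        rw [← sub_eq_iff_eq_add'] at e
        rw [← e]
        refine sub_mem (Submodule.mem_sup_right ⟨_, h.comm_neg u hu n₂ hn₂, rfl⟩)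
          (Submodule.mem_sup_left (h.comm_neg _ (adU_mem_genO B z hu) n₂ hn₂))
      · exact h.comm_pos
      · intro n hn p hp
        obtain ⟨n₁, hn₁, _, ⟨n₂, hn₂, rfl⟩, rfl⟩ := Submodule.mem_sup.1 hn
        have e := commMP_equivariant B z n₂ p
        rw [h.neg_eq_zero n₂ hn₂ p hp, h.neg_eq_zero n₂ hn₂ _ (lie_mem_genP B z hp), mul_zero,
          zero_mul, sub_zero, add_zero] at e
        have e₁ := h.neg_eq_zero n₁ hn₁ p hp
        simp only [commMP, map_add, LinearMap.add_apply, LieModule.toEnd_apply_apply] at e e₁ ⊢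
        rw [add_add_add_comm, e₁, ← e, add_zero]
      · exact h.pos_eq_zero
    exact (le_sSup (a := Im ⊔ Im.map (LieModule.toEnd K (B₀ B) (Um B) z))
      (s := {Im | ∃ Ip, IsPeripheral B Im Ip}) ⟨Ip, hp⟩)
      (Submodule.mem_sup_right ⟨m, hm, rfl⟩)
  exact key hm

/-- The part of degree `-1` of the subalgebra generated by `𝓑_{-1} 𝓑_0` and `𝓑_1`, as a
`𝓑_0`-module. -/
def subM : LieSubmodule K (B₀ B) (Um B) where
  toSubmodule := genM B
  lie_mem := fun {z _} hm => lie_mem_genM B z hm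

/-- The part of degree `-1` of the maximal peripheral ideal, as a `𝓑_0`-module. -/
def periM : LieSubmodule K (B₀ B) (subM B) where
  toSubmodule := (maxPeripheral B).comap (subM B).toSubmodule.subtype
  lie_mem := fun {z _} hm => lie_mem_maxPeripheral B z hm

/-- The part `(𝓑^W)_{-1}` of degree `-1` of the cartanification of `𝓑`. This is the part of degree
`-1` of the local cartanification, which is the quotient of the subalgebra generated by
`𝓑_{-1} 𝓑_0` and `𝓑_1` by its maximal peripheral ideal (passing to the minimal graded Lie
superalgebra does not change the local part). -/
abbrev CartM : Type _ := subM B ⧸ periM B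

/-- The element `x z` of `(𝓑^W)_{-1}` for `x ∈ 𝓑_{-1}` and `z ∈ 𝓑_0`. -/
def elt (x : Bm B) (z : B₀ B) : CartM B :=
  LieSubmodule.Quotient.mk (⟨x ⊗ₜ[K] inU B z, (isAdmissible_gen B).mul_mem x z⟩ : subM B)

end Cartan
/-! ### The triple `(𝔤, λ, κ)` -/

/-- The data of a triple `(𝔤, λ, κ)`: a generalised Cartan matrix `A` (not necessarily
indecomposable) which is invertible, nonzero numbers `ε_i` such that `D⁻¹ A` is symmetric for
`D = diag(ε_i)` (they determine the invariant form `κ` on `𝔤` by `κ(e_i, f_j) = δ_{ij} ε_j`), and the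
Dynkin labels `λ_i` of a dominant integral weight `λ`. -/
structure Triple (K : Type*) [Field K] (r : ℕ) where
  A : Matrix (Fin r) (Fin r) ℤ
  diag : ∀ i, A i i = 2
  offDiag : ∀ i j, i ≠ j → A i j ≤ 0
  zero : ∀ i j, A i j = 0 → A j i = 0
  det_ne : A.det ≠ 0
  ε : Fin r → K
  ε_ne : ∀ i, ε i ≠ 0
  symm : ∀ i j, (ε i)⁻¹ * (A i j : K) = (ε j)⁻¹ * (A j i : K)
  lam : Fin r → ℕ

namespace Triple

variable {K : Type*} [Field K] {r : ℕ} (T : Triple K r)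

/-! A weight `μ` of `𝔤`, that is, an element of the dual of the Cartan subalgebra with basis
`h_1, …, h_r`, is given by its Dynkin labels `μ_i = μ(h_i)`. -/

/-- The weight `λ`. -/
def wt : Fin r → K := fun i => T.lam i

/-- The weight `λ^▲` with Dynkin labels `λ_i / ε_i`. -/
def up : Fin r → K := fun i => (T.ε i)⁻¹ * T.lam i

/-- The Cartan matrix `B` of `𝓑`, with `B_{00} = 0`, `B_{i0} = -λ_i`, `B_{0j} = -λ_j / ε_j` and
`B_{ij} = A_{ij}`. -/
def B : Matrix (Option (Fin r)) (Option (Fin r)) K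
  | none, none => 0
  | some i, none => -T.wt i
  | none, some j => -T.up j
  | some i, some j => T.A i j

/-- The simple root `α_j`: `α_j(h_i) = A_{ij}`. -/
def simpleRoot (j : Fin r) : Fin r → K := fun i => T.A i j

/-- The numbers `κ(h_i, h_j) = κ([e_i, f_i], h_j) = κ(e_i, [f_i, h_j]) = A_{ji} ε_i`. -/
def gram : Matrix (Fin r) (Fin r) K := Matrix.of fun i j => (T.A j i : K) * T.ε i

/-- The bilinear form `(μ, ν)` on weights induced by `κ`, `(μ, ν) = κ(φ⁻¹ μ, φ⁻¹ ν)`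
with `φ(h_i)(h_j) = κ(h_i, h_j)`. -/
def pair (μ ν : Fin r → K) : K := μ ⬝ᵥ (T.gram⁻¹).mulVec ν

variable [CharZero K]

/-- The Kac-Moody algebra `𝔤` with Cartan matrix `A`, as the subalgebra of `𝓑_0` generated by
`e_i, f_i, h_i` for `i = 1, …, r`. -/
def g : LieSubalgebra K (B₀ T.B) := subalg T.B Set.univ

/-- The subalgebra `𝔤⁻` generated by `e_k, f_k, h_k` for the `k` with `λ_k = 0`. -/
def gMinus : LieSubalgebra K (B₀ T.B) := subalg T.B {k | T.lam k = 0}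

/-- `x` is a root vector of weight `α` in the subalgebra `𝔞` of `𝔤`. -/
structure IsRootVector (𝔞 : LieSubalgebra K (B₀ T.B)) (α : Fin r → K) (x : B₀ T.B) : Prop where
  mem : x ∈ 𝔞
  ne_zero : x ≠ 0
  lie_h : ∀ i, ⁅hG T.B (some i), x⁆ = α i • x

/-- `α` is a root of the subalgebra `𝔞` of `𝔤`. -/
def IsRoot (𝔞 : LieSubalgebra K (B₀ T.B)) (α : Fin r → K) : Prop :=
  α ≠ 0 ∧ ∃ x, T.IsRootVector 𝔞 α x

/-- `μ` is a sum of simple roots, with nonnegative integer coefficients. -/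
def IsNonneg (μ : Fin r → K) : Prop := ∃ n : Fin r → ℕ, μ = ∑ j, (n j : K) • T.simpleRoot j

/-- `μ` is pseudo-minuscule: it is dominant integral, and `(μ^▼, α)` is `0` or `1` for any positive
root `α` of `𝔤`, where `μ^▼` has the Dynkin labels `ε_i μ_i`. -/
def IsPseudoMinuscule (μ : Fin r → K) : Prop :=
  (∀ i, ∃ n : ℕ, μ i = n) ∧ ∀ α, T.IsRoot T.g α → T.IsNonneg α →
    T.pair (fun i => T.ε i * μ i) α = 0 ∨ T.pair (fun i => T.ε i * μ i) α = 1

/-- `ϑ` is a highest root of (a simple component of) `𝔤⁻`: it is maximal among the roots of `𝔤⁻`. -/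
def IsHighestRoot (ϑ : Fin r → K) : Prop :=
  T.IsRoot T.gMinus ϑ ∧ ∀ β, T.IsRoot T.gMinus β → T.IsNonneg (β - ϑ) → β = ϑ

/-- `(𝓑^W)_{-1}`. -/
abbrev M : Type _ := CartM T.B

/-- `f_0 z` as an element of `(𝓑^W)_{-1}`, for `z ∈ 𝓑_0`. -/
def f0mul (z : B₀ T.B) : T.M := elt T.B (f0 T.B) z

/-- `f_0 h_0`. -/
def f0h0 : T.M := T.f0mul (hG T.B none)

/-- The `𝔤`-submodule `U(𝔤)(v)` of `(𝓑^W)_{-1}`. -/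
def gen (v : T.M) : LieSubmodule K T.g T.M := LieSubmodule.lieSpan K T.g {v}

/-- The `𝔤`-submodule `N` is a highest-weight module with highest weight `μ`. -/
def HasHighestWeight (N : LieSubmodule K T.g T.M) (μ : Fin r → K) : Prop :=
  ∃ v : T.M, v ≠ 0 ∧ T.gen v = N ∧ (∀ i, ⁅eG T.B i, v⁆ = 0) ∧
    ∀ i, ⁅hG T.B (some i), v⁆ = μ i • v

/-- The submodules `U(𝔤)(f_0 h_0)` and `U(𝔤)(f_0 e_ϑ)`, where `ϑ` runs over the highest roots of
`𝔤⁻`, for given root vectors `e_ϑ`. -/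
def family (e : {ϑ // T.IsHighestRoot ϑ} → B₀ T.B) :
    Option {ϑ // T.IsHighestRoot ϑ} → LieSubmodule K T.g T.M
  | none => T.gen T.f0h0
  | some ϑ => T.gen (T.f0mul (e ϑ))

end Triple

end Cartanification

end

set_option linter.unusedSectionVars false

/-! The product rules in degrees ±1 are arranged so that in [xz, y], for x in 𝓑_{-1}, z in 𝓑_0 and y
in 𝓑_1, the quadratic terms of U(𝓑_0) cancel: [xz, y] = -⟦⟦z,y⟧,x⟧ + ⟨x|⟦z,y⟧⟩ L - ⟨x|y⟩ z. Hence
the bracket `brk` maps (𝓑^W)_{-1} × 𝓑_1 to 𝓑_0, and factoring out the peripheral ideal makes it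
faithful in the first argument. Since e_0 generates 𝓑_1 under the e_i with i in I, a singular vector
(one annihilated by these e_i) vanishes as soon as its bracket with e_0 does: `eq_zero_of_singular`.
As A is invertible, h_0 is a combination of the h_i and of L, which acts by -1, so 𝔤-submodules and
𝓑_0-submodules of (𝓑^W)_{-1} agree.

The level of a root Σ d_j α_j is the number Σ λ_j d_j (`lev`). Because λ = λ^▲, it is at once the
value of the form in the definition of a pseudo-minuscule weight and minus the eigenvalue of h_0. So
all levels lie in {-1, 0, 1} (`abs_lev_le`), and for a positive root vector z one gets [f_0 z, e_0]
= (1 - level) z. This leads to f_0 z = 0 whenever z has level one: `elt_f0_eq_zero`.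

The vector f_0 h_0 + f_0 L is singular with zero bracket with e_0, so f_0 h_0 = -f_0 L. Since L is
central, x ↦ xL is a homomorphism, and U(𝔤)(f_0 h_0) is a nonzero image of the module 𝓑_{-1}, which
is irreducible with highest weight λ by nondegeneracy of the invariant form on 𝓑.

The algebra 𝔤⁻ annihilates e_0 and f_0, hence z ↦ f_0 z is equivariant for it, and f_0 e_ϑ is
singular because [e_i, e_ϑ] has level one when λ_i ≠ 0. A nonzero submodule of U(𝔤)(f_0 e_ϑ)
contains a singular vector w; let u = [w, e_0]. Then u is nonzero, commutes with the e_k of 𝔤⁻ and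
is annihilated by (ad e_i)^2 for the other i. A negative u is excluded by the invariant form
(`eq_zero_of_nonpos`), and a u in the Cartan subalgebra by a maximum argument for generalised Cartan
matrices (`eq_zero_of_cartan`). A positive u generates e_ϑ by lowering operators, so w already has
the weight of f_0 e_ϑ.

If 𝔤 is simple, the Weyl group orbit of λ, bounded by one on all roots, bounds every label of every
root: there are finitely many roots (`finite_degrees`). A maximal root has full support, so exactly
one λ_i is nonzero. The set of z with f_0 z in the sum of the submodules contains 𝔤⁻, all h_k and
f_i, and therefore everything. Independence follows by comparing weights, as distinct highest roots
are incomparable and h_0 is not in 𝔤⁻. -/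

noncomputable section

namespace Cartanification

/-! ### Simultaneous eigenvectors -/

section Eigen

variable {K V ι κ : Type*} [Field K] [AddCommGroup V] [Module K V]

/-- A submodule stable under a family of operators contains the components of its elements in the
simultaneous eigenspaces. -/
theorem mem_of_sum_eigen_mem (T : κ → Module.End K V) (χ : ι → κ → K) (hχ : Function.Injective χ)
    (N : Submodule K V) (hN : ∀ k, ∀ x ∈ N, T k x ∈ N) (s : Finset ι) :
    ∀ x : ι → V, (∀ i ∈ s, ∀ k, T k (x i) = χ i k • x i) → ∑ i ∈ s, x i ∈ N →
      ∀ i ∈ s, x i ∈ N := by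
  classical
  induction s using Finset.induction_on with
  | empty => simp
  | insert a s ha ih =>
    intro x hx hsum
    have hs : ∀ i ∈ s, x i ∈ N := by
      intro i hi
      obtain ⟨k, hk⟩ : ∃ k, χ i k ≠ χ a k := by
        by_contra! h
        have : i = a := hχ (funext h)
        exact ha (this ▸ hi)
      -- The operator `T k - χ a k` removes the component `x a` and multiplies the others by
      -- scalars, nonzero at `i`.
      have h := ih (fun j => (χ j k - χ a k) • x j) (fun j hj l => by
        rw [map_smul, hx j (Finset.mem_insert_of_mem hj), smul_comm]) (by
          have h₁ := N.sub_mem (hN k _ hsum) (N.smul_mem (χ a k) hsum)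
          rw [map_sum, Finset.smul_sum, ← Finset.sum_sub_distrib, Finset.sum_insert ha,
            hx a (Finset.mem_insert_self _ _), sub_self, zero_add] at h₁
          convert h₁ using 1
          refine Finset.sum_congr rfl fun j hj => ?_
          rw [hx j (Finset.mem_insert_of_mem hj), sub_smul]) i hi
      exact (N.smul_mem_iff (sub_ne_zero.2 hk)).1 h
    intro i hi
    rcases Finset.mem_insert.1 hi with rfl | hi
    · rw [Finset.sum_insert ha] at hsum
      exact (N.add_mem_iff_left (N.sum_mem hs)).1 hsum
    · exact hs i hi

theorem eq_zero_of_sum_eigen_eq_zero (T : κ → Module.End K V) (χ : ι → κ → K)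
    (hχ : Function.Injective χ) (s : Finset ι) (x : ι → V)
    (hx : ∀ i ∈ s, ∀ k, T k (x i) = χ i k • x i) (h : ∑ i ∈ s, x i = 0) : ∀ i ∈ s, x i = 0 :=
  fun i hi => (Submodule.mem_bot K).1 (mem_of_sum_eigen_mem T χ hχ ⊥ (by simp) s x hx
    ((Submodule.mem_bot K).2 h) i hi)

/-- A submodule stable under a family of operators is the sum of its intersections with
simultaneous eigenspaces that span. -/
theorem le_iSup_inf_of_stable (T : κ → Module.End K V) (χ : ι → κ → K)
    (hχ : Function.Injective χ) (C : ι → Submodule K V)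
    (hC : ∀ i, ∀ x ∈ C i, ∀ k, T k x = χ i k • x)
    (N : Submodule K V) (hN : ∀ k, ∀ x ∈ N, T k x ∈ N) (hle : N ≤ ⨆ i, C i) :
    N ≤ ⨆ i, N ⊓ C i := by
  intro x hx
  obtain ⟨f, hf, rfl⟩ := (Submodule.mem_iSup_iff_exists_finsupp C x).1 (hle hx)
  refine Submodule.sum_mem _ fun i hi => Submodule.mem_iSup_of_mem i ⟨?_, hf i⟩
  exact mem_of_sum_eigen_mem T χ hχ N hN f.support f (fun i _ => hC i _ (hf i)) hx i hi

/-- Eigenspaces for distinct families of eigenvalues intersect trivially. -/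
theorem disjoint_iSup_eigen (T : κ → Module.End K V) (χ : ι → κ → K)
    (hχ : Function.Injective χ) (C : ι → Submodule K V)
    (hC : ∀ i, ∀ x ∈ C i, ∀ k, T k x = χ i k • x) (P Q : ι → Prop) (hPQ : ∀ i, P i → ¬ Q i)
    {x : V} (hP : x ∈ ⨆ i, ⨆ _ : P i, C i) (hQ : x ∈ ⨆ i, ⨆ _ : Q i, C i) : x = 0 := by
  classical
  have aux : ∀ R : ι → Prop, ∀ x ∈ ⨆ i, ⨆ _ : R i, C i, ∃ f : ι →₀ V,
      (∀ i, f i ∈ C i) ∧ (∀ i, ¬ R i → f i = 0) ∧ (f.sum fun _ y => y) = x := by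
    intro R x hx
    obtain ⟨f, hf, rfl⟩ := (Submodule.mem_iSup_iff_exists_finsupp _ x).1 hx
    refine ⟨f, fun i => ?_, fun i hi => ?_, rfl⟩
    · exact (iSup_le fun _ => le_rfl : (⨆ _ : R i, C i) ≤ C i) (hf i)
    · have := hf i
      simpa [hi] using this
  obtain ⟨f, hf, hf', hfx⟩ := aux P x hP
  obtain ⟨g, hg, hg', hgx⟩ := aux Q x hQ
  have h0 : ∑ i ∈ f.support ∪ g.support, (f - g) i = 0 := by
    simp only [Finsupp.sub_apply, Finset.sum_sub_distrib]
    rw [← Finsupp.sum_of_support_subset f Finset.subset_union_left (fun _ y => y) (by simp),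
      ← Finsupp.sum_of_support_subset g Finset.subset_union_right (fun _ y => y) (by simp),
      hfx, hgx, sub_self]
  have h1 := eq_zero_of_sum_eigen_eq_zero T χ hχ _ (fun i => (f - g) i)
    (fun i _ => hC i _ ((C i).sub_mem (hf i) (hg i))) h0
  rw [← hfx]
  refine Finset.sum_eq_zero fun i hi => ?_
  by_cases hP : P i
  · have := h1 i (Finset.mem_union_left _ hi)
    rw [Finsupp.sub_apply, hg' i (hPQ i hP), sub_zero] at this
    exact this
  · exact hf' i hP

/-- If the part `N` of an eigenspace spans together with the other eigenspaces, then it is the whole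
eigenspace. -/
theorem mem_of_mem_sup_iSup_eigen (T : κ → Module.End K V) (χ : ι → κ → K)
    (hχ : Function.Injective χ) (C : ι → Submodule K V)
    (hC : ∀ i, ∀ x ∈ C i, ∀ k, T k x = χ i k • x) {i : ι} {N : Submodule K V} (hN : N ≤ C i)
    {x : V} (hx : x ∈ C i) (hx' : x ∈ N ⊔ ⨆ j, ⨆ _ : j ≠ i, C j) : x ∈ N := by
  obtain ⟨y, hy, z, hz, rfl⟩ := Submodule.mem_sup.1 hx'
  have hz' : z ∈ ⨆ j, ⨆ _ : j = i, C j := by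
    rw [iSup_iSup_eq_left]
    exact ((C i).add_mem_iff_right (hN hy)).1 hx
  rw [disjoint_iSup_eigen T χ hχ C hC (· ≠ i) (· = i) (fun _ h => h) hz hz', add_zero]
  exact hy

/-- The vectors in an eigenspace are linear combinations of the elements of a spanning family of
eigenvectors that belong to it. -/
theorem mem_span_of_mem_eigen {ω : Type*} (T : κ → Module.End K V) (χ : ι → κ → K)
    (hχ : Function.Injective χ) (C : ι → Submodule K V)
    (hC : ∀ i, ∀ x ∈ C i, ∀ k, T k x = χ i k • x) (v : ω → V) (δ : ω → ι)
    (hv : ∀ w, v w ∈ C (δ w)) {i : ι} {x : V} (hx : x ∈ C i)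
    (hx' : x ∈ Submodule.span K (Set.range v)) :
    x ∈ Submodule.span K {y | ∃ w, δ w = i ∧ v w = y} := by
  refine mem_of_mem_sup_iSup_eigen T χ hχ C hC (i := i) ?_ hx ?_
  · rw [Submodule.span_le]
    rintro _ ⟨w, rfl, rfl⟩
    exact hv w
  · refine (Submodule.span_le.2 ?_) hx'
    rintro _ ⟨w, rfl⟩
    by_cases h : δ w = i
    · exact Submodule.mem_sup_left (Submodule.subset_span ⟨w, h, rfl⟩)
    · exact Submodule.mem_sup_right
        (Submodule.mem_iSup_of_mem (δ w) (Submodule.mem_iSup_of_mem h (hv w)))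

end Eigen

/-! ### Associative superalgebras -/

section Super

/-- Pairs of an even and an odd element of an associative algebra, with the supercommutator as
product. -/
structure SuperPair (R : Type*) where
  even : R
  odd : R

variable {R : Type*}

namespace SuperPair

/-- Pairs of an even and an odd element as a product. -/
def equivProd : SuperPair R ≃ R × R where
  toFun x := (x.even, x.odd)
  invFun x := ⟨x.1, x.2⟩
  left_inv _ := rfl
  right_inv _ := rfl

@[ext] theorem ext' {x y : SuperPair R} (h : x.even = y.even) (h' : x.odd = y.odd) : x = y := by
  cases x; cases y; simp_all

variable [Ring R]

instance : AddCommGroup (SuperPair R) := equivProd.addCommGroup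

@[simp] theorem even_add (x y : SuperPair R) : (x + y).even = x.even + y.even := rfl
@[simp] theorem odd_add (x y : SuperPair R) : (x + y).odd = x.odd + y.odd := rfl
@[simp] theorem even_neg (x : SuperPair R) : (-x).even = -x.even := rfl
@[simp] theorem odd_neg (x : SuperPair R) : (-x).odd = -x.odd := rfl
@[simp] theorem even_zero : (0 : SuperPair R).even = 0 := rfl
@[simp] theorem odd_zero : (0 : SuperPair R).odd = 0 := rfl
@[simp] theorem even_sub (x y : SuperPair R) : (x - y).even = x.even - y.even := rfl
@[simp] theorem odd_sub (x y : SuperPair R) : (x - y).odd = x.odd - y.odd := rfl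

/-- This is the supercommutator of R[ξ] with ξ odd, central and ξ² = 1, the pair standing for `even
+ odd ξ`. Operators can thus be given any parity without a grading of the space on which they act.
-/
instance : Mul (SuperPair R) where
  mul x y := ⟨x.even * y.even - y.even * x.even + (x.odd * y.odd + y.odd * x.odd),
    x.even * y.odd - y.odd * x.even + (x.odd * y.even - y.even * x.odd)⟩

theorem even_mul (x y : SuperPair R) : (x * y).even =
    x.even * y.even - y.even * x.even + (x.odd * y.odd + y.odd * x.odd) := rfl
theorem odd_mul (x y : SuperPair R) : (x * y).odd =
    x.even * y.odd - y.odd * x.even + (x.odd * y.even - y.even * x.odd) := rfl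

instance : NonUnitalNonAssocRing (SuperPair R) where
  left_distrib x y z := by
    apply ext' <;> simp only [even_mul, odd_mul, even_add, odd_add] <;> noncomm_ring
  right_distrib x y z := by
    apply ext' <;> simp only [even_mul, odd_mul, even_add, odd_add] <;> noncomm_ring
  zero_mul x := by
    apply ext' <;> simp [even_mul, odd_mul]
  mul_zero x := by
    apply ext' <;> simp [even_mul, odd_mul]

variable {K : Type*} [Field K] [Algebra K R]

instance : Module K (SuperPair R) := equivProd.module K

@[simp] theorem even_smul (c : K) (x : SuperPair R) : (c • x).even = c • x.even := rfl
@[simp] theorem odd_smul (c : K) (x : SuperPair R) : (c • x).odd = c • x.odd := rfl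

instance : IsScalarTower K (SuperPair R) (SuperPair R) where
  smul_assoc c x y := by
    apply ext' <;> simp only [smul_eq_mul, even_mul, odd_mul, even_smul, odd_smul, smul_mul_assoc,
      mul_smul_comm, smul_add, smul_sub]

instance : SMulCommClass K (SuperPair R) (SuperPair R) where
  smul_comm c x y := by
    apply ext' <;> simp only [smul_eq_mul, even_mul, odd_mul, even_smul, odd_smul, smul_mul_assoc,
      mul_smul_comm, smul_add, smul_sub]

open Classical in
/-- An element of given parity. -/
def hom (p : ℤ) (x : R) : SuperPair R := if Odd p then ⟨0, x⟩ else ⟨x, 0⟩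

theorem hom_mul (p q : ℤ) (x y : R) :
    hom p x * hom q y = hom (p + q) (x * y - sgn K p q • (y * x)) := by
  unfold hom sgn
  by_cases hp : Odd p <;> by_cases hq : Odd q <;>
    simp [hp, hq, Int.odd_add, even_mul, odd_mul, SuperPair.ext'_iff, ← Int.not_odd_iff_even]

theorem hom_smul (p : ℤ) (c : K) (x : R) : hom p (c • x) = c • hom p x := by
  unfold hom
  split_ifs <;> apply ext' <;> simp

theorem hom_add (p : ℤ) (x y : R) : hom p (x + y) = hom p x + hom p y := by
  unfold hom
  split_ifs <;> apply ext' <;> simp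

theorem hom_zero (p : ℤ) : hom p (0 : R) = 0 := by
  unfold hom
  split_ifs <;> rfl

theorem hom_skew (p q : ℤ) (x y : R) :
    hom p x * hom q y + sgn K p q • (hom q y * hom p x) = 0 := by
  unfold hom sgn
  by_cases hp : Odd p <;> by_cases hq : Odd q <;>
    simp only [hp, hq, and_true, and_false, and_self, if_true, if_false, one_smul, neg_smul] <;>
    refine ext' ?_ ?_ <;> simp [even_mul, odd_mul, ← sub_eq_add_neg, add_comm]

theorem hom_jacobi (p q s : ℤ) (x y z : R) :
    hom p x * (hom q y * hom s z) - (hom p x * hom q y) * hom s z -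
      sgn K p q • (hom q y * (hom p x * hom s z)) = 0 := by
  unfold hom sgn
  by_cases hp : Odd p <;> by_cases hq : Odd q <;> by_cases hs : Odd s <;>
    simp only [hp, hq, hs, and_true, and_false, and_self, if_true, if_false, one_smul, neg_smul] <;>
    refine ext' ?_ ?_ <;>
    simp only [even_mul, odd_mul, even_sub, odd_sub, even_zero, odd_zero, even_neg, odd_neg] <;>
    noncomm_ring

theorem hom_zero_mul_hom (q : ℤ) (x y : R) : hom 0 x * hom q y = hom q (x * y - y * x) := by
  unfold hom
  by_cases hq : Odd q <;> simp [hq, SuperPair.ext'_iff, even_mul, odd_mul]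

end SuperPair

end Super

/-! ### A module over the Lie superalgebra defined by the Chevalley relations -/

section Model

variable {K : Type*} [Field K] {I : Type} [DecidableEq I] (B : Matrix (Option I) (Option I) K)

variable (K I) in
/-- The space spanned by the words in the letters `f_i`. -/
abbrev WordSpace : Type _ := List (Option I) →₀ K

/-- The sign that appears when `e_i` is moved past `f_j`. -/
def genSign (K : Type*) [Field K] {I : Type} (i j : Option I) : K :=
  sgn K (Gen.level (.e i : Gen I)) (Gen.level (.f j : Gen I))

/-- The eigenvalue of `h_i` on a word. -/
def wordEigen (i : Option I) : List (Option I) → K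
  | [] => 1
  | j :: l => wordEigen i l - B i j

variable (K) in
/-- The action of `f_i` on words. -/
def fWord (i : Option I) : Module.End K (WordSpace K I) := Finsupp.lmapDomain K K (List.cons i)

/-- The action of `h_i` on words. -/
def hWord (i : Option I) : Module.End K (WordSpace K I) :=
  Finsupp.lift _ K _ fun l => Finsupp.single l (wordEigen B i l)

/-- The image of a word under `e_i`. -/
def eWordAux (i : Option I) : List (Option I) → WordSpace K I
  | [] => 0
  | j :: l => genSign K i j • fWord K j (eWordAux i l) +
      if i = j then Finsupp.single l (wordEigen B i l) else 0

/-- The action of `e_i` on words. -/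
def eWord (i : Option I) : Module.End K (WordSpace K I) := Finsupp.lift _ K _ (eWordAux B i)

theorem fWord_single (i : Option I) (l : List (Option I)) (c : K) :
    fWord K i (Finsupp.single l c) = Finsupp.single (i :: l) c := by
  simp [fWord]

theorem hWord_single (i : Option I) (l : List (Option I)) (c : K) :
    hWord B i (Finsupp.single l c) = wordEigen B i l • Finsupp.single l c := by
  simp [hWord, mul_comm]

theorem eWord_single (i : Option I) (l : List (Option I)) (c : K) :
    eWord B i (Finsupp.single l c) = c • eWordAux B i l := by
  simp [eWord]

theorem hWord_fWord (i j : Option I) (x : WordSpace K I) :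
    hWord B i (fWord K j x) = fWord K j (hWord B i x) - B i j • fWord K j x := by
  induction x using Finsupp.induction_linear with
  | zero => simp
  | add x y hx hy => simp only [map_add, hx, hy, smul_add]; abel
  | single l c =>
    rw [fWord_single, hWord_single, hWord_single, map_smul, fWord_single, wordEigen, sub_smul]

theorem eWord_fWord (i j : Option I) (x : WordSpace K I) :
    eWord B i (fWord K j x) = genSign K i j • fWord K j (eWord B i x) +
      if i = j then hWord B i x else 0 := by
  induction x using Finsupp.induction_linear with
  | zero => simp
  | add x y hx hy =>
    simp only [map_add, hx, hy, smul_add]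
    split_ifs <;> abel
  | single l c =>
    rw [fWord_single, eWord_single, eWord_single, hWord_single, eWordAux, map_smul, smul_add]
    split_ifs
    · simp [smul_comm c, mul_comm]
    · simp [smul_comm c]

theorem hWord_eWord (i j : Option I) (x : WordSpace K I) :
    hWord B i (eWord B j x) = eWord B j (hWord B i x) + B i j • eWord B j x := by
  induction x using Finsupp.induction_linear with
  | zero => simp
  | add x y hx hy => simp only [map_add, hx, hy, smul_add]; abel
  | single l c =>
    rw [hWord_single, map_smul, eWord_single, map_smul, smul_comm _ c, smul_comm _ c, ← smul_add]
    congr 1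
    induction l with
    | nil => simp [eWordAux]
    | cons k l ih =>
      rw [eWordAux, map_add, map_smul, hWord_fWord, ih, map_add, map_smul, map_smul, wordEigen]
      split_ifs with h
      · subst h
        rw [hWord_single]
        simp only [smul_add, smul_sub, sub_smul, smul_smul, mul_comm]
        module
      · simp only [map_zero, smul_add, smul_sub, sub_smul]
        module

/-- The image of the generators in the superalgebra of endomorphisms. -/
def genEnd : Gen I → SuperPair (Module.End K (WordSpace K I))
  | .e i => SuperPair.hom (Gen.level (.e i : Gen I)) (eWord B i)
  | .f i => SuperPair.hom (Gen.level (.f i : Gen I)) (fWord K i)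
  | .h i => SuperPair.hom 0 (hWord B i)

/-- The action of the free algebra. -/
def freeEnd : FreeNonUnitalNonAssocAlgebra K (Gen I) →ₙₐ[K]
    SuperPair (Module.End K (WordSpace K I)) :=
  FreeNonUnitalNonAssocAlgebra.lift K (genEnd B)

theorem freeEnd_of (x : Gen I) : freeEnd B (word K (.of x)) = genEnd B x :=
  FreeNonUnitalNonAssocAlgebra.lift_of_apply K (genEnd B) x

theorem freeEnd_word (w : FreeMagma (Gen I)) :
    ∃ x, freeEnd B (word K w) = SuperPair.hom (wordDeg Gen.level w) x := by
  induction w with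
  | ih1 x =>
    rw [freeEnd_of]
    rcases x with i | i | i
    · exact ⟨_, rfl⟩
    · exact ⟨_, rfl⟩
    · exact ⟨_, rfl⟩
  | ih2 a b ha hb =>
    obtain ⟨x, hx⟩ := ha
    obtain ⟨y, hy⟩ := hb
    refine ⟨x * y - sgn K (wordDeg Gen.level a) (wordDeg Gen.level b) • (y * x), ?_⟩
    rw [show a * b = a.mul b from rfl, word_mul, map_mul, hx, hy, SuperPair.hom_mul (K := K)]
    rfl

/-- Skew symmetry and the Jacobi identity hold for any homogeneous pairs; the Chevalley relations
are the commutation rules of the operators on words, a Verma module for the relations. -/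
theorem freeEnd_relator {x : FreeNonUnitalNonAssocAlgebra K (Gen I)} (hx : Relator B x) :
    freeEnd B x = 0 := by
  cases hx with
  | skew a b =>
    obtain ⟨x, hx⟩ := freeEnd_word B a
    obtain ⟨y, hy⟩ := freeEnd_word B b
    simp only [map_add, map_smul, map_mul, hx, hy]
    exact SuperPair.hom_skew _ _ x y
  | jacobi a b c =>
    obtain ⟨x, hx⟩ := freeEnd_word B a
    obtain ⟨y, hy⟩ := freeEnd_word B b
    obtain ⟨z, hz⟩ := freeEnd_word B c
    simp only [map_sub, map_smul, map_mul, hx, hy, hz]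
    exact SuperPair.hom_jacobi _ _ _ x y z
  | he i j =>
    simp only [map_sub, map_smul, map_mul, freeEnd_of, genEnd, SuperPair.hom_zero_mul_hom]
    rw [← SuperPair.hom_smul, sub_eq_zero]
    congr 1
    refine LinearMap.ext fun x => ?_
    simp [hWord_eWord]
  | hf i j =>
    simp only [map_add, map_smul, map_mul, freeEnd_of, genEnd, SuperPair.hom_zero_mul_hom]
    rw [← SuperPair.hom_smul, ← SuperPair.hom_add,
      ← SuperPair.hom_zero (Gen.level (.f j : Gen I))]
    congr 1
    refine LinearMap.ext fun x => ?_
    simp [hWord_fWord]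
  | ef i =>
    simp only [map_sub, map_mul, freeEnd_of, genEnd, SuperPair.hom_mul (K := K)]
    rw [sub_eq_zero]
    congr 1
    · cases i <;> simp [Gen.level]
    · refine LinearMap.ext fun x => ?_
      simp [eWord_fWord, genSign]
  | ef_ne i j hij =>
    simp only [map_mul, freeEnd_of, genEnd, SuperPair.hom_mul (K := K)]
    rw [← SuperPair.hom_zero (Gen.level (.e i : Gen I) + Gen.level (.f j : Gen I))]
    congr 1
    refine LinearMap.ext fun x => ?_
    simp [eWord_fWord, genSign, hij]

theorem freeEnd_eq_zero {x : FreeNonUnitalNonAssocAlgebra K (Gen I)}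
    (hx : AlgIdeal.proj (AlgIdeal.span (K := K) {x | Relator B x}) x = 0) : freeEnd B x = 0 := by
  have h := (AlgIdeal.proj_eq_zero _).1 hx
  simp only [AlgIdeal.span, Submodule.mem_sInf] at h
  let F : FreeNonUnitalNonAssocAlgebra K (Gen I) →ₗ[K]
      SuperPair (Module.End K (WordSpace K I)) :=
    { toFun := freeEnd B
      map_add' := map_add (freeEnd B)
      map_smul' := map_smul (freeEnd B) }
  refine h (LinearMap.ker F) ⟨fun y hy => freeEnd_relator B hy, ?_⟩
  intro y z
  simp only [LinearMap.mem_ker]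
  constructor <;> intro h
  · exact (map_mul (freeEnd B) y z).trans (by rw [show freeEnd B z = 0 from h, mul_zero])
  · exact (map_mul (freeEnd B) y z).trans (by rw [show freeEnd B y = 0 from h, zero_mul])

/-- The generators `h_i` of the Lie superalgebra defined by the Chevalley relations are nonzero. -/
theorem tilde_h_ne_zero (i : Option I) :
    AlgIdeal.proj (AlgIdeal.span (K := K) {x | Relator B x}) (word K (.of (.h i))) ≠ 0 := by
  intro h
  have h₁ := freeEnd_eq_zero B h
  rw [freeEnd_of] at h₁
  have h₂ := congrArg SuperPair.even h₁
  simp only [genEnd, SuperPair.hom] at h₂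
  -- The highest weight in `wordEigen` is chosen to be `1` on every `h_i`, so `h_i` does not
  -- annihilate the empty word.
  have h₃ := congrArg (fun T : Module.End K (WordSpace K I) => T (Finsupp.single [] 1)) h₂
  simp [hWord_single, wordEigen] at h₃

end Model

end Cartanification

namespace Cartanification

/-! ### Gradings and the maximal ideal of the algebra defined by the Chevalley relations -/

section Tilde

variable {K : Type*} [Field K] {I : Type} (B : Matrix (Option I) (Option I) K)

/-- The value of a non-associative word in `TildeAlg B`. -/
def tval (w : FreeMagma (Gen I)) : TildeAlg B := AlgIdeal.proj _ (word K w)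

theorem tval_mul (a b : FreeMagma (Gen I)) : tval B (a.mul b) = tval B a * tval B b := by
  simp only [tval, word_mul, AlgIdeal.proj_mul]

theorem tilde_relator {x : FreeNonUnitalNonAssocAlgebra K (Gen I)} (hx : Relator B x) :
    AlgIdeal.proj (AlgIdeal.span (K := K) {x | Relator B x}) x = 0 :=
  (AlgIdeal.proj_eq_zero _).2 (AlgIdeal.subset_span _ hx)

theorem span_tval : Submodule.span K (Set.range (tval B)) = ⊤ := by
  rw [Submodule.eq_top_iff']
  intro x
  obtain ⟨y, rfl⟩ := AlgIdeal.proj_surjective _ x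
  induction y using MonoidAlgebra.induction_linear with
  | zero => simp
  | add f g hf hg => rw [map_add]; exact add_mem hf hg
  | single w c =>
    have : (MonoidAlgebra.single w c : FreeNonUnitalNonAssocAlgebra K (Gen I)) = c • word K w := by
      simp [word]
    rw [this, map_smul]
    exact Submodule.smul_mem _ _ (Submodule.subset_span ⟨w, rfl⟩)

theorem tval_skew (a b : FreeMagma (Gen I)) : tval B a * tval B b =
    -(sgn K (wordDeg Gen.level a) (wordDeg Gen.level b) • (tval B b * tval B a)) := by
  have h := tilde_relator B (Relator.skew (B := B) a b)
  simp only [map_add, map_smul, AlgIdeal.proj_mul] at h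
  exact eq_neg_of_add_eq_zero_left h

theorem tval_jacobi (a b : FreeMagma (Gen I)) (x : TildeAlg B) :
    tval B a * (tval B b * x) = tval B a * tval B b * x +
      sgn K (wordDeg Gen.level a) (wordDeg Gen.level b) • (tval B b * (tval B a * x)) := by
  have hx : x ∈ Submodule.span K (Set.range (tval B)) := span_tval B ▸ Submodule.mem_top
  induction hx using Submodule.span_induction with
  | mem x hx =>
    obtain ⟨c, rfl⟩ := hx
    have h := tilde_relator B (Relator.jacobi (B := B) a b c)
    simp only [map_sub, map_smul, AlgIdeal.proj_mul] at h
    rw [sub_sub, sub_eq_zero] at h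
    exact h
  | zero => simp
  | add y z _ _ h₁ h₂ => simp only [mul_add, smul_add, h₁, h₂]; abel
  | smul r y _ h => simp only [mul_smul_comm, h, smul_add, smul_comm r]

theorem tval_h_mul_e (i j : Option I) :
    tval B (.of (.h i)) * tval B (.of (.e j)) = B i j • tval B (.of (.e j)) := by
  have h := tilde_relator B (Relator.he (B := B) i j)
  simp only [map_sub, map_smul, AlgIdeal.proj_mul] at h
  exact sub_eq_zero.1 h

theorem tval_h_mul_f (i j : Option I) :
    tval B (.of (.h i)) * tval B (.of (.f j)) = -(B i j • tval B (.of (.f j))) := by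
  have h := tilde_relator B (Relator.hf (B := B) i j)
  simp only [map_add, map_smul, AlgIdeal.proj_mul] at h
  exact eq_neg_of_add_eq_zero_left h

theorem tval_e_mul_f (i : Option I) :
    tval B (.of (.e i)) * tval B (.of (.f i)) = tval B (.of (.h i)) := by
  have h := tilde_relator B (Relator.ef (B := B) i)
  simp only [map_sub, AlgIdeal.proj_mul] at h
  exact sub_eq_zero.1 h

section Grading

variable [Fintype I] [DecidableEq I]

/-- The element of the Cartan subalgebra that acts on `e_j` by the scalar `c_j`. -/
def tildeGrading (c : Option I → K) : TildeAlg B :=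
  ∑ i, (Matrix.vecMul c B⁻¹) i • tval B (.of (.h i))

/-- The coefficients `c B⁻¹` make the element act on `e_j` by `c_j`, and it acts as a derivation.
Invertibility of `B` thus makes every integral grading inner, so that subspaces stable under left
multiplication are automatically graded. -/
theorem tildeGrading_mul (hB : IsUnit B.det) (d : Gen I → ℤ) (hd : ∀ i, d (.f i) = -d (.e i))
    (hd' : ∀ i, d (.h i) = 0) (w : FreeMagma (Gen I)) :
    tildeGrading B (fun i => (d (.e i) : K)) * tval B w = (wordDeg d w : K) • tval B w := by
  have hc : ∀ j, ∑ i, (Matrix.vecMul (fun i => (d (.e i) : K)) B⁻¹) i * B i j = d (.e j) := by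
    intro j
    change (Matrix.vecMul (Matrix.vecMul (fun i => (d (.e i) : K)) B⁻¹) B) j = _
    rw [Matrix.vecMul_vecMul, Matrix.nonsing_inv_mul _ hB, Matrix.vecMul_one]
  have he : ∀ j, tildeGrading B (fun i => (d (.e i) : K)) * tval B (.of (.e j)) =
      (d (.e j) : K) • tval B (.of (.e j)) := fun j => by
    simp only [tildeGrading, Finset.sum_mul, smul_mul_assoc, tval_h_mul_e, smul_smul,
      ← Finset.sum_smul, hc]
  have hf : ∀ j, tildeGrading B (fun i => (d (.e i) : K)) * tval B (.of (.f j)) =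
      (d (.f j) : K) • tval B (.of (.f j)) := fun j => by
    simp only [tildeGrading, Finset.sum_mul, smul_mul_assoc, tval_h_mul_f, smul_smul,
      ← Finset.sum_smul, hc, smul_neg, Finset.sum_neg_distrib, hd]
    simp
  have hm : ∀ (a : FreeMagma (Gen I)) (x : TildeAlg B),
      tildeGrading B (fun i => (d (.e i) : K)) * (tval B a * x) =
      tildeGrading B (fun i => (d (.e i) : K)) * tval B a * x +
        tval B a * (tildeGrading B (fun i => (d (.e i) : K)) * x) := fun a x => by
    simp only [tildeGrading, Finset.sum_mul, Finset.mul_sum, smul_mul_assoc, mul_smul_comm,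
      ← Finset.sum_add_distrib, ← smul_add]
    refine Finset.sum_congr rfl fun i _ => ?_
    have h := tval_jacobi B (.of (.h i)) a x
    rw [sgn, if_neg (by simp [wordDeg, Gen.level]), one_smul] at h
    rw [h]
  induction w with
  | ih1 x =>
    rcases x with j | j | j
    · exact he j
    · exact hf j
    · have h := hm (.of (.e j)) (tval B (.of (.f j)))
      rw [tval_e_mul_f, he, hf, smul_mul_assoc, mul_smul_comm, ← add_smul, tval_e_mul_f] at h
      rw [h]
      simp [wordDeg, hd, hd']
  | ih2 a b iha ihb =>
    rw [show a * b = a.mul b from rfl, tval_mul, hm, iha, ihb, smul_mul_assoc, mul_smul_comm,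
      ← add_smul]
    simp [wordDeg]

theorem tildeGrading_mul_comp (hB : IsUnit B.det) (d : Gen I → ℤ) (hd : ∀ i, d (.f i) = -d (.e i))
    (hd' : ∀ i, d (.h i) = 0) (k : ℤ) {x : TildeAlg B} (hx : x ∈ tildeComp B d k) :
    tildeGrading B (fun i => (d (.e i) : K)) * x = (k : K) • x := by
  induction hx using Submodule.span_induction with
  | mem x hx =>
    obtain ⟨w, rfl, rfl⟩ := hx
    exact tildeGrading_mul B hB d hd hd' w
  | zero => simp
  | add y z _ _ h₁ h₂ => rw [mul_add, h₁, h₂, smul_add]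
  | smul r y _ h => rw [mul_smul_comm, h, smul_comm]

theorem iSup_tildeComp (d : Gen I → ℤ) : ⨆ k, tildeComp B d k = ⊤ := by
  rw [eq_top_iff, ← span_tval B, Submodule.span_le]
  rintro _ ⟨w, rfl⟩
  exact Submodule.mem_iSup_of_mem (wordDeg d w) (Submodule.subset_span ⟨w, rfl, rfl⟩)

/-- A subspace stable under left multiplication by the generators is stable under left
multiplication. -/
theorem mul_mem_of_stable (J : Submodule K (TildeAlg B))
    (hJ : ∀ g : Gen I, ∀ x ∈ J, tval B (.of g) * x ∈ J) (y : TildeAlg B) {x : TildeAlg B}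
    (hx : x ∈ J) : y * x ∈ J := by
  have hw : ∀ w : FreeMagma (Gen I), ∀ x ∈ J, tval B w * x ∈ J := by
    intro w
    induction w with
    | ih1 g => exact hJ g
    | ih2 a b iha ihb =>
      intro x hx
      rw [show a * b = a.mul b from rfl, tval_mul, ← sub_eq_of_eq_add (tval_jacobi B a b x)]
      exact sub_mem (iha _ (ihb _ hx)) (J.smul_mem _ (ihb _ (iha _ hx)))
  have hy : y ∈ Submodule.span K (Set.range (tval B)) := span_tval B ▸ Submodule.mem_top
  induction hy using Submodule.span_induction with
  | mem y hy => obtain ⟨w, rfl⟩ := hy; exact hw w x hx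
  | zero => simp
  | add y z _ _ h₁ h₂ => rw [add_mul]; exact add_mem h₁ h₂
  | smul r y _ h => rw [smul_mul_assoc]; exact J.smul_mem _ h

variable [CharZero K]

theorem intCast_fun_injective : Function.Injective fun (k : ℤ) (_ : Unit) => (k : K) :=
  fun _ _ h => Int.cast_injective (congrFun h ())

theorem le_iSup_inf_tildeComp (hB : IsUnit B.det) (d : Gen I → ℤ)
    (hd : ∀ i, d (.f i) = -d (.e i)) (hd' : ∀ i, d (.h i) = 0) (J : Submodule K (TildeAlg B))
    (hJ : ∀ y, ∀ x ∈ J, y * x ∈ J) : J ≤ ⨆ k, J ⊓ tildeComp B d k :=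
  le_iSup_inf_of_stable (fun _ : Unit => LinearMap.mulLeft K
    (tildeGrading B (fun i => (d (.e i) : K)))) _ intCast_fun_injective
    (tildeComp B d) (fun _ _ hx _ => tildeGrading_mul_comp B hB d hd hd' _ hx) J
    (fun _ x hx => hJ _ x hx) (iSup_tildeComp B d ▸ le_top)

/-- The local part. -/
def tildeLocal : Submodule K (TildeAlg B) :=
  tildeComp B Gen.height (-1) ⊔ tildeComp B Gen.height 0 ⊔ tildeComp B Gen.height 1

theorem tildeComp_le_local {k : ℤ} (hk : k = -1 ∨ k = 0 ∨ k = 1) :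
    tildeComp B Gen.height k ≤ tildeLocal B := by
  rcases hk with rfl | rfl | rfl
  · exact le_sup_left.trans le_sup_left
  · exact le_sup_right.trans le_sup_left
  · exact le_sup_right

/-- A sum of ideals avoiding the local part might meet it; gradedness prevents this. Each ideal lies
in the sum of the components of height different from -1, 0 and 1, and so does their sum. -/
theorem maxIdeal_inf_local (hB : IsUnit B.det) : (maxIdeal B).toSubmodule ⊓ tildeLocal B = ⊥ := by
  have h₁ : (maxIdeal B).toSubmodule ≤
      ⨆ k : ℤ, ⨆ _ : ¬ (k = -1 ∨ k = 0 ∨ k = 1), tildeComp B Gen.height k := by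
    refine iSup_le fun ⟨J, hJ, hJ'⟩ => hJ.trans (iSup_le fun k => ?_)
    by_cases hk : k = -1 ∨ k = 0 ∨ k = 1
    · have : J.toSubmodule ⊓ tildeComp B Gen.height k ≤ ⊥ :=
        (inf_le_inf_left _ (tildeComp_le_local B hk)).trans hJ'.le
      exact this.trans bot_le
    · exact inf_le_right.trans (le_iSup_of_le k (le_iSup_of_le hk le_rfl))
  have h₂ : tildeLocal B ≤
      ⨆ k : ℤ, ⨆ _ : k = -1 ∨ k = 0 ∨ k = 1, tildeComp B Gen.height k := by
    refine sup_le (sup_le ?_ ?_) ?_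
    · exact le_iSup_of_le (-1) (le_iSup_of_le (by simp) le_rfl)
    · exact le_iSup_of_le 0 (le_iSup_of_le (by simp) le_rfl)
    · exact le_iSup_of_le 1 (le_iSup_of_le (by simp) le_rfl)
  refine eq_bot_iff.2 fun x hx => ?_
  exact disjoint_iSup_eigen (fun _ : Unit => LinearMap.mulLeft K
    (tildeGrading B (fun i => (Gen.height (.e i : Gen I) : K)))) _ intCast_fun_injective
    (tildeComp B Gen.height)
    (fun _ _ hx _ => tildeGrading_mul_comp B hB Gen.height (fun _ => rfl) (fun _ => rfl) _ hx)
    _ _ (fun _ h => h) (h₁ hx.1) (h₂ hx.2)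

theorem tilde_mul_tval (k : ℤ) (w : FreeMagma (Gen I)) {x : TildeAlg B}
    (hx : x ∈ tildeComp B Gen.level k) :
    x * tval B w = -(sgn K k (wordDeg Gen.level w) • (tval B w * x)) := by
  induction hx using Submodule.span_induction with
  | mem x hx =>
    obtain ⟨v, rfl, rfl⟩ := hx
    exact tval_skew B v w
  | zero => simp
  | add y z _ _ h₁ h₂ => rw [add_mul, mul_add, h₁, h₂, smul_add, neg_add]
  | smul r y _ h => rw [mul_smul_comm, smul_mul_assoc, h, smul_neg, smul_comm]

/-- Stability on the left suffices: the subspace is graded by level, and on homogeneous elements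
right multiplication is left multiplication up to sign. Gradedness by height is automatic too. -/
theorem le_maxIdeal (hB : IsUnit B.det) (J : Submodule K (TildeAlg B))
    (hJ : ∀ g : Gen I, ∀ x ∈ J, tval B (.of g) * x ∈ J) (hJ' : J ⊓ tildeLocal B = ⊥) :
    J ≤ (maxIdeal B).toSubmodule := by
  have hl : ∀ y, ∀ x ∈ J, y * x ∈ J := fun y x hx => mul_mem_of_stable B J hJ y hx
  have hg := le_iSup_inf_tildeComp B hB Gen.level (by rintro (_ | _) <;> rfl)
    (by rintro (_ | _) <;> rfl) J hl
  have hr : ∀ x ∈ J, ∀ y, x * y ∈ J := by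
    intro x hx y
    have hy : y ∈ Submodule.span K (Set.range (tval B)) := span_tval B ▸ Submodule.mem_top
    induction hy using Submodule.span_induction with
    | mem y hy =>
      obtain ⟨w, rfl⟩ := hy
      have hc : ∀ k, J ⊓ tildeComp B Gen.level k ≤ J.comap (LinearMap.mulRight K (tval B w)) := by
        rintro k x ⟨hx, hx'⟩
        change x * tval B w ∈ J
        rw [tilde_mul_tval B k w hx']
        exact J.neg_mem (J.smul_mem _ (hl _ _ hx))
      exact iSup_le hc (hg hx)
    | zero => simp
    | add y z _ _ h₁ h₂ => rw [mul_add]; exact add_mem h₁ h₂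
    | smul r y _ h => rw [mul_smul_comm]; exact J.smul_mem _ h
  let J' : AlgIdeal K (TildeAlg B) :=
    { J with
      mul_mem_left' := fun x y hy => hl x y hy
      mul_mem_right' := fun x y hx => hr x hx y }
  exact le_iSup_of_le (f := fun J : {J : AlgIdeal K (TildeAlg B) | _} => J.1.toSubmodule)
    ⟨J', le_iSup_inf_tildeComp B hB Gen.height (fun _ => rfl) (fun _ => rfl) J hl, hJ'⟩ le_rfl

end Grading

end Tilde

end Cartanification

namespace Cartanification

/-! ### Chevalley generators and root spaces of 𝓑 -/

section Contr

variable {K : Type*} [Field K] {I : Type} (B : Matrix (Option I) (Option I) K)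

/-- `1` for the generators `e_i`, and `-1` for the generators `f_i`. -/
def bsgn : Bool → ℤ
  | true => 1
  | false => -1

/-- The generators `e_i` (for `true`) and `f_i` (for `false`). -/
def chev : Bool → Option I → ContrAlg B
  | true, i => val B (.of (.e i))
  | false, i => val B (.of (.f i))

/-- The generators `h_i`. -/
def cart (i : Option I) : ContrAlg B := val B (.of (.h i))

/-- The level of the simple roots. -/
def lvl : Option I → ℤ
  | none => 1
  | some _ => 0

/-- The scalar `c` with `[x_i, y_i] = c h_i` for `x_i = e_i` and `y_i = f_i`, or conversely. -/
def chevCoeff (K : Type*) [Field K] {I : Type} : Bool → Option I → K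
  | true, _ => 1
  | false, none => 1
  | false, some _ => -1

theorem chevCoeff_ne_zero (b : Bool) (i : Option I) : chevCoeff K b i ≠ 0 := by
  cases b <;> cases i <;> simp [chevCoeff]

theorem chev_mem (b : Bool) (i : Option I) : chev B b i ∈ comp B (bsgn b * lvl i) := by
  have h : ∀ g : Gen I, val B (.of g) ∈ comp B g.level := fun g => val_mem (.of g)
  rcases b with _ | _ <;> rcases i with _ | i
  · exact h (.f none)
  · exact h (.f (some i))
  · exact h (.e none)
  · exact h (.e (some i))

theorem cart_mem (i : Option I) : cart B i ∈ comp B 0 := val_mem (.of (.h i))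

theorem cart_mul_chev (i : Option I) (b : Bool) (j : Option I) :
    cart B i * chev B b j = ((bsgn b : K) * B i j) • chev B b j := by
  cases b
  · have h := val_h_mul_f B i j
    rw [bsgn, Int.cast_neg, Int.cast_one, neg_one_mul, neg_smul]
    exact h
  · have h := val_h_mul_e B i j
    rw [bsgn, Int.cast_one, one_mul]
    exact h

theorem val_e_mul_f_ne {i j : Option I} (hij : i ≠ j) :
    val B (.of (.e i)) * val B (.of (.f j)) = 0 := by
  have h := relator_eq_zero (Relator.ef_ne (B := B) i j hij)
  rw [AlgIdeal.proj_mul, AlgIdeal.proj_mul] at h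
  exact h

theorem chev_mul_chev_self (b : Bool) (i : Option I) :
    chev B b i * chev B (!b) i = chevCoeff K b i • cart B i := by
  cases b
  · have h := super_skew (chev_mem B false i) (chev_mem B true i)
    rw [show chev B true i * chev B false i = cart B i from val_e_mul_f B i] at h
    change chev B false i * chev B true i = _
    rw [eq_neg_of_add_eq_zero_left h]
    cases i <;> simp [sgn, bsgn, lvl, chevCoeff]
  · rw [chevCoeff, one_smul]
    exact val_e_mul_f B i

theorem chev_mul_chev_ne (b : Bool) {i j : Option I} (hij : i ≠ j) :
    chev B b i * chev B (!b) j = 0 := by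
  cases b
  · have h := super_skew (chev_mem B false i) (chev_mem B true j)
    rw [show chev B true j * chev B false i = 0 from val_e_mul_f_ne B hij.symm] at h
    simpa using h
  · exact val_e_mul_f_ne B hij

theorem span_val : Submodule.span K (Set.range (val B)) = ⊤ := by
  have : Set.range (val B) = (maxIdeal B).proj '' Set.range (tval B) := by
    rw [← Set.range_comp]; rfl
  rw [this, Submodule.span_image, span_tval, Submodule.map_top, LinearMap.range_eq_top]
  exact AlgIdeal.proj_surjective _

theorem iSup_comp : ⨆ k, comp B k = ⊤ := by
  rw [eq_top_iff, ← span_val B, Submodule.span_le]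
  rintro _ ⟨w, rfl⟩
  exact Submodule.mem_iSup_of_mem _ (val_mem w)

/-- The super Jacobi identity. -/
theorem jacobi_of_mem {j k : ℤ} {x y : ContrAlg B} (hx : x ∈ comp B j) (hy : y ∈ comp B k)
    (z : ContrAlg B) : x * (y * z) = x * y * z + sgn K j k • (y * (x * z)) := by
  have hz : z ∈ ⨆ k, comp B k := iSup_comp B ▸ Submodule.mem_top
  induction hz using Submodule.iSup_induction' with
  | mem l z hz =>
    have h := super_jacobi hx hy hz
    rwa [sub_sub, sub_eq_zero] at h
  | zero => simp
  | add u v _ _ h₁ h₂ => simp only [mul_add, smul_add, h₁, h₂]; abel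

theorem jacobi_zero {x : ContrAlg B} (hx : x ∈ comp B 0) (y z : ContrAlg B) :
    x * (y * z) = x * y * z + y * (x * z) := by
  have hy : y ∈ ⨆ k, comp B k := iSup_comp B ▸ Submodule.mem_top
  induction hy using Submodule.iSup_induction' with
  | mem l y hy => simpa [sgn] using jacobi_of_mem B hx hy z
  | zero => simp
  | add u v _ _ h₁ h₂ => simp only [mul_add, add_mul, h₁, h₂]; abel

theorem skew_zero {x : ContrAlg B} (hx : x ∈ comp B 0) (y : ContrAlg B) : x * y = -(y * x) := by
  have hy : y ∈ ⨆ k, comp B k := iSup_comp B ▸ Submodule.mem_top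
  induction hy using Submodule.iSup_induction' with
  | mem l y hy => exact level_zero_skew hx hy
  | zero => simp
  | add u v _ _ h₁ h₂ => simp only [mul_add, add_mul, h₁, h₂]; abel

theorem cart_mul_cart (i j : Option I) : cart B i * cart B j = 0 := by
  have h : cart B j = chev B true j * chev B false j := (val_e_mul_f B j).symm
  rw [h, jacobi_zero B (cart_mem B i), cart_mul_chev, cart_mul_chev, smul_mul_assoc,
    mul_smul_comm, ← add_smul]
  simp [bsgn]

section Grading

variable [Fintype I] [DecidableEq I]

/-- The eigenvalues of the `h_i` on a root space. -/
def rootVal (d : Option I → ℤ) : Option I → K := B.mulVec fun j => (d j : K)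

theorem rootVal_add (d d' : Option I → ℤ) : rootVal B (d + d') = rootVal B d + rootVal B d' := by
  simp only [rootVal, ← Matrix.mulVec_add]
  congr 1
  ext j
  simp

theorem rootVal_single (i : Option I) (n : ℤ) (k : Option I) :
    rootVal B (Pi.single i n) k = n * B k i := by
  have : (fun j => ((Pi.single i n : Option I → ℤ) j : K)) = Pi.single i (n : K) := by
    ext j
    by_cases h : j = i
    · subst h; simp
    · simp [h]
  rw [rootVal, this, Matrix.mulVec_single]
  simp [mul_comm]

theorem rootVal_neg (d : Option I → ℤ) : rootVal B (-d) = -rootVal B d := by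
  simp only [rootVal, ← Matrix.mulVec_neg]
  congr 1
  ext j
  simp

@[simp] theorem rootVal_zero : rootVal B (0 : Option I → ℤ) = 0 := by
  have := rootVal_add B 0 0
  simpa using this

/-- The root space of degree `d` (the Cartan subalgebra for `d = 0`). -/
def gr (d : Option I → ℤ) : Submodule K (ContrAlg B) where
  carrier := {x | ∀ k, cart B k * x = rootVal B d k • x}
  add_mem' hx hy k := by rw [mul_add, hx k, hy k, smul_add]
  zero_mem' k := by simp
  smul_mem' c x hx k := by rw [mul_smul_comm, hx k, smul_comm]

theorem mul_mem_gr {d d' : Option I → ℤ} {x y : ContrAlg B} (hx : x ∈ gr B d) (hy : y ∈ gr B d') :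
    x * y ∈ gr B (d + d') := fun k => by
  rw [jacobi_zero B (cart_mem B k), hx k, hy k, rootVal_add, Pi.add_apply, add_smul,
    smul_mul_assoc, mul_smul_comm]

theorem chev_mem_gr (b : Bool) (i : Option I) : chev B b i ∈ gr B (bsgn b • Pi.single i 1) := by
  intro k
  rw [cart_mul_chev, ← Pi.single_smul, rootVal_single]
  simp

theorem cart_mem_gr (i : Option I) : cart B i ∈ gr B 0 := fun k => by
  rw [cart_mul_cart]; simp

/-- The number of letters `e_j` minus the number of letters `f_j`. -/
def Gen.coord : Gen I → Option I → ℤ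
  | .e i => Pi.single i 1
  | .f i => -Pi.single i 1
  | .h _ => 0

/-- The degree of a word. -/
def mdeg (w : FreeMagma (Gen I)) : Option I → ℤ := fun j => wordDeg (fun g => g.coord j) w

theorem mdeg_mul (a b : FreeMagma (Gen I)) : mdeg (a.mul b) = mdeg a + mdeg b := rfl

theorem val_mem_gr (w : FreeMagma (Gen I)) : val B w ∈ gr B (mdeg w) := by
  induction w with
  | ih1 g =>
    rcases g with i | i | i
    · have h := chev_mem_gr B true i
      rw [bsgn, one_smul] at h
      exact h
    · have h := chev_mem_gr B false i
      rw [bsgn, neg_one_smul] at h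
      exact h
    · exact cart_mem_gr B i
  | ih2 a b ha hb =>
    rw [show a * b = a.mul b from rfl, val_mul, mdeg_mul]
    exact mul_mem_gr B ha hb

theorem level_eq_mdeg (w : FreeMagma (Gen I)) : wordDeg Gen.level w = mdeg w none := by
  induction w with
  | ih1 g => rcases g with (_ | i) | (_ | i) | i <;> simp [mdeg, wordDeg, Gen.level, Gen.coord]
  | ih2 a b ha hb =>
    rw [show a * b = a.mul b from rfl, mdeg_mul, Pi.add_apply, ← ha, ← hb]
    rfl

theorem height_eq_mdeg (w : FreeMagma (Gen I)) : wordDeg Gen.height w = ∑ j, mdeg w j := by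
  induction w with
  | ih1 g => rcases g with i | i | i <;> simp [mdeg, wordDeg, Gen.height, Gen.coord]
  | ih2 a b ha hb =>
    rw [show a * b = a.mul b from rfl, mdeg_mul]
    simp only [Pi.add_apply, Finset.sum_add_distrib, ← ha, ← hb]
    rfl

variable [CharZero K]

variable {B} in
theorem rootVal_injective (hB : IsUnit B.det) :
    Function.Injective (rootVal B) := fun d d' h => by
  have h' := Matrix.mulVec_injective_iff_isUnit.2 ((Matrix.isUnit_iff_isUnit_det B).2 hB) h
  funext j
  exact Int.cast_injective (congrFun h' j)

theorem iSup_gr : ⨆ d, gr B d = ⊤ := by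
  rw [eq_top_iff, ← span_val B, Submodule.span_le]
  rintro _ ⟨w, rfl⟩
  exact Submodule.mem_iSup_of_mem _ (val_mem_gr B w)

variable (hB : IsUnit B.det)

-- Roots are distinct for distinct degrees because `B` is invertible, so the root space is spanned
-- by the words of degree `d`, whose level is the coordinate of `d` at the node 0.
include hB in
theorem gr_le_comp (d : Option I → ℤ) : gr B d ≤ comp B (d none) := by
  intro x hx
  have h := mem_span_of_mem_eigen (fun k => LinearMap.mulLeft K (cart B k)) _ (rootVal_injective hB)
    (gr B) (fun _ _ h => h) (val B) mdeg (val_mem_gr B) hx (span_val B ▸ Submodule.mem_top)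
  refine Submodule.span_le.2 ?_ h
  rintro _ ⟨w, rfl, rfl⟩
  rw [← level_eq_mdeg]
  exact val_mem w

end Grading

end Contr

end Cartanification

namespace Cartanification

section Struct

variable {K : Type*} [Field K] {I : Type} (B : Matrix (Option I) (Option I) K)

/-! ### Nonvanishing and the absence of ideals that avoid the local part -/

/-- A subspace stable under left multiplication by the generators `e_i`, `f_i`, `h_i`. -/
def GenStable (J : Submodule K (ContrAlg B)) : Prop :=
  (∀ b i, ∀ x ∈ J, chev B b i * x ∈ J) ∧ ∀ i, ∀ x ∈ J, cart B i * x ∈ J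

theorem mul_mem_of_genStable {J : Submodule K (ContrAlg B)} (hJ : GenStable B J)
    (y : ContrAlg B) {x : ContrAlg B} (hx : x ∈ J) : y * x ∈ J := by
  have hw : ∀ w : FreeMagma (Gen I), ∀ x ∈ J, val B w * x ∈ J := by
    intro w
    induction w with
    | ih1 g =>
      rcases g with i | i | i
      · exact hJ.1 true i
      · exact hJ.1 false i
      · exact hJ.2 i
    | ih2 a b iha ihb =>
      intro x hx
      rw [show a * b = a.mul b from rfl, val_mul,
        ← sub_eq_of_eq_add (jacobi_of_mem B (val_mem a) (val_mem b) x)]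
      exact sub_mem (iha _ (ihb _ hx)) (J.smul_mem _ (ihb _ (iha _ hx)))
  have hy : y ∈ Submodule.span K (Set.range (val B)) := span_val B ▸ Submodule.mem_top
  induction hy using Submodule.span_induction with
  | mem y hy => obtain ⟨w, rfl⟩ := hy; exact hw w x hx
  | zero => simp
  | add y z _ _ h₁ h₂ => rw [add_mul]; exact add_mem h₁ h₂
  | smul r y _ h => rw [smul_mul_assoc]; exact J.smul_mem _ h

/-- A subspace that is stable under left multiplication by the generators, and contains them, is
everything. -/
theorem eq_top_of_genStable {J : Submodule K (ContrAlg B)} (hJ : GenStable B J)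
    (h : ∀ b i, chev B b i ∈ J) (h' : ∀ i, cart B i ∈ J) : J = ⊤ := by
  rw [eq_top_iff, ← span_val B, Submodule.span_le]
  rintro _ ⟨w, rfl⟩
  induction w with
  | ih1 g =>
    rcases g with i | i | i
    · exact h true i
    · exact h false i
    · exact h' i
  | ih2 a b iha ihb =>
    rw [show a * b = a.mul b from rfl, val_mul]
    exact mul_mem_of_genStable B hJ _ ihb

section Local

variable [Fintype I] [DecidableEq I] [CharZero K] (hB : IsUnit B.det)

include hB

/-- The element `h_i` is nonzero before passing to the quotient, by its action on words, and lies in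
the local part, which the maximal ideal avoids. -/
theorem cart_ne_zero (i : Option I) : cart B i ≠ 0 := by
  intro h
  have h₁ : tval B (.of (.h i)) ∈ (maxIdeal B).toSubmodule := (AlgIdeal.proj_eq_zero _).1 h
  have h₂ : tval B (.of (.h i)) ∈ tildeLocal B :=
    tildeComp_le_local B (Or.inr (Or.inl rfl)) (Submodule.subset_span ⟨_, rfl, rfl⟩)
  have h₃ : tval B (.of (.h i)) ∈ (maxIdeal B).toSubmodule ⊓ tildeLocal B := ⟨h₁, h₂⟩
  rw [maxIdeal_inf_local B hB] at h₃
  exact tilde_h_ne_zero B i h₃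

theorem chev_ne_zero (b : Bool) (i : Option I) : chev B b i ≠ 0 := by
  intro h
  have h₁ := chev_mul_chev_self B b i
  rw [h, zero_mul] at h₁
  exact smul_ne_zero (chevCoeff_ne_zero b i) (cart_ne_zero B hB i) h₁.symm

/-- A linear relation acts by zero on each `e_j`, so its coefficients form a left null vector of
`B`. -/
theorem linearIndependent_cart : LinearIndependent K (cart B) := by
  rw [Fintype.linearIndependent_iff]
  intro c hc
  have h : Matrix.vecMul c B = 0 := by
    funext j
    have h₁ := congrArg (· * chev B true j) hc
    simp only [Finset.sum_mul, smul_mul_assoc, cart_mul_chev, smul_smul, ← Finset.sum_smul,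
      zero_mul] at h₁
    have h₂ := (smul_eq_zero.1 h₁).resolve_right (chev_ne_zero B hB true j)
    simpa [bsgn, Matrix.vecMul, dotProduct] using h₂
  have h₁ : c = 0 := by
    have := congrArg (fun v => Matrix.vecMul v B⁻¹) h
    simpa [Matrix.vecMul_vecMul, Matrix.mul_nonsing_inv _ hB] using this
  exact congrFun h₁

/-- The preimage in the algebra before the quotient is a left ideal that meets the local part only
inside `maxIdeal`, hence trivially; maximality then puts it inside `maxIdeal`. This is the only way
in which maximality is used later. -/
theorem eq_zero_of_stable_of_height {J : Submodule K (ContrAlg B)} (hJ : GenStable B J)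
    (hJ' : J ≤ ⨆ d : Option I → ℤ, ⨆ _ : 1 < |∑ j, d j|, gr B d) : J = ⊥ := by
  have key : J.comap (maxIdeal B).proj ≤ (maxIdeal B).toSubmodule := by
    refine le_maxIdeal B hB _ ?_ ?_
    · rintro (i | i | i) x hx
      · exact hJ.1 true i _ hx
      · exact hJ.1 false i _ hx
      · exact hJ.2 i _ hx
    · refine eq_bot_iff.2 fun t ⟨ht, ht'⟩ => ?_
      have h₁ : tildeLocal B ≤ (⨆ d : Option I → ℤ, ⨆ _ : |∑ j, d j| ≤ 1, gr B d).comap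
          (maxIdeal B).proj := by
        have aux : ∀ k : ℤ, |k| ≤ 1 → tildeComp B Gen.height k ≤
            (⨆ d : Option I → ℤ, ⨆ _ : |∑ j, d j| ≤ 1, gr B d).comap (maxIdeal B).proj := by
          intro k hk
          refine Submodule.span_le.2 ?_
          rintro _ ⟨w, rfl, rfl⟩
          refine Submodule.mem_iSup_of_mem (mdeg w) (Submodule.mem_iSup_of_mem ?_ (val_mem_gr B w))
          rwa [← height_eq_mdeg]
        exact sup_le (sup_le (aux _ (by simp)) (aux _ (by simp))) (aux _ (by simp))
      have h₂ : (maxIdeal B).proj t = 0 :=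
        disjoint_iSup_eigen (fun k => LinearMap.mulLeft K (cart B k)) _ (rootVal_injective hB)
          (gr B) (fun _ _ h => h) _ _ (fun _ h => not_le.2 h) (hJ' ht) (h₁ ht')
      have h₃ : t ∈ (maxIdeal B).toSubmodule ⊓ tildeLocal B :=
        ⟨(AlgIdeal.proj_eq_zero _).1 h₂, ht'⟩
      rwa [maxIdeal_inf_local B hB] at h₃
  refine eq_bot_iff.2 fun x hx => ?_
  obtain ⟨t, rfl⟩ := AlgIdeal.proj_surjective _ x
  exact (AlgIdeal.proj_eq_zero _).2 (key hx)

end Local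

/-! ### Right-normed words -/

/-- The right-normed products of the `e_i` (for `true`) or the `f_i` (for `false`). -/
def rn (b : Bool) : List (Option I) → Option I → ContrAlg B
  | [], i => chev B b i
  | j :: l, i => chev B b j * rn b l i

/-- The right-normed products of the `e_i` or the `f_i` with an element. -/
def rnApply (b : Bool) (x : ContrAlg B) : List (Option I) → ContrAlg B
  | [] => x
  | j :: l => chev B b j * rnApply b x l

theorem rn_eq_rnApply (b : Bool) (l : List (Option I)) (i : Option I) :
    rn B b l i = rnApply B b (chev B b i) l := by
  induction l with
  | nil => rfl
  | cons j l ih => rw [rn, rnApply, ih]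

section Words

variable [Fintype I] [DecidableEq I]

/-- The number of occurrences of the letters in a list. -/
def cnt {J : Type*} [DecidableEq J] (l : List J) : J → ℤ := fun j => l.count j

@[simp] theorem cnt_nil {J : Type*} [DecidableEq J] : cnt ([] : List J) = 0 := by
  funext j; simp [cnt]

theorem cnt_cons {J : Type*} [DecidableEq J] (j : J) (l : List J) :
    cnt (j :: l) = Pi.single j 1 + cnt l := by
  funext k
  by_cases h : k = j
  · subst h; simp [cnt, add_comm]
  · simp [cnt, h, Ne.symm h]

theorem cnt_nonneg {J : Type*} [DecidableEq J] (l : List J) (j : J) : 0 ≤ cnt l j := by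
  simp [cnt]

theorem cnt_pos {J : Type*} [DecidableEq J] {l : List J} {j : J} : 0 < cnt l j ↔ j ∈ l := by
  simp [cnt, List.count_pos_iff]

theorem cnt_eq_zero {J : Type*} [DecidableEq J] {l : List J} {j : J} : cnt l j = 0 ↔ j ∉ l := by
  simp [cnt, List.count_eq_zero]

theorem sum_cnt {J : Type*} [DecidableEq J] [Fintype J] (l : List J) :
    ∑ j, cnt l j = l.length := by
  induction l with
  | nil => simp
  | cons j l ih =>
    rw [cnt_cons]
    simp [Finset.sum_add_distrib, ih, add_comm]

theorem rnApply_mem_gr (b : Bool) {x : ContrAlg B} {d : Option I → ℤ} (hx : x ∈ gr B d)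
    (l : List (Option I)) : rnApply B b x l ∈ gr B (d + bsgn b • cnt l) := by
  induction l with
  | nil => simpa [rnApply] using hx
  | cons j l ih =>
    have := mul_mem_gr B (chev_mem_gr B b j) ih
    rw [cnt_cons, smul_add, add_left_comm]
    exact this

theorem rn_mem_gr (b : Bool) (l : List (Option I)) (i : Option I) :
    rn B b l i ∈ gr B (bsgn b • cnt (i :: l)) := by
  rw [rn_eq_rnApply, cnt_cons, smul_add]
  exact rnApply_mem_gr B b (chev_mem_gr B b i) l

/-- The span of the right-normed words. -/
def nil (b : Bool) : Submodule K (ContrAlg B) :=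
  Submodule.span K {x | ∃ l i, rn B b l i = x}

/-- The Cartan subalgebra. -/
def cartan : Submodule K (ContrAlg B) := Submodule.span K (Set.range (cart B))

theorem chev_mul_mem_nil (b : Bool) (j : Option I) {x : ContrAlg B} (hx : x ∈ nil B b) :
    chev B b j * x ∈ nil B b := by
  have : nil B b ≤ (nil B b).comap (LinearMap.mulLeft K (chev B b j)) := by
    refine Submodule.span_le.2 ?_
    rintro _ ⟨l, i, rfl⟩
    exact Submodule.subset_span ⟨j :: l, i, rfl⟩
  exact this hx

theorem cart_mul_mem_nil (b : Bool) (j : Option I) {x : ContrAlg B} (hx : x ∈ nil B b) :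
    cart B j * x ∈ nil B b := by
  have : nil B b ≤ (nil B b).comap (LinearMap.mulLeft K (cart B j)) := by
    refine Submodule.span_le.2 ?_
    rintro _ ⟨l, i, rfl⟩
    change cart B j * rn B b l i ∈ nil B b
    rw [rn_mem_gr B b l i j]
    exact Submodule.smul_mem _ _ (Submodule.subset_span ⟨l, i, rfl⟩)
  exact this hx

theorem chev_mul_cart (b : Bool) (i j : Option I) :
    chev B b j * cart B i = -((bsgn b : K) * B i j) • chev B b j := by
  rw [← neg_neg (chev B b j * cart B i), ← skew_zero B (cart_mem B i), cart_mul_chev, neg_smul]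

theorem chev_mul_mem_nil_of_cartan (b : Bool) (j : Option I) {x : ContrAlg B} (hx : x ∈ cartan B) :
    chev B b j * x ∈ nil B b := by
  have : cartan B ≤ (nil B b).comap (LinearMap.mulLeft K (chev B b j)) := by
    refine Submodule.span_le.2 ?_
    rintro _ ⟨i, rfl⟩
    change chev B b j * cart B i ∈ nil B b
    rw [chev_mul_cart]
    exact Submodule.smul_mem _ _ (Submodule.subset_span ⟨[], j, rfl⟩)
  exact this hx

theorem chev_not_mul_chev_mem (b : Bool) (i j : Option I) :
    ∃ c : K, chev B (!b) i * chev B b j = c • cart B i := by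
  by_cases h : i = j
  · subst h
    have := chev_mul_chev_self B (!b) i
    rw [Bool.not_not] at this
    exact ⟨_, this⟩
  · have := chev_mul_chev_ne B (!b) h
    rw [Bool.not_not] at this
    exact ⟨0, by rw [this, zero_smul]⟩

theorem chev_not_mul_mem (b : Bool) (j : Option I) {x : ContrAlg B} (hx : x ∈ nil B b) :
    chev B (!b) j * x ∈ nil B b ⊔ cartan B := by
  have : nil B b ≤ (nil B b ⊔ cartan B).comap (LinearMap.mulLeft K (chev B (!b) j)) := by
    refine Submodule.span_le.2 ?_
    rintro _ ⟨l, i, rfl⟩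
    change chev B (!b) j * rn B b l i ∈ nil B b ⊔ cartan B
    induction l with
    | nil =>
      obtain ⟨c, hc⟩ := chev_not_mul_chev_mem B b j i
      rw [rn, hc]
      exact Submodule.mem_sup_right (Submodule.smul_mem _ _ (Submodule.subset_span ⟨j, rfl⟩))
    | cons k l ih =>
      rw [rn, jacobi_of_mem B (chev_mem B (!b) j) (chev_mem B b k)]
      obtain ⟨c, hc⟩ := chev_not_mul_chev_mem B b j k
      rw [hc, smul_mul_assoc]
      refine add_mem (Submodule.mem_sup_left (Submodule.smul_mem _ _ (cart_mul_mem_nil B b j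
        (Submodule.subset_span ⟨l, i, rfl⟩)))) (Submodule.smul_mem _ _ (Submodule.mem_sup_left ?_))
      obtain ⟨y, hy, z, hz, hyz⟩ := Submodule.mem_sup.1 ih
      rw [← hyz, mul_add]
      exact add_mem (chev_mul_mem_nil B b k hy) (chev_mul_mem_nil_of_cartan B b k hz)
  exact this hx

/-- The triangular decomposition. -/
theorem nil_sup_cartan_sup_nil : nil B true ⊔ cartan B ⊔ nil B false = ⊤ := by
  have hle : ∀ b, nil B b ≤ nil B true ⊔ cartan B ⊔ nil B false := by
    rintro (_ | _)
    · exact le_sup_right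
    · exact le_sup_left.trans le_sup_left
  have hle' : cartan B ≤ nil B true ⊔ cartan B ⊔ nil B false := le_sup_right.trans le_sup_left
  refine eq_top_of_genStable B ⟨fun b j x hx => ?_, fun j x hx => ?_⟩
    (fun b i => hle b (Submodule.subset_span ⟨[], i, rfl⟩))
    (fun i => hle' (Submodule.subset_span ⟨i, rfl⟩))
  · obtain ⟨v, hv, z, hz, rfl⟩ := Submodule.mem_sup.1 hx
    obtain ⟨y, hy, u, hu, rfl⟩ := Submodule.mem_sup.1 hv
    rw [mul_add, mul_add]
    refine add_mem (add_mem ?_ (hle b (chev_mul_mem_nil_of_cartan B b j hu))) ?_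
    · cases b
      · exact sup_le (hle true) hle' (chev_not_mul_mem B true j hy)
      · exact hle true (chev_mul_mem_nil B true j hy)
    · cases b
      · exact hle false (chev_mul_mem_nil B false j hz)
      · exact sup_le (hle false) hle' (chev_not_mul_mem B false j hz)
  · obtain ⟨v, hv, z, hz, rfl⟩ := Submodule.mem_sup.1 hx
    obtain ⟨y, hy, u, hu, rfl⟩ := Submodule.mem_sup.1 hv
    rw [mul_add, mul_add]
    refine add_mem (add_mem (hle _ (cart_mul_mem_nil B _ j hy)) ?_)
      (hle _ (cart_mul_mem_nil B _ j hz))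
    have : cartan B ≤ LinearMap.ker (LinearMap.mulLeft K (cart B j)) := by
      refine Submodule.span_le.2 ?_
      rintro _ ⟨i, rfl⟩
      exact cart_mul_cart B j i
    rw [show cart B j * u = 0 from this hu]
    exact zero_mem _

variable [CharZero K] (hB : IsUnit B.det)

/-- The generators of the triangular decomposition: words and the `h_i`. -/
def triang : Option I ⊕ (Bool × List (Option I) × Option I) → ContrAlg B
  | .inl i => cart B i
  | .inr (b, l, i) => rn B b l i

/-- The degrees of the generators of the triangular decomposition. -/
def triangDeg : Option I ⊕ (Bool × List (Option I) × Option I) → Option I → ℤ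
  | .inl _ => 0
  | .inr (b, l, i) => bsgn b • cnt (i :: l)

theorem triang_mem_gr (w) : triang B w ∈ gr B (triangDeg w) := by
  rcases w with i | ⟨b, l, i⟩
  · exact cart_mem_gr B i
  · exact rn_mem_gr B b l i

theorem span_triang : Submodule.span K (Set.range (triang B)) = ⊤ := by
  rw [eq_top_iff, ← nil_sup_cartan_sup_nil B]
  refine sup_le (sup_le ?_ ?_) ?_ <;> refine Submodule.span_le.2 ?_
  · rintro _ ⟨l, i, rfl⟩
    exact Submodule.subset_span ⟨.inr (true, l, i), rfl⟩
  · rintro _ ⟨i, rfl⟩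
    exact Submodule.subset_span ⟨.inl i, rfl⟩
  · rintro _ ⟨l, i, rfl⟩
    exact Submodule.subset_span ⟨.inr (false, l, i), rfl⟩

include hB

theorem mem_span_triang {d : Option I → ℤ} {x : ContrAlg B} (hx : x ∈ gr B d) :
    x ∈ Submodule.span K {y | ∃ w, triangDeg w = d ∧ triang B w = y} :=
  mem_span_of_mem_eigen (fun k => LinearMap.mulLeft K (cart B k)) _ (rootVal_injective hB)
    (gr B) (fun _ _ h => h) (triang B) triangDeg (triang_mem_gr B) hx
    (span_triang B ▸ Submodule.mem_top)

theorem cnt_cons_ne_zero {J : Type*} [DecidableEq J] (b : Bool) (i : J) (l : List J) :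
    bsgn b • cnt (i :: l) ≠ 0 := by
  intro h
  have h₁ := congrFun h i
  have h₂ : 0 < cnt (i :: l) i := cnt_pos.2 (by simp)
  cases b <;> simp [bsgn] at h₁ <;> omega

theorem gr_zero_le : gr B (0 : Option I → ℤ) ≤ cartan B := by
  intro x hx
  refine Submodule.span_le.2 ?_ (mem_span_triang B hB hx)
  rintro _ ⟨w, hw, rfl⟩
  rcases w with i | ⟨b, l, i⟩
  · exact Submodule.subset_span ⟨i, rfl⟩
  · exact absurd hw (cnt_cons_ne_zero B hB b i l)

/-- The degrees of nonzero elements are nonnegative or nonpositive. -/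
theorem exists_sign_of_ne_zero {d : Option I → ℤ} {x : ContrAlg B} (hx : x ∈ gr B d)
    (hx0 : x ≠ 0) (hd : d ≠ 0) : ∃ b, ∀ j, 0 ≤ bsgn b * d j := by
  by_contra! h
  refine hx0 ?_
  have := mem_span_triang B hB hx
  rwa [show {y | ∃ w, triangDeg w = d ∧ triang B w = y} = ∅ from ?_, Submodule.span_empty,
    Submodule.mem_bot] at this
  refine Set.eq_empty_of_forall_notMem ?_
  rintro _ ⟨w, rfl, rfl⟩
  rcases w with i | ⟨b, l, i⟩
  · exact hd rfl
  · obtain ⟨j, hj⟩ := h b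
    have := cnt_nonneg (i :: l) j
    cases b <;> simp [bsgn, triangDeg] at hj <;> omega

theorem mem_span_rn {d : Option I → ℤ} {x : ContrAlg B} (b : Bool) (hd : 0 < bsgn b * ∑ j, d j)
    (hx : x ∈ gr B d) :
    x ∈ Submodule.span K {y | ∃ l i, bsgn b • cnt (i :: l) = d ∧ rn B b l i = y} := by
  refine Submodule.span_mono ?_ (mem_span_triang B hB hx)
  rintro _ ⟨w, rfl, rfl⟩
  rcases w with i | ⟨c, l, i⟩
  · simp [triangDeg] at hd
  · have h : c = b := by
      have h₁ : ∑ j, cnt (i :: l) j = (i :: l).length := sum_cnt _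
      have h₂ : ∑ j, (triangDeg (Sum.inr (c, l, i)) : Option I → ℤ) j =
          bsgn c * (i :: l).length := by
        rw [← h₁, Finset.mul_sum]
        rfl
      rw [h₂] at hd
      cases b <;> cases c <;> simp [bsgn] at hd ⊢ <;> omega
    subst h
    exact ⟨l, i, rfl, rfl⟩

theorem mem_span_chev {x : ContrAlg B} (b : Bool) (i : Option I)
    (hx : x ∈ gr B (bsgn b • Pi.single i 1)) : ∃ c : K, x = c • chev B b i := by
  have h := mem_span_rn B hB b (by
    simp only [Pi.smul_apply, smul_eq_mul, ← Finset.mul_sum, Finset.sum_pi_single', Finset.mem_univ,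
      if_true]
    cases b <;> simp [bsgn]) hx
  have h' : x ∈ Submodule.span K {chev B b i} := by
    refine Submodule.span_mono ?_ h
    rintro _ ⟨l, j, hd, rfl⟩
    have hd' : cnt (j :: l) = Pi.single i 1 := by
      cases b <;> simpa [bsgn] using hd
    have h₁ := congrArg (fun d : Option I → ℤ => ∑ k, d k) hd'
    simp only [sum_cnt, Finset.sum_pi_single', Finset.mem_univ, if_true] at h₁
    have hl : l = [] := by
      rw [← List.length_eq_zero_iff]
      simpa using h₁
    subst hl
    have hj : j = i := by
      by_contra hne
      have := congrFun hd' j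
      rw [cnt_cons] at this
      simp [hne] at this
    subst hj
    rfl
  obtain ⟨c, hc⟩ := Submodule.mem_span_singleton.1 h'
  exact ⟨c, hc.symm⟩

theorem mem_span_chev_mul {d : Option I → ℤ} {x : ContrAlg B} (b : Bool)
    (hd : 2 ≤ bsgn b * ∑ j, d j) (hx : x ∈ gr B d) :
    x ∈ Submodule.span K {y | ∃ i, ∃ z ∈ gr B (d - bsgn b • Pi.single i 1), chev B b i * z = y} := by
  refine Submodule.span_mono ?_ (mem_span_rn B hB b (by omega) hx)
  rintro _ ⟨l, i, rfl, rfl⟩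
  cases l with
  | nil =>
    exfalso
    simp only [Pi.smul_apply, smul_eq_mul, ← Finset.mul_sum, sum_cnt] at hd
    cases b <;> simp [bsgn] at hd
  | cons j l =>
    refine ⟨j, rn B b l i, ?_, rfl⟩
    have := rn_mem_gr B b l i
    rwa [cnt_cons, cnt_cons, smul_add, smul_add, add_left_comm, add_sub_cancel_left, ← smul_add,
      ← cnt_cons]

/-- An element of height at least two (in absolute value) that is annihilated by all lowering
generators vanishes. -/
theorem eq_zero_of_chev_mul_eq_zero {d : Option I → ℤ} {x : ContrAlg B} (b : Bool)
    (hd : 2 ≤ bsgn b * ∑ j, d j) (hx : x ∈ gr B d) (h : ∀ i, chev B (!b) i * x = 0) : x = 0 := by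
  -- The words in the generators of sign `b` applied to `x` span a stable subspace all of whose
  -- degrees have height at least two in absolute value. Such a subspace is zero.
  let J : Submodule K (ContrAlg B) := Submodule.span K (Set.range (rnApply B b x))
  have hs : ∀ (y : ContrAlg B), (∀ l, y * rnApply B b x l ∈ J) → ∀ z ∈ J, y * z ∈ J := by
    intro y hy z hz
    have : J ≤ J.comap (LinearMap.mulLeft K y) := Submodule.span_le.2 (by
      rintro _ ⟨l, rfl⟩
      exact hy l)
    exact this hz
  have hc : ∀ i, ∀ z ∈ J, cart B i * z ∈ J := fun i => hs _ fun l => by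
    rw [rnApply_mem_gr B b hx l i]
    exact J.smul_mem _ (Submodule.subset_span ⟨l, rfl⟩)
  have hu : ∀ i, ∀ z ∈ J, chev B b i * z ∈ J := fun i => hs _ fun l =>
    Submodule.subset_span ⟨i :: l, rfl⟩
  have hl : ∀ i, ∀ z ∈ J, chev B (!b) i * z ∈ J := fun i => hs _ fun l => by
    induction l with
    | nil => rw [rnApply, h]; exact zero_mem _
    | cons k l ih =>
      rw [rnApply, jacobi_of_mem B (chev_mem B (!b) i) (chev_mem B b k)]
      obtain ⟨c, hc'⟩ := chev_not_mul_chev_mem B b i k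
      rw [hc', smul_mul_assoc]
      exact add_mem (J.smul_mem _ (hc i _ (Submodule.subset_span ⟨l, rfl⟩)))
        (J.smul_mem _ (hu k _ ih))
  have hJ : GenStable B J := by
    refine ⟨fun c i => ?_, hc⟩
    by_cases hcb : c = b
    · subst hcb; exact hu i
    · rw [show c = !b by cases b <;> cases c <;> simp_all]
      exact hl i
  have hJ0 := eq_zero_of_stable_of_height B hB hJ (Submodule.span_le.2 (by
    rintro _ ⟨l, rfl⟩
    refine Submodule.mem_iSup_of_mem _ (Submodule.mem_iSup_of_mem ?_ (rnApply_mem_gr B b hx l))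
    simp only [Pi.add_apply, Pi.smul_apply, smul_eq_mul, Finset.sum_add_distrib, ← Finset.mul_sum,
      sum_cnt]
    rw [lt_abs]
    have : (0 : ℤ) ≤ l.length := by positivity
    cases b <;> simp only [bsgn] at hd ⊢ <;> omega))
  have : x ∈ J := Submodule.subset_span ⟨[], rfl⟩
  rwa [hJ0] at this

end Words

end Struct

end Cartanification

namespace Cartanification

/-! ### The invariant form on 𝓑 and its nondegeneracy -/

section Form

variable {K : Type*} [Field K] {I : Type} (B : Matrix (Option I) (Option I) K)

theorem sgn_mul_self (p q : ℤ) : sgn K p q * sgn K p q = 1 := by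
  unfold sgn; split_ifs <;> simp

theorem sgn_comm (p q : ℤ) : sgn K p q = sgn K q p := by
  unfold sgn; simp only [and_comm]

theorem sgn_add_right (p q s : ℤ) : sgn K p (q + s) = sgn K p q * sgn K p s := by
  unfold sgn
  by_cases hp : Odd p <;> by_cases hq : Odd q <;> by_cases hs : Odd s <;>
    simp [hp, hq, hs, Int.odd_add, ← Int.not_odd_iff_even]

theorem sgn_add_left (p q s : ℤ) : sgn K (p + q) s = sgn K p s * sgn K q s := by
  rw [sgn_comm, sgn_add_right, sgn_comm s, sgn_comm s]

variable [Fintype I] [DecidableEq I]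

/-- The height of a degree. -/
def ht (d : Option I → ℤ) : ℤ := ∑ j, d j

omit [DecidableEq I] in
theorem ht_add (d d' : Option I → ℤ) : ht (d + d') = ht d + ht d' := Finset.sum_add_distrib

omit [DecidableEq I] in
theorem ht_neg (d : Option I → ℤ) : ht (-d) = -ht d := Finset.sum_neg_distrib _

omit [DecidableEq I] in
theorem ht_sub (d d' : Option I → ℤ) : ht (d - d') = ht d - ht d' := Finset.sum_sub_distrib _ _

omit [DecidableEq I] in
@[simp] theorem ht_zero : ht (0 : Option I → ℤ) = 0 := by simp [ht]

theorem ht_smul_single (c : ℤ) (i : Option I) : ht (c • Pi.single i 1) = c := by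
  simp [ht, ← Finset.mul_sum]

theorem bsgn_not (b : Bool) : bsgn (!b) = -bsgn b := by cases b <;> simp [bsgn]

theorem bsgn_mul_self (b : Bool) : bsgn b * bsgn b = 1 := by cases b <;> simp [bsgn]

variable [CharZero K] (hB : IsUnit B.det)

section

include hB

/-- The coordinates of a root all have the same sign, so they cannot cancel in the height. -/
theorem eq_zero_of_ht_eq_zero {d : Option I → ℤ} {x : ContrAlg B} (hx : x ∈ gr B d) (hd : d ≠ 0)
    (h : ht d = 0) : x = 0 := by
  by_contra hx0
  obtain ⟨b, hb⟩ := exists_sign_of_ne_zero B hB hx hx0 hd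
  refine hd (funext fun j => ?_)
  have h₁ : ∑ j, bsgn b * d j = 0 := by rw [← Finset.mul_sum]; exact mul_eq_zero_of_right _ h
  have h₂ := (Finset.sum_eq_zero_iff_of_nonneg fun j _ => hb j).1 h₁ j (Finset.mem_univ j)
  cases b <;> simpa [bsgn] using h₂

theorem exists_chev_of_ht {d : Option I → ℤ} {x : ContrAlg B} (b : Bool) (hx : x ∈ gr B d)
    (hx0 : x ≠ 0) (h : ht d = bsgn b) : ∃ i, d = bsgn b • Pi.single i 1 := by
  by_contra! hd
  have h₁ := mem_span_rn B hB b (by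
    change 0 < bsgn b * ht d
    rw [h, bsgn_mul_self]; exact one_pos) hx
  refine hx0 ?_
  rwa [show {y | ∃ l i, bsgn b • cnt (i :: l) = d ∧ rn B b l i = y} = ∅ from ?_,
    Submodule.span_empty, Submodule.mem_bot] at h₁
  refine Set.eq_empty_of_forall_notMem ?_
  rintro _ ⟨l, i, rfl, rfl⟩
  have h₂ : ht (bsgn b • cnt (i :: l)) = bsgn b * (i :: l).length := by
    rw [← sum_cnt (i :: l), Finset.mul_sum]; rfl
  rw [h₂] at h
  have hl : l = [] := by
    rw [← List.length_eq_zero_iff]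
    rw [List.length_cons] at h
    cases b <;> simp only [bsgn] at h <;> omega
  subst hl
  exact hd i (by rw [cnt_cons, cnt_nil, add_zero])

theorem iSupIndep_gr : iSupIndep (gr B) := by
  rw [iSupIndep_def]
  intro d
  rw [Submodule.disjoint_def]
  intro x hx hx'
  exact disjoint_iSup_eigen (fun k => LinearMap.mulLeft K (cart B k)) _ (rootVal_injective hB)
    (gr B) (fun _ _ h => h) (· ≠ d) (· = d) (fun _ h => h) hx' (by rwa [iSup_iSup_eq_left])

/-- The operator that acts on the root spaces by given scalars. -/
theorem exists_scaling (φ : (Option I → ℤ) → K) :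
    ∃ Φ : Module.End K (ContrAlg B), ∀ d, ∀ x ∈ gr B d, Φ x = φ d • x := by
  have hint : DirectSum.IsInternal (gr B) :=
    DirectSum.isInternal_submodule_of_iSupIndep_of_iSup_eq_top (iSupIndep_gr B hB) (iSup_gr B)
  let e := LinearEquiv.ofBijective (DirectSum.coeLinearMap (gr B)) hint
  refine ⟨(DirectSum.toModule K _ _ fun d => φ d • (gr B d).subtype) ∘ₗ e.symm.toLinearMap,
    fun d x hx => ?_⟩
  have h : e.symm x = DirectSum.lof K _ (fun d => gr B d) d ⟨x, hx⟩ := by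
    rw [LinearEquiv.symm_apply_eq]
    exact (DirectSum.coeLinearMap_lof (gr B) d ⟨x, hx⟩).symm
  simp [h]

theorem exists_functional (t : Option I → K) : ∃ θ : ContrAlg B →ₗ[K] K,
    (∀ i, θ (cart B i) = t i) ∧ ∀ d, d ≠ 0 → ∀ x ∈ gr B d, θ x = 0 := by
  obtain ⟨Φ, hΦ⟩ := exists_scaling B hB (fun d => if d = 0 then 1 else 0)
  have hli := linearIndependent_cart B hB
  obtain ⟨g, hg⟩ := LinearMap.exists_extend (Finsupp.linearCombination K t ∘ₗ hli.repr)
  refine ⟨g ∘ₗ Φ, fun i => ?_, fun d hd x hx => ?_⟩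
  · rw [LinearMap.comp_apply, hΦ 0 _ (cart_mem_gr B i), if_pos rfl, one_smul]
    have hm : cart B i ∈ Submodule.span K (Set.range (cart B)) := Submodule.subset_span ⟨i, rfl⟩
    have := LinearMap.congr_fun hg ⟨cart B i, hm⟩
    rw [LinearMap.comp_apply] at this
    refine this.trans ?_
    have h₁ : hli.repr ⟨cart B i, hm⟩ = Finsupp.single i 1 :=
      hli.repr_eq_single i _ rfl
    simp [h₁]
  · rw [LinearMap.comp_apply, hΦ d x hx, if_neg hd, zero_smul, map_zero]

end

/-- The defining properties of the invariant form. -/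
structure FormData (s : Option I → K) (κ : ContrAlg B →ₗ[K] ContrAlg B →ₗ[K] K)
    (θ : ContrAlg B →ₗ[K] K) : Prop where
  functional_cart : ∀ i, θ (cart B i) = s i
  orthogonal : ∀ d d' x y, x ∈ gr B d → y ∈ gr B d' → d + d' ≠ 0 → κ x y = 0
  height_mul : ∀ d x y, x ∈ gr B d → ht d ≠ 0 → (ht d : K) * κ x y = θ (x * y)
  cart_cart : ∀ i j, κ (cart B i) (cart B j) = s j * B i j

-- If ρ is the element of the Cartan subalgebra acting on root spaces by the height, an invariant
-- form satisfies κ([ρ,x],y) = κ(ρ,[x,y]). The functional `θ` plays the role of κ(ρ, ·), and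
-- dividing by the height recovers κ outside the Cartan subalgebra. Invariance of the form so
-- defined remains to be proved.
include hB in
theorem exists_formData (s : Option I → K) : ∃ κ θ, FormData B s κ θ := by
  obtain ⟨θ, hθ, hθ'⟩ := exists_functional B hB s
  choose η hη hη' using fun i => exists_functional B hB (Pi.single i 1)
  -- The convention `0⁻¹ = 0` makes the term with `Φ` vanish on the Cartan subalgebra, where the
  -- second term gives the form instead.
  obtain ⟨Φ, hΦ⟩ := exists_scaling B hB (fun d => (ht d : K)⁻¹)
  refine ⟨LinearMap.mk₂ K (fun x y => θ (Φ x * y) + ∑ i, ∑ j, η i x * η j y * (s j * B i j))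
    (fun x y z => by
      simp only [map_add, add_mul, Finset.sum_add_distrib]; ring)
    (fun c x y => by
      simp only [map_smul, smul_mul_assoc, smul_eq_mul, mul_add, Finset.mul_sum, mul_assoc])
    (fun x y z => by
      simp only [map_add, mul_add, add_mul, Finset.sum_add_distrib]; ring)
    (fun c x y => by
      simp only [map_smul, mul_smul_comm, smul_eq_mul, mul_add, Finset.mul_sum, mul_assoc,
        mul_left_comm c]), θ, hθ, ?_, ?_, ?_⟩
  · intro d d' x y hx hy hd
    have h₁ : θ (Φ x * y) = 0 := by
      rw [hΦ d x hx, smul_mul_assoc, map_smul, hθ' _ hd _ (mul_mem_gr B hx hy), smul_zero]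
    have h₂ : ∀ i j, η i x * η j y = 0 := by
      intro i j
      by_cases h : d = 0
      · rw [hη' j d' (by rintro rfl; exact hd (by simp [h])) y hy, mul_zero]
      · rw [hη' i d h x hx, zero_mul]
    simp [h₁, h₂]
  · intro d x y hx hd
    have hd' : (ht d : K) ≠ 0 := Int.cast_ne_zero.2 hd
    have h₂ : ∀ i, η i x = 0 := fun i => hη' i d (by rintro rfl; simp at hd) x hx
    simp only [LinearMap.mk₂_apply, h₂, zero_mul, Finset.sum_const_zero, add_zero, hΦ d x hx,
      smul_mul_assoc, map_smul, smul_eq_mul]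
    rw [← mul_assoc, mul_inv_cancel₀ hd', one_mul]
  · intro i j
    simp only [LinearMap.mk₂_apply, hΦ 0 _ (cart_mem_gr B i), hη, ht_zero]
    simp [Pi.single_apply]

namespace FormData

variable {B} {s : Option I → K} {κ : ContrAlg B →ₗ[K] ContrAlg B →ₗ[K] K} {θ : ContrAlg B →ₗ[K] K}
  (F : FormData B s κ θ) (hs : ∀ i j, s j * B i j = s i * B j i)

/-- Invariance for elements of bounded height. -/
def Inv (κ : ContrAlg B →ₗ[K] ContrAlg B →ₗ[K] K) (n : ℕ) : Prop :=
  ∀ d₁ d₂ d₃ x y z, x ∈ gr B d₁ → y ∈ gr B d₂ → z ∈ gr B d₃ → |ht d₁| ≤ n → |ht d₂| ≤ n →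
    |ht d₃| ≤ n → κ (x * y) z = κ x (y * z)

include hB

theorem skew_gr {d d' : Option I → ℤ} {x y : ContrAlg B} (hx : x ∈ gr B d) (hy : y ∈ gr B d') :
    x * y = -(sgn K (d none) (d' none) • (y * x)) :=
  eq_neg_of_add_eq_zero_left (super_skew (gr_le_comp B hB d hx) (gr_le_comp B hB d' hy))

theorem jacobi_gr {d d' : Option I → ℤ} {x y : ContrAlg B} (hx : x ∈ gr B d) (hy : y ∈ gr B d')
    (z : ContrAlg B) : x * (y * z) = x * y * z + sgn K (d none) (d' none) • (y * (x * z)) :=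
  jacobi_of_mem B (gr_le_comp B hB d hx) (gr_le_comp B hB d' hy) z

include F hs

/-- Outside the Cartan subalgebra, exchanging the arguments changes the sign of the height and
reverses the bracket up to the super sign; the two minus signs cancel. On the Cartan subalgebra
symmetry is that of `B` scaled by `s`. -/
theorem symm {d d' : Option I → ℤ} {x y : ContrAlg B} (hx : x ∈ gr B d) (hy : y ∈ gr B d') :
    κ x y = sgn K (d none) (d' none) * κ y x := by
  by_cases hd : d + d' = 0
  · have hd' : d' = -d := (neg_eq_of_add_eq_zero_right hd).symm
    subst hd'
    by_cases h0 : d = 0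
    · subst h0
      have hc : ∀ y ∈ cartan B, ∀ x ∈ cartan B, κ x y = κ y x := by
        intro y hy x hx
        induction hx, hy using Submodule.span_induction₂ with
        | mem_mem x y hx hy =>
          obtain ⟨i, rfl⟩ := hx
          obtain ⟨j, rfl⟩ := hy
          rw [F.cart_cart, F.cart_cart, hs]
        | zero_left => simp
        | zero_right => simp
        | add_left x y z _ _ _ h₁ h₂ => simp [h₁, h₂]
        | add_right x y z _ _ _ h₁ h₂ => simp [h₁, h₂]
        | smul_left r x y _ _ h => simp [h]
        | smul_right r x y _ _ h => simp [h]
      rw [neg_zero] at hy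
      rw [hc y (gr_zero_le B hB hy) x (gr_zero_le B hB hx)]
      simp [sgn]
    · by_cases hh : ht d = 0
      · rw [eq_zero_of_ht_eq_zero B hB hx h0 hh]
        simp
      · have h₁ := F.height_mul d x y hx hh
        have h₂ := F.height_mul (-d) y x hy (by rw [ht_neg]; simpa)
        rw [skew_gr hB hx hy, map_neg, map_smul, ← h₂, ht_neg, smul_eq_mul] at h₁
        refine mul_left_cancel₀ (Int.cast_ne_zero.2 hh : (ht d : K) ≠ 0) ?_
        rw [h₁]
        push_cast
        ring
  · rw [F.orthogonal d d' x y hx hy hd, F.orthogonal d' d y x hy hx (by rwa [add_comm]), mul_zero]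

/-- Reversing the order of the factors. -/
theorem rev {d₁ d₂ d₃ : Option I → ℤ} {x y z : ContrAlg B} (hx : x ∈ gr B d₁) (hy : y ∈ gr B d₂)
    (hz : z ∈ gr B d₃) (h : κ (z * y) x = κ z (y * x)) : κ (x * y) z = κ x (y * z) := by
  rw [F.symm hB hs (mul_mem_gr B hx hy) hz, skew_gr hB hx hy, map_neg, map_smul, ← h,
    F.symm hB hs hx (mul_mem_gr B hy hz), skew_gr hB hy hz, map_neg, map_smul, LinearMap.neg_apply,
    LinearMap.smul_apply]
  simp only [Pi.add_apply, sgn_add_left, sgn_add_right, smul_eq_mul]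
  ring

/-- The inductive step for products of two elements with an element of maximal height. -/
theorem exchange {n : ℕ} (hn : 1 ≤ n) (hI : Inv κ n) (b : Bool) {d₁ d₂ d₃ : Option I → ℤ}
    {x y z : ContrAlg B} (hx : x ∈ gr B d₁) (hy : y ∈ gr B d₂) (hz : z ∈ gr B d₃)
    (h₁ : 0 < bsgn b * ht d₁) (h₂ : 0 < bsgn b * ht d₂) (h₁₂ : bsgn b * (ht d₁ + ht d₂) = n + 1)
    (h₃ : bsgn b * ht d₃ = -(n + 1)) :
    κ x (y * z) = -(sgn K (d₁ none) (d₂ none) * κ y (x * z)) := by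
  -- The element of extreme height is a sum of brackets of a generator `v` of its own sign with
  -- elements `w` of height one step nearer to zero. After expanding with the Jacobi identity, every
  -- product involves heights at most `n`.
  have hz' := mem_span_chev_mul B hB (!b) (d := d₃) (x := z) (by
    change 2 ≤ bsgn (!b) * ht d₃
    rw [bsgn_not]; linarith) hz
  clear hz
  induction hz' using Submodule.span_induction with
  | mem z hz' =>
    obtain ⟨j, w, hw, rfl⟩ := hz'
    have hv := chev_mem_gr B (!b) j
    set v := chev B (!b) j
    set dv : Option I → ℤ := bsgn (!b) • Pi.single j 1 with hdv
    have hhv : ht dv = -bsgn b := by rw [hdv, ht_smul_single, bsgn_not]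
    have hw1 : ht (d₃ - dv) = ht d₃ + bsgn b := by rw [ht_sub, hhv]; ring
    have e₁ := hI d₁ (d₂ + dv) (d₃ - dv) x (y * v) w hx (mul_mem_gr B hy hv) hw
      (by cases b <;> simp only [bsgn] at * <;> rw [abs_le] <;> omega)
      (by rw [ht_add]; cases b <;> simp only [bsgn] at * <;> rw [abs_le] <;> omega)
      (by cases b <;> simp only [bsgn] at * <;> rw [abs_le] <;> omega)
    have e₂ := hI d₁ dv (d₂ + (d₃ - dv)) x v (y * w) hx hv (mul_mem_gr B hy hw)
      (by cases b <;> simp only [bsgn] at * <;> rw [abs_le] <;> omega)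
      (by cases b <;> simp only [bsgn] at * <;> rw [abs_le] <;> omega)
      (by rw [ht_add]; cases b <;> simp only [bsgn] at * <;> rw [abs_le] <;> omega)
    have e₃ := hI (d₁ + dv) d₂ (d₃ - dv) (x * v) y w (mul_mem_gr B hx hv) hy hw
      (by rw [ht_add]; cases b <;> simp only [bsgn] at * <;> rw [abs_le] <;> omega)
      (by cases b <;> simp only [bsgn] at * <;> rw [abs_le] <;> omega)
      (by cases b <;> simp only [bsgn] at * <;> rw [abs_le] <;> omega)
    have e₁' := hI d₂ (d₁ + dv) (d₃ - dv) y (x * v) w hy (mul_mem_gr B hx hv) hw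
      (by cases b <;> simp only [bsgn] at * <;> rw [abs_le] <;> omega)
      (by rw [ht_add]; cases b <;> simp only [bsgn] at * <;> rw [abs_le] <;> omega)
      (by cases b <;> simp only [bsgn] at * <;> rw [abs_le] <;> omega)
    have e₂' := hI d₂ dv (d₁ + (d₃ - dv)) y v (x * w) hy hv (mul_mem_gr B hx hw)
      (by cases b <;> simp only [bsgn] at * <;> rw [abs_le] <;> omega)
      (by cases b <;> simp only [bsgn] at * <;> rw [abs_le] <;> omega)
      (by rw [ht_add]; cases b <;> simp only [bsgn] at * <;> rw [abs_le] <;> omega)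
    have e₃' := hI (d₂ + dv) d₁ (d₃ - dv) (y * v) x w (mul_mem_gr B hy hv) hx hw
      (by rw [ht_add]; cases b <;> simp only [bsgn] at * <;> rw [abs_le] <;> omega)
      (by cases b <;> simp only [bsgn] at * <;> rw [abs_le] <;> omega)
      (by cases b <;> simp only [bsgn] at * <;> rw [abs_le] <;> omega)
    rw [jacobi_gr hB hy hv, jacobi_gr hB hx hv, map_add, map_add, map_smul, map_smul, ← e₁, ← e₂,
      e₃.symm, ← e₁', ← e₂', ← e₃', skew_gr hB hy (mul_mem_gr B hx hv),
      skew_gr hB (mul_mem_gr B hy hv) hx]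
    simp only [map_neg, map_smul, LinearMap.neg_apply, LinearMap.smul_apply, Pi.add_apply,
      sgn_add_left, sgn_add_right, smul_eq_mul]
    rw [sgn_comm (d₂ none) (d₁ none), sgn_comm (dv none) (d₁ none)]
    have s₁ := sgn_mul_self (K := K) (d₁ none) (d₂ none)
    have s₂ := sgn_mul_self (K := K) (d₁ none) (dv none)
    linear_combination (-(sgn K (d₂ none) (dv none)) * κ (x * v * y) w
      - κ (x * (y * v)) w * (sgn K (d₁ none) (dv none) * sgn K (d₁ none) (dv none))) * s₁ -
      κ (x * (y * v)) w * s₂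
  | zero => simp
  | add u v _ _ hu hv => simp only [mul_add, map_add, hu, hv]; ring
  | smul r u _ hu => simp only [mul_smul_comm, map_smul, hu, smul_eq_mul]; ring

/-- Invariance for products of two elements with an element of maximal height. -/
theorem invariant_extreme {n : ℕ} (hn : 1 ≤ n) (hI : Inv κ n) (b : Bool) {d₁ d₂ d₃ : Option I → ℤ}
    {x y z : ContrAlg B} (hx : x ∈ gr B d₁) (hy : y ∈ gr B d₂) (hz : z ∈ gr B d₃)
    (h₁ : 0 < bsgn b * ht d₁) (h₂ : 0 < bsgn b * ht d₂) (h₁₂ : bsgn b * (ht d₁ + ht d₂) = n + 1)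
    (h₃ : bsgn b * ht d₃ = -(n + 1)) : κ (x * y) z = κ x (y * z) := by
  have h := F.exchange hB hs hn hI b hx hy hz h₁ h₂ h₁₂ h₃
  have hne : ht d₁ + ht d₂ ≠ 0 := by rintro h0; rw [h0] at h₁₂; omega
  -- Applying `θ` to the Jacobi identity for x(yz) gives ht d₁ κ(x,yz) = (ht d₁ + ht d₂) κ(xy,z) ±
  -- ht d₂ κ(y,xz). By `exchange` the last term is -ht d₂ κ(x,yz), and the total height can be
  -- cancelled.
  have e₁ := F.height_mul d₁ x (y * z) hx (by rintro h0; rw [h0] at h₁; omega)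
  have e₂ := F.height_mul d₂ y (x * z) hy (by rintro h0; rw [h0] at h₂; omega)
  have e₃ := F.height_mul (d₁ + d₂) (x * y) z (mul_mem_gr B hx hy) (by rwa [ht_add])
  rw [jacobi_gr hB hx hy, map_add, map_smul, ← e₂, ← e₃, h, ht_add] at e₁
  rw [h]
  refine mul_left_cancel₀ (Int.cast_ne_zero.2 hne : ((ht d₁ + ht d₂ : ℤ) : K) ≠ 0) ?_
  push_cast at e₁ ⊢
  rw [smul_eq_mul] at e₁
  linear_combination -e₁

/-- Invariance for products with an element of the Cartan subalgebra in the middle. -/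
theorem invariant_mid {d₁ d₂ : Option I → ℤ} {x y h : ContrAlg B} (hx : x ∈ gr B d₁)
    (hy : y ∈ gr B d₂) (hh : h ∈ gr B (0 : Option I → ℤ)) : κ (x * h) y = κ x (h * y) := by
  have hc := gr_zero_le B hB hh
  clear hh
  induction hc using Submodule.span_induction with
  | mem h hh =>
    obtain ⟨i, rfl⟩ := hh
    have e : x * cart B i = -(rootVal B d₁ i • x) := by
      rw [← hx i, skew_zero B (cart_mem B i), neg_neg]
    rw [e, hy i]
    simp only [map_neg, map_smul, LinearMap.neg_apply, LinearMap.smul_apply, smul_eq_mul]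
    by_cases hd : d₁ + d₂ = 0
    · rw [(neg_eq_of_add_eq_zero_right hd).symm, rootVal_neg, Pi.neg_apply, neg_mul]
    · rw [F.orthogonal d₁ d₂ x y hx hy hd]
      simp
  | zero => simp
  | add u v _ _ hu hv => simp only [mul_add, add_mul, map_add, LinearMap.add_apply, hu, hv]
  | smul r u _ hu =>
    simp only [mul_smul_comm, smul_mul_assoc, map_smul, LinearMap.smul_apply, hu]

/-- Invariance for products of an element of the Cartan subalgebra with elements of maximal
height. -/
theorem invariant_cartan {n : ℕ} (hn : 1 ≤ n) (hI : Inv κ n) (b : Bool) {d₂ d₃ : Option I → ℤ}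
    {h y z : ContrAlg B} (hh : h ∈ gr B (0 : Option I → ℤ)) (hy : y ∈ gr B d₂) (hz : z ∈ gr B d₃)
    (h₂ : bsgn b * ht d₂ = n + 1) (h₃ : bsgn b * ht d₃ = -(n + 1)) :
    κ (h * y) z = κ h (y * z) := by
  have hz' := mem_span_chev_mul B hB (!b) (d := d₃) (x := z) (by
    change 2 ≤ bsgn (!b) * ht d₃
    rw [bsgn_not]; linarith) hz
  clear hz
  induction hz' using Submodule.span_induction with
  | mem z hz' =>
    obtain ⟨j, w, hw, rfl⟩ := hz'
    have hv := chev_mem_gr B (!b) j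
    set v := chev B (!b) j
    set dv : Option I → ℤ := bsgn (!b) • Pi.single j 1 with hdv
    have hhv : ht dv = -bsgn b := by rw [hdv, ht_smul_single, bsgn_not]
    have hw1 : ht (d₃ - dv) = ht d₃ + bsgn b := by rw [ht_sub, hhv]; ring
    have hhy : h * y ∈ gr B d₂ := by simpa using mul_mem_gr B hh hy
    have hhv' : h * v ∈ gr B dv := by simpa using mul_mem_gr B hh hv
    have e₁ := hI 0 (d₂ + dv) (d₃ - dv) h (y * v) w hh (mul_mem_gr B hy hv) hw
      (by simp)
      (by rw [ht_add]; cases b <;> simp only [bsgn] at * <;> rw [abs_le] <;> omega)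
      (by cases b <;> simp only [bsgn] at * <;> rw [abs_le] <;> omega)
    have e₂ := hI 0 dv (d₂ + (d₃ - dv)) h v (y * w) hh hv (mul_mem_gr B hy hw)
      (by simp)
      (by cases b <;> simp only [bsgn] at * <;> rw [abs_le] <;> omega)
      (by rw [ht_add]; cases b <;> simp only [bsgn] at * <;> rw [abs_le] <;> omega)
    -- In reversed order this pairs a product of `w` and `v` with the element `h * y` of extreme
    -- height.
    have e₃ : κ (h * y * v) w = κ (h * y) (v * w) := by
      refine F.rev hB hs hhy hv hw ?_
      refine F.invariant_extreme hB hs hn hI (!b) hw hv hhy ?_ ?_ ?_ ?_ <;> rw [bsgn_not] <;>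
        cases b <;> simp only [bsgn] at * <;> omega
    -- Here `y` is the element of extreme height. The relation identifies the two terms that are
    -- left over after the Jacobi expansions, up to signs.
    have e₄ := F.exchange hB hs hn hI (!b) hhv' hw hy
      (by rw [bsgn_not]; cases b <;> simp only [bsgn] at * <;> omega)
      (by rw [bsgn_not]; cases b <;> simp only [bsgn] at * <;> omega)
      (by rw [bsgn_not]; cases b <;> simp only [bsgn] at * <;> omega)
      (by rw [bsgn_not]; cases b <;> simp only [bsgn] at * <;> omega)
    rw [skew_gr hB hw hy, skew_gr hB hhv' hy, map_neg, map_smul, map_neg, map_smul,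
      F.symm hB hs hw (mul_mem_gr B hy hhv')] at e₄
    rw [jacobi_gr hB hy hv, map_add, map_smul, ← e₁, ← e₂, ← e₃,
      jacobi_zero B (gr_le_comp B hB 0 hh) y v, map_add, LinearMap.add_apply]
    simp only [smul_eq_mul, Pi.add_apply, sgn_add_right] at e₄ ⊢
    have s₁ := sgn_mul_self (K := K) (d₂ none) ((d₃ - dv) none)
    have s₂ := sgn_mul_self (K := K) (dv none) ((d₃ - dv) none)
    have s₃ := sgn_mul_self (K := K) (d₂ none) (dv none)
    rw [sgn_comm (dv none) (d₂ none), sgn_comm ((d₃ - dv) none) (d₂ none),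
      sgn_comm ((d₃ - dv) none) (dv none)] at e₄
    generalize sgn K (d₂ none) ((d₃ - dv) none) = p at *
    generalize sgn K (dv none) ((d₃ - dv) none) = q at *
    generalize sgn K (d₂ none) (dv none) = u at *
    generalize κ (y * (h * v)) w = X at *
    generalize κ (h * v) (y * w) = Y at *
    have hY : Y = -(u * X) := by
      have : p * (p * Y) = -(u * (q * q) * (p * p) * X) := by linear_combination -p * e₄
      rw [← mul_assoc, s₁, s₂] at this
      linear_combination this
    rw [hY]
    linear_combination X * s₃
  | zero => simp
  | add u v _ _ hu hv => simp only [mul_add, map_add, hu, hv]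
  | smul r u _ hu => simp only [mul_smul_comm, map_smul, hu]

/-- Invariance for products of an element of the Cartan subalgebra with generators. -/
theorem invariant_cartan_one (b : Bool) {d₂ d₃ : Option I → ℤ} {h y z : ContrAlg B}
    (hh : h ∈ gr B (0 : Option I → ℤ)) (hy : y ∈ gr B d₂) (hz : z ∈ gr B d₃)
    (h₂ : ht d₂ = bsgn b) (h₃ : d₂ + d₃ = 0) :
    κ (h * y) z = κ h (y * z) := by
  by_cases hy0 : y = 0
  · simp [hy0]
  obtain ⟨i, rfl⟩ := exists_chev_of_ht B hB b hy hy0 h₂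
  obtain ⟨c, rfl⟩ := mem_span_chev B hB b i hy
  have hd₃ : d₃ = bsgn (!b) • Pi.single i 1 := by
    rw [bsgn_not, neg_smul]
    exact (neg_eq_of_add_eq_zero_right h₃).symm
  obtain ⟨c', rfl⟩ := mem_span_chev B hB (!b) i (hd₃ ▸ hz)
  have hc := gr_zero_le B hB hh
  clear hh hy0 hy hz
  induction hc using Submodule.span_induction with
  | mem h hh =>
    obtain ⟨k, rfl⟩ := hh
    have e := F.height_mul _ (chev B b i) (chev B (!b) i) (chev_mem_gr B b i)
      (by rw [ht_smul_single]; cases b <;> simp [bsgn])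
    rw [ht_smul_single, chev_mul_chev_self, map_smul, F.functional_cart, smul_eq_mul] at e
    simp only [mul_smul_comm, smul_mul_assoc, map_smul, LinearMap.smul_apply, cart_mul_chev,
      chev_mul_chev_self, F.cart_cart, smul_eq_mul]
    linear_combination (c' * c * B k i) * e
  | zero => simp
  | add u v _ _ hu hv => simp only [add_mul, map_add, LinearMap.add_apply, hu, hv]
  | smul r u _ hu =>
    generalize c • chev B b i = y' at hu ⊢
    rw [smul_mul_assoc, map_smul κ, map_smul κ, LinearMap.smul_apply, LinearMap.smul_apply, hu]

/-- Invariance for products with an element of the Cartan subalgebra on the right. -/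
theorem invariant_right {d₁ d₂ : Option I → ℤ} {x y h : ContrAlg B}
    (hx : x ∈ gr B d₁) (hy : y ∈ gr B d₂) (hh : h ∈ gr B (0 : Option I → ℤ))
    (H : κ (h * y) x = κ h (y * x)) : κ (x * y) h = κ x (y * h) :=
  F.rev hB hs hx hy hh H

/-- Three heights ±1 cannot add up to zero, so one of the three elements lies in the Cartan
subalgebra and one of the three Cartan cases applies. -/
theorem inv_one : Inv κ 1 := by
  intro d₁ d₂ d₃ x y z hx hy hz h₁ h₂ h₃
  by_cases hd : d₁ + d₂ + d₃ = 0
  swap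
  · rw [F.orthogonal _ _ _ _ (mul_mem_gr B hx hy) hz hd,
      F.orthogonal _ _ _ _ hx (mul_mem_gr B hy hz) (by rwa [← add_assoc])]
  by_cases hx0 : x = 0
  · simp [hx0]
  by_cases hy0 : y = 0
  · simp [hy0]
  by_cases hz0 : z = 0
  · simp [hz0]
  have hht : ht d₁ + ht d₂ + ht d₃ = 0 := by rw [← ht_add, ← ht_add, hd, ht_zero]
  have key : ∀ {d : Option I → ℤ} {x : ContrAlg B}, x ∈ gr B d → x ≠ 0 → |ht d| ≤ (1 : ℕ) →
      d = 0 ∨ ∃ b, ht d = bsgn b := by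
    intro d x hx hx0 h
    by_cases h0 : ht d = 0
    · by_contra! hne
      exact hx0 (eq_zero_of_ht_eq_zero B hB hx hne.1 h0)
    · right
      rw [abs_le] at h
      rcases lt_or_gt_of_ne h0 with h' | h'
      · exact ⟨false, by simp only [bsgn]; push_cast at h; omega⟩
      · exact ⟨true, by simp only [bsgn]; push_cast at h; omega⟩
  rcases key hy hy0 h₂ with rfl | ⟨b, hb⟩
  · exact F.invariant_mid hB hs hx hz hy
  rcases key hx hx0 h₁ with rfl | ⟨b', hb'⟩
  · exact F.invariant_cartan_one hB hs b hx hy hz hb (by simpa using hd)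
  rcases key hz hz0 h₃ with rfl | ⟨b'', hb''⟩
  · refine F.invariant_right hB hs hx hy hz (F.invariant_cartan_one hB hs b hz hy hx hb ?_)
    rw [add_comm]; simpa using hd
  · exfalso
    rw [hb, hb', hb''] at hht
    cases b <;> cases b' <;> cases b'' <;> simp [bsgn] at hht

/-- Only triples with an element of height ±(n+1) are new. If it is the third, the extreme and
Cartan cases apply; if it is the first, the order is reversed; if it is the middle one, `exchange`
and supersymmetry give the claim. -/
theorem inv_succ {n : ℕ} (hn : 1 ≤ n) (hI : Inv κ n) : Inv κ (n + 1) := by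
  have extreme : ∀ {d₁ d₂ d₃ : Option I → ℤ} {x y z : ContrAlg B}, x ∈ gr B d₁ → y ∈ gr B d₂ →
      z ∈ gr B d₃ → d₁ + d₂ + d₃ = 0 → |ht d₁| ≤ (n + 1 : ℕ) → |ht d₂| ≤ (n + 1 : ℕ) →
      |ht d₃| = (n + 1 : ℕ) → κ (x * y) z = κ x (y * z) := by
    intro d₁ d₂ d₃ x y z hx hy hz hd h₁ h₂ h₃
    have hht : ht d₁ + ht d₂ + ht d₃ = 0 := by rw [← ht_add, ← ht_add, hd, ht_zero]
    by_cases hx0 : x = 0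
    · simp [hx0]
    by_cases hy0 : y = 0
    · simp [hy0]
    obtain ⟨b, hb⟩ : ∃ b, bsgn b * ht d₃ = -(n + 1) := by
      rcases abs_choice (ht d₃) with h | h <;> rw [h] at h₃ <;> push_cast at h₃
      · exact ⟨false, by simp only [bsgn]; omega⟩
      · exact ⟨true, by simp only [bsgn]; omega⟩
    rw [abs_le] at h₁ h₂
    push_cast at h₁ h₂
    by_cases hd₁ : d₁ = 0
    · subst hd₁
      refine F.invariant_cartan hB hs hn hI b hx hy hz ?_ hb
      rw [ht_zero] at hht
      cases b <;> simp only [bsgn] at * <;> omega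
    by_cases hd₂ : d₂ = 0
    · subst hd₂
      exact F.invariant_mid hB hs hx hz hy
    have h₁' : ht d₁ ≠ 0 := fun h => hx0 (eq_zero_of_ht_eq_zero B hB hx hd₁ h)
    have h₂' : ht d₂ ≠ 0 := fun h => hy0 (eq_zero_of_ht_eq_zero B hB hy hd₂ h)
    refine F.invariant_extreme hB hs hn hI b hx hy hz ?_ ?_ ?_ hb <;>
      cases b <;> simp only [bsgn] at * <;> omega
  intro d₁ d₂ d₃ x y z hx hy hz h₁ h₂ h₃
  by_cases hd : d₁ + d₂ + d₃ = 0
  swap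
  · rw [F.orthogonal _ _ _ _ (mul_mem_gr B hx hy) hz hd,
      F.orthogonal _ _ _ _ hx (mul_mem_gr B hy hz) (by rwa [← add_assoc])]
  have hht : ht d₁ + ht d₂ + ht d₃ = 0 := by rw [← ht_add, ← ht_add, hd, ht_zero]
  by_cases h₃' : |ht d₃| = (n + 1 : ℕ)
  · exact extreme hx hy hz hd h₁ h₂ h₃'
  by_cases h₁' : |ht d₁| = (n + 1 : ℕ)
  · refine F.rev hB hs hx hy hz (extreme hz hy hx ?_ h₃ h₂ h₁')
    rw [← hd]; abel
  by_cases h₂' : |ht d₂| = (n + 1 : ℕ)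
  · obtain ⟨b, hb⟩ : ∃ b, bsgn b * ht d₂ = -(n + 1) := by
      rcases abs_choice (ht d₂) with h | h <;> rw [h] at h₂' <;> push_cast at h₂'
      · exact ⟨false, by simp only [bsgn]; omega⟩
      · exact ⟨true, by simp only [bsgn]; omega⟩
    have h₁'' := lt_of_le_of_ne h₁ h₁'
    have h₃'' := lt_of_le_of_ne h₃ h₃'
    rw [abs_lt] at h₁'' h₃''
    push_cast at h₁'' h₃''
    have e := F.exchange hB hs hn hI b hx hz hy
      (by cases b <;> simp only [bsgn] at * <;> omega)
      (by cases b <;> simp only [bsgn] at * <;> omega)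
      (by cases b <;> simp only [bsgn] at * <;> omega) hb
    rw [skew_gr hB hy hz, map_neg, map_smul, F.symm hB hs (mul_mem_gr B hx hy) hz, smul_eq_mul, e,
      sgn_comm (d₂ none) (d₃ none)]
    simp only [Pi.add_apply, sgn_add_left]
    rw [sgn_comm (d₃ none) (d₂ none)]
    ring
  · refine hI d₁ d₂ d₃ x y z hx hy hz ?_ ?_ ?_
    · have := lt_of_le_of_ne h₁ h₁'; push_cast at this; omega
    · have := lt_of_le_of_ne h₂ h₂'; push_cast at this; omega
    · have := lt_of_le_of_ne h₃ h₃'; push_cast at this; omega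

theorem invariant (x y z : ContrAlg B) : κ (x * y) z = κ x (y * z) := by
  have hI : ∀ n : ℕ, Inv κ (n + 1) := fun n => by
    induction n with
    | zero => exact F.inv_one hB hs
    | succ n ih => exact F.inv_succ hB hs (by omega) ih
  have hx : x ∈ ⨆ d, gr B d := iSup_gr B ▸ Submodule.mem_top
  have hy : y ∈ ⨆ d, gr B d := iSup_gr B ▸ Submodule.mem_top
  have hz : z ∈ ⨆ d, gr B d := iSup_gr B ▸ Submodule.mem_top
  induction hx using Submodule.iSup_induction' with
  | mem d₁ x hx =>
    induction hy using Submodule.iSup_induction' with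
    | mem d₂ y hy =>
      induction hz using Submodule.iSup_induction' with
      | mem d₃ z hz =>
        refine hI (|ht d₁| + |ht d₂| + |ht d₃|).toNat d₁ d₂ d₃ x y z hx hy hz ?_ ?_ ?_ <;>
          have := abs_nonneg (ht d₁) <;> have := abs_nonneg (ht d₂) <;>
          have := abs_nonneg (ht d₃) <;> push_cast <;> omega
      | zero => simp
      | add u v _ _ hu hv => simp only [mul_add, map_add, hu, hv]
    | zero => simp
    | add u v _ _ hu hv => simp only [mul_add, add_mul, map_add, LinearMap.add_apply, hu, hv]
  | zero => simp
  | add u v _ _ hu hv => simp only [add_mul, map_add, LinearMap.add_apply, hu, hv]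

/-- The form is nondegenerate. -/
theorem eq_zero_of_orthogonal (hs0 : ∀ i, s i ≠ 0) (b : Bool) {d : Option I → ℤ} {x : ContrAlg B}
    (hd : 0 < bsgn b * ht d) (hx : x ∈ gr B d) (h : ∀ y ∈ gr B (-d), κ x y = 0) : x = 0 := by
  obtain ⟨n, hn⟩ : ∃ n : ℕ, bsgn b * ht d = n + 1 :=
    ⟨(bsgn b * ht d - 1).toNat, by omega⟩
  clear hd
  induction n generalizing d x with
  | zero =>
    by_contra hx0
    obtain ⟨i, rfl⟩ := exists_chev_of_ht B hB b hx hx0 (by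
      cases b <;> simp only [bsgn] at * <;> push_cast at hn <;> omega)
    obtain ⟨c, rfl⟩ := mem_span_chev B hB b i hx
    have e := F.height_mul _ (chev B b i) (chev B (!b) i) (chev_mem_gr B b i)
      (by rw [ht_smul_single]; cases b <;> simp [bsgn])
    have h₁ := h (chev B (!b) i) (by
      have := chev_mem_gr B (!b) i
      rwa [bsgn_not, neg_smul] at this)
    rw [map_smul, LinearMap.smul_apply, smul_eq_mul] at h₁
    have hc : c ≠ 0 := by rintro rfl; simp at hx0
    rw [(mul_eq_zero.1 h₁).resolve_left hc, mul_zero, chev_mul_chev_self, map_smul,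
      F.functional_cart, smul_eq_mul] at e
    exact mul_ne_zero (chevCoeff_ne_zero b i) (hs0 i) e.symm
  | succ n ih =>
    -- By invariance each lowered element is again orthogonal to the opposite root space, hence zero
    -- by induction. An element of height at least two annihilated by all lowering generators
    -- vanishes.
    refine eq_zero_of_chev_mul_eq_zero B hB b (d := d) ?_ hx fun i => ?_
    · change 2 ≤ bsgn b * ht d
      rw [hn]; push_cast; omega
    have hv := chev_mem_gr B (!b) i
    refine ih (mul_mem_gr B hv hx) ?_ ?_
    · intro y hy
      rw [skew_gr hB hv hx, map_neg, map_smul, LinearMap.neg_apply, LinearMap.smul_apply,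
        F.invariant hB hs, h, smul_zero, neg_zero]
      have := mul_mem_gr B hv hy
      rwa [neg_add_rev, add_neg_cancel_comm_assoc] at this
    · rw [ht_add, ht_smul_single, bsgn_not]
      have := bsgn_mul_self b
      push_cast at hn ⊢
      linarith

end FormData

end Form

end Cartanification

namespace Cartanification

/-! ### Weight spaces, words and singular vectors in modules over 𝓑_0 -/

section Modules

variable {K : Type*} [Field K] {I : Type} (B : Matrix (Option I) (Option I) K)

/-- The generators `e_i` (for `true`) and `f_i` (for `false`) of level zero. -/
def cG : Bool → I → B₀ B
  | true, i => eG B i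
  | false, i => fG B i

@[simp] theorem coe_cG (b : Bool) (i : I) : (cG B b i : ContrAlg B) = chev B b (some i) := by
  cases b <;> rfl

@[simp] theorem coe_hG (i : Option I) : (hG B i : ContrAlg B) = cart B i := rfl

@[simp] theorem coe_e0 : (e0 B : ContrAlg B) = chev B true none := rfl

@[simp] theorem coe_f0 : (f0 B : ContrAlg B) = chev B false none := rfl

@[simp] theorem coe_pairing (y : Bp B) (x : Bm B) : (pairing B y x : ContrAlg B) = y * x := rfl

variable [Fintype I] [DecidableEq I]

theorem comp_le_iSup_gr (j : ℤ) : comp B j ≤ ⨆ d : Option I → ℤ, ⨆ _ : d none = j, gr B d := by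
  refine Submodule.span_le.2 ?_
  rintro _ ⟨w, rfl, rfl⟩
  exact Submodule.mem_iSup_of_mem (mdeg w) (Submodule.mem_iSup_of_mem (level_eq_mdeg w).symm
    (val_mem_gr B w))

variable [CharZero K]

@[simp] theorem coe_lie (y z : B₀ B) : ((⁅y, z⁆ : B₀ B) : ContrAlg B) = y * z := rfl

@[simp] theorem coe_lie_p (z : B₀ B) (y : Bp B) : ((⁅z, y⁆ : Bp B) : ContrAlg B) = z * y := rfl

@[simp] theorem coe_lie_m (z : B₀ B) (y : Bm B) : ((⁅z, y⁆ : Bm B) : ContrAlg B) = z * y := rfl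

section WeightSpaces

variable (N : Type*) [AddCommGroup N] [Module K N] [LieRingModule (B₀ B) N]
  [LieModule K (B₀ B) N]

/-- The weight spaces of a module. -/
def wsp (d : Option I → ℤ) : Submodule K N where
  carrier := {m | ∀ k, ⁅hG B k, m⁆ = rootVal B d k • m}
  add_mem' hx hy k := by rw [lie_add, hx k, hy k, smul_add]
  zero_mem' k := by simp
  smul_mem' c x hx k := by rw [lie_smul, hx k, smul_comm]

variable {N}

theorem mem_wsp_zero {d : Option I → ℤ} {z : B₀ B} :
    z ∈ wsp B (B₀ B) d ↔ (z : ContrAlg B) ∈ gr B d :=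
  forall_congr' fun _ => Subtype.ext_iff

theorem mem_wsp_p {d : Option I → ℤ} {z : Bp B} :
    z ∈ wsp B (Bp B) d ↔ (z : ContrAlg B) ∈ gr B d :=
  forall_congr' fun _ => Subtype.ext_iff

theorem mem_wsp_m {d : Option I → ℤ} {z : Bm B} :
    z ∈ wsp B (Bm B) d ↔ (z : ContrAlg B) ∈ gr B d :=
  forall_congr' fun _ => Subtype.ext_iff

theorem lie_mem_wsp {d d' : Option I → ℤ} {z : B₀ B} {m : N} (hz : z ∈ wsp B (B₀ B) d)
    (hm : m ∈ wsp B N d') : ⁅z, m⁆ ∈ wsp B N (d + d') := fun k => by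
  rw [leibniz_lie, hz k, hm k, rootVal_add, Pi.add_apply, add_smul, smul_lie, lie_smul]

theorem cG_mem (b : Bool) (i : I) : cG B b i ∈ wsp B (B₀ B) (bsgn b • Pi.single (some i) 1) := by
  rw [mem_wsp_zero, coe_cG]
  exact chev_mem_gr B b (some i)

theorem hG_mem (i : Option I) : hG B i ∈ wsp B (B₀ B) 0 := (mem_wsp_zero B).2 (cart_mem_gr B i)

theorem e0_mem : e0 B ∈ wsp B (Bp B) (Pi.single none 1) := by
  rw [mem_wsp_p]
  simpa [bsgn] using chev_mem_gr B true none

theorem f0_mem : f0 B ∈ wsp B (Bm B) (-Pi.single none 1) := by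
  rw [mem_wsp_m]
  simpa [bsgn] using chev_mem_gr B false none

theorem lie_hG_hG (i j : Option I) : ⁅hG B i, hG B j⁆ = 0 := Subtype.ext (cart_mul_cart B i j)

theorem lie_hG_cG (i : Option I) (b : Bool) (j : I) :
    ⁅hG B i, cG B b j⁆ = ((bsgn b : K) * B i (some j)) • cG B b j :=
  Subtype.ext (by simpa using cart_mul_chev B i b (some j))

theorem lie_cG_cG_self (b : Bool) (i : I) :
    ⁅cG B b i, cG B (!b) i⁆ = chevCoeff K b (some i) • hG B (some i) :=
  Subtype.ext (by simpa using chev_mul_chev_self B b (some i))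

theorem lie_cG_cG_ne (b : Bool) {i j : I} (h : i ≠ j) : ⁅cG B b i, cG B (!b) j⁆ = 0 :=
  Subtype.ext (by simpa using chev_mul_chev_ne B b (fun h' => h (Option.some_injective _ h')))

/-- The right-normed action of the generators. -/
def app (b : Bool) (v : N) : List I → N
  | [] => v
  | i :: l => ⁅cG B b i, app b v l⁆

/-- The degree of a word in the generators of level zero. -/
def dg (l : List I) : Option I → ℤ := cnt (l.map some)

@[simp] theorem dg_nil : dg ([] : List I) = 0 := cnt_nil

theorem dg_cons (i : I) (l : List I) : dg (i :: l) = Pi.single (some i) 1 + dg l := cnt_cons _ _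

theorem dg_nonneg (l : List I) : 0 ≤ dg l := fun j => cnt_nonneg _ j

theorem dg_some_pos {l : List I} {i : I} : 0 < dg l (some i) ↔ i ∈ l := by
  rw [dg, cnt_pos]; simp

theorem dg_eq_zero {l : List I} (h : dg l = 0) : l = [] := by
  rcases l with _ | ⟨i, l⟩
  · rfl
  · have h₁ : 0 < dg (i :: l) (some i) := dg_some_pos.2 (by simp)
    rw [h] at h₁
    simp at h₁

theorem app_mem_wsp (b : Bool) {v : N} {d : Option I → ℤ} (hv : v ∈ wsp B N d) (l : List I) :
    app B b v l ∈ wsp B N (d + bsgn b • dg l) := by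
  induction l with
  | nil => simpa [app] using hv
  | cons i l ih =>
    have := lie_mem_wsp B (cG_mem B b i) ih
    rw [dg_cons, smul_add]
    rwa [add_left_comm]

/-- The span of the right-normed words with letters in a set that are applied to a vector. -/
def words (S : Set I) (b : Bool) (v : N) : Submodule K N :=
  Submodule.span K {x | ∃ l, (∀ i ∈ l, i ∈ S) ∧ app B b v l = x}

theorem app_mem_words {S : Set I} (b : Bool) (v : N) {l : List I} (hl : ∀ i ∈ l, i ∈ S) :
    app B b v l ∈ words B S b v := Submodule.subset_span ⟨l, hl, rfl⟩

theorem self_mem_words (S : Set I) (b : Bool) (v : N) : v ∈ words B S b v :=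
  app_mem_words B b v (l := []) (by simp)

theorem lie_mem_words_of_app {S : Set I} {b : Bool} {v : N} {z : B₀ B}
    (hz : ∀ l : List I, (∀ i ∈ l, i ∈ S) → ⁅z, app B b v l⁆ ∈ words B S b v) {x : N}
    (hx : x ∈ words B S b v) : ⁅z, x⁆ ∈ words B S b v := by
  induction hx using Submodule.span_induction with
  | mem x hx => obtain ⟨l, hl, rfl⟩ := hx; exact hz l hl
  | zero => simp
  | add x y _ _ hx hy => rw [lie_add]; exact add_mem hx hy
  | smul c x _ hx => rw [lie_smul]; exact Submodule.smul_mem _ _ hx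

theorem lie_c_mem_words {S : Set I} {b : Bool} {v : N} {j : I} (hj : j ∈ S) {x : N}
    (hx : x ∈ words B S b v) : ⁅cG B b j, x⁆ ∈ words B S b v :=
  lie_mem_words_of_app B (fun l hl => app_mem_words B b v (l := j :: l) (by simpa [hj] using hl)) hx

theorem lie_h_mem_words {S : Set I} {b : Bool} {v : N} {d : Option I → ℤ} (hv : v ∈ wsp B N d)
    (j : Option I) {x : N} (hx : x ∈ words B S b v) : ⁅hG B j, x⁆ ∈ words B S b v :=
  lie_mem_words_of_app B (fun l hl => by
    rw [app_mem_wsp B b hv l j]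
    exact Submodule.smul_mem _ _ (app_mem_words B b v hl)) hx

theorem lie_opposite_mem_words {S : Set I} {b : Bool} {v : N} {d : Option I → ℤ}
    (hv : v ∈ wsp B N d) (h : ∀ i ∈ S, ⁅cG B (!b) i, v⁆ = 0) {j : I} (hj : j ∈ S) {x : N}
    (hx : x ∈ words B S b v) : ⁅cG B (!b) j, x⁆ ∈ words B S b v := by
  refine lie_mem_words_of_app B (fun l hl => ?_) hx
  clear hx
  induction l with
  | nil => rw [app, h j hj]; exact zero_mem _
  | cons i l ih =>
    simp only [List.mem_cons, forall_eq_or_imp] at hl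
    rw [app, leibniz_lie]
    refine add_mem ?_ (lie_c_mem_words B hl.1 (ih hl.2))
    by_cases hij : j = i
    · subst hij
      have e := lie_cG_cG_self B (!b) j
      rw [Bool.not_not] at e
      rw [e, smul_lie, app_mem_wsp B b hv l]
      exact Submodule.smul_mem _ _ (Submodule.smul_mem _ _ (app_mem_words B b v hl.2))
    · have e := lie_cG_cG_ne B (!b) hij
      rw [Bool.not_not] at e
      rw [e, zero_lie]
      exact zero_mem _

/-- A vector annihilated by the generators of one sign generates its module under the generators
of the other sign. -/
theorem lie_subalg_mem_words {S : Set I} {b : Bool} {v : N} {d : Option I → ℤ}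
    (hv : v ∈ wsp B N d) (h : ∀ i ∈ S, ⁅cG B (!b) i, v⁆ = 0) {z : B₀ B} (hz : z ∈ subalg B S)
    {x : N} (hx : x ∈ words B S b v) : ⁅z, x⁆ ∈ words B S b v := by
  let T : LieSubalgebra K (B₀ B) :=
    { carrier := {z | ∀ x ∈ words B S b v, ⁅z, x⁆ ∈ words B S b v}
      add_mem' := fun ha hb x hx => by rw [add_lie]; exact add_mem (ha x hx) (hb x hx)
      zero_mem' := fun x _ => by rw [zero_lie]; exact zero_mem _
      smul_mem' := fun c z hz x hx => by rw [smul_lie]; exact Submodule.smul_mem _ _ (hz x hx)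
      lie_mem' := fun {y z} hy hz x hx => by
        rw [lie_lie]
        exact sub_mem (hy _ (hz x hx)) (hz _ (hy x hx)) }
  have hgen : ∀ b' : Bool, ∀ i ∈ S, cG B b' i ∈ T := by
    intro b' i hi x hx
    by_cases hb : b' = b
    · subst hb
      exact lie_c_mem_words B hi hx
    · obtain rfl : b' = !b := by cases b <;> cases b' <;> simp_all
      exact lie_opposite_mem_words B hv h hi hx
  have hle : subalg B S ≤ T := LieSubalgebra.lieSpan_le.2 (by
    rintro _ ⟨i, hi, rfl | rfl | rfl⟩
    · exact hgen true i hi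
    · exact hgen false i hi
    · exact fun x hx => lie_h_mem_words B hv (some i) hx)
  exact hle hz x hx

end WeightSpaces

section Generation

variable (hB : IsUnit B.det)

include hB

theorem gradingElt_mul_of_mem {j : ℤ} {x : ContrAlg B} (hx : x ∈ comp B j) :
    (gradingElt B : ContrAlg B) * x = (j : K) • x := by
  have : comp B j ≤ LinearMap.ker (LinearMap.mulLeft K (gradingElt B : ContrAlg B) -
      (j : K) • LinearMap.id) := by
    refine Submodule.span_le.2 ?_
    rintro _ ⟨w, rfl, rfl⟩
    simp [gradingElt_mul B hB w]
  simpa [sub_eq_zero] using this hx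

theorem level_eq {j : ℤ} {d : Option I → ℤ} {x : ContrAlg B} (hx : x ∈ comp B j)
    (hx' : x ∈ gr B d) (hx0 : x ≠ 0) : d none = j := by
  have h₁ := gradingElt_mul_of_mem B hB hx
  rw [gradingElt_mul_of_mem B hB (gr_le_comp B hB d hx')] at h₁
  exact_mod_cast smul_left_injective K hx0 h₁

/-- `𝓑_0` is generated by the `e_i`, `f_i` with `i ≠ 0` and the `h_i`. -/
theorem subalgebra_eq_top (S : LieSubalgebra K (B₀ B)) (h : ∀ b i, cG B b i ∈ S)
    (h' : ∀ i, hG B i ∈ S) : S = ⊤ := by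
  have key : ∀ b l (i : Option I), cnt (i :: l) none = 0 →
      rn B b l i ∈ S.toSubmodule.map (comp B 0).subtype := by
    intro b l i hl
    induction l with
    | nil =>
      rcases i with _ | i
      · simp [cnt] at hl
      · exact ⟨cG B b i, h b i, by simp [rn]⟩
    | cons j l ih =>
      rw [cnt_eq_zero] at hl
      simp only [List.mem_cons, not_or] at hl
      obtain ⟨z, hz, hz'⟩ := ih (cnt_eq_zero.2 (by simp only [List.mem_cons, not_or]; tauto))
      rcases j with _ | j
      · tauto
      · refine ⟨⁅cG B b j, z⁆, S.lie_mem (h b j) hz, ?_⟩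
        rw [rn, ← hz']
        simp
  have hle : comp B 0 ≤ S.toSubmodule.map (comp B 0).subtype := by
    refine (comp_le_iSup_gr B 0).trans (iSup₂_le fun d hd x hx => ?_)
    refine Submodule.span_le.2 ?_ (mem_span_triang B hB hx)
    rintro _ ⟨w, rfl, rfl⟩
    rcases w with i | ⟨b, l, i⟩
    · exact ⟨hG B i, h' i, rfl⟩
    · refine key b l i ?_
      cases b <;> simpa [triangDeg, bsgn] using hd
  refine eq_top_iff.2 fun z _ => ?_
  obtain ⟨z', hz', e⟩ := hle z.2
  rwa [← Subtype.ext e]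

/-- `𝓑_1` is generated by `e_0` and `𝓑_{-1}` by `f_0` under the `e_i` and `f_i`, respectively. -/
theorem comp_le_of_stable (b : Bool) (S : Submodule K (ContrAlg B)) (h₀ : chev B b none ∈ S)
    (h : ∀ (i : I), ∀ x ∈ S, chev B b (some i) * x ∈ S) : comp B (bsgn b) ≤ S := by
  -- A word without the letter 0 is an iterated commutator of operators that preserve `S`.
  have zero : ∀ l (i : Option I), cnt (i :: l) none = 0 →
      rn B b l i ∈ comp B 0 ∧ ∀ x ∈ S, rn B b l i * x ∈ S := by
    intro l i hl
    induction l with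
    | nil =>
      rcases i with _ | i
      · simp [cnt] at hl
      · exact ⟨by simpa [rn, lvl] using chev_mem B b (some i), h i⟩
    | cons j l ih =>
      rw [cnt_eq_zero] at hl
      simp only [List.mem_cons, not_or] at hl
      obtain ⟨hz, hz'⟩ := ih (cnt_eq_zero.2 (by simp only [List.mem_cons, not_or]; tauto))
      rcases j with _ | j
      · tauto
      · have hc : chev B b (some j) ∈ comp B 0 := by simpa [lvl] using chev_mem B b (some j)
        refine ⟨by simpa [rn] using mul_mem_comp hc hz, fun x hx => ?_⟩
        have e := jacobi_zero B hc (rn B b l i) x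
        rw [← sub_eq_iff_eq_add] at e
        rw [rn, ← e]
        exact sub_mem (h _ _ (hz' x hx)) (hz' _ (h _ _ hx))
  -- Outer letters in I preserve `S`. When the outermost letter is 0, skew symmetry lets the
  -- remaining word, which has no letter 0, act on the generator of index 0.
  have one : ∀ l (i : Option I), cnt (i :: l) none = 1 → rn B b l i ∈ S := by
    intro l
    induction l with
    | nil =>
      intro i hl
      rcases i with _ | i
      · exact h₀
      · simp [cnt] at hl
    | cons j l ih =>
      intro i hl
      have hl' : cnt (i :: j :: l) none = (Pi.single j 1 : Option I → ℤ) none + cnt (i :: l) none := by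
        rw [cnt_cons, cnt_cons, cnt_cons]
        simp only [Pi.add_apply]
        ring
      rw [hl] at hl'
      rcases j with _ | j
      · obtain ⟨hz, hz'⟩ := zero l i (by simpa using hl')
        rw [rn, ← neg_neg (chev B b none * rn B b l i), ← skew_zero B hz]
        exact neg_mem (hz' _ h₀)
      · exact h _ _ (ih i (by simpa using hl'.symm))
  refine (comp_le_iSup_gr B _).trans (iSup₂_le fun d hd x hx => ?_)
  refine Submodule.span_le.2 ?_ (mem_span_triang B hB hx)
  rintro _ ⟨w, rfl, rfl⟩
  rcases w with i | ⟨b', l, i⟩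
  · cases b <;> simp [triangDeg, bsgn] at hd
  · have hn := cnt_nonneg (i :: l) none
    have : b' = b ∧ cnt (i :: l) none = 1 := by
      cases b <;> cases b' <;> simp only [triangDeg, bsgn, Pi.smul_apply, smul_eq_mul] at hd <;>
        simp <;> omega
    obtain ⟨rfl, hl⟩ := this
    exact one l i hl

theorem p_eq_top (S : Submodule K (Bp B)) (h₀ : e0 B ∈ S)
    (h : ∀ i, ∀ x ∈ S, ⁅cG B true i, x⁆ ∈ S) : S = ⊤ := by
  have := comp_le_of_stable B hB true (S.map (comp B 1).subtype) ⟨_, h₀, rfl⟩ (by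
    rintro i _ ⟨x, hx, rfl⟩
    exact ⟨_, h i x hx, by simp⟩)
  refine eq_top_iff.2 fun z _ => ?_
  obtain ⟨z', hz', e⟩ := this z.2
  rwa [← Subtype.ext e]

theorem m_eq_top (S : Submodule K (Bm B)) (h₀ : f0 B ∈ S)
    (h : ∀ i, ∀ x ∈ S, ⁅cG B false i, x⁆ ∈ S) : S = ⊤ := by
  have := comp_le_of_stable B hB false (S.map (comp B (-1)).subtype) ⟨_, h₀, rfl⟩ (by
    rintro i _ ⟨x, hx, rfl⟩
    exact ⟨_, h i x hx, by simp⟩)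
  refine eq_top_iff.2 fun z _ => ?_
  obtain ⟨z', hz', e⟩ := this z.2
  rwa [← Subtype.ext e]

theorem iSup_wsp_zero : ⨆ d : Option I → ℤ, ⨆ _ : d none = 0, wsp B (B₀ B) d = ⊤ := by
  refine eq_top_iff.2 fun z _ => ?_
  have : comp B 0 ≤ (⨆ d : Option I → ℤ, ⨆ _ : d none = 0, wsp B (B₀ B) d).map
      (comp B 0).subtype := by
    refine (comp_le_iSup_gr B _).trans (iSup₂_le fun d hd x hx => ?_)
    refine ⟨⟨x, hd ▸ gr_le_comp B hB d hx⟩, ?_, rfl⟩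
    exact Submodule.mem_iSup_of_mem d (Submodule.mem_iSup_of_mem hd ((mem_wsp_zero B).2 hx))
  obtain ⟨z', hz', e⟩ := this z.2
  rwa [← Subtype.ext e]

variable {N : Type*} [AddCommGroup N] [Module K N] [LieRingModule (B₀ B) N]
  [LieModule K (B₀ B) N]

/-- A subspace stable under the generators is a submodule. -/
theorem lie_mem_of_stable (S : Submodule K N) (h : ∀ b i, ∀ x ∈ S, ⁅cG B b i, x⁆ ∈ S)
    (h' : ∀ i, ∀ x ∈ S, ⁅hG B i, x⁆ ∈ S) (z : B₀ B) {x : N} (hx : x ∈ S) : ⁅z, x⁆ ∈ S := by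
  let T : LieSubalgebra K (B₀ B) :=
    { carrier := {z | ∀ x ∈ S, ⁅z, x⁆ ∈ S}
      add_mem' := fun ha hb x hx => by rw [add_lie]; exact add_mem (ha x hx) (hb x hx)
      zero_mem' := fun x _ => by rw [zero_lie]; exact zero_mem _
      smul_mem' := fun c z hz x hx => by rw [smul_lie]; exact Submodule.smul_mem _ _ (hz x hx)
      lie_mem' := fun {y z} hy hz x hx => by
        rw [lie_lie]
        exact sub_mem (hy _ (hz x hx)) (hz _ (hy x hx)) }
  have hT : T = ⊤ := subalgebra_eq_top B hB T (fun b i => h b i) (fun i => h' i)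
  have hz : z ∈ T := hT ▸ LieSubalgebra.mem_top z
  exact hz x hx

theorem lieSpan_eq_span_app {v : N} {d : Option I → ℤ} (b : Bool) (hv : v ∈ wsp B N d)
    (h : ∀ i, ⁅cG B (!b) i, v⁆ = 0) : (LieSubmodule.lieSpan K (B₀ B) {v}).toSubmodule =
      Submodule.span K (Set.range (app B b v)) := by
  have hw : words B Set.univ b v = Submodule.span K (Set.range (app B b v)) := by
    simp [words, Set.range]
  rw [← hw]
  let P : LieSubmodule K (B₀ B) N :=
    { toSubmodule := words B Set.univ b v
      lie_mem := fun {z x} hx => lie_mem_of_stable B hB (words B Set.univ b v)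
        (fun b' i x hx => by
          by_cases hb : b' = b
          · subst hb
            exact lie_c_mem_words B (Set.mem_univ _) hx
          · obtain rfl : b' = !b := by cases b <;> cases b' <;> simp_all
            exact lie_opposite_mem_words B hv (fun i _ => h i) (Set.mem_univ _) hx)
        (fun i x hx => lie_h_mem_words B hv i hx) z hx }
  refine le_antisymm ?_ (Submodule.span_le.2 ?_)
  · have : LieSubmodule.lieSpan K (B₀ B) {v} ≤ P := LieSubmodule.lieSpan_le.2 (by
      rintro _ rfl
      exact self_mem_words B Set.univ b _)
    exact this
  · rintro _ ⟨l, -, rfl⟩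
    induction l with
    | nil => exact LieSubmodule.subset_lieSpan rfl
    | cons i l ih => exact (LieSubmodule.lieSpan K (B₀ B) {v}).lie_mem ih

/-- A nonzero submodule of a module generated by a singular vector contains a singular vector. -/
theorem exists_singular {v : N} {d : Option I → ℤ} (b : Bool) (hv : v ∈ wsp B N d)
    (h : ∀ i, ⁅cG B (!b) i, v⁆ = 0) (P : LieSubmodule K (B₀ B) N)
    (hP : P ≤ LieSubmodule.lieSpan K (B₀ B) {v}) (hP0 : P ≠ ⊥) :
    ∃ c : Option I → ℤ, ∃ w ∈ P, w ≠ 0 ∧ w ∈ wsp B N (d + bsgn b • c) ∧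
      w ∈ Submodule.span K {x | ∃ l, dg l = c ∧ app B b v l = x} ∧ ∀ i, ⁅cG B (!b) i, w⁆ = 0 := by
  have hχ : Function.Injective fun c : Option I → ℤ => rootVal B (d + bsgn b • c) := by
    intro c c' hc
    have := add_left_cancel (rootVal_injective hB hc)
    cases b <;> simpa [bsgn] using this
  let T : Option I → Module.End K N := fun k => LieModule.toEnd K (B₀ B) N (hG B k)
  have hPle : P.toSubmodule ≤ ⨆ c, wsp B N (d + bsgn b • c) := by
    refine (show P.toSubmodule ≤ (LieSubmodule.lieSpan K (B₀ B) {v}).toSubmodule from hP).trans ?_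
    rw [lieSpan_eq_span_app B hB b hv h, Submodule.span_le]
    rintro _ ⟨l, rfl⟩
    exact Submodule.mem_iSup_of_mem (dg l) (app_mem_wsp B b hv l)
  have h₁ := le_iSup_inf_of_stable T (fun c => rootVal B (d + bsgn b • c)) hχ
    (fun c => wsp B N (d + bsgn b • c)) (fun c x hx k => hx k) P.toSubmodule
    (fun k x hx => P.lie_mem hx) hPle
  have hspan : ∀ c, ∀ x ∈ P, x ∈ wsp B N (d + bsgn b • c) →
      x ∈ Submodule.span K {x | ∃ l, dg l = c ∧ app B b v l = x} := by
    intro c x hxP hx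
    refine mem_span_of_mem_eigen T (fun c => rootVal B (d + bsgn b • c)) hχ
      (fun c => wsp B N (d + bsgn b • c)) (fun c x hx k => hx k) (app B b v) dg
      (app_mem_wsp B b hv) hx ?_
    rw [← lieSpan_eq_span_app B hB b hv h]
    exact hP hxP
  -- The submodule is the sum of its weight components, each at some depth `ht c` below `v`. A
  -- nonzero component of least depth is singular, since a generator of the opposite sign would
  -- produce one of depth smaller by one.
  have hex : ∃ n : ℕ, ∃ c : Option I → ℤ, ∃ w ∈ P, w ≠ 0 ∧ w ∈ wsp B N (d + bsgn b • c) ∧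
      ht c = n := by
    by_contra! hne
    refine hP0 ?_
    rw [← LieSubmodule.toSubmodule_eq_bot, eq_bot_iff]
    refine h₁.trans (iSup_le ?_)
    rintro c x ⟨hx, hx'⟩
    by_contra hx0
    have hs := hspan c x hx hx'
    have : ∃ l, dg l = c := by
      by_contra! hl
      rw [show {x | ∃ l, dg l = c ∧ app B b v l = x} = ∅ by ext; simp [hl], Submodule.span_empty]
        at hs
      exact hx0 hs
    obtain ⟨l, rfl⟩ := this
    refine hne l.length _ x hx hx0 hx' ?_
    rw [ht, dg, sum_cnt, List.length_map]
  classical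
  obtain ⟨c, w, hw, hw0, hw', hc⟩ := Nat.find_spec hex
  refine ⟨c, w, hw, hw0, hw', hspan c w hw hw', fun i => ?_⟩
  by_contra hne
  have hmem := lie_mem_wsp B (cG_mem B (!b) i) hw'
  have e : bsgn (!b) • Pi.single (some i) 1 + (d + bsgn b • c) =
      d + bsgn b • (c - Pi.single (some i) 1) := by
    rw [bsgn_not, smul_sub, neg_smul]; abel
  rw [e] at hmem
  have hs := hspan _ _ (P.lie_mem hw) hmem
  have : ∃ l, dg l = c - Pi.single (some i) 1 := by
    by_contra! hl
    rw [show {x | ∃ l, dg l = c - Pi.single (some i) 1 ∧ app B b v l = x} = ∅ by ext; simp [hl],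
      Submodule.span_empty] at hs
    exact hne hs
  obtain ⟨l, hl⟩ := this
  have hlen : ht (c - Pi.single (some i) 1) = l.length := by
    rw [← hl, ht, dg, sum_cnt, List.length_map]
  refine Nat.find_min hex (m := l.length) ?_ ⟨_, _, P.lie_mem hw, hne, hmem, hlen⟩
  have h2 := ht_sub c (Pi.single (some i) 1)
  have h3 : ht (Pi.single (some i) 1 : Option I → ℤ) = 1 := by simp [ht]
  rw [hlen, hc, h3] at h2
  omega

end Generation

/-! ### The invariant pairing of 𝓑_{-1} and 𝓑_1 -/

section InvariantForm

variable (hB : IsUnit B.det)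

include hB

/-- Let `θ` take the coefficient of h_0 in the Cartan part. It vanishes on brackets in 𝓑_0, since
these produce only the h_i with i in I. Hence ⟨x|y⟩ = -θ(⟦y,x⟧) is invariant, and it is normalised
because ⟦e_0,f_0⟧ = h_0. -/
theorem exists_invariant_form :
    ∃ φ : Bm B →ₗ[K] Bp B →ₗ[K] K, IsInvariantForm φ ∧ φ (f0 B) (e0 B) = -1 := by
  obtain ⟨θ, hθ, hθ'⟩ := exists_functional B hB (Pi.single none 1)
  have hzero : ∀ z w : B₀ B, θ (z * w) = 0 := by
    let T : LieSubalgebra K (B₀ B) :=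
      { carrier := {z | ∀ w : B₀ B, θ (z * w) = 0}
        add_mem' := fun {x y} ha hb w => by
          have := congrArg₂ (· + ·) (ha w) (hb w)
          simpa [add_mul] using this
        zero_mem' := fun w => by simp
        smul_mem' := fun c z hz w => by
          have := hz w
          simp [smul_mul_assoc, this]
        lie_mem' := fun {y z} hy hz w => by
          have e := congrArg Subtype.val (lie_lie y z w)
          change ((⁅y, z⁆ : B₀ B) : ContrAlg B) * w = y * (z * w) - z * (y * w) at e
          have h₁ := hy ⁅z, w⁆
          have h₂ := hz ⁅y, w⁆
          rw [coe_lie] at h₁ h₂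
          rw [e, map_sub, h₁, h₂, sub_zero] }
    have hext : ∀ z : B₀ B, (∀ d, ∀ w ∈ gr B d, θ (z * w) = 0) → z ∈ T := by
      intro z hz w
      have hw : (w : ContrAlg B) ∈ ⨆ d, gr B d := iSup_gr B ▸ Submodule.mem_top
      generalize (w : ContrAlg B) = w at hw
      induction hw using Submodule.iSup_induction' with
      | mem d w hw => exact hz d w hw
      | zero => simp
      | add u v _ _ hu hv => simp only [mul_add, map_add, hu, hv, add_zero]
    have hT : T = ⊤ := by
      refine subalgebra_eq_top B hB T (fun b i => hext _ fun d w hw => ?_)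
        (fun i => hext _ fun d w hw => ?_)
      · by_cases hd : bsgn b • Pi.single (some i) 1 + d = 0
        · have hd' : d = bsgn (!b) • Pi.single (some i) 1 := by
            rw [bsgn_not, neg_smul]; exact (neg_eq_of_add_eq_zero_right hd).symm
          obtain ⟨c, rfl⟩ := mem_span_chev B hB (!b) (some i) (hd' ▸ hw)
          rw [coe_cG, mul_smul_comm, chev_mul_chev_self, map_smul, map_smul, hθ]
          simp
        · rw [coe_cG]
          exact hθ' _ hd _ (mul_mem_gr B (chev_mem_gr B b (some i)) hw)
      · rw [coe_hG, hw i, map_smul]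
        by_cases hd : d = 0
        · simp [hd]
        · rw [hθ' d hd w hw, smul_zero]
    intro z
    have hz : z ∈ T := hT ▸ LieSubalgebra.mem_top z
    exact hz
  refine ⟨LinearMap.mk₂ K (fun x y => -θ (y * x)) (fun x x' y => by simp [mul_add]; ring)
    (fun c x y => by simp [mul_smul_comm]) (fun x y y' => by simp [add_mul]; ring)
    (fun c x y => by simp [smul_mul_assoc]), fun x z y => ?_, ?_⟩
  · have h₁ := hzero z (pairing B y x)
    have h₂ := congrArg Subtype.val (pairing_lie B z y x)
    simp only [coe_lie, coe_pairing, Submodule.coe_add, coe_lie_p, coe_lie_m] at h₁ h₂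
    rw [h₂, map_add] at h₁
    rw [map_neg, LinearMap.neg_apply]
    simp only [LinearMap.mk₂_apply, coe_lie_m, coe_lie_p, neg_neg]
    exact eq_neg_of_add_eq_zero_right h₁
  · have := chev_mul_chev_self B true none
    simp only [LinearMap.mk₂_apply, coe_e0, coe_f0]
    rw [show chev B true none * chev B false none = _ from this, map_smul, hθ]
    simp [chevCoeff]

theorem form_f0_e0 : form B (f0 B) (e0 B) = -1 := by
  have h := exists_invariant_form B hB
  unfold form
  rw [dif_pos h]
  exact h.choose_spec.2

theorem form_eq_zero {d d' : Option I → ℤ} {x : Bm B} {y : Bp B} (hx : x ∈ wsp B (Bm B) d)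
    (hy : y ∈ wsp B (Bp B) d') (hd : d + d' ≠ 0) : form B x y = 0 := by
  by_contra hne
  refine hd (rootVal_injective hB (funext fun k => ?_))
  have h := form_lie B x (hG B k) y
  rw [hx k, hy k, map_smul, map_smul, LinearMap.smul_apply, smul_eq_mul, smul_eq_mul,
    ← add_mul] at h
  rw [rootVal_zero, rootVal_add]
  exact (mul_eq_zero.1 h).resolve_right hne

end InvariantForm

end Modules

end Cartanification

namespace Cartanification

open scoped TensorProduct

/-! ### The embedding of 𝓑_0 in its enveloping algebra -/

section Faithful

variable {K : Type*} [Field K] {I : Type} (B : Matrix (Option I) (Option I) K)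
  [Fintype I] [DecidableEq I] [CharZero K] (hB : IsUnit B.det)

include hB

theorem exists_chev_mul_ne_zero (b : Bool) {d : Option I → ℤ} {x : ContrAlg B}
    (hd : 0 < bsgn b * ht d) (hx : x ∈ gr B d) (hx0 : x ≠ 0) : ∃ i, chev B (!b) i * x ≠ 0 := by
  by_contra! h
  by_cases h1 : bsgn b * ht d = 1
  · obtain ⟨i, rfl⟩ := exists_chev_of_ht B hB b hx hx0 (by cases b <;> simp only [bsgn] at * <;> omega)
    obtain ⟨c, rfl⟩ := mem_span_chev B hB b i hx
    have e := chev_mul_chev_self B (!b) i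
    rw [Bool.not_not] at e
    have h₂ := h i
    rw [mul_smul_comm, e] at h₂
    have hc : c ≠ 0 := by rintro rfl; simp at hx0
    exact smul_ne_zero hc (smul_ne_zero (chevCoeff_ne_zero _ _) (cart_ne_zero B hB i)) h₂
  · exact hx0 (eq_zero_of_chev_mul_eq_zero B hB b (by change 2 ≤ bsgn b * ht d; omega) hx h)

/-- Outside the Cartan subalgebra some lowering generator acts nontrivially; in the Cartan
subalgebra, annihilating every `e_j` means having coefficients in the left kernel of `B`. -/
theorem eq_zero_of_annihilated {d : Option I → ℤ} {x : ContrAlg B} (hx : x ∈ gr B d)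
    (h : ∀ b i, chev B b i * x = 0) : x = 0 := by
  by_contra hx0
  by_cases hd : d = 0
  · subst hd
    obtain ⟨c, hc⟩ := (Submodule.mem_span_range_iff_exists_fun K).1 (gr_zero_le B hB hx)
    have hv : Matrix.vecMul c B = 0 := by
      funext j
      have h₁ := h true j
      rw [← hc, Finset.mul_sum] at h₁
      simp only [mul_smul_comm, chev_mul_cart, smul_smul, bsgn, Int.cast_one, one_mul,
        ← Finset.sum_smul, mul_neg, Finset.sum_neg_distrib] at h₁
      rw [neg_smul, neg_eq_zero, smul_eq_zero] at h₁
      exact h₁.resolve_right (chev_ne_zero B hB true j)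
    have hc0 : c = 0 := Matrix.vecMul_injective_iff_isUnit.2
      ((Matrix.isUnit_iff_isUnit_det B).2 hB) (by simpa using hv)
    subst hc0
    simp at hc
    exact hx0 hc.symm
  · have hh : ht d ≠ 0 := fun h0 => hx0 (eq_zero_of_ht_eq_zero B hB hx hd h0)
    rcases lt_or_gt_of_ne hh with hlt | hlt
    · obtain ⟨i, hi⟩ := exists_chev_mul_ne_zero B hB false (by simpa [bsgn] using hlt) hx hx0
      exact hi (h _ i)
    · obtain ⟨i, hi⟩ := exists_chev_mul_ne_zero B hB true (by simpa [bsgn] using hlt) hx hx0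
      exact hi (h _ i)

-- The adjoint action on 𝓑 extends to U(𝓑_0), so it is enough that this action is faithful. Its
-- kernel is graded by the roots, and a homogeneous element commuting with the generators is zero.
attribute [local instance] LieRing.ofAssociativeRing in
theorem inU_injective : Function.Injective (inU B) := by
  let f : B₀ B →ₗ⁅K⁆ Module.End K (ContrAlg B) :=
    { toFun := fun z => LinearMap.mulLeft K (z : ContrAlg B)
      map_add' := fun x y => by ext; simp [add_mul]
      map_smul' := fun c x => by ext; simp [smul_mul_assoc]
      map_lie' := fun {x y} => by
        ext z
        have := jacobi_zero B x.2 y z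
        simp [LieRing.of_associative_ring_bracket, this] }
  have hker : ∀ z, inU B z = 0 → ∀ x, (z : ContrAlg B) * x = 0 := fun z hz x => by
    have h := UniversalEnvelopingAlgebra.lift_ι_apply K f z
    have h0 : UniversalEnvelopingAlgebra.ι K z = 0 := hz
    rw [h0, map_zero] at h
    exact (LinearMap.congr_fun h x).symm
  let J : Submodule K (B₀ B) :=
    { carrier := {z | ∀ x, (z : ContrAlg B) * x = 0}
      add_mem' := fun ha hb x => by simp [add_mul, ha x, hb x]
      zero_mem' := fun x => by simp
      smul_mem' := fun c z hz x => by simp [smul_mul_assoc, hz x] }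
  have hJ : J = ⊥ := by
    have h := le_iSup_inf_of_stable (fun k => LieModule.toEnd K (B₀ B) (B₀ B) (hG B k))
      (rootVal B) (rootVal_injective hB) (wsp B (B₀ B)) (fun d x hx k => hx k) J
      (fun k z hz x => by
        have := jacobi_zero B (hG B k).2 z x
        rw [hz, hz, mul_zero, add_zero] at this
        exact this.symm)
      (by
        have := iSup_wsp_zero B hB
        refine le_top.trans (this.symm.le.trans ?_)
        exact iSup_mono fun d => iSup_le fun _ => le_rfl)
    rw [eq_bot_iff]
    refine h.trans (iSup_le ?_)
    rintro d z ⟨hz, hz'⟩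
    refine Subtype.ext (eq_zero_of_annihilated B hB ((mem_wsp_zero B).1 hz') fun b i => ?_)
    have := skew_zero B z.2 (chev B b i)
    rw [hz] at this
    exact neg_eq_zero.1 this.symm
  refine (injective_iff_map_eq_zero (inU B)).2 fun z hz => ?_
  have : z ∈ J := hker z hz
  rwa [hJ] at this

end Faithful

/-! ### The subalgebra generated by 𝓑_{-1} 𝓑_0 and 𝓑_1, and its peripheral ideal -/

section Local

variable {K : Type*} [Field K] [CharZero K] {I : Type} [Fintype I] [DecidableEq I]
  (B : Matrix (Option I) (Option I) K)

/-- Moving `z` past `y` leaves x⟦z,y⟧ and the factor xy + yx = -⟨x|y⟩ in front of `z`: the brackets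
and the terms with L cancel in the sum of the two product rules. So the commutator lies in 𝓑_0 and
not merely in U(𝓑_0). -/
theorem commMP_tmul (x : Bm B) (z : B₀ B) (y : Bp B) :
    commMP B (x ⊗ₜ[K] inU B z) (y ⊗ₜ[K] (1 : U₀ B)) =
      inU B (-pairing B ⁅z, y⁆ x + form B x ⁅z, y⁆ • gradingElt B - form B x y • z) := by
  have h₁ : leftMul K (B₀ B) (Bp B) (inU B z) (y ⊗ₜ[K] (1 : U₀ B)) =
      ⁅z, y⁆ ⊗ₜ (1 : U₀ B) + y ⊗ₜ (inU B z * 1) := leftMul_ι_tmul z y 1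
  rw [commMP, envProd_tmul, envProd_tmul, h₁, map_add, map_one, Module.End.one_apply,
    envProdOne_tmul, envProdOne_tmul, envProdOne_tmul]
  simp only [mulMP, mulPM, LinearMap.mk₂_apply, map_sub, map_add, map_neg, map_smul, mul_one,
    add_mul, sub_mul, neg_mul, smul_mul_assoc, one_mul, smul_add]
  abel

/-- The span of the elements `x z`. -/
def spanM : Submodule K (Um B) := Submodule.span K {m | ∃ x z, x ⊗ₜ[K] inU B z = m}

theorem comm_inU {V : Type*} [AddCommGroup V] [Module K V] [LieRingModule (B₀ B) V]
    [LieModule K (B₀ B) V] (z : B₀ B) (m : Env K (B₀ B) V) : comm K V (inU B z) m = ⁅z, m⁆ := rfl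

theorem lie_mem_spanM (z : B₀ B) {m : Um B} (hm : m ∈ spanM B) : ⁅z, m⁆ ∈ spanM B := by
  induction hm using Submodule.span_induction with
  | mem m hm =>
    obtain ⟨x, w, rfl⟩ := hm
    rw [lie_inU_tmul, ← inU_lie]
    exact add_mem (Submodule.subset_span ⟨_, _, rfl⟩) (Submodule.subset_span ⟨_, _, rfl⟩)
  | zero => simp
  | add x y _ _ hx hy => rw [lie_add]; exact add_mem hx hy
  | smul c x _ hx => rw [lie_smul]; exact Submodule.smul_mem _ _ hx

/-- Commutators of xz with 𝓑_1 stay in 𝓑_0, so the generated subalgebra is no larger than 𝓑_{-1}𝓑_0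
⊕ 𝓑_0 ⊕ 𝓑_1. -/
theorem isAdmissible_span : IsAdmissible B (spanM B) (LinearMap.range (inU B))
    (LinearMap.range ((TensorProduct.mk K (Bp B) (U₀ B)).flip 1)) where
  comm_zero := by
    rintro _ ⟨y, rfl⟩ _ ⟨z, rfl⟩
    exact ⟨⁅y, z⁆, inU_lie B y z⟩
  comm_neg := by
    rintro _ ⟨z, rfl⟩ m hm
    exact lie_mem_spanM B z hm
  comm_pos := by
    rintro _ ⟨z, rfl⟩ _ ⟨y, rfl⟩
    refine ⟨⁅z, y⁆, ?_⟩
    rw [comm_inU]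
    simp [lie_inU_tmul]
  comm_neg_pos := by
    rintro m hm _ ⟨y, rfl⟩
    induction hm using Submodule.span_induction with
    | mem m hm =>
      obtain ⟨x, z, rfl⟩ := hm
      exact ⟨_, (commMP_tmul B x z y).symm⟩
    | zero => simp [commMP]
    | add m n _ _ hm hn =>
      have := add_mem hm hn
      simp only [commMP, map_add, LinearMap.add_apply] at this ⊢
      rwa [add_add_add_comm] at this
    | smul c m _ hm =>
      have := Submodule.smul_mem _ c hm
      simp only [commMP, map_smul, LinearMap.smul_apply] at this ⊢
      rwa [smul_add] at this
  mul_mem x z := Submodule.subset_span ⟨x, z, rfl⟩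
  mem y := ⟨y, rfl⟩

theorem genM_le_spanM : genM B ≤ spanM B := (isAdmissible_span B).genM_le

theorem spanM_le_genM : spanM B ≤ genM B := by
  refine Submodule.span_le.2 ?_
  rintro _ ⟨x, z, rfl⟩
  exact (isAdmissible_gen B).mul_mem x z

theorem exists_of_mem_genO {u : U₀ B} (hu : u ∈ genO B) : ∃ z, inU B z = u :=
  (isAdmissible_span B).genO_le hu

theorem exists_of_mem_genP {p : Up B} (hp : p ∈ genP B) : ∃ y : Bp B, y ⊗ₜ[K] (1 : U₀ B) = p :=
  (isAdmissible_span B).genP_le hp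

/-- The elements of degree -1 that commute with the whole part of degree 1 already form, together
with zero in degree 1, a peripheral ideal; conversely every peripheral ideal consists of such
elements in degree -1. -/
theorem mem_maxPeripheral {m : Um B} (hm : m ∈ genM B) : m ∈ maxPeripheral B ↔
    ∀ y : Bp B, commMP B m (y ⊗ₜ[K] (1 : U₀ B)) = 0 := by
  constructor
  · intro h y
    let Z : Submodule K (Um B) :=
      { carrier := {m | commMP B m (y ⊗ₜ[K] (1 : U₀ B)) = 0}
        add_mem' := fun {a b} ha hb => by
          simp only [commMP, Set.mem_ofPred_eq, map_add, LinearMap.add_apply] at ha hb ⊢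
          rw [add_add_add_comm, ha, hb, add_zero]
        zero_mem' := by simp [commMP]
        smul_mem' := fun c a ha => by
          simp only [commMP, Set.mem_ofPred_eq, map_smul, LinearMap.smul_apply] at ha ⊢
          rw [← smul_add, ha, smul_zero] }
    have : maxPeripheral B ≤ Z := sSup_le fun Im ⟨Ip, hp⟩ n hn =>
      hp.neg_eq_zero n hn _ ((isAdmissible_gen B).mem y)
    exact this h
  · intro h
    let Z : Submodule K (Um B) :=
      { carrier := {m | m ∈ genM B ∧ ∀ p ∈ genP B, commMP B m p = 0}
        add_mem' := fun {a b} ha hb => ⟨add_mem ha.1 hb.1, fun p hp => by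
          have h₁ := ha.2 p hp
          have h₂ := hb.2 p hp
          simp only [commMP, map_add, LinearMap.add_apply] at h₁ h₂ ⊢
          rw [add_add_add_comm, h₁, h₂, add_zero]⟩
        zero_mem' := ⟨zero_mem _, by simp [commMP]⟩
        smul_mem' := fun c a ha => ⟨Submodule.smul_mem _ _ ha.1, fun p hp => by
          have h₁ := ha.2 p hp
          simp only [commMP, map_smul, LinearMap.smul_apply] at h₁ ⊢
          rw [← smul_add, h₁, smul_zero]⟩ }
    have hZ : IsPeripheral B Z ⊥ :=
      { le_neg := fun m hm => hm.1
        le_pos := bot_le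
        comm_neg := by
          rintro u hu m ⟨hm, hm'⟩
          obtain ⟨z, rfl⟩ := exists_of_mem_genO B hu
          refine ⟨lie_mem_genM B z hm, fun p hp => ?_⟩
          have e := commMP_equivariant B z m p
          rw [hm' p hp, hm' _ (lie_mem_genP B z hp), mul_zero, zero_mul, sub_zero, add_zero] at e
          exact e.symm
        comm_pos := by
          rintro u _ p hp
          rw [(Submodule.mem_bot K).1 hp]
          simp [comm]
        neg_eq_zero := fun m hm p hp => hm.2 p hp
        pos_eq_zero := by
          rintro m _ p hp
          rw [(Submodule.mem_bot K).1 hp]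
          simp [commMP] }
    have hle : Z ≤ maxPeripheral B := le_sSup ⟨⊥, hZ⟩
    refine hle ⟨hm, fun p hp => ?_⟩
    obtain ⟨y, rfl⟩ := exists_of_mem_genP B hp
    exact h y

end Local

/-! ### The module (𝓑^W)_{-1} and its bracket with 𝓑_1 -/

section CartM

variable {K : Type*} [Field K] [CharZero K] {I : Type} [Fintype I] [DecidableEq I]
  (B : Matrix (Option I) (Option I) K)

theorem mk_eq_mk {m n : Um B} (hm : m ∈ genM B) (hn : n ∈ genM B) (h : m = n) :
    (LieSubmodule.Quotient.mk (⟨m, hm⟩ : subM B) : CartM B) =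
      LieSubmodule.Quotient.mk (⟨n, hn⟩ : subM B) := by subst h; rfl

/-- The map `(x, z) ↦ x z` to `(𝓑^W)_{-1}`. -/
def eltL : Bm B →ₗ[K] B₀ B →ₗ[K] CartM B :=
  LinearMap.mk₂ K (elt B)
    (fun x x' z => mk_eq_mk B _ (add_mem ((isAdmissible_gen B).mul_mem x z)
      ((isAdmissible_gen B).mul_mem x' z)) (TensorProduct.add_tmul x x' (inU B z)))
    (fun c x z => mk_eq_mk B _ (Submodule.smul_mem _ c ((isAdmissible_gen B).mul_mem x z))
      (TensorProduct.smul_tmul' c x (inU B z)).symm)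
    (fun x z z' => mk_eq_mk B _ (add_mem ((isAdmissible_gen B).mul_mem x z)
      ((isAdmissible_gen B).mul_mem x z')) (by rw [map_add, TensorProduct.tmul_add]))
    (fun c x z => mk_eq_mk B _ (Submodule.smul_mem _ c ((isAdmissible_gen B).mul_mem x z))
      (by rw [map_smul, TensorProduct.tmul_smul]))

@[simp] theorem eltL_apply (x : Bm B) (z : B₀ B) : eltL B x z = elt B x z := rfl

theorem lie_elt (w : B₀ B) (x : Bm B) (z : B₀ B) :
    ⁅w, elt B x z⁆ = elt B ⁅w, x⁆ z + elt B x ⁅w, z⁆ :=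
  mk_eq_mk B (lie_mem_genM B w ((isAdmissible_gen B).mul_mem x z)) (add_mem
    ((isAdmissible_gen B).mul_mem _ _) ((isAdmissible_gen B).mul_mem _ _)) (by
      rw [lie_inU_tmul, inU_lie])

theorem elt_mem_wsp {d d' : Option I → ℤ} {x : Bm B} {z : B₀ B} (hx : x ∈ wsp B (Bm B) d)
    (hz : z ∈ wsp B (B₀ B) d') : elt B x z ∈ wsp B (CartM B) (d + d') := fun k => by
  rw [lie_elt, hx k, hz k, rootVal_add, Pi.add_apply, add_smul, ← eltL_apply, ← eltL_apply,
    map_smul, map_smul, LinearMap.smul_apply, eltL_apply]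

theorem span_elt : Submodule.span K {m | ∃ x z, elt B x z = m} = ⊤ := by
  refine eq_top_iff.2 fun m _ => ?_
  obtain ⟨⟨m, hm⟩, rfl⟩ := LieSubmodule.Quotient.surjective_mk' (periM B) m
  have key : ∀ n ∈ spanM B, ∀ hn : n ∈ genM B,
      (LieSubmodule.Quotient.mk (⟨n, hn⟩ : subM B) : CartM B) ∈
        Submodule.span K {m | ∃ x z, elt B x z = m} := by
    intro n hn
    induction hn using Submodule.span_induction with
    | mem n hn => obtain ⟨x, z, rfl⟩ := hn; exact fun _ => Submodule.subset_span ⟨x, z, rfl⟩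
    | zero => exact fun _ => zero_mem _
    | add u v hu hv h₁ h₂ =>
      exact fun _ => add_mem (h₁ (spanM_le_genM B hu)) (h₂ (spanM_le_genM B hv))
    | smul c u hu h => exact fun _ => Submodule.smul_mem _ c (h (spanM_le_genM B hu))
  exact key m (genM_le_spanM B hm) hm

variable (hB : IsUnit B.det)

include hB

/-- The bracket `(𝓑^W)_{-1} × 𝓑_1 → 𝓑_0`. -/
theorem exists_bracket : ∃ β : CartM B →ₗ[K] Bp B →ₗ[K] B₀ B,
    (∀ x z y, β (elt B x z) y =
      -pairing B ⁅z, y⁆ x + form B x ⁅z, y⁆ • gradingElt B - form B x y • z) ∧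
    (∀ (z : B₀ B) m y, ⁅z, β m y⁆ = β ⁅z, m⁆ y + β m ⁅z, y⁆) ∧
    ∀ m, (∀ y, β m y = 0) → m = 0 := by
  -- Commutators lie in the image of 𝓑_0 in U(𝓑_0). A linear left inverse of the embedding reads
  -- them as elements of 𝓑_0, linearly in both arguments.
  obtain ⟨g, hg⟩ := LinearMap.exists_leftInverse_of_injective (inU B)
    (LinearMap.ker_eq_bot.2 (inU_injective B hB))
  have hg' : ∀ z, g (inU B z) = z := fun z => LinearMap.congr_fun hg z
  let β₀ : subM B →ₗ[K] Bp B →ₗ[K] B₀ B := LinearMap.mk₂ K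
    (fun m y => g (commMP B m (y ⊗ₜ[K] (1 : U₀ B))))
    (fun m n y => by
      rw [← map_add]
      congr 1
      simp only [commMP, LieSubmodule.coe_add, map_add, LinearMap.add_apply]
      abel)
    (fun c m y => by
      rw [← map_smul]
      congr 1
      simp only [commMP, LieSubmodule.coe_smul, map_smul, LinearMap.smul_apply, smul_add])
    (fun m y y' => by
      rw [← map_add]
      congr 1
      simp only [commMP, TensorProduct.add_tmul, map_add, LinearMap.add_apply]
      abel)
    (fun c m y => by
      rw [← map_smul]
      congr 1
      simp only [commMP, ← TensorProduct.smul_tmul', map_smul, LinearMap.smul_apply, smul_add])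
  have hβ₀ : ∀ m y, inU B (β₀ m y) = commMP B m (y ⊗ₜ[K] (1 : U₀ B)) := by
    intro m y
    obtain ⟨z, hz⟩ := exists_of_mem_genO B ((isAdmissible_gen B).comm_neg_pos m m.2 _
      ((isAdmissible_gen B).mem y))
    change inU B (g _) = _
    rw [← hz, hg']
  let β : CartM B →ₗ[K] Bp B →ₗ[K] B₀ B := (periM B).toSubmodule.liftQ β₀ (fun m hm => by
    refine LinearMap.ext fun y => inU_injective B hB ?_
    rw [hβ₀, (mem_maxPeripheral B m.2).1 hm y]
    simp)
  have hβ : ∀ m y, β (LieSubmodule.Quotient.mk m) y = β₀ m y := fun _ _ => rfl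
  refine ⟨β, fun x z y => inU_injective B hB ?_, fun z m y => inU_injective B hB ?_, fun m hm => ?_⟩
  · rw [elt, hβ, hβ₀]
    exact commMP_tmul B x z y
  · obtain ⟨m, rfl⟩ := LieSubmodule.Quotient.surjective_mk' (periM B) m
    change inU B ⁅z, β₀ m y⁆ = inU B (β₀ ⁅z, m⁆ y + β₀ m ⁅z, y⁆)
    rw [inU_lie, map_add, hβ₀, hβ₀, hβ₀, commMP_equivariant, lie_inU_tmul, mul_one, one_mul,
      sub_self, TensorProduct.tmul_zero, add_zero]
    rfl
  · obtain ⟨m, rfl⟩ := LieSubmodule.Quotient.surjective_mk' (periM B) m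
    refine (LieSubmodule.Quotient.mk_eq_zero (N := periM B)).2 ?_
    refine (mem_maxPeripheral B m.2).2 fun y => ?_
    rw [← hβ₀ m y, show β₀ m y = 0 from hm y, map_zero]

/-- The bracket `(𝓑^W)_{-1} × 𝓑_1 → 𝓑_0`. -/
def brk : CartM B →ₗ[K] Bp B →ₗ[K] B₀ B := (exists_bracket B hB).choose

theorem brk_elt (x : Bm B) (z : B₀ B) (y : Bp B) : brk B hB (elt B x z) y =
    -pairing B ⁅z, y⁆ x + form B x ⁅z, y⁆ • gradingElt B - form B x y • z :=
  (exists_bracket B hB).choose_spec.1 x z y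

theorem lie_brk (z : B₀ B) (m : CartM B) (y : Bp B) :
    ⁅z, brk B hB m y⁆ = brk B hB ⁅z, m⁆ y + brk B hB m ⁅z, y⁆ :=
  (exists_bracket B hB).choose_spec.2.1 z m y

theorem eq_zero_of_brk {m : CartM B} (h : ∀ y, brk B hB m y = 0) : m = 0 :=
  (exists_bracket B hB).choose_spec.2.2 m h

theorem brk_mem_wsp {d d' : Option I → ℤ} {m : CartM B} {y : Bp B} (hm : m ∈ wsp B (CartM B) d)
    (hy : y ∈ wsp B (Bp B) d') : brk B hB m y ∈ wsp B (B₀ B) (d + d') := fun k => by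
  rw [lie_brk, hm k, hy k, rootVal_add, Pi.add_apply, add_smul, map_smul, map_smul,
    LinearMap.smul_apply]

/-- A singular vector is determined by its bracket with `e_0`. -/
theorem eq_zero_of_singular {m : CartM B} (h : ∀ i, ⁅cG B true i, m⁆ = 0)
    (h0 : brk B hB m (e0 B) = 0) : m = 0 := by
  refine eq_zero_of_brk B hB fun y => ?_
  have : LinearMap.ker (brk B hB m) = ⊤ := p_eq_top B hB _ h0 fun i x hx => by
    have e := lie_brk B hB (cG B true i) m x
    rw [LinearMap.mem_ker.1 hx, lie_zero, h, map_zero, LinearMap.zero_apply, zero_add] at e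
    exact e.symm
  exact LinearMap.mem_ker.1 (this ▸ Submodule.mem_top)

theorem gradingElt_lie_m (x : Bm B) : ⁅gradingElt B, x⁆ = -x := by
  refine Subtype.ext ?_
  rw [coe_lie_m, gradingElt_mul_of_mem B hB x.2]
  simp

theorem gradingElt_lie_p (x : Bp B) : ⁅gradingElt B, x⁆ = x := by
  refine Subtype.ext ?_
  rw [coe_lie_p, gradingElt_mul_of_mem B hB x.2]
  simp

theorem gradingElt_lie_cartM (m : CartM B) : ⁅gradingElt B, m⁆ = -m := by
  have hm : m ∈ Submodule.span K {m | ∃ x z, elt B x z = m} := span_elt B ▸ Submodule.mem_top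
  induction hm using Submodule.span_induction with
  | mem m hm =>
    obtain ⟨x, z, rfl⟩ := hm
    rw [lie_elt, gradingElt_central, gradingElt_lie_m B hB, ← eltL_apply, ← eltL_apply, map_neg,
      map_zero, add_zero, LinearMap.neg_apply, eltL_apply]
  | zero => simp
  | add u v _ _ hu hv => rw [lie_add, hu, hv, neg_add]
  | smul c u _ hu => rw [lie_smul, hu, smul_neg]

end CartM

end Cartanification

namespace Cartanification

/-! ### Irreducibility of 𝓑_{-1} -/

section Natural

variable {K : Type*} [Field K] [CharZero K] {I : Type} [Fintype I] [DecidableEq I]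
  (B : Matrix (Option I) (Option I) K)

theorem lie_e_f0 (i : I) : ⁅cG B true i, f0 B⁆ = 0 :=
  Subtype.ext (by simpa using chev_mul_chev_ne B true (Option.some_ne_none i))

theorem lie_f_e0 (i : I) : ⁅cG B false i, e0 B⁆ = 0 :=
  Subtype.ext (by simpa using chev_mul_chev_ne B false (Option.some_ne_none i))

theorem pairing_e0_f0 : pairing B (e0 B) (f0 B) = hG B none :=
  Subtype.ext (by simpa [chevCoeff] using chev_mul_chev_self B true none)

theorem cG_mem_subalg {S : Set I} (b : Bool) {i : I} (hi : i ∈ S) : cG B b i ∈ subalg B S := by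
  refine LieSubalgebra.subset_lieSpan ⟨i, hi, ?_⟩
  cases b
  · exact Or.inr (Or.inl rfl)
  · exact Or.inl rfl

theorem hG_mem_subalg {S : Set I} {i : I} (hi : i ∈ S) : hG B (some i) ∈ subalg B S :=
  LieSubalgebra.subset_lieSpan ⟨i, hi, Or.inr (Or.inr rfl)⟩

theorem rn_mem_subalg {S : Set I} (b : Bool) (l : List (Option I)) (i : Option I)
    (hl : ∀ j ∈ i :: l, j ∈ some '' S) : ∃ z ∈ subalg B S, (z : ContrAlg B) = rn B b l i := by
  induction l with
  | nil =>
    obtain ⟨i, hi, rfl⟩ := hl i (by simp)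
    exact ⟨cG B b i, cG_mem_subalg B b hi, coe_cG B b i⟩
  | cons j l ih =>
    obtain ⟨j', hj, rfl⟩ := hl j (by simp)
    obtain ⟨z, hz, e⟩ := ih fun k hk => hl k (by simp only [List.mem_cons] at hk ⊢; tauto)
    refine ⟨⁅cG B b j', z⁆, (subalg B S).lie_mem (cG_mem_subalg B b hj) hz, ?_⟩
    rw [rn, ← e, ← coe_cG]
    rfl

theorem mem_of_cnt_smul {S : Set I} {b : Bool} {l : List (Option I)} {d : Option I → ℤ}
    (hl : bsgn b • cnt l = d) (hn : d none = 0) (hS : ∀ i, i ∉ S → d (some i) = 0) :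
    ∀ j ∈ l, j ∈ some '' S := by
  intro j hj
  by_contra hj'
  have h0 : d j = 0 := by
    rcases j with _ | j
    · exact hn
    · exact hS j fun h => hj' ⟨j, h, rfl⟩
  have := cnt_pos.2 hj
  rw [← hl] at h0
  cases b <;> simp [bsgn] at h0 <;> omega

/-- The elements of `𝓑_0` of nonzero degree lie in the subalgebra generated by the `e_i`, `f_i` and
`h_i` for the nodes `i` in the support. -/
theorem mem_subalg (hB : IsUnit B.det) (S : Set I) {d : Option I → ℤ} {z : B₀ B} (hd : d ≠ 0)
    (hn : d none = 0) (hS : ∀ i, i ∉ S → d (some i) = 0) (hz : z ∈ wsp B (B₀ B) d) :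
    z ∈ subalg B S := by
  have h₁ : (z : ContrAlg B) ∈ (subalg B S).toSubmodule.map (comp B 0).subtype := by
    refine Submodule.span_le.2 ?_ (mem_span_triang B hB ((mem_wsp_zero B).1 hz))
    rintro _ ⟨w, hw, rfl⟩
    rcases w with i | ⟨b, l, i⟩
    · exact absurd hw.symm hd
    · obtain ⟨z, hz, e⟩ := rn_mem_subalg B b l i (mem_of_cnt_smul hw hn hS)
      exact ⟨z, hz, e⟩
  obtain ⟨z', hz', e⟩ := h₁
  rwa [← Subtype.ext e]

variable (hB : IsUnit B.det) {s : Option I → K} (hs0 : ∀ i, s i ≠ 0)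
  (hs : ∀ i j, s j * B i j = s i * B j i)

include hB

theorem lieSpan_f0 : LieSubmodule.lieSpan K (B₀ B) {f0 B} = ⊤ := by
  rw [← LieSubmodule.toSubmodule_eq_top]
  exact m_eq_top B hB _ (LieSubmodule.subset_lieSpan rfl) fun i x hx =>
    (LieSubmodule.lieSpan K (B₀ B) {f0 B}).lie_mem hx

include hs0 hs

/-- The negative of a root is a root. -/
theorem exists_ne_zero_neg {d : Option I → ℤ} {x : ContrAlg B} (hx : x ∈ gr B d) (hx0 : x ≠ 0) :
    ∃ y ∈ gr B (-d), y ≠ 0 := by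
  by_cases hd : d = 0
  · subst hd
    exact ⟨x, by rwa [neg_zero], hx0⟩
  obtain ⟨κ, θ, F⟩ := exists_formData B hB s
  by_contra! h
  have hh : ht d ≠ 0 := fun h0 => hx0 (eq_zero_of_ht_eq_zero B hB hx hd h0)
  obtain ⟨b, hb⟩ : ∃ b, 0 < bsgn b * ht d := by
    rcases lt_or_gt_of_ne hh with hlt | hlt
    · exact ⟨false, by simpa [bsgn] using hlt⟩
    · exact ⟨true, by simpa [bsgn] using hlt⟩
  exact hx0 (F.eq_zero_of_orthogonal hB hs hs0 b hb hx fun y hy => by rw [h y hy, map_zero])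

/-- If `x` is annihilated by the e_i, then by invariance the elements of 𝓑_1 orthogonal to `x` are
stable under the e_i. For degree reasons e_0 is among them, so `x` is orthogonal to all of 𝓑_1 and
vanishes by nondegeneracy. -/
theorem eq_zero_of_singular_m {d : Option I → ℤ} {x : Bm B} (hx : x ∈ wsp B (Bm B) d)
    (hd : d ≠ -Pi.single none 1) (h : ∀ i, ⁅cG B true i, x⁆ = 0) : x = 0 := by
  by_contra hx0
  have hx0' : (x : ContrAlg B) ≠ 0 := fun h => hx0 (Subtype.ext h)
  have hx' := (mem_wsp_m B).1 hx
  obtain ⟨κ, θ, F⟩ := exists_formData B hB s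
  have hn : d none = -1 := level_eq B hB x.2 hx' hx0'
  have hneg : ∀ j, d j ≤ 0 := by
    obtain ⟨b, hb⟩ := exists_sign_of_ne_zero B hB hx' hx0' (by rintro rfl; simp at hn)
    have h₁ := hb none
    rw [hn] at h₁
    cases b
    · intro j; have := hb j; simp only [bsgn] at this; omega
    · simp [bsgn] at h₁
  refine hx0' (F.eq_zero_of_orthogonal hB hs hs0 false ?_ hx' fun y hy => ?_)
  · have : ht d < 0 := Finset.sum_neg' (fun j _ => hneg j) ⟨none, Finset.mem_univ _, by omega⟩
    simpa [bsgn] using this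
  · have hle := comp_le_of_stable B hB true (comp B 1 ⊓ LinearMap.ker (κ x))
      ⟨(e0 B).2, F.orthogonal _ _ _ _ hx' ((mem_wsp_p B).1 (e0_mem B)) fun h0 => hd
        (eq_neg_of_add_eq_zero_left h0)⟩
      (by
        rintro i y ⟨hy, -⟩
        refine ⟨by simpa [lvl] using mul_mem_comp (chev_mem B true (some i)) hy, ?_⟩
        have h₁ : chev B true (some i) * (x : ContrAlg B) = 0 := by
          have := congrArg Subtype.val (h i)
          simpa using this
        have h₂ := skew_zero B (cG B true i).2 x
        rw [coe_cG, h₁] at h₂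
        change κ x (chev B true (some i) * y) = 0
        rw [← F.invariant hB hs, ← neg_neg ((x : ContrAlg B) * _), ← h₂]
        simp)
    have hy' := gr_le_comp B hB _ hy
    rw [Pi.neg_apply, hn, neg_neg] at hy'
    exact (hle hy').2

/-- `𝓑_{-1}` is an irreducible module. -/
theorem eq_top_of_ne_bot (P : LieSubmodule K (B₀ B) (Bm B)) (hP : P ≠ ⊥) : P = ⊤ := by
  obtain ⟨c, w, hw, hw0, hwd, hws, hwe⟩ := exists_singular B hB false (f0_mem B) (lie_e_f0 B) P
    (by rw [lieSpan_f0 B hB]; exact le_top) hP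
  have hc : c = 0 := by
    by_contra hc
    refine hw0 (eq_zero_of_singular_m B hB hs0 hs hwd ?_ hwe)
    simpa [bsgn] using hc
  subst hc
  have : w ∈ Submodule.span K {f0 B} := by
    refine Submodule.span_mono ?_ hws
    rintro _ ⟨l, hl, rfl⟩
    rw [dg_eq_zero hl]
    rfl
  obtain ⟨a, rfl⟩ := Submodule.mem_span_singleton.1 this
  have ha : a ≠ 0 := by rintro rfl; simp at hw0
  have hf : f0 B ∈ P := by
    have := P.smul_mem a⁻¹ hw
    rwa [smul_smul, inv_mul_cancel₀ ha, one_smul] at this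
  rw [eq_top_iff, ← lieSpan_f0 B hB, LieSubmodule.lieSpan_le]
  rintro _ rfl
  exact hf

end Natural

/-! ### Levels of roots and the pseudo-minuscule condition -/

namespace Triple

variable {K : Type*} [Field K] [CharZero K] {r : ℕ} (T : Triple K r)

/-- The symmetriser of `B`. -/
def symB : Option (Fin r) → K
  | none => 1
  | some i => T.ε i

theorem symB_ne_zero (i) : T.symB i ≠ 0 := by
  cases i
  · exact one_ne_zero
  · exact T.ε_ne _

theorem symB_mul (i j) : T.symB j * T.B i j = T.symB i * T.B j i := by
  have h := T.symm
  rcases i with _ | i <;> rcases j with _ | j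
  · rfl
  · simp [symB, B, wt, up, T.ε_ne]
  · simp [symB, B, wt, up, T.ε_ne]
  · have h := T.symm i j
    have h₁ := T.ε_ne i
    have h₂ := T.ε_ne j
    field_simp at h
    simpa [symB, B, mul_comm] using h

/-- The value of `λ` on a degree. -/
def lev (d : Option (Fin r) → ℤ) : ℤ := ∑ j, T.lam j * d (some j)

theorem lev_add (d d') : T.lev (d + d') = T.lev d + T.lev d' := by
  simp [lev, mul_add, Finset.sum_add_distrib]

theorem lev_neg (d) : T.lev (-d) = -T.lev d := by simp [lev]

theorem lev_single (i : Fin r) : T.lev (Pi.single (some i) 1) = T.lam i := by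
  simp [lev, Pi.single_apply]

theorem lev_nonneg {d : Option (Fin r) → ℤ} (hd : 0 ≤ d) : 0 ≤ T.lev d :=
  Finset.sum_nonneg fun _ _ => mul_nonneg (Nat.cast_nonneg _) (hd _)

/-- The matrix `A` over the field. -/
def AK : Matrix (Fin r) (Fin r) K := T.A.map (Int.cast : ℤ → K)

theorem AK_det_ne : T.AK.det ≠ 0 := by
  have : T.AK.det = ((T.A.det : ℤ) : K) := (Int.cast_det T.A).symm
  rw [this]
  exact Int.cast_ne_zero.2 T.det_ne

theorem mulVec_injective : Function.Injective T.AK.mulVec :=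
  Matrix.mulVec_injective_iff_isUnit.2 ((Matrix.isUnit_iff_isUnit_det _).2
    (isUnit_iff_ne_zero.2 T.AK_det_ne))

theorem rootVal_some (d : Option (Fin r) → ℤ) (i : Fin r) :
    rootVal T.B d (some i) = -(T.lam i * d none) + ∑ j, (T.A i j : K) * d (some j) := by
  simp [rootVal, Matrix.mulVec, dotProduct, Fintype.sum_option, B, wt]

/-- The hypothesis λ = λ^▲ makes row 0 of `B` equal to the negatives of the λ_j. Thus h_0 measures
the level on 𝓑_0. -/
theorem rootVal_none (hlam : T.wt = T.up) (d : Option (Fin r) → ℤ) :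
    rootVal T.B d none = -(T.lev d : K) := by
  have h : ∀ j, T.B none (some j) = -(T.lam j : K) := fun j => by
    change -T.up j = _
    rw [← hlam]; rfl
  simp [rootVal, Matrix.mulVec, dotProduct, Fintype.sum_option, h, lev]
  simp [B]

/-- The labels determine the degree. -/
theorem rootVal_some_injective {d d' : Option (Fin r) → ℤ} (hn : d none = d' none)
    (h : ∀ i, rootVal T.B d (some i) = rootVal T.B d' (some i)) : d = d' := by
  have : (fun j => ((d (some j) : ℤ) : K)) = fun j => ((d' (some j) : ℤ) : K) := by
    refine T.mulVec_injective (funext fun i => ?_)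
    have := h i
    rw [T.rootVal_some, T.rootVal_some, hn] at this
    exact add_left_cancel this
  funext j
  rcases j with _ | j
  · exact hn
  · exact Int.cast_injective (congrFun this j)

/-- For the weight α = Σ x_j α_j, whose labels are `AK x`, this yields (μ, α) = Σ μ_j x_j / ε_j. -/
theorem gram_inv_mulVec (x : Fin r → K) :
    (T.gram⁻¹).mulVec (T.AK.mulVec x) = fun j => (T.ε j)⁻¹ * x j := by
  have hg : T.gram = Matrix.diagonal T.ε * T.AK.transpose := by
    ext i j
    rw [Matrix.diagonal_mul]
    simp [gram, AK, mul_comm]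
  have hu : IsUnit T.gram.det := by
    rw [hg, Matrix.det_mul, Matrix.det_diagonal, Matrix.det_transpose]
    exact isUnit_iff_ne_zero.2 (mul_ne_zero (Finset.prod_ne_zero_iff.2 fun i _ => T.ε_ne i)
      T.AK_det_ne)
  have hm : T.AK.mulVec x = T.gram.mulVec fun j => (T.ε j)⁻¹ * x j := by
    funext i
    simp only [Matrix.mulVec, dotProduct, gram, AK, Matrix.of_apply, Matrix.map_apply]
    refine Finset.sum_congr rfl fun j _ => ?_
    have h := T.symm i j
    have h₁ := T.ε_ne i
    have h₂ := T.ε_ne j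
    field_simp at h ⊢
    linear_combination x j * h
  rw [hm, Matrix.mulVec_mulVec, Matrix.nonsing_inv_mul _ hu, Matrix.one_mulVec]

variable (hB : T.B.det ≠ 0) (hpm : T.IsPseudoMinuscule T.up) (hlam : T.wt = T.up)

theorem isUnit_det (hB : T.B.det ≠ 0) : IsUnit T.B.det := isUnit_iff_ne_zero.2 hB

/-- The labels of a degree. -/
def lab (d : Option (Fin r) → ℤ) : Fin r → K := fun i => rootVal T.B d (some i)

theorem isRootVector_of_mem (hB : T.B.det ≠ 0) (S : Set (Fin r)) {d : Option (Fin r) → ℤ}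
    (hd : d ≠ 0) (hn : d none = 0) (hS : ∀ i, i ∉ S → d (some i) = 0) {z : B₀ T.B}
    (hz : z ∈ wsp T.B (B₀ T.B) d) (hz0 : z ≠ 0) :
    T.lab d ≠ 0 ∧ T.IsRootVector (subalg T.B S) (T.lab d) z := by
  refine ⟨fun h => hd (T.rootVal_some_injective hn fun i => ?_), mem_subalg T.B (T.isUnit_det hB) S
    hd hn hS hz, hz0, fun i => hz (some i)⟩
  rw [rootVal_zero]
  exact congrFun h i

theorem lab_eq {d : Option (Fin r) → ℤ} (hn : d none = 0) :
    T.lab d = T.AK.mulVec fun j => (d (some j) : K) := by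
  funext i
  simp [lab, T.rootVal_some, hn, Matrix.mulVec, dotProduct, AK]

theorem lab_nonneg {d : Option (Fin r) → ℤ} (hn : d none = 0) (hd : 0 ≤ d) :
    T.IsNonneg (T.lab d) := by
  refine ⟨fun j => (d (some j)).toNat, ?_⟩
  funext i
  rw [T.lab_eq hn]
  simp only [Matrix.mulVec, dotProduct, Finset.sum_apply, Pi.smul_apply, smul_eq_mul, simpleRoot,
    AK, Matrix.map_apply]
  refine Finset.sum_congr rfl fun j _ => ?_
  have : ((d (some j)).toNat : ℤ) = d (some j) := Int.toNat_of_nonneg (hd (some j))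
  rw [mul_comm, ← Int.cast_natCast (R := K) (d (some j)).toNat, this]

include hB hpm hlam

/-- For a positive root the factors ε_j in μ^▼ cancel those of the form, and with λ = λ^▲ the number
in the pseudo-minuscule condition is exactly the level. A negative root is the opposite of a
positive one by nondegeneracy of the invariant form. -/
theorem abs_lev_le {d : Option (Fin r) → ℤ} {z : B₀ T.B} (hz : z ∈ wsp T.B (B₀ T.B) d)
    (hz0 : z ≠ 0) : |T.lev d| ≤ 1 := by
  have pos : ∀ {d : Option (Fin r) → ℤ} {z : B₀ T.B}, z ∈ wsp T.B (B₀ T.B) d → z ≠ 0 → d ≠ 0 →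
      d none = 0 → 0 ≤ d → |T.lev d| ≤ 1 := by
    intro d z hz hz0 hd hn hd'
    obtain ⟨h₁, h₂⟩ := T.isRootVector_of_mem hB Set.univ hd hn (by simp) hz hz0
    have h := hpm.2 (T.lab d) ⟨h₁, z, h₂⟩ (T.lab_nonneg hn hd')
    have e : T.pair (fun i => T.ε i * T.up i) (T.lab d) = (T.lev d : K) := by
      rw [pair, T.lab_eq hn, gram_inv_mulVec]
      simp only [dotProduct, lev]
      push_cast
      refine Finset.sum_congr rfl fun j _ => ?_
      have h := congrFun hlam j
      change (T.lam j : K) = T.up j at h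
      rw [h]
      have := T.ε_ne j
      field_simp
    rw [e] at h
    have : T.lev d = 0 ∨ T.lev d = 1 := by exact_mod_cast h
    rcases this with h | h <;> simp [h]
  have hu := T.isUnit_det hB
  have hz0' : (z : ContrAlg T.B) ≠ 0 := fun h => hz0 (Subtype.ext h)
  have hz' := (mem_wsp_zero T.B).1 hz
  have hn : d none = 0 := level_eq T.B hu z.2 hz' hz0'
  by_cases hd : d = 0
  · simp [hd, lev]
  obtain ⟨b, hb⟩ := exists_sign_of_ne_zero T.B hu hz' hz0' hd
  cases b
  · obtain ⟨y, hy, hy0⟩ := exists_ne_zero_neg T.B hu T.symB_ne_zero T.symB_mul hz' hz0'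
    have hy' : y ∈ comp T.B 0 := by
      have := gr_le_comp T.B hu _ hy
      rwa [Pi.neg_apply, hn, neg_zero] at this
    have := pos (d := -d) (z := ⟨y, hy'⟩) ((mem_wsp_zero T.B).2 hy)
      (fun h => hy0 (congrArg Subtype.val h)) (neg_ne_zero.2 hd) (by simp [hn])
      (fun j => by simpa [bsgn] using hb j)
    rwa [lev_neg, abs_neg] at this
  · exact pos hz hz0 hd hn (fun j => by simpa [bsgn] using hb j)

theorem lam_le_one (i : Fin r) : T.lam i ≤ 1 := by
  have h := T.abs_lev_le hB hpm hlam (d := Pi.single (some i) 1) (z := cG T.B true i)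
    (by simpa [bsgn] using cG_mem T.B true i)
    (fun h => chev_ne_zero T.B (T.isUnit_det hB) true (some i) (by
      have := congrArg Subtype.val h
      simpa using this))
  rw [lev_single, Nat.abs_cast] at h
  exact_mod_cast h

end Triple

end Cartanification

namespace Cartanification

namespace Triple

variable {K : Type*} [Field K] [CharZero K] {r : ℕ} (T : Triple K r)

/-! ### Brackets of the elements f_0 z with e_0 -/

section Singular

variable (hB : T.B.det ≠ 0) (hpm : T.IsPseudoMinuscule T.up) (hlam : T.wt = T.up)

include hB

theorem none_eq_zero {d : Option (Fin r) → ℤ} {z : B₀ T.B} (hz : z ∈ wsp T.B (B₀ T.B) d)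
    (hz0 : z ≠ 0) : d none = 0 :=
  level_eq T.B (T.isUnit_det hB) z.2 ((mem_wsp_zero T.B).1 hz) fun h => hz0 (Subtype.ext h)

theorem nonneg_or_nonpos {d : Option (Fin r) → ℤ} {z : B₀ T.B} (hz : z ∈ wsp T.B (B₀ T.B) d)
    (hz0 : z ≠ 0) : 0 ≤ d ∨ d ≤ 0 := by
  by_cases hd : d = 0
  · exact Or.inl hd.ge
  obtain ⟨b, hb⟩ := exists_sign_of_ne_zero T.B (T.isUnit_det hB) ((mem_wsp_zero T.B).1 hz)
    (fun h => hz0 (Subtype.ext h)) hd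
  cases b
  · exact Or.inr fun j => by have := hb j; simp only [bsgn] at this; simp; omega
  · exact Or.inl fun j => by have := hb j; simp only [bsgn] at this; simp; omega

/-- The bracket of a positive root vector with `f_0` vanishes. -/
theorem lie_f0_eq_zero {d : Option (Fin r) → ℤ} {z : B₀ T.B} (hz : z ∈ wsp T.B (B₀ T.B) d)
    (hd : 0 ≤ d) (hd0 : d ≠ 0) : ⁅z, f0 T.B⁆ = 0 := by
  by_contra h0
  have hz0 : z ≠ 0 := by rintro rfl; simp at h0
  have hn := T.none_eq_zero hB hz hz0
  have hm := (mem_wsp_m T.B).1 (lie_mem_wsp T.B hz (f0_mem T.B))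
  obtain ⟨j, hj⟩ := Function.ne_iff.1 hd0
  rcases j with _ | j
  · exact hj hn
  obtain ⟨b, hb⟩ := exists_sign_of_ne_zero T.B (T.isUnit_det hB) hm
    (fun h => h0 (Subtype.ext h)) (fun h => by
      have := congrFun h none
      simp [hn] at this)
  -- The bracket would have degree -1 at the node 0 and positive degree at `j`, against the sign
  -- coherence of roots.
  have h₁ := hb none
  have h₂ := hb (some j)
  have h₃ : 0 < d (some j) := lt_of_le_of_ne (hd _) (Ne.symm hj)
  cases b <;> simp [bsgn, hn] at h₁ h₂
  omega

/-- In the bracket formula only -⟨f_0|e_0⟩ z survives, and ⟨f_0|e_0⟩ = -1. So `z` can be recovered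
from f_0 z. -/
theorem brk_elt_f0_e0 (z : B₀ T.B) (h : ⁅z, e0 T.B⁆ = 0) :
    brk T.B (T.isUnit_det hB) (elt T.B (f0 T.B) z) (e0 T.B) = z := by
  rw [brk_elt, h, form_f0_e0 T.B (T.isUnit_det hB)]
  simp

section

include hlam

/-- As `z` commutes with f_0, the element ⟦⟦z,e_0⟧,f_0⟧ equals ⟦z,h_0⟧, which is the level times
`z`. The term with L vanishes because the form pairs opposite weights only. -/
theorem brk_elt_f0_e0_of_pos {d : Option (Fin r) → ℤ} {z : B₀ T.B}
    (hz : z ∈ wsp T.B (B₀ T.B) d) (hd : 0 ≤ d) (hd0 : d ≠ 0) :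
    brk T.B (T.isUnit_det hB) (elt T.B (f0 T.B) z) (e0 T.B) = (1 - (T.lev d : K)) • z := by
  have hu := T.isUnit_det hB
  have hform : form T.B (f0 T.B) ⁅z, e0 T.B⁆ = 0 :=
    form_eq_zero T.B hu (f0_mem T.B) (lie_mem_wsp T.B hz (e0_mem T.B)) (by simpa using hd0)
  have hp : pairing T.B ⁅z, e0 T.B⁆ (f0 T.B) = (T.lev d : K) • z := by
    have h := pairing_lie T.B z (e0 T.B) (f0 T.B)
    rw [T.lie_f0_eq_zero hB hz hd hd0, map_zero, add_zero, pairing_e0_f0] at h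
    rw [← h, ← lie_skew, hz none, T.rootVal_none hlam, neg_smul, neg_neg]
  rw [brk_elt, hform, hp, form_f0_e0 T.B hu]
  module

end

section

include hpm hlam

/-- All vectors `z` of level one have to be treated together. Their elements f_0 z bracket to zero
with e_0, and [e_i, f_0 z] = f_0 [e_i, z], where [e_i, z] has level one again or is zero because
level two is impossible. Hence the brackets vanish on all of 𝓑_1. -/
theorem elt_f0_eq_zero {d : Option (Fin r) → ℤ} {z : B₀ T.B} (hz : z ∈ wsp T.B (B₀ T.B) d)
    (hd : T.lev d = 1) : elt T.B (f0 T.B) z = 0 := by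
  have hu := T.isUnit_det hB
  let S : Submodule K (Bp T.B) :=
    { carrier := {y | ∀ d, ∀ z ∈ wsp T.B (B₀ T.B) d, T.lev d = 1 →
        brk T.B hu (elt T.B (f0 T.B) z) y = 0}
      add_mem' := fun ha hb d z hz hd => by rw [map_add, ha d z hz hd, hb d z hz hd, add_zero]
      zero_mem' := fun d z _ _ => map_zero _
      smul_mem' := fun c a ha d z hz hd => by rw [map_smul, ha d z hz hd, smul_zero] }
  have hS : S = ⊤ := by
    refine p_eq_top T.B hu S (fun d z hz hd => ?_) (fun i y hy d z hz hd => ?_)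
    · by_cases hz0 : z = 0
      · subst hz0
        rw [T.brk_elt_f0_e0 hB 0 (zero_lie _)]
      have hd0 : d ≠ 0 := by rintro rfl; simp [lev] at hd
      have hpos : 0 ≤ d := (T.nonneg_or_nonpos hB hz hz0).resolve_right fun h => by
        have := T.lev_nonneg (neg_nonneg.2 h)
        rw [T.lev_neg] at this
        omega
      rw [T.brk_elt_f0_e0_of_pos hB hlam hz hpos hd0, hd]
      simp
    · have e := lie_brk T.B hu (cG T.B true i) (elt T.B (f0 T.B) z) y
      have hm : ⁅cG T.B true i, z⁆ ∈ wsp T.B (B₀ T.B) (Pi.single (some i) 1 + d) := by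
        simpa [bsgn] using lie_mem_wsp T.B (cG_mem T.B true i) hz
      have h0 : brk T.B hu (elt T.B (f0 T.B) ⁅cG T.B true i, z⁆) y = 0 := by
        have hl : T.lev (Pi.single (some i) 1 + d) = T.lam i + 1 := by
          rw [T.lev_add, T.lev_single, hd]
        by_cases hi : T.lam i = 0
        · exact hy _ _ hm (by rw [hl, hi]; rfl)
        · have : ⁅cG T.B true i, z⁆ = 0 := by
            by_contra h0
            have := T.abs_lev_le hB hpm hlam hm h0
            rw [hl, abs_le] at this
            omega
          rw [this, ← eltL_apply, map_zero, map_zero, LinearMap.zero_apply]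
      have hl : elt T.B ⁅cG T.B true i, f0 T.B⁆ z = 0 := by
        rw [lie_e_f0, ← eltL_apply, map_zero, LinearMap.zero_apply]
      rw [hy d z hz hd, lie_zero, lie_elt, hl, zero_add, h0, zero_add] at e
      exact e.symm
  refine eq_zero_of_brk T.B hu fun y => ?_
  have hy : y ∈ S := hS ▸ Submodule.mem_top
  exact hy d z hz hd

theorem lie_e_elt_f0 (i : Fin r) (z : B₀ T.B) :
    ⁅cG T.B true i, elt T.B (f0 T.B) z⁆ = elt T.B (f0 T.B) ⁅cG T.B true i, z⁆ := by
  rw [lie_elt, lie_e_f0, ← eltL_apply, map_zero, LinearMap.zero_apply, zero_add]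

theorem elt_f0_e_eq_zero {i : Fin r} (hi : T.lam i ≠ 0) :
    elt T.B (f0 T.B) (cG T.B true i) = 0 := by
  refine T.elt_f0_eq_zero hB hpm hlam (d := Pi.single (some i) 1)
    (by simpa [bsgn] using cG_mem T.B true i) ?_
  rw [T.lev_single]
  have := T.lam_le_one hB hpm hlam i
  omega

/-- `f_0 h_0 = - f_0 L`. -/
theorem f0h0_eq : T.f0h0 = -elt T.B (f0 T.B) (gradingElt T.B) := by
  have hu := T.isUnit_det hB
  have hs : T.f0h0 + elt T.B (f0 T.B) (gradingElt T.B) = 0 := by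
    -- L commutes with e_i, and [e_i, h_0] is a multiple of λ_i e_i, where f_0 e_i = 0 if λ_i ≠ 0.
    -- So the sum is singular; its bracket with e_0 is h_0 - h_0.
    refine eq_zero_of_singular T.B hu (fun i => ?_) ?_
    · have h₁ : ⁅cG T.B true i, gradingElt T.B⁆ = 0 := by
        rw [← lie_skew, gradingElt_central, neg_zero]
      have h₂ : ⁅cG T.B true i, hG T.B none⁆ = -(T.B none (some i)) • cG T.B true i := by
        rw [← lie_skew, lie_hG_cG, neg_smul]
        simp [bsgn]
      rw [lie_add, f0h0, f0mul, T.lie_e_elt_f0 hB hpm hlam, T.lie_e_elt_f0 hB hpm hlam, h₁, h₂,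
        ← eltL_apply, ← eltL_apply, map_zero, add_zero, map_smul, eltL_apply]
      by_cases hi : T.lam i = 0
      · have : T.B none (some i) = 0 := by simp [B, up, hi]
        rw [this, neg_zero, zero_smul]
      · rw [T.elt_f0_e_eq_zero hB hpm hlam hi, smul_zero]
    · have h₁ : ⁅hG T.B none, e0 T.B⁆ = 0 := by
        rw [e0_mem T.B none, rootVal_single]
        simp [B]
      rw [map_add, LinearMap.add_apply, f0h0, f0mul, T.brk_elt_f0_e0 hB _ h₁, brk_elt,
        gradingElt_lie_p T.B hu, pairing_e0_f0]
      simp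
  exact eq_neg_of_add_eq_zero_left hs

end

end Singular

/-! ### 𝔤-submodules of (𝓑^W)_{-1} as 𝓑_0-submodules -/

section Submodules

theorem eG_mem_g (i : Fin r) : eG T.B i ∈ T.g :=
  LieSubalgebra.subset_lieSpan ⟨i, trivial, Or.inl rfl⟩

theorem fG_mem_g (i : Fin r) : fG T.B i ∈ T.g :=
  LieSubalgebra.subset_lieSpan ⟨i, trivial, Or.inr (Or.inl rfl)⟩

theorem hG_mem_g (i : Fin r) : hG T.B (some i) ∈ T.g :=
  LieSubalgebra.subset_lieSpan ⟨i, trivial, Or.inr (Or.inr rfl)⟩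

theorem cG_mem_g (b : Bool) (i : Fin r) : cG T.B b i ∈ T.g := by
  cases b
  · exact T.fG_mem_g i
  · exact T.eG_mem_g i

variable (hB : T.B.det ≠ 0)

include hB

/-- If this entry vanished, the rest of row 0 of `B⁻¹` would be a left null vector of the invertible
matrix A. Consequently h_0 lies in the span of L and the h_i with i in I. -/
theorem inv_none_none_ne : T.B⁻¹ none none ≠ 0 := by
  intro h
  have hv : ∀ j, ∑ i, T.B⁻¹ none i * T.B i j = if none = j then 1 else 0 := fun j => by
    rw [← Matrix.mul_apply, Matrix.nonsing_inv_mul _ (T.isUnit_det hB), Matrix.one_apply]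
  have hx : (fun i => T.B⁻¹ none (some i)) = 0 := by
    have hi : Function.Injective T.AK.vecMul := Matrix.vecMul_injective_iff_isUnit.2
      ((Matrix.isUnit_iff_isUnit_det _).2 (isUnit_iff_ne_zero.2 T.AK_det_ne))
    refine hi (funext fun j => ?_)
    have := hv (some j)
    rw [Fintype.sum_option, h, zero_mul, zero_add] at this
    simpa [Matrix.vecMul, dotProduct, AK, B] using this
  have := hv none
  rw [Fintype.sum_option, h, zero_mul, zero_add] at this
  have hx' : ∀ i, T.B⁻¹ none (some i) = 0 := fun i => congrFun hx i
  simp [hx'] at this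

theorem hG_none_eq : hG T.B none = (T.B⁻¹ none none)⁻¹ •
    (gradingElt T.B - ∑ i, T.B⁻¹ none (some i) • hG T.B (some i)) := by
  rw [gradingElt, Fintype.sum_option, add_sub_cancel_right, smul_smul,
    inv_mul_cancel₀ (T.inv_none_none_ne hB), one_smul]

/-- A `𝔤`-submodule of `(𝓑^W)_{-1}` is a `𝓑_0`-submodule. -/
theorem lie_mem_of_g (Q : LieSubmodule K T.g T.M) (z : B₀ T.B) {m : T.M} (hm : m ∈ Q) :
    ⁅z, m⁆ ∈ Q := by
  have hg : ∀ z ∈ T.g, ∀ m ∈ Q, ⁅z, m⁆ ∈ Q := fun z hz m hm =>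
    Q.lie_mem (x := (⟨z, hz⟩ : T.g)) hm
  refine lie_mem_of_stable T.B (T.isUnit_det hB) Q.toSubmodule
    (fun b i => hg _ (T.cG_mem_g b i)) (fun i m hm => ?_) z hm
  rcases i with _ | i
  · rw [T.hG_none_eq hB, smul_lie, sub_lie, gradingElt_lie_cartM T.B (T.isUnit_det hB)]
    refine Submodule.smul_mem _ _ (sub_mem (neg_mem hm) ?_)
    refine hg _ (sum_mem fun i _ => T.g.smul_mem _ (T.hG_mem_g i)) m hm
  · exact hg _ (T.hG_mem_g i) m hm

/-- A `𝔤`-submodule of `(𝓑^W)_{-1}` as a `𝓑_0`-submodule. -/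
def toB₀ (Q : LieSubmodule K T.g T.M) : LieSubmodule K (B₀ T.B) T.M where
  toSubmodule := Q.toSubmodule
  lie_mem := fun {z _} hm => T.lie_mem_of_g hB Q z hm

theorem gen_toSubmodule (v : T.M) :
    (T.gen v).toSubmodule = (LieSubmodule.lieSpan K (B₀ T.B) {v}).toSubmodule := by
  let P : LieSubmodule K T.g T.M :=
    { toSubmodule := (LieSubmodule.lieSpan K (B₀ T.B) {v}).toSubmodule
      lie_mem := fun {z _} hm => (LieSubmodule.lieSpan K (B₀ T.B) {v}).lie_mem (x := (z : B₀ T.B)) hm }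
  refine le_antisymm ?_ ?_
  · have : T.gen v ≤ P := LieSubmodule.lieSpan_le.2 (by
      rintro _ rfl
      exact LieSubmodule.subset_lieSpan rfl)
    exact this
  · have : LieSubmodule.lieSpan K (B₀ T.B) {v} ≤ T.toB₀ hB (T.gen v) := LieSubmodule.lieSpan_le.2 (by
      rintro _ rfl
      exact LieSubmodule.subset_lieSpan (R := K) (L := T.g) rfl)
    exact this

theorem mem_gen_self (v : T.M) : v ∈ T.gen v := LieSubmodule.subset_lieSpan rfl

theorem isIrreducible_gen {v : T.M} (hv : v ≠ 0) (h : ∀ P : LieSubmodule K (B₀ T.B) T.M,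
    P ≤ LieSubmodule.lieSpan K (B₀ T.B) {v} → P ≠ ⊥ → v ∈ P) :
    LieModule.IsIrreducible K T.g (T.gen v) := by
  have : Nontrivial (T.gen v) := ⟨⟨⟨v, T.mem_gen_self hB v⟩, 0, fun e => hv (congrArg Subtype.val e)⟩⟩
  refine LieModule.IsIrreducible.mk fun N hN => ?_
  let Q : LieSubmodule K T.g T.M := N.map (T.gen v).incl
  have hQ : Q ≤ T.gen v := by
    rintro _ ⟨x, _, rfl⟩
    exact x.2
  have hvQ : v ∈ T.toB₀ hB Q := by
    refine h _ ?_ ?_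
    · intro x hx
      have : x ∈ (T.gen v).toSubmodule := hQ hx
      rw [T.gen_toSubmodule hB] at this
      exact this
    · intro h0
      refine hN (LieSubmodule.eq_bot_iff N |>.2 fun x hx => ?_)
      have : (x : T.M) ∈ T.toB₀ hB Q := ⟨x, hx, rfl⟩
      rw [h0] at this
      exact Subtype.ext this
  have hle : T.gen v ≤ Q := LieSubmodule.lieSpan_le.2 (by
    rintro _ rfl
    exact hvQ)
  refine eq_top_iff.2 fun x _ => ?_
  obtain ⟨y, hy, e⟩ := hle x.2
  rwa [← (Subtype.ext e : y = x)]

end Submodules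

/-! ### The submodule generated by f_0 h_0 -/

section NullVector

variable (hB : T.B.det ≠ 0) (hpm : T.IsPseudoMinuscule T.up) (hlam : T.wt = T.up)

include hB hpm hlam

theorem brk_f0h0 : brk T.B (T.isUnit_det hB) T.f0h0 (e0 T.B) = hG T.B none := by
  refine T.brk_elt_f0_e0 hB _ ?_
  rw [e0_mem T.B none, rootVal_single]
  simp [B]

theorem f0h0_ne_zero : T.f0h0 ≠ 0 := fun h => by
  have h₁ := T.brk_f0h0 hB hpm hlam
  rw [h, map_zero, LinearMap.zero_apply] at h₁
  exact cart_ne_zero T.B (T.isUnit_det hB) none (congrArg Subtype.val h₁.symm)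

/-- Multiplication x ↦ xL is a module homomorphism because L is central, and f_0 h_0 = -f_0 L is in
its image. The preimage of a nonzero submodule is a nonzero submodule of the irreducible module
𝓑_{-1}, hence contains f_0. -/
theorem f0h0_mem_of_ne_bot (P : LieSubmodule K (B₀ T.B) T.M)
    (hP : P ≤ LieSubmodule.lieSpan K (B₀ T.B) {T.f0h0}) (hP0 : P ≠ ⊥) : T.f0h0 ∈ P := by
  have hu := T.isUnit_det hB
  let φ : Bm T.B →ₗ⁅K, B₀ T.B⁆ T.M :=
    { toLinearMap := (eltL T.B).flip (gradingElt T.B)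
      map_lie' := fun {z x} => by
        change elt T.B ⁅z, x⁆ (gradingElt T.B) = ⁅z, elt T.B x (gradingElt T.B)⁆
        rw [lie_elt, ← lie_skew z, gradingElt_central, neg_zero, ← eltL_apply _ x, map_zero,
          add_zero] }
  have hφ : T.f0h0 = -φ (f0 T.B) := T.f0h0_eq hB hpm hlam
  have hle : P ≤ φ.range := hP.trans (LieSubmodule.lieSpan_le.2 (by
    rintro _ rfl
    rw [hφ]
    exact neg_mem ⟨f0 T.B, rfl⟩))
  have hc : P.comap φ ≠ ⊥ := by
    intro h0
    refine hP0 (LieSubmodule.eq_bot_iff P |>.2 fun x hx => ?_)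
    obtain ⟨y, rfl⟩ := (LieModuleHom.mem_range φ x).1 (hle hx)
    have : y ∈ P.comap φ := hx
    rw [h0, LieSubmodule.mem_bot] at this
    rw [this, map_zero]
  have htop := eq_top_of_ne_bot T.B hu T.symB_ne_zero T.symB_mul _ hc
  have hf : f0 T.B ∈ P.comap φ := htop ▸ LieSubmodule.mem_top _
  rw [hφ]
  exact neg_mem hf

theorem f0h0_singular (i : Fin r) : ⁅cG T.B true i, T.f0h0⁆ = 0 := by
  rw [T.f0h0_eq hB hpm hlam, lie_neg, T.lie_e_elt_f0 hB hpm hlam, ← lie_skew, gradingElt_central,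
    neg_zero, ← eltL_apply, map_zero, neg_zero]

theorem f0h0_irreducible : LieModule.IsIrreducible K T.g (T.gen T.f0h0) ∧
    T.HasHighestWeight (T.gen T.f0h0) T.wt := by
  refine ⟨T.isIrreducible_gen hB (T.f0h0_ne_zero hB hpm hlam) (T.f0h0_mem_of_ne_bot hB hpm hlam),
    T.f0h0, T.f0h0_ne_zero hB hpm hlam, rfl, T.f0h0_singular hB hpm hlam, fun i => ?_⟩
  have := elt_mem_wsp T.B (f0_mem T.B) (hG_mem T.B none) (some i)
  rw [f0h0, f0mul, this, add_zero, rootVal_neg, Pi.neg_apply, rootVal_single]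
  simp [B]

end NullVector

end Triple

end Cartanification

namespace Cartanification

/-! ### Serre relations and words on disconnected diagrams -/

section Serre

variable {K : Type*} [Field K] [CharZero K] {I : Type} [Fintype I] [DecidableEq I]
  (B : Matrix (Option I) (Option I) K)

/-- The iterated products of a generator with another one. -/
def power (b : Bool) (i : I) (j : Option I) (k : ℕ) : ContrAlg B :=
  (LinearMap.mulLeft K (chev B b (some i)) ^ k) (chev B b j)

theorem power_succ (b : Bool) (i : I) (j : Option I) (k : ℕ) :
    power B b i j (k + 1) = chev B b (some i) * power B b i j k := by
  rw [power, pow_succ']; rfl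

theorem power_mem_gr (b : Bool) (i : I) (j : Option I) (k : ℕ) :
    power B b i j k ∈ gr B (bsgn b • (Pi.single (some i) (k : ℤ) + Pi.single j 1)) := by
  induction k with
  | zero => simpa [power] using chev_mem_gr B b j
  | succ k ih =>
    rw [power_succ]
    have := mul_mem_gr B (chev_mem_gr B b (some i)) ih
    rwa [← smul_add, ← add_assoc, ← Pi.single_add, add_comm (1 : ℤ)] at this

theorem mul_chev_mul (b : Bool) (i : I) (y z : ContrAlg B) : y * (chev B b (some i) * z) =
    chev B b (some i) * (y * z) - chev B b (some i) * y * z := by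
  have hx : chev B b (some i) ∈ comp B 0 := by simpa [lvl] using chev_mem B b (some i)
  rw [jacobi_zero B hx y z]
  abel

/-- This is the computation in sl₂ with a vector of extremal weight; the factor n - k is what
produces the Serre relation at k = n. -/
theorem chev_not_mul_power (b : Bool) (i : I) {j : Option I} (hij : j ≠ some i) {n : ℕ}
    (h2 : B (some i) (some i) = 2) (hn : B (some i) j = -(n : K)) (k : ℕ) :
    chev B (!b) (some i) * power B b i j (k + 1) =
      (chevCoeff K b (some i) * ((bsgn b : K) * ((k + 1) * (n - k)))) • power B b i j k := by
  have hh : ∀ k, cart B (some i) * power B b i j k = ((bsgn b : K) * (2 * k - n)) •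
      power B b i j k := fun k => by
    rw [power_mem_gr B b i j k]
    congr 1
    have : bsgn b • (Pi.single (some i) (k : ℤ) + Pi.single j 1 : Option I → ℤ) =
        Pi.single (some i) (bsgn b * k) + Pi.single j (bsgn b) := by
      rw [smul_add, ← Pi.single_smul, ← Pi.single_smul]
      simp
    rw [this, rootVal_add, Pi.add_apply, rootVal_single, rootVal_single, h2, hn]
    push_cast
    ring
  have hx : ∀ z, chev B (!b) (some i) * (chev B b (some i) * z) = chev B b (some i) *
      (chev B (!b) (some i) * z) - chevCoeff K b (some i) • (cart B (some i) * z) := fun z => by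
    rw [mul_chev_mul, chev_mul_chev_self, smul_mul_assoc]
  induction k with
  | zero =>
    have h0 : chev B (!b) (some i) * power B b i j 0 = 0 := by
      have := chev_mul_chev_ne B (!b) hij.symm
      rwa [Bool.not_not] at this
    rw [power_succ, hx, h0, hh, mul_zero, smul_smul, zero_sub, ← neg_smul]
    congr 1
    push_cast
    ring
  | succ k ih =>
    rw [power_succ, hx, ih, hh, mul_smul_comm, ← power_succ, smul_smul, ← sub_smul]
    congr 1
    push_cast
    ring

/-- The Serre relations. -/
theorem power_eq_zero (hB : IsUnit B.det) (b : Bool) (i : I) {j : Option I} (hij : j ≠ some i)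
    {n : ℕ} (h2 : B (some i) (some i) = 2) (hn : B (some i) j = -(n : K))
    (h0 : n = 0 → B j (some i) = 0) : power B b i j (n + 1) = 0 := by
  -- It suffices that every generator of the opposite sign annihilates the iterated bracket: the one
  -- at `i` by the computation in sl₂, the one at `j` by the argument for `hk`, and all others
  -- because they commute with both letters.
  refine eq_zero_of_chev_mul_eq_zero B hB b (d := _) ?_ (power_mem_gr B b i j (n + 1)) fun m => ?_
  · change 2 ≤ bsgn b * ht _
    have : ht (Pi.single (some i) ((n + 1 : ℕ) : ℤ) + Pi.single j 1 : Option I → ℤ) = n + 2 := by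
      rw [ht_add]
      simp [ht]
      ring
    rw [show ht (bsgn b • (Pi.single (some i) ((n + 1 : ℕ) : ℤ) + Pi.single j 1 : Option I → ℤ)) =
      bsgn b * (n + 2) by rw [← this, ht, ht, Finset.mul_sum]; rfl, ← mul_assoc, bsgn_mul_self]
    omega
  by_cases hmi : m = some i
  · subst hmi
    rw [chev_not_mul_power B b i hij h2 hn]
    simp
  have hx : ∀ z, chev B (!b) m * (chev B b (some i) * z) = chev B b (some i) *
      (chev B (!b) m * z) := fun z => by
    rw [mul_chev_mul, chev_mul_chev_ne B b (Ne.symm hmi), zero_mul, sub_zero]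
  by_cases hmj : m = j
  · subst hmj
    -- Lowering the letter `j` leaves a power of ad x_i applied to a multiple of h_j. A single
    -- application gives a multiple of x_i, which vanishes if the entry of `B` does; a second one
    -- gives ⟦x_i, x_i⟧ = 0.
    have hk : ∀ k, (1 < k ∨ B m (some i) = 0) → k ≠ 0 → chev B (!b) m * power B b i m k = 0 := by
      intro k hk hk0
      obtain ⟨k, rfl⟩ := Nat.exists_eq_succ_of_ne_zero hk0
      have e := chev_mul_chev_self B (!b) m
      rw [Bool.not_not] at e
      have h1 : chev B (!b) m * power B b i m 1 = (chevCoeff K (!b) m *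
          -((bsgn b : K) * B m (some i))) • chev B b (some i) := by
        rw [power_succ, hx]
        change _ * (_ * chev B b m) = _
        rw [e, mul_smul_comm, chev_mul_cart, smul_smul]
      have hs : chev B b (some i) * chev B b (some i) = 0 := by
        have hx : chev B b (some i) ∈ comp B 0 := by simpa [lvl] using chev_mem B b (some i)
        have := skew_zero B hx (chev B b (some i))
        have h2 := eq_neg_iff_add_eq_zero.1 this
        rw [← two_smul K] at h2
        exact (smul_eq_zero.1 h2).resolve_left two_ne_zero
      rcases hk with hk | hk
      · obtain ⟨k, rfl⟩ := Nat.exists_eq_succ_of_ne_zero (show k ≠ 0 by omega)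
        clear hk hk0
        induction k with
        | zero => rw [Nat.succ_eq_add_one, power_succ, hx]; rw [h1, mul_smul_comm, hs, smul_zero]
        | succ k ih => rw [Nat.succ_eq_add_one, power_succ, hx, ih, mul_zero]
      · clear hk0
        induction k with
        | zero => rw [Nat.succ_eq_add_one]; rw [h1, hk]; simp
        | succ k ih => rw [Nat.succ_eq_add_one, power_succ, hx, ih, mul_zero]
    refine hk _ ?_ (by omega)
    by_cases hn0 : n = 0
    · exact Or.inr (h0 hn0)
    · exact Or.inl (by omega)
  · have : ∀ k, chev B (!b) m * power B b i j k = 0 := fun k => by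
      induction k with
      | zero =>
        have := chev_mul_chev_ne B (!b) hmj
        rwa [Bool.not_not] at this
      | succ k ih => rw [power_succ, hx, ih, mul_zero]
    exact this _

theorem chev_mul_chev_eq_zero (hB : IsUnit B.det) (b : Bool) {i : I} {j : Option I}
    (hij : j ≠ some i) (h2 : B (some i) (some i) = 2) (h : B (some i) j = 0)
    (h' : B j (some i) = 0) : chev B b (some i) * chev B b j = 0 := by
  have := power_eq_zero B hB b i hij (n := 0) h2 (by simpa using h) fun _ => h'
  rwa [power_succ] at this

/-- A word with letters in two disconnected sets of nodes is zero. -/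
theorem rn_eq_zero_of_disconnected (hB : IsUnit B.det) (h2 : ∀ i : I, B (some i) (some i) = 2)
    (b : Bool) (Z : Set I) (R : Set I)
    (hZ : ∀ i ∈ Z, ∀ j ∈ R, j ∉ Z → B (some i) (some j) = 0 ∧ B (some j) (some i) = 0)
    (l : List (Option I)) (i : Option I) (hR : ∀ j ∈ i :: l, j ∈ some '' R)
    (h₁ : ∃ j ∈ i :: l, j ∈ some '' Z) (h₂ : ∃ j ∈ i :: l, j ∉ some '' Z) :
    rn B b l i = 0 := by
  -- When the inner word no longer meets both sides, its letters are all on one side and the outer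
  -- letter is on the other. That generator then commutes with every letter of the inner word.
  have comm : ∀ (x : I) (l : List (Option I)) (i : Option I),
      (∀ j ∈ i :: l, chev B b (some x) * chev B b j = 0) → chev B b (some x) * rn B b l i = 0 := by
    intro x l i hl
    have hx : chev B b (some x) ∈ comp B 0 := by simpa [lvl] using chev_mem B b (some x)
    induction l with
    | nil => exact hl i (by simp)
    | cons j l ih =>
      rw [rn, jacobi_zero B hx, hl j (by simp), zero_mul, zero_add,
        ih fun k hk => hl k (by simp only [List.mem_cons] at hk ⊢; tauto), mul_zero]
  induction l with
  | nil =>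
    obtain ⟨j, hj, hj'⟩ := h₁
    obtain ⟨k, hk, hk'⟩ := h₂
    simp only [List.mem_singleton] at hj hk
    subst hj hk
    exact absurd hj' hk'
  | cons k l ih =>
    have hR' : ∀ j ∈ i :: l, j ∈ some '' R := fun j hj =>
      hR j (by simp only [List.mem_cons] at hj ⊢; tauto)
    obtain ⟨k, hkR, rfl⟩ := hR k (by simp)
    by_cases h₁' : ∃ j ∈ i :: l, j ∈ some '' Z
    · by_cases h₂' : ∃ j ∈ i :: l, j ∉ some '' Z
      · rw [rn, ih hR' h₁' h₂', mul_zero]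
      · push Not at h₂'
        have hk : some k ∉ some '' Z := by
          intro hk
          obtain ⟨j, hj, hj'⟩ := h₂
          simp only [List.mem_cons] at hj
          rcases hj with rfl | rfl | hj
          · exact hj' (h₂' _ (by simp))
          · exact hj' hk
          · exact hj' (h₂' _ (by simp [hj]))
        refine comm k l i fun j hj => ?_
        obtain ⟨j, hjZ, rfl⟩ := h₂' j hj
        have hkZ : k ∉ Z := fun h => hk ⟨k, h, rfl⟩
        have e := hZ j hjZ k hkR hkZ
        exact chev_mul_chev_eq_zero B hB b (fun h => hkZ (Option.some_injective _ h ▸ hjZ)) (h2 k)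
          e.2 e.1
    · push Not at h₁'
      have hk : some k ∈ some '' Z := by
        obtain ⟨j, hj, hj'⟩ := h₁
        simp only [List.mem_cons] at hj
        rcases hj with rfl | rfl | hj
        · exact absurd hj' (h₁' _ (by simp))
        · exact hj'
        · exact absurd hj' (h₁' _ (by simp [hj]))
      obtain ⟨k', hkZ, e⟩ := hk
      obtain rfl := Option.some_injective _ e
      refine comm k' l i fun j hj => ?_
      obtain ⟨j, hjR, rfl⟩ := hR' j hj
      have hjZ : j ∉ Z := fun h => h₁' _ hj ⟨j, h, rfl⟩
      have e := hZ k' hkZ j hjR hjZ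
      exact chev_mul_chev_eq_zero B hB b (fun h => hjZ (Option.some_injective _ h ▸ hkZ)) (h2 k')
        e.1 e.2

end Serre

/-! ### Root decomposition of the subalgebras attached to sets of nodes -/

section Subalg

variable {K : Type*} [Field K] [CharZero K] {I : Type} [Fintype I] [DecidableEq I]
  (B : Matrix (Option I) (Option I) K) (hB : IsUnit B.det)

include hB

/-- The root space decomposition of the subalgebra generated by the `e_i`, `f_i` and `h_i` for
`i ∈ S`. -/
theorem subalg_le (S : Set I) : (subalg B S).toSubmodule ≤
    Submodule.span K {z | ∃ i ∈ S, hG B (some i) = z} ⊔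
      ⨆ d : {d : Option I → ℤ // d ≠ 0 ∧ d none = 0 ∧ ∀ i, i ∉ S → d (some i) = 0},
        wsp B (B₀ B) d.1 := by
  set H := Submodule.span K {z | ∃ i ∈ S, hG B (some i) = z}
  set R := ⨆ d : {d : Option I → ℤ // d ≠ 0 ∧ d none = 0 ∧ ∀ i, i ∉ S → d (some i) = 0},
    wsp B (B₀ B) d.1
  have hmem : ∀ (d : Option I → ℤ), d none = 0 → (∀ i, i ∉ S → d (some i) = 0) → d ≠ 0 →
      wsp B (B₀ B) d ≤ H ⊔ R := fun d hn hS hd =>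
    le_trans (le_iSup (fun d : {d : Option I → ℤ // d ≠ 0 ∧ d none = 0 ∧
      ∀ i, i ∉ S → d (some i) = 0} => wsp B (B₀ B) d.1) ⟨d, hd, hn, hS⟩) le_sup_right
  have hsupp : ∀ (b : Bool), ∀ i ∈ S, ∀ j, j ∉ S →
      (bsgn b • Pi.single (some i) 1 : Option I → ℤ) (some j) = 0 := fun b i hi j hj => by
    have : j ≠ i := fun h => hj (h ▸ hi)
    simp [this]
  have hc : ∀ (b : Bool), ∀ i ∈ S, cG B b i ∈ H ⊔ R := fun b i hi =>
    hmem _ (by simp) (hsupp b i hi) (by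
      intro h
      have := congrFun h (some i)
      cases b <;> simp [bsgn] at this) (cG_mem B b i)
  have hh : ∀ i ∈ S, hG B (some i) ∈ H ⊔ R := fun i hi =>
    Submodule.mem_sup_left (Submodule.subset_span ⟨i, hi, rfl⟩)
  have ext : ∀ z : B₀ B, (∀ i ∈ S, ⁅z, hG B (some i)⁆ ∈ H ⊔ R) → (∀ d : Option I → ℤ, d ≠ 0 →
      d none = 0 → (∀ i, i ∉ S → d (some i) = 0) → ∀ x ∈ wsp B (B₀ B) d, ⁅z, x⁆ ∈ H ⊔ R) →
      ∀ x ∈ H ⊔ R, ⁅z, x⁆ ∈ H ⊔ R := by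
    intro z h₁ h₂ x hx
    have : H ⊔ R ≤ (H ⊔ R).comap (LieModule.toEnd K (B₀ B) (B₀ B) z) := by
      refine sup_le (Submodule.span_le.2 ?_) (iSup_le ?_)
      · rintro _ ⟨i, hi, rfl⟩
        exact h₁ i hi
      · rintro ⟨d, hd, hn, hS⟩ x hx
        exact h₂ d hd hn hS x hx
    exact this hx
  -- The elements of the candidate space whose adjoint action preserves it form a subalgebra, so
  -- only the generators have to be examined.
  let T : LieSubalgebra K (B₀ B) :=
    { carrier := {z | z ∈ H ⊔ R ∧ ∀ x ∈ H ⊔ R, ⁅z, x⁆ ∈ H ⊔ R}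
      add_mem' := fun ha hb => ⟨add_mem ha.1 hb.1, fun x hx => by
        rw [add_lie]; exact add_mem (ha.2 x hx) (hb.2 x hx)⟩
      zero_mem' := ⟨zero_mem _, fun x _ => by rw [zero_lie]; exact zero_mem _⟩
      smul_mem' := fun c z hz => ⟨Submodule.smul_mem _ _ hz.1, fun x hx => by
        rw [smul_lie]; exact Submodule.smul_mem _ _ (hz.2 x hx)⟩
      lie_mem' := fun {y z} hy hz => ⟨hy.2 z hz.1, fun x hx => by
        rw [lie_lie]
        exact sub_mem (hy.2 _ (hz.2 x hx)) (hz.2 _ (hy.2 x hx))⟩ }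
  have hgen : ∀ (b : Bool), ∀ i ∈ S, cG B b i ∈ T := fun b i hi => by
    refine ⟨hc b i hi, ext _ (fun j hj => ?_) (fun d hd hn hS x hx => ?_)⟩
    · rw [← lie_skew, lie_hG_cG]
      exact neg_mem (Submodule.smul_mem _ _ (hc b i hi))
    · by_cases hd' : bsgn b • Pi.single (some i) 1 + d = 0
      · have hd'' : d = bsgn (!b) • Pi.single (some i) 1 := by
          rw [bsgn_not, neg_smul]; exact (neg_eq_of_add_eq_zero_right hd').symm
        subst hd''
        obtain ⟨c, hc⟩ := mem_span_chev B hB (!b) (some i) ((mem_wsp_zero B).1 hx)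
        obtain rfl : x = c • cG B (!b) i := Subtype.ext (by simpa using hc)
        rw [lie_smul, lie_cG_cG_self]
        exact Submodule.smul_mem _ _ (Submodule.smul_mem _ _ (hh i hi))
      · exact hmem _ (by simp [hn]) (fun j hj => by
          rw [Pi.add_apply, hsupp b i hi j hj, hS j hj, add_zero]) hd'
          (lie_mem_wsp B (cG_mem B b i) hx)
  have hle : subalg B S ≤ T := LieSubalgebra.lieSpan_le.2 (by
    rintro _ ⟨i, hi, rfl | rfl | rfl⟩
    · exact hgen true i hi
    · exact hgen false i hi
    · refine ⟨hh i hi, ext _ (fun j hj => ?_) (fun d hd hn hS x hx => ?_)⟩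
      · rw [lie_hG_hG]
        exact zero_mem _
      · rw [hx (some i)]
        exact Submodule.smul_mem _ _ (hmem d hn hS hd hx))
  exact fun z hz => (hle hz).1

theorem mem_span_of_mem_subalg (S : Set I) {z : B₀ B} (hz : z ∈ subalg B S)
    (hz' : z ∈ wsp B (B₀ B) 0) : z ∈ Submodule.span K {z | ∃ i ∈ S, hG B (some i) = z} := by
  refine mem_of_mem_sup_iSup_eigen (fun k => LieModule.toEnd K (B₀ B) (B₀ B) (hG B k))
    (rootVal B) (rootVal_injective hB) (wsp B (B₀ B)) (fun d x hx k => hx k) (i := 0) ?_ hz' ?_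
  · refine Submodule.span_le.2 ?_
    rintro _ ⟨i, -, rfl⟩
    exact hG_mem B (some i)
  · have hle : (⨆ d : {d : Option I → ℤ // d ≠ 0 ∧ d none = 0 ∧ ∀ i, i ∉ S → d (some i) = 0},
        wsp B (B₀ B) d.1) ≤ ⨆ d, ⨆ _ : d ≠ 0, wsp B (B₀ B) d :=
      iSup_le fun d => le_iSup₂_of_le d.1 d.2.1 le_rfl
    exact sup_le_sup le_rfl hle (subalg_le B hB S hz)

end Subalg

end Cartanification

namespace Cartanification

/-! ### A maximum principle for generalised Cartan matrices -/

section NullVectors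

/-- An indecomposable symmetrisable generalised Cartan matrix with a positive vector `n` such that
`A n` is nonnegative and nonzero is nondegenerate. -/
theorem mulVec_eq_zero_of_null {J K : Type*} [Fintype J] [Field K] [CharZero K]
    (A : Matrix J J ℤ) (hA : ∀ i j, i ≠ j → A i j ≤ 0) (P : Set J) (n : J → ℤ)
    (hn : ∀ j ∈ P, 0 < n j) (hn' : ∀ j ∉ P, n j = 0) (hp : ∀ j ∈ P, 0 ≤ ∑ k, A j k * n k)
    (hconn : ∀ Z ⊆ P, Z.Nonempty → Z ≠ P → ∃ j ∈ Z, ∃ k ∈ P, k ∉ Z ∧ A j k ≠ 0)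
    (b : J → K) (hb : b ≠ 0) (hb' : ∀ j ∉ P, b j = 0) (hAb : ∀ j ∈ P, ∑ k, (A j k : K) * b k = 0) :
    ∀ j ∈ P, ∑ k, A j k * n k = 0 := by
  -- Since A has integral entries, a ℚ-linear functional on K that does not vanish on some
  -- coordinate of `b` gives a rational null vector. A choice of sign makes one coordinate positive,
  -- and the order on ℚ becomes available.
  obtain ⟨β, hβ', hAβ, j₁, hj₁⟩ : ∃ β : J → ℚ, (∀ j ∉ P, β j = 0) ∧
      (∀ j ∈ P, ∑ k, (A j k : ℚ) * β k = 0) ∧ ∃ j, 0 < β j := by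
    obtain ⟨j₁, hj₁⟩ := Function.ne_iff.1 hb
    obtain ⟨φ, hφ⟩ : ∃ φ : K →ₗ[ℚ] ℚ, φ (b j₁) ≠ 0 := by
      by_contra! h
      exact hj₁ ((Module.forall_dual_apply_eq_zero_iff ℚ (b j₁)).1 h)
    have hφA : ∀ c : ℚ, ∀ j ∈ P, ∑ k, (A j k : ℚ) * (c * φ (b k)) = 0 := fun c j hj => by
      have h := congrArg φ (hAb j hj)
      rw [map_sum, map_zero] at h
      have h' : ∀ k, φ ((A j k : K) * b k) = (A j k : ℚ) * φ (b k) := fun k => by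
        rw [← zsmul_eq_mul, map_zsmul, zsmul_eq_mul]
      simp only [h'] at h
      rw [← mul_zero c, ← h, Finset.mul_sum]
      exact Finset.sum_congr rfl fun k _ => by ring
    rcases lt_or_gt_of_ne hφ with hlt | hlt
    · exact ⟨fun j => -1 * φ (b j), fun j hj => by simp [hb' j hj], hφA (-1), j₁, by linarith⟩
    · exact ⟨fun j => 1 * φ (b j), fun j hj => by simp [hb' j hj], hφA 1, j₁, by linarith⟩
  classical
  have hj₁P : j₁ ∈ P := by
    by_contra h
    rw [hβ' j₁ h] at hj₁
    exact lt_irrefl _ hj₁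
  -- With t the largest ratio β_j / n_j on `P`, the vector t n - β is nonnegative and has a zero in
  -- `P`; moreover t is positive because some β_j is.
  obtain ⟨j₀, hj₀, hmax⟩ := Finset.exists_max_image (Finset.univ.filter (· ∈ P))
    (fun j => β j / n j) ⟨j₁, by simpa using hj₁P⟩
  simp only [Finset.mem_filter, Finset.mem_univ, true_and] at hj₀ hmax
  set t := β j₀ / n j₀ with ht
  have hnQ : ∀ j ∈ P, (0 : ℚ) < n j := fun j hj => by exact_mod_cast hn j hj
  have htpos : 0 < t := lt_of_lt_of_le (div_pos hj₁ (hnQ _ hj₁P)) (hmax j₁ hj₁P)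
  have hγ : ∀ j, 0 ≤ t * n j - β j := fun j => by
    by_cases hj : j ∈ P
    · have := hmax j hj
      rw [div_le_iff₀ (hnQ j hj)] at this
      linarith
    · rw [hn' j hj, hβ' j hj]; simp
  have hAγ : ∀ j ∈ P, ∑ k, (A j k : ℚ) * (t * n k - β k) = t * (∑ k, A j k * n k : ℤ) := by
    intro j hj
    simp only [mul_sub, Finset.sum_sub_distrib, hAβ j hj, sub_zero]
    push_cast
    rw [Finset.mul_sum]
    exact Finset.sum_congr rfl fun k _ => by ring
  have hterm : ∀ j, t * n j - β j = 0 → ∀ k, (A j k : ℚ) * (t * n k - β k) ≤ 0 := by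
    intro j hj k
    by_cases hjk : j = k
    · subst hjk; rw [hj, mul_zero]
    · exact mul_nonpos_of_nonpos_of_nonneg (by exact_mod_cast hA j k hjk) (hγ k)
  -- At a zero of t n - β the terms of the row sum are at most zero, while the sum is t (A n)_j ≥ 0.
  -- So the zeros spread along the edges of the diagram, and by connectedness t n = β on `P`.
  let Z : Set J := {j | j ∈ P ∧ t * n j - β j = 0}
  have hZP : Z = P := by
    by_contra hne
    have hj₀Z : j₀ ∈ Z := ⟨hj₀, by rw [ht, div_mul_cancel₀ _ (hnQ _ hj₀).ne', sub_self]⟩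
    obtain ⟨j, hj, k, hk, hkZ, hjk⟩ := hconn Z (fun j hj => hj.1) ⟨j₀, hj₀Z⟩ hne
    have hkne : t * n k - β k ≠ 0 := fun h => hkZ ⟨hk, h⟩
    have hjk' : j ≠ k := fun h => hkZ (h ▸ hj)
    have hlt : ∑ k, (A j k : ℚ) * (t * n k - β k) < 0 :=
      Finset.sum_neg' (fun k _ => hterm j hj.2 k) ⟨k, Finset.mem_univ _, mul_neg_of_neg_of_pos
        (by exact_mod_cast lt_of_le_of_ne (hA j k hjk') hjk) (lt_of_le_of_ne (hγ k) (Ne.symm hkne))⟩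
    rw [hAγ j hj.1] at hlt
    have : (0 : ℚ) ≤ (∑ k, A j k * n k : ℤ) := by exact_mod_cast hp j hj.1
    exact absurd hlt (not_lt.2 (mul_nonneg htpos.le this))
  intro j hj
  have h0 : ∑ k, (A j k : ℚ) * (t * n k - β k) = 0 := by
    refine Finset.sum_eq_zero fun k _ => ?_
    by_cases hk : k ∈ P
    · rw [← hZP] at hk
      rw [hk.2, mul_zero]
    · rw [hn' k hk, hβ' k hk]; simp
  rw [hAγ j hj] at h0
  exact_mod_cast (mul_eq_zero.1 h0).resolve_left htpos.ne'

end NullVectors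

/-! ### The action of 𝔤⁻ on e_0 and f_0, sl₂-theory and ideals of subalgebras -/

namespace Triple

variable {K : Type*} [Field K] [CharZero K] {r : ℕ} (T : Triple K r)

theorem B_diag (i : Fin r) : T.B (some i) (some i) = 2 := by simp [B, T.diag]

section

variable (hB : T.B.det ≠ 0) (hlam : T.wt = T.up)

include hB

theorem lie_e0_eq_zero {i : Fin r} (hi : T.lam i = 0) : ⁅cG T.B true i, e0 T.B⁆ = 0 :=
  Subtype.ext (by
    simpa using chev_mul_chev_eq_zero T.B (T.isUnit_det hB) true (i := i) (j := none) (by simp)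
      (T.B_diag i) (by simp [B, wt, hi]) (by simp [B, up, hi]))

theorem lie_f0_f_eq_zero {i : Fin r} (hi : T.lam i = 0) : ⁅cG T.B false i, f0 T.B⁆ = 0 :=
  Subtype.ext (by
    simpa using chev_mul_chev_eq_zero T.B (T.isUnit_det hB) false (i := i) (j := none) (by simp)
      (T.B_diag i) (by simp [B, wt, hi]) (by simp [B, up, hi]))

theorem lie_lie_eq_zero (b : Bool) {i : Fin r} (hi : T.lam i = 1) :
    chev T.B b (some i) * (chev T.B b (some i) * chev T.B b none) = 0 := by
  have := power_eq_zero T.B (T.isUnit_det hB) b i (j := none) (n := 1) (by simp) (T.B_diag i)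
    (by simp [B, wt, hi]) (by simp)
  rwa [power_succ, power_succ] at this

/-- The subalgebra `𝔤⁻` annihilates `e_0` and `f_0`. -/
theorem lie_gMinus {z : B₀ T.B} (hz : z ∈ T.gMinus) : ⁅z, e0 T.B⁆ = 0 ∧ ⁅z, f0 T.B⁆ = 0 := by
  let S : LieSubalgebra K (B₀ T.B) :=
    { carrier := {z | ⁅z, e0 T.B⁆ = 0 ∧ ⁅z, f0 T.B⁆ = 0}
      add_mem' := fun ha hb => by simp [ha.1, ha.2, hb.1, hb.2]
      zero_mem' := by simp
      smul_mem' := fun c z hz => by simp [hz.1, hz.2]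
      lie_mem' := fun {y z} hy hz => by simp [lie_lie, hy.1, hy.2, hz.1, hz.2] }
  have hle : T.gMinus ≤ S := LieSubalgebra.lieSpan_le.2 (by
    rintro _ ⟨i, hi, rfl | rfl | rfl⟩
    · exact ⟨T.lie_e0_eq_zero hB hi, lie_e_f0 T.B i⟩
    · exact ⟨lie_f_e0 T.B i, T.lie_f0_f_eq_zero hB hi⟩
    · have hi' : (T.lam i : K) = 0 := by
        have : T.lam i = 0 := hi
        rw [this, Nat.cast_zero]
      refine ⟨?_, ?_⟩
      · rw [e0_mem T.B (some i), rootVal_single]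
        simp [B, wt, hi']
      · rw [f0_mem T.B (some i), rootVal_neg, Pi.neg_apply, rootVal_single]
        simp [B, wt, hi'])
  exact hle hz

theorem sl2 (j : Fin r) : IsSl2Triple (hG T.B (some j)) (cG T.B true j) (cG T.B false j) where
  h_ne_zero h := cart_ne_zero T.B (T.isUnit_det hB) (some j) (congrArg Subtype.val h)
  lie_e_f := by simpa [chevCoeff] using lie_cG_cG_self T.B true j
  lie_h_e_nsmul := by
    rw [lie_hG_cG, T.B_diag, ofNat_smul_eq_nsmul K 2 (cG T.B true j) |>.symm]
    simp [bsgn]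
  lie_h_f_nsmul := by
    rw [lie_hG_cG, T.B_diag, ofNat_smul_eq_nsmul K 2 (cG T.B false j) |>.symm]
    simp [bsgn]

/-- The generators act locally nilpotently. -/
theorem exists_ad_pow_eq_zero (b : Bool) (j : Fin r) (z : B₀ T.B) :
    ∃ n : ℕ, ((LieAlgebra.ad K (B₀ T.B) (cG T.B b j)) ^ n) z = 0 := by
  -- The elements killed by a power of ad form the Engel subalgebra, so only generators matter. For
  -- a different node and the same sign this is the Serre relation; the other cases need at most
  -- three applications.
  have h := subalgebra_eq_top T.B (T.isUnit_det hB) (LieSubalgebra.engel K (cG T.B b j)) ?_ ?_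
  · have hz : z ∈ LieSubalgebra.engel K (cG T.B b j) := h ▸ LieSubalgebra.mem_top z
    exact (LieSubalgebra.mem_engel_iff K _ _).1 hz
  · intro b' i
    rw [LieSubalgebra.mem_engel_iff]
    by_cases hij : i = j
    · subst hij
      by_cases hb : b' = b
      · subst hb
        exact ⟨1, by simp⟩
      · obtain rfl : b' = !b := by cases b <;> cases b' <;> simp_all
        refine ⟨3, ?_⟩
        simp only [pow_succ, pow_zero, one_mul, Module.End.mul_apply, LieAlgebra.ad_apply]
        rw [lie_cG_cG_self, lie_smul, lie_smul, ← lie_skew _ (hG T.B (some i)), lie_hG_cG, lie_neg,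
          lie_smul, lie_self]
        simp
    · by_cases hb : b' = b
      · subst hb
        have hn : T.B (some j) (some i) = -(((-(T.A j i)).toNat : ℕ) : K) := by
          have : (((-(T.A j i)).toNat : ℕ) : ℤ) = -(T.A j i) :=
            Int.toNat_of_nonneg (by have := T.offDiag j i (Ne.symm hij); omega)
          rw [← Int.cast_natCast (R := K), this]
          simp [B]
        have := power_eq_zero T.B (T.isUnit_det hB) b' j (j := some i) (n := (-(T.A j i)).toNat)
          (fun h => hij (Option.some_injective _ h)) (T.B_diag j) hn (fun h0 => by
            have h₁ := T.offDiag j i (Ne.symm hij)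
            have h₂ : T.A j i = 0 := by omega
            simp [B, T.zero j i h₂])
        refine ⟨(-(T.A j i)).toNat + 1, Subtype.ext ?_⟩
        have key : ∀ n, (((LieAlgebra.ad K (B₀ T.B) (cG T.B b' j)) ^ n) (cG T.B b' i) :
            ContrAlg T.B) = power T.B b' j (some i) n := by
          intro n
          induction n with
          | zero => simp [power]
          | succ n ih => rw [pow_succ', power_succ, ← ih]; simp
        rw [key, this]
        rfl
      · obtain rfl : b' = !b := by cases b <;> cases b' <;> simp_all
        exact ⟨1, by simpa using lie_cG_cG_ne T.B b (Ne.symm hij)⟩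
  · intro i
    rw [LieSubalgebra.mem_engel_iff]
    refine ⟨2, ?_⟩
    simp only [pow_succ, pow_zero, one_mul, Module.End.mul_apply, LieAlgebra.ad_apply]
    rw [← lie_skew _ (hG T.B i), lie_hG_cG, lie_neg, lie_smul, lie_self]
    simp

/-- The weight of a singular vector of finite type is a natural number. -/
theorem exists_nat_of_singular {N : Type*} [AddCommGroup N] [Module K N]
    [LieRingModule (B₀ T.B) N] [LieModule K (B₀ T.B) N] (j : Fin r) {m : N} {μ : K} (hm : m ≠ 0)
    (he : ⁅cG T.B true j, m⁆ = 0) (hh : ⁅hG T.B (some j), m⁆ = μ • m)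
    (hf : ∃ n : ℕ, ((LieModule.toEnd K (B₀ T.B) N (cG T.B false j)) ^ n) m = 0) :
    ∃ n : ℕ, μ = n ∧ (n = 0 → ⁅cG T.B false j, m⁆ = 0) := by
  have P : (T.sl2 hB j).HasPrimitiveVectorWith m μ := ⟨hm, hh, he⟩
  -- Let f^n m be the last nonzero power. Applying e to f^(n+1) m = 0 gives (n+1)(μ - n) f^n m = 0,
  -- so μ = n.
  obtain ⟨n, hn₁, hn₂⟩ := Nat.exists_not_and_succ_of_not_zero_of_exists
    (p := fun n => ((LieModule.toEnd K (B₀ T.B) N (cG T.B false j)) ^ n) m = 0) (by simpa using hm) hf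
  have h := P.lie_e_pow_succ_toEnd_f n
  rw [hn₂, lie_zero] at h
  have h₁ := (smul_eq_zero.1 h.symm).resolve_right hn₁
  have h₂ : (n + 1 : K) ≠ 0 := by exact_mod_cast n.succ_ne_zero
  refine ⟨n, sub_eq_zero.1 ((mul_eq_zero.1 h₁).resolve_left h₂), ?_⟩
  rintro rfl
  simpa using hn₂

/-- Root vectors are defined by the h_i with i in I only. In these subalgebras the coordinate at the
node 0 is zero, so by invertibility of A those eigenvalues already separate degrees, and the vector
is homogeneous. -/
theorem exists_degree {S : Set (Fin r)} {α : Fin r → K} {x : B₀ T.B}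
    (hx : T.IsRootVector (subalg T.B S) α x) : ∃ d : Option (Fin r) → ℤ, d none = 0 ∧
      (∀ i, i ∉ S → d (some i) = 0) ∧ x ∈ wsp T.B (B₀ T.B) d ∧ T.lab d = α := by
  let D := {d : Option (Fin r) → ℤ // d none = 0 ∧ ∀ i, i ∉ S → d (some i) = 0}
  let Tk : Fin r → Module.End K (B₀ T.B) :=
    fun k => LieModule.toEnd K (B₀ T.B) (B₀ T.B) (hG T.B (some k))
  have h := le_iSup_inf_of_stable Tk (fun d : D => T.lab d.1)
    (fun d d' h => Subtype.ext (T.rootVal_some_injective (d.2.1.trans d'.2.1.symm)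
      fun i => congrFun h i))
    (fun d : D => wsp T.B (B₀ T.B) d.1) (fun d x hx k => hx (some k)) (Submodule.span K {x})
    (fun k y hy => by
      obtain ⟨c, rfl⟩ := Submodule.mem_span_singleton.1 hy
      rw [map_smul]
      refine Submodule.smul_mem _ _ ?_
      change ⁅hG T.B (some k), x⁆ ∈ _
      rw [hx.lie_h k]
      exact Submodule.smul_mem _ _ (Submodule.mem_span_singleton_self x))
    (by
      rw [Submodule.span_le, Set.singleton_subset_iff]
      have hle : Submodule.span K {z | ∃ i ∈ S, hG T.B (some i) = z} ⊔
          ⨆ d : {d : Option (Fin r) → ℤ // d ≠ 0 ∧ d none = 0 ∧ ∀ i, i ∉ S → d (some i) = 0},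
            wsp T.B (B₀ T.B) d.1 ≤ ⨆ d : D, wsp T.B (B₀ T.B) d.1 := by
        refine sup_le (Submodule.span_le.2 ?_) (iSup_le fun d => ?_)
        · rintro _ ⟨i, -, rfl⟩
          exact Submodule.mem_iSup_of_mem (⟨0, rfl, fun _ _ => rfl⟩ : D) (hG_mem T.B (some i))
        · exact le_iSup (fun d : D => wsp T.B (B₀ T.B) d.1) ⟨d.1, d.2.2⟩
      exact hle (subalg_le T.B (T.isUnit_det hB) S hx.mem))
  by_contra! hne
  refine hx.ne_zero ?_
  have : x ∈ ⨆ d : D, Submodule.span K {x} ⊓ wsp T.B (B₀ T.B) d.1 :=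
    h (Submodule.mem_span_singleton_self x)
  have hbot : ⨆ d : D, Submodule.span K {x} ⊓ wsp T.B (B₀ T.B) d.1 ≤ ⊥ := by
    refine iSup_le ?_
    rintro ⟨d, hn, hS⟩ y ⟨hy, hy'⟩
    obtain ⟨c, rfl⟩ := Submodule.mem_span_singleton.1 hy
    by_contra hy0
    have hc : c ≠ 0 := by rintro rfl; simp at hy0
    have hxd : x ∈ wsp T.B (B₀ T.B) d := by
      have := Submodule.smul_mem _ c⁻¹ hy'
      rwa [smul_smul, inv_mul_cancel₀ hc, one_smul] at this
    refine hne d hn hS hxd (funext fun i => ?_)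
    have h₁ := hxd (some i)
    rw [hx.lie_h i] at h₁
    exact (smul_left_injective K hx.ne_zero h₁).symm
  exact (Submodule.mem_bot K).1 (hbot this)

/-- A positive root vector annihilated by the `e_k` generates some `e_k`. -/
theorem exists_e_mem_words {S : Set (Fin r)} {d : Option (Fin r) → ℤ} {u : B₀ T.B}
    (hu : u ∈ wsp T.B (B₀ T.B) d) (hu0 : u ≠ 0) (hd : 0 ≤ d) (hd0 : d ≠ 0)
    (hS : ∀ i, i ∉ S → d (some i) = 0) :
    ∃ k, 0 < d (some k) ∧ cG T.B true k ∈ words T.B S false u := by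
  have hB' := T.isUnit_det hB
  -- Starting from `u`, lower the height until it is one. A nonzero positive root vector is not
  -- annihilated by all lowering generators, and f_0 does annihilate it; hence a letter in the
  -- support of `d` always works.
  have key : ∀ n : ℕ, ∀ d' : Option (Fin r) → ℤ, ∀ x ∈ words T.B S false u, 0 ≤ d' → d' ≤ d →
      x ∈ wsp T.B (B₀ T.B) d' → x ≠ 0 → ht d' = n + 1 →
      ∃ k, 0 < d (some k) ∧ cG T.B true k ∈ words T.B S false u := by
    intro n
    induction n with
    | zero =>
      intro d' x hx hd' hle hxd hx0 hht
      obtain ⟨i, rfl⟩ := exists_chev_of_ht T.B hB' true ((mem_wsp_zero T.B).1 hxd)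
        (fun h => hx0 (Subtype.ext h)) (by simpa [bsgn] using hht)
      obtain ⟨c, hc⟩ := mem_span_chev T.B hB' true i ((mem_wsp_zero T.B).1 hxd)
      have hn := T.none_eq_zero hB hxd hx0
      rcases i with _ | k
      · simp [bsgn] at hn
      · obtain rfl : x = c • cG T.B true k := Subtype.ext (by simpa using hc)
        have hc : c ≠ 0 := by rintro rfl; simp at hx0
        refine ⟨k, ?_, ?_⟩
        · have := hle (some k)
          simp [bsgn] at this
          omega
        · have := Submodule.smul_mem _ c⁻¹ hx
          rwa [smul_smul, inv_mul_cancel₀ hc, one_smul] at this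
    | succ n ih =>
      intro d' x hx hd' hle hxd hx0 hht
      obtain ⟨i, hi⟩ := exists_chev_mul_ne_zero T.B hB' true (by
        simp only [bsgn]; push_cast at hht; omega) ((mem_wsp_zero T.B).1 hxd)
        (fun h => hx0 (Subtype.ext h))
      rcases i with _ | k
      · exfalso
        have h0 := congrArg Subtype.val (T.lie_f0_eq_zero hB hxd hd' (by
          rintro rfl; simp at hht; omega))
        rw [coe_lie_m, coe_f0, skew_zero T.B x.2] at h0
        exact hi (neg_eq_zero.1 h0)
      · have hxk : ⁅cG T.B false k, x⁆ ≠ 0 := fun h => hi (by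
          have := congrArg Subtype.val h
          simpa using this)
        have hm := lie_mem_wsp T.B (cG_mem T.B false k) hxd
        have hht' : ht (bsgn false • Pi.single (some k) 1 + d') = n + 1 := by
          rw [ht_add, ht_smul_single, hht]
          simp [bsgn]
        have hpos : 0 ≤ bsgn false • Pi.single (some k) 1 + d' := by
          rcases T.nonneg_or_nonpos hB hm hxk with h | h
          · exact h
          · exfalso
            have : ht (bsgn false • Pi.single (some k) 1 + d') ≤ 0 :=
              Finset.sum_nonpos fun j _ => h j
            omega
        have hk : 0 < d (some k) := by
          have h₁ := hpos (some k)
          have h₂ : d' (some k) ≤ d (some k) := hle (some k)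
          simp [bsgn] at h₁
          omega
        have hkS : k ∈ S := by
          by_contra h
          have := hS k h
          omega
        refine ih _ _ (lie_c_mem_words T.B hkS hx) hpos (le_trans ?_ hle) hm hxk hht'
        intro j
        have : (0 : ℤ) ≤ (Pi.single (some k) 1 : Option (Fin r) → ℤ) j := by
          by_cases h : j = some k
          · subst h; simp
          · simp [h]
        simp [bsgn]
        exact this
  have hpos : 0 < ht d := by
    obtain ⟨j, hj⟩ := Function.ne_iff.1 hd0
    exact Finset.sum_pos' (fun j _ => hd j) ⟨j, Finset.mem_univ _, lt_of_le_of_ne (hd j) (Ne.symm hj)⟩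
  exact key (ht d - 1).toNat d u (self_mem_words T.B S false u) hd le_rfl hu hu0 (by omega)

/-- An ideal that contains `e_k` contains the positive root vectors with `k` in the support. -/
theorem mem_of_e_mem {S : Set (Fin r)} {J : Submodule K (B₀ T.B)}
    (hJ : ∀ z ∈ subalg T.B S, ∀ x ∈ J, ⁅z, x⁆ ∈ J) {k : Fin r} (hk : cG T.B true k ∈ J)
    {d : Option (Fin r) → ℤ} {x : B₀ T.B} (hx : x ∈ wsp T.B (B₀ T.B) d) (hd : 0 ≤ d)
    (hn : d none = 0) (hS : ∀ i, i ∉ S → d (some i) = 0) (hkd : 0 < d (some k)) : x ∈ J := by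
  have hB' := T.isUnit_det hB
  -- Outer letters are stripped until the letter e_k is reached. It is then either the whole word or
  -- bracketed with a word in the subalgebra, and in both cases the result is in `J`.
  have key : ∀ l (i : Option (Fin r)), (∀ j ∈ i :: l, j ∈ some '' S) → some k ∈ i :: l →
      ∃ z ∈ J, (z : ContrAlg T.B) = rn T.B true l i := by
    intro l i hl hkl
    induction l with
    | nil =>
      simp only [List.mem_singleton] at hkl
      subst hkl
      exact ⟨_, hk, coe_cG T.B true k⟩
    | cons j l ih =>
      have hl' : ∀ j ∈ i :: l, j ∈ some '' S := fun j hj =>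
        hl j (by simp only [List.mem_cons] at hj ⊢; tauto)
      obtain ⟨j', hj', rfl⟩ := hl j (by simp)
      by_cases hkl' : some k ∈ i :: l
      · obtain ⟨z, hz, e⟩ := ih hl' hkl'
        refine ⟨⁅cG T.B true j', z⁆, hJ _ (cG_mem_subalg T.B true hj') z hz, ?_⟩
        rw [rn, ← e, ← coe_cG]
        rfl
      · obtain rfl : k = j' := by
          simp only [List.mem_cons, Option.some.injEq] at hkl hkl'
          tauto
        obtain ⟨z, hz, e⟩ := rn_mem_subalg T.B true l i hl'
        refine ⟨-⁅z, cG T.B true k⁆, neg_mem (hJ z hz _ hk), ?_⟩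
        rw [lie_skew, rn, ← e, ← coe_cG]
        rfl
  have hpos : 0 < bsgn true * ∑ j, d j := by
    rw [bsgn, one_mul]
    exact Finset.sum_pos' (fun j _ => hd j) ⟨some k, Finset.mem_univ _, hkd⟩
  have h₁ : (x : ContrAlg T.B) ∈ J.map (comp T.B 0).subtype := by
    refine Submodule.span_le.2 ?_ (mem_span_rn T.B hB' true hpos ((mem_wsp_zero T.B).1 hx))
    rintro _ ⟨l, i, hl, rfl⟩
    obtain ⟨z, hz, e⟩ := key l i (mem_of_cnt_smul hl hn hS) (by
      rw [← cnt_pos, ← one_smul ℤ (cnt (i :: l)), show (1 : ℤ) = bsgn true from rfl, hl]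
      exact hkd)
    exact ⟨z, hz, e⟩
  obtain ⟨z', hz', e⟩ := h₁
  rwa [← Subtype.ext e]

end

end Triple

end Cartanification

namespace Cartanification

/-! ### Homogeneous components of words -/

section Words

variable {K : Type*} [Field K] [CharZero K] {I : Type} [Fintype I] [DecidableEq I]
  (B : Matrix (Option I) (Option I) K)
  {N : Type*} [AddCommGroup N] [Module K N] [LieRingModule (B₀ B) N] [LieModule K (B₀ B) N]

theorem mem_span_words (hB : IsUnit B.det) {S : Set I} {b : Bool} {v x : N}
    {d d' : Option I → ℤ} (hv : v ∈ wsp B N d) (hx : x ∈ words B S b v) (hx' : x ∈ wsp B N d') :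
    x ∈ Submodule.span K {y | ∃ l, (∀ i ∈ l, i ∈ S) ∧ d + bsgn b • dg l = d' ∧
      app B b v l = y} := by
  have hw : words B S b v = Submodule.span K
      (Set.range fun l : {l : List I // ∀ i ∈ l, i ∈ S} => app B b v l.1) := by
    rw [words]
    congr 1
    ext y
    simp
  rw [hw] at hx
  have := mem_span_of_mem_eigen (fun k => LieModule.toEnd K (B₀ B) N (hG B k)) (rootVal B)
    (rootVal_injective hB) (wsp B N) (fun d x hx k => hx k)
    (fun l : {l : List I // ∀ i ∈ l, i ∈ S} => app B b v l.1) (fun l => d + bsgn b • dg l.1)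
    (fun l => app_mem_wsp B b hv l.1) hx' hx
  refine Submodule.span_mono ?_ this
  rintro _ ⟨l, hl, rfl⟩
  exact ⟨l.1, l.2, hl, rfl⟩

theorem words_le_subalg {S : Set I} {b : Bool} {v : B₀ B} (hv : v ∈ subalg B S) :
    words B S b v ≤ (subalg B S).toSubmodule := by
  refine Submodule.span_le.2 ?_
  rintro _ ⟨l, hl, rfl⟩
  induction l with
  | nil => exact hv
  | cons i l ih =>
    simp only [List.mem_cons, forall_eq_or_imp] at hl
    exact (subalg B S).lie_mem (cG_mem_subalg B b hl.1) (ih hl.2)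

end Words

namespace Triple

variable {K : Type*} [Field K] [CharZero K] {r : ℕ} (T : Triple K r)

/-! ### Connected supports and degrees of highest roots -/

section

variable (hB : T.B.det ≠ 0)

include hB

/-- The support of a root is connected. -/
theorem exists_adjacent {d : Option (Fin r) → ℤ} {x : B₀ T.B} (hx : x ∈ wsp T.B (B₀ T.B) d)
    (hx0 : x ≠ 0) (hd : 0 ≤ d) (Z : Set (Fin r)) (hZ : Z ⊆ {j | 0 < d (some j)})
    (hZ0 : Z.Nonempty) (hZne : Z ≠ {j | 0 < d (some j)}) :
    ∃ j ∈ Z, ∃ k ∈ {j | 0 < d (some j)}, k ∉ Z ∧ T.A j k ≠ 0 := by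
  by_contra! h
  have hB' := T.isUnit_det hB
  have hn := T.none_eq_zero hB hx hx0
  obtain ⟨j, hj⟩ := hZ0
  obtain ⟨k, hk, hkZ⟩ : ∃ k, 0 < d (some k) ∧ k ∉ Z := by
    by_contra! h'
    exact hZne (Set.Subset.antisymm hZ fun k hk => h' k hk)
  have hpos : 0 < bsgn true * ∑ j, d j := by
    rw [bsgn, one_mul]
    exact Finset.sum_pos' (fun j _ => hd j) ⟨some j, Finset.mem_univ _, hZ hj⟩
  refine hx0 (Subtype.ext ?_)
  have h₁ := mem_span_rn T.B hB' true hpos ((mem_wsp_zero T.B).1 hx)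
  have h₂ : (x : ContrAlg T.B) ∈ (⊥ : Submodule K (ContrAlg T.B)) := by
    refine Submodule.span_le.2 ?_ h₁
    rintro _ ⟨l, i, hl, rfl⟩
    have hmem : ∀ m, 0 < d (some m) → some m ∈ i :: l := fun m hm => by
      rw [← cnt_pos, ← one_smul ℤ (cnt (i :: l)), show (1 : ℤ) = bsgn true from rfl, hl]
      exact hm
    refine rn_eq_zero_of_disconnected T.B hB' T.B_diag true Z {j | 0 < d (some j)} ?_ l i
      (mem_of_cnt_smul hl hn ?_) ⟨some j, hmem j (hZ hj), j, hj, rfl⟩ ⟨some k, hmem k hk, ?_⟩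
    · intro a ha c hc hcZ
      have := h a ha c hc hcZ
      simp [B, this, T.zero a c this]
    · intro m hm
      exact le_antisymm (not_lt.1 hm) (hd _)
    · rintro ⟨k', hk', e⟩
      exact hkZ (Option.some_injective _ e ▸ hk')
  exact (Submodule.mem_bot K).1 h₂

/-- The degree of a highest root of `𝔤⁻`. -/
theorem highestRoot_degree {ϑ : Fin r → K} {e : B₀ T.B} (hϑ : T.IsHighestRoot ϑ)
    (he : T.IsRootVector T.gMinus ϑ e) : ∃ d : Option (Fin r) → ℤ, 0 ≤ d ∧ d ≠ 0 ∧ d none = 0 ∧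
      (∀ i, T.lam i ≠ 0 → d (some i) = 0) ∧ e ∈ wsp T.B (B₀ T.B) d ∧ T.lab d = ϑ ∧
      ∀ k, T.lam k = 0 → ⁅cG T.B true k, e⁆ = 0 := by
  obtain ⟨d, hn, hS, hed, rfl⟩ := T.exists_degree hB he
  have hd0 : d ≠ 0 := by
    rintro rfl
    refine hϑ.1.1 (funext fun i => ?_)
    simp [lab]
  -- Maximality of ϑ among the labels of roots of 𝔤⁻, rephrased for degrees.
  have hroot : ∀ d' : Option (Fin r) → ℤ, d' ≠ 0 → d' none = 0 →
      (∀ i, T.lam i ≠ 0 → d' (some i) = 0) → (∃ z ∈ wsp T.B (B₀ T.B) d', z ≠ 0) → 0 ≤ d' - d →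
      d' = d := by
    rintro d' hd' hn' hS' ⟨z, hz, hz0⟩ hle
    obtain ⟨h₁, h₂⟩ := T.isRootVector_of_mem hB {k | T.lam k = 0} hd' hn' hS' hz hz0
    refine T.rootVal_some_injective (hn'.trans hn.symm) fun i => ?_
    have h₃ := hϑ.2 (T.lab d') ⟨h₁, z, h₂⟩ (by
      have e : T.lab d' - T.lab d = T.lab (d' - d) := by
        funext i
        simp only [lab, Pi.sub_apply]
        rw [sub_eq_add_neg d', rootVal_add, rootVal_neg]
        simp [sub_eq_add_neg]
      rw [e]
      exact T.lab_nonneg (by simp [hn, hn']) hle)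
    exact congrFun h₃ i
  -- If `d` were nonpositive, a simple root of 𝔤⁻ at a node of its support would lie above it, and
  -- by maximality would equal it.
  have hd : 0 ≤ d := by
    refine (T.nonneg_or_nonpos hB hed he.ne_zero).resolve_right fun hneg => ?_
    obtain ⟨j, hj⟩ := Function.ne_iff.1 hd0
    rcases j with _ | k
    · exact hj hn
    have hk : T.lam k = 0 := by
      by_contra hk
      exact hj (hS k hk)
    have h₁ := hroot (Pi.single (some k) 1) (by simp) (by simp) (fun i hi => by
      have : i ≠ k := fun h => hi (h ▸ hk)
      simp [this]) ⟨cG T.B true k, by simpa [bsgn] using cG_mem T.B true k, fun h => by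
        have := congrArg Subtype.val h
        rw [coe_cG] at this
        exact chev_ne_zero T.B (T.isUnit_det hB) true (some k) this⟩
      (sub_nonneg.2 (hneg.trans (Pi.single_nonneg.2 zero_le_one)))
    have h₂ := hneg (some k)
    rw [← h₁] at h₂
    simp at h₂
  refine ⟨d, hd, hd0, hn, hS, hed, rfl, fun k hk => ?_⟩
  by_contra h0
  have h₁ := hroot (Pi.single (some k) 1 + d) (fun h => by
      have h₁ := congrFun h (some k)
      have h₂ : 0 ≤ d (some k) := hd (some k)
      simp at h₁
      omega) (by simp [hn]) (fun i hi => by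
      have : i ≠ k := fun h => hi (h ▸ hk)
      simp [this, hS i hi]) ⟨_, by simpa [bsgn] using lie_mem_wsp T.B (cG_mem T.B true k) hed, h0⟩
      (by rw [add_sub_cancel_right]; exact Pi.single_nonneg.2 zero_le_one)
  have h₂ := congrFun h₁ (some k)
  simp at h₂

end

/-! ### Which elements of 𝓑_0 can be the bracket of a singular vector with e_0 -/

section

variable (hB : T.B.det ≠ 0) (hpm : T.IsPseudoMinuscule T.up) (hlam : T.wt = T.up)

include hB hpm hlam

/-- Negative root vectors are not annihilated by the `e_k` in `𝔤⁻` and the squares of the other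
`e_i`. -/
theorem eq_zero_of_nonpos {d : Option (Fin r) → ℤ} {u : B₀ T.B} (hu : u ∈ wsp T.B (B₀ T.B) d)
    (hd : d ≤ 0) (hd0 : d ≠ 0) (h : ∀ k, T.lam k = 0 → ⁅cG T.B true k, u⁆ = 0)
    (h' : ∀ i, T.lam i = 1 → ⁅cG T.B true i, ⁅cG T.B true i, u⁆⁆ = 0) : u = 0 := by
  by_contra hu0
  have hB' := T.isUnit_det hB
  have hn := T.none_eq_zero hB hu hu0
  have hu' := (mem_wsp_zero T.B).1 hu
  have hu0' : (u : ContrAlg T.B) ≠ 0 := fun h => hu0 (Subtype.ext h)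
  have hneg : ht d < 0 := by
    obtain ⟨j, hj⟩ := Function.ne_iff.1 hd0
    exact Finset.sum_neg' (fun j _ => hd j) ⟨j, Finset.mem_univ _, lt_of_le_of_ne (hd j) hj⟩
  -- In height -1 the vector is a multiple of f_i, and one of [e_i, f_i] = h_i and [e_i, [e_i, f_i]]
  -- = -2 e_i contradicts the hypotheses, according to whether λ_i is 0 or 1.
  by_cases h1 : ht d = -1
  · obtain ⟨i, rfl⟩ := exists_chev_of_ht T.B hB' false hu' hu0' (by simpa [bsgn] using h1)
    rcases i with _ | i
    · simp [bsgn] at hn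
    obtain ⟨c, hc⟩ := mem_span_chev T.B hB' false (some i) hu'
    obtain rfl : u = c • cG T.B false i := Subtype.ext (by simpa using hc)
    have hc : c ≠ 0 := by rintro rfl; simp at hu0
    have e : ⁅cG T.B true i, c • cG T.B false i⁆ = c • hG T.B (some i) := by
      rw [lie_smul, (T.sl2 hB i).lie_e_f]
    rcases Nat.le_one_iff_eq_zero_or_eq_one.1 (T.lam_le_one hB hpm hlam i) with hi | hi
    · have := h i hi
      rw [e] at this
      exact smul_ne_zero hc (T.sl2 hB i).h_ne_zero this
    · have := h' i hi
      rw [e, lie_smul, ← lie_skew, (T.sl2 hB i).lie_h_e_smul K, smul_neg, neg_eq_zero] at this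
      exact smul_ne_zero hc (smul_ne_zero two_ne_zero (T.sl2 hB i).e_ne_zero) this
  -- Otherwise `u` is orthogonal to every word [e_j, rest] of opposite degree. If λ_j = 0,
  -- invariance moves e_j onto `u`. If not, the bound on the level forces all letters of the rest to
  -- have λ = 0, so that the rest commutes with `u`.
  obtain ⟨κ, θ, F⟩ := exists_formData T.B hB' T.symB
  have inv := F.invariant hB' T.symB_mul
  refine hu0' (F.eq_zero_of_orthogonal hB' T.symB_mul T.symB_ne_zero false
    (by simpa [bsgn] using hneg) hu' fun y hy => ?_)
  have hlev := T.abs_lev_le hB hpm hlam hu hu0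
  have hpos : 0 < bsgn true * ∑ j, (-d) j := by
    have := ht_neg d
    rw [ht] at this
    rw [bsgn, one_mul, this]
    omega
  have hy' := mem_span_rn T.B hB' true hpos hy
  have hle : Submodule.span K {y | ∃ l i, bsgn true • cnt (i :: l) = -d ∧ rn T.B true l i = y} ≤
      LinearMap.ker (κ u) := by
    refine Submodule.span_le.2 ?_
    rintro _ ⟨l, i, hl, rfl⟩
    change κ u (rn T.B true l i) = 0
    have hmem := mem_of_cnt_smul (S := Set.univ) hl (by simp [hn]) (by simp)
    have hanni : ∀ l (i : Option (Fin r)), (∀ j ∈ i :: l, j ∈ some '' {k | T.lam k = 0}) →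
        rn T.B true l i ∈ comp T.B 0 ∧ rn T.B true l i * u = 0 := by
      intro l i hl
      induction l with
      | nil =>
        obtain ⟨i, hi, rfl⟩ := hl i (by simp)
        refine ⟨by simpa [rn, lvl] using chev_mem T.B true (some i), ?_⟩
        have := congrArg Subtype.val (h i hi)
        simpa [rn] using this
      | cons j l ih =>
        obtain ⟨j, hj, rfl⟩ := hl j (by simp)
        obtain ⟨h₁, h₂⟩ := ih fun k hk => hl k (by simp only [List.mem_cons] at hk ⊢; tauto)
        have hc : chev T.B true (some j) ∈ comp T.B 0 := by
          simpa [lvl] using chev_mem T.B true (some j)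
        refine ⟨by simpa [rn] using mul_mem_comp hc h₁, ?_⟩
        have e := jacobi_zero T.B hc (rn T.B true l i) u
        have e' : chev T.B true (some j) * (u : ContrAlg T.B) = 0 := by
          have := congrArg Subtype.val (h j hj)
          simpa using this
        rw [h₂, e', mul_zero, mul_zero, add_zero] at e
        exact e.symm
    rcases l with _ | ⟨j, l⟩
    · exfalso
      have h₂ := congrArg ht hl
      have h₃ := sum_cnt [i]
      rw [bsgn, one_smul, ht_neg] at h₂
      change ht (cnt [i]) = _ at h₃
      rw [h₃] at h₂
      simp at h₂
      omega
    · obtain ⟨j, -, rfl⟩ := hmem j (by simp)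
      have hcu : κ u (rn T.B true (some j :: l) i) =
          -κ (chev T.B true (some j) * u) (rn T.B true l i) := by
        have hc : chev T.B true (some j) ∈ comp T.B 0 := by
          simpa [lvl] using chev_mem T.B true (some j)
        rw [rn, ← inv, skew_zero T.B hc]
        simp
      by_cases hj : T.lam j = 0
      · have := congrArg Subtype.val (h j hj)
        rw [coe_lie, coe_cG] at this
        rw [hcu, this]
        simp
      · have hrest : ∀ m ∈ i :: l, m ∈ some '' {k | T.lam k = 0} := by
          intro m hm
          obtain ⟨m, -, rfl⟩ := hmem m (by simp only [List.mem_cons] at hm ⊢; tauto)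
          refine ⟨m, ?_, rfl⟩
          by_contra hm0
          have hm0 : T.lam m ≠ 0 := hm0
          have e : -d = Pi.single (some j) 1 + cnt (i :: l) := by
            rw [← hl, bsgn, one_smul, cnt_cons, cnt_cons, cnt_cons]
            abel
          have h₁ := T.lev_neg d
          rw [e, T.lev_add, T.lev_single] at h₁
          have h₂ : 1 ≤ T.lev (cnt (i :: l)) := by
            have h₃ : (T.lam m : ℤ) * cnt (i :: l) (some m) ≤ T.lev (cnt (i :: l)) :=
              Finset.single_le_sum (f := fun j => (T.lam j : ℤ) * cnt (i :: l) (some j))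
                (fun k _ => mul_nonneg (Nat.cast_nonneg _) (cnt_nonneg _ _)) (Finset.mem_univ m)
            have h₄ : 0 < cnt (i :: l) (some m) := cnt_pos.2 hm
            have h₅ : 0 < (T.lam m : ℤ) := by exact_mod_cast Nat.pos_of_ne_zero hm0
            have := mul_pos h₅ h₄
            omega
          rw [abs_le] at hlev
          omega
        obtain ⟨h₁, h₂⟩ := hanni l i hrest
        have hc : chev T.B true (some j) ∈ comp T.B 0 := by
          simpa [lvl] using chev_mem T.B true (some j)
        rw [rn, skew_zero T.B hc, map_neg, ← inv, ← neg_neg ((u : ContrAlg T.B) * _),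
          ← skew_zero T.B h₁, h₂]
        simp
  exact hle hy'

omit hpm hlam in
/-- No element of the Cartan subalgebra is singular in the module generated by the root vector of
a highest root. -/
theorem eq_zero_of_cartan {d : Option (Fin r) → ℤ} {e u : B₀ T.B} (hed : e ∈ wsp T.B (B₀ T.B) d)
    (he0 : e ≠ 0) (hd : 0 ≤ d) (hd0 : d ≠ 0) (hS : ∀ i, T.lam i ≠ 0 → d (some i) = 0)
    (hek : ∀ k, T.lam k = 0 → ⁅cG T.B true k, e⁆ = 0)
    (hu : u ∈ wsp T.B (B₀ T.B) 0) (huw : u ∈ words T.B {k | T.lam k = 0} false e)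
    (huk : ∀ k, T.lam k = 0 → ⁅cG T.B true k, u⁆ = 0) : u = 0 := by
  classical
  by_contra hu0
  have hB' := T.isUnit_det hB
  have hn := T.none_eq_zero hB hed he0
  set P : Set (Fin r) := {j | 0 < d (some j)} with hPdef
  have hPS : ∀ j ∈ P, T.lam j = 0 := fun j hj => by
    by_contra h
    have : 0 < d (some j) := hj
    rw [hS j h] at this
    exact lt_irrefl _ this
  -- A word of degree zero has an outermost f_k applied to a multiple of e_k, hence is a multiple of
  -- h_k with k in the support of `d`.
  have huh : u ∈ Submodule.span K (Set.range fun j : P => hG T.B (some (j : Fin r))) := by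
    refine Submodule.span_le.2 ?_ (mem_span_words T.B hB' hed huw hu)
    rintro _ ⟨l, hl, hdl, rfl⟩
    have hdl' : d = dg l := by
      rw [bsgn, neg_smul, one_smul] at hdl
      exact add_neg_eq_zero.1 hdl
    rcases l with _ | ⟨k, l⟩
    · exact absurd hdl' hd0
    · have hk : k ∈ P := by
        have := dg_some_pos.2 (List.mem_cons_self (a := k) (l := l))
        rw [← hdl'] at this
        exact this
      have hm := app_mem_wsp T.B false hed l
      have hdeg : d + bsgn false • dg l = bsgn true • Pi.single (some k) 1 := by
        rw [hdl', dg_cons, bsgn, bsgn, neg_smul, one_smul, one_smul, add_neg_cancel_right]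
      rw [hdeg] at hm
      obtain ⟨c, hc⟩ := mem_span_chev T.B hB' true (some k) ((mem_wsp_zero T.B).1 hm)
      have hc' : app T.B false e l = c • cG T.B true k := Subtype.ext (by simpa using hc)
      rw [app, hc', lie_smul, ← lie_skew, (T.sl2 hB k).lie_e_f]
      exact Submodule.smul_mem _ _ (neg_mem (Submodule.subset_span ⟨⟨k, hk⟩, rfl⟩))
  obtain ⟨c, hc⟩ := (Submodule.mem_span_range_iff_exists_fun K).1 huh
  let c' : Fin r → K := fun k => if h : k ∈ P then c ⟨k, h⟩ else 0
  have hc' : ∀ k ∉ P, c' k = 0 := fun k hk => dif_neg hk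
  have hsum : u = ∑ k, c' k • hG T.B (some k) := by
    rw [← hc]
    have h₁ : ∀ j : P, c j • hG T.B (some (j : Fin r)) =
        c' (j : Fin r) • hG T.B (some (j : Fin r)) := fun j => by
      simp only [c', dif_pos j.2]
    rw [Finset.sum_congr rfl fun j _ => h₁ j]
    rw [← Finset.sum_subtype_eq_sum_filter (p := (· ∈ P)) (s := Finset.univ)
      (f := fun k => c' k • hG T.B (some k)) |>.trans (Finset.sum_filter_of_ne fun k _ hk => by
        by_contra h
        exact hk (by rw [hc' k h, zero_smul]))]
    refine Finset.sum_congr ?_ fun _ _ => rfl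
    ext; simp
  -- Commuting with the e_j makes the coefficients a null vector of the transpose of A on the
  -- relevant nodes. The symmetriser later turns it into a null vector of A with coordinates c_k
  -- ε_k.
  have hnull : ∀ j, T.lam j = 0 → ∑ k, c' k * (T.A k j : K) = 0 := by
    intro j hj
    have h₁ := huk j hj
    rw [hsum, lie_sum] at h₁
    have h₂ : ∀ k, ⁅cG T.B true j, c' k • hG T.B (some k)⁆ =
        -(c' k * (T.A k j : K)) • cG T.B true j := fun k => by
      rw [lie_smul, ← lie_skew, lie_hG_cG, smul_neg, smul_smul, neg_smul]
      simp [bsgn, B]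
    simp only [h₂, ← Finset.sum_smul, Finset.sum_neg_distrib] at h₁
    exact neg_eq_zero.1 ((smul_eq_zero.1 h₁).resolve_right (T.sl2 hB j).e_ne_zero)
  have hlab : ∀ j, rootVal T.B d (some j) = ((∑ k, T.A j k * d (some k) : ℤ) : K) := fun j => by
    rw [T.rootVal_some, hn]
    simp
  have hnat : ∀ j, T.lam j = 0 → ∃ n : ℕ, ((∑ k, T.A j k * d (some k) : ℤ) : K) = n ∧
      (n = 0 → ⁅cG T.B false j, e⁆ = 0) := fun j hj =>
    T.exists_nat_of_singular hB j he0 (hek j hj) (by rw [hed (some j), hlab])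
      (T.exists_ad_pow_eq_zero hB false j e)
  -- The coordinates of `d` are positive on its connected support, where A d ≥ 0 because `e` is a
  -- singular vector for the sl₂ of each node. In the presence of a null vector this forces A d = 0
  -- there.
  have hp0 := mulVec_eq_zero_of_null T.A T.offDiag P (fun j => d (some j)) (fun j hj => hj)
    (fun j hj => le_antisymm (not_lt.1 hj) (hd _)) (fun j hj => by
      obtain ⟨n, hn, -⟩ := hnat j (hPS j hj)
      have : ∑ k, T.A j k * d (some k) = (n : ℤ) := by exact_mod_cast hn
      rw [this]
      exact Nat.cast_nonneg n)
    (fun Z hZ hZ0 hZne => T.exists_adjacent hB hed he0 hd Z hZ hZ0 hZne)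
    (fun k => c' k * T.ε k) (fun h => hu0 (by
      rw [hsum]
      refine Finset.sum_eq_zero fun k _ => ?_
      have := congrFun h k
      rw [(mul_eq_zero.1 this).resolve_right (T.ε_ne k), zero_smul]))
    (fun j hj => by simp [hc' j hj])
    (fun j hj => by
      have h₁ := hnull j (hPS j hj)
      rw [← mul_zero (T.ε j), ← h₁, Finset.mul_sum]
      refine Finset.sum_congr rfl fun k _ => ?_
      have h₂ := T.symm j k
      have h₃ := T.ε_ne j
      have h₄ := T.ε_ne k
      field_simp at h₂
      linear_combination c' k * h₂)
  have hpos : 0 < bsgn true * ht d := by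
    obtain ⟨j, hj⟩ := Function.ne_iff.1 hd0
    rw [bsgn, one_mul]
    exact Finset.sum_pos' (fun j _ => hd j) ⟨j, Finset.mem_univ _, lt_of_le_of_ne (hd j) (Ne.symm hj)⟩
  -- Some lowering generator does not annihilate `e`. It is not f_0, and its node is in the support
  -- of `d` by sign coherence; but a singular vector of weight zero for sl₂ is annihilated by f_i.
  obtain ⟨i, hi⟩ := exists_chev_mul_ne_zero T.B hB' true hpos ((mem_wsp_zero T.B).1 hed)
    (fun h => he0 (Subtype.ext h))
  rcases i with _ | i
  · have h0 := congrArg Subtype.val (T.lie_f0_eq_zero hB hed hd hd0)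
    rw [coe_lie_m, coe_f0, skew_zero T.B e.2] at h0
    exact hi (neg_eq_zero.1 h0)
  · have hi' : ⁅cG T.B false i, e⁆ ≠ 0 := fun h => hi (by
      have := congrArg Subtype.val h
      simpa using this)
    have hiP : i ∈ P := by
      by_contra hiP
      have hdi : d (some i) = 0 := le_antisymm (not_lt.1 hiP) (hd _)
      have hm := lie_mem_wsp T.B (cG_mem T.B false i) hed
      obtain ⟨j, hj⟩ := Function.ne_iff.1 hd0
      have hji : j ≠ some i := by rintro rfl; exact hj hdi
      have h0 : 0 < d j := lt_of_le_of_ne (hd j) (Ne.symm hj)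
      rcases T.nonneg_or_nonpos hB hm hi' with h | h
      · have := h (some i)
        simp [bsgn, hdi] at this
      · have := h j
        simp [bsgn, hji] at this
        omega
    obtain ⟨n, hn₁, hn₂⟩ := hnat i (hPS i hiP)
    rw [hp0 i hiP] at hn₁
    refine hi' (hn₂ ?_)
    exact_mod_cast hn₁.symm

end

end Triple

end Cartanification

namespace Cartanification

/-! ### Irreducibility of the submodule generated by f_0 e_ϑ -/

namespace Triple

variable {K : Type*} [Field K] [CharZero K] {r : ℕ} (T : Triple K r)

variable (hB : T.B.det ≠ 0)

include hB

theorem cG_mem_gMinus (b : Bool) {k : Fin r} (hk : T.lam k = 0) : cG T.B b k ∈ T.gMinus :=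
  cG_mem_subalg T.B b hk

/-- The map z ↦ f_0 z is equivariant for 𝔤⁻, which annihilates f_0. -/
theorem lie_elt_f0_of_mem_gMinus {y : B₀ T.B} (hy : y ∈ T.gMinus) (z : B₀ T.B) :
    ⁅y, elt T.B (f0 T.B) z⁆ = elt T.B (f0 T.B) ⁅y, z⁆ := by
  rw [lie_elt, (T.lie_gMinus hB hy).2, ← eltL_apply, map_zero, LinearMap.zero_apply, zero_add]

theorem app_elt_f0 (z : B₀ T.B) {l : List (Fin r)} (hl : ∀ i ∈ l, T.lam i = 0) :
    app T.B false (elt T.B (f0 T.B) z) l = elt T.B (f0 T.B) (app T.B false z l) := by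
  induction l with
  | nil => rfl
  | cons i l ih =>
    simp only [List.mem_cons, forall_eq_or_imp] at hl
    rw [app, ih hl.2, T.lie_elt_f0_of_mem_gMinus hB (T.cG_mem_gMinus hB false hl.1)]
    rfl

/-- As `w` is singular, the e_i act on its bracket with e_0 through e_0 alone; the Serre relations
give [e_k, e_0] = 0 for λ_k = 0 and (ad e_i)^2 e_0 = 0 for λ_i = 1. -/
theorem brk_singular {w : T.M} (hw : ∀ i, ⁅cG T.B true i, w⁆ = 0) :
    (∀ k, T.lam k = 0 → ⁅cG T.B true k, brk T.B (T.isUnit_det hB) w (e0 T.B)⁆ = 0) ∧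
    ∀ i, T.lam i = 1 →
      ⁅cG T.B true i, ⁅cG T.B true i, brk T.B (T.isUnit_det hB) w (e0 T.B)⁆⁆ = 0 := by
  refine ⟨fun k hk => ?_, fun i hi => ?_⟩
  · rw [lie_brk, hw, T.lie_e0_eq_zero hB hk]
    simp
  · have h : ⁅cG T.B true i, ⁅cG T.B true i, e0 T.B⁆⁆ = 0 :=
      Subtype.ext (by simpa using T.lie_lie_eq_zero hB true hi)
    rw [lie_brk, hw, map_zero, LinearMap.zero_apply, zero_add, lie_brk, hw, h]
    simp

section

variable (hpm : T.IsPseudoMinuscule T.up) (hlam : T.wt = T.up)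

include hpm hlam

/-- For λ_i ≠ 0 the element [e_i, e] has level one, since the support of `d` contributes nothing,
and f_0 annihilates level one. -/
theorem f0e_singular {e : B₀ T.B} {d : Option (Fin r) → ℤ} (hed : e ∈ wsp T.B (B₀ T.B) d)
    (hS : ∀ i, T.lam i ≠ 0 → d (some i) = 0)
    (hek : ∀ k, T.lam k = 0 → ⁅cG T.B true k, e⁆ = 0) (i : Fin r) :
    ⁅cG T.B true i, elt T.B (f0 T.B) e⁆ = 0 := by
  rw [T.lie_e_elt_f0 hB hpm hlam]
  by_cases hi : T.lam i = 0
  · rw [hek i hi, ← eltL_apply, map_zero]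
  · have hm : ⁅cG T.B true i, e⁆ ∈ wsp T.B (B₀ T.B) (Pi.single (some i) 1 + d) := by
      simpa [bsgn] using lie_mem_wsp T.B (cG_mem T.B true i) hed
    refine T.elt_f0_eq_zero hB hpm hlam hm ?_
    have hl : T.lev d = 0 := Finset.sum_eq_zero fun k _ => by
      by_cases hk : T.lam k = 0
      · simp [hk]
      · simp [hS k hk]
    have := T.lam_le_one hB hpm hlam i
    rw [T.lev_add, hl, T.lev_single]
    omega

/-- The degree of a singular vector in the module generated by `f_0 e_ϑ`. -/
theorem degree_eq_zero_of_singular {e : B₀ T.B} {d c : Option (Fin r) → ℤ}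
    (hed : e ∈ wsp T.B (B₀ T.B) d) (he0 : e ≠ 0) (hd : 0 ≤ d) (hd0 : d ≠ 0)
    (hS : ∀ i, T.lam i ≠ 0 → d (some i) = 0)
    (hek : ∀ k, T.lam k = 0 → ⁅cG T.B true k, e⁆ = 0) {w : T.M} (hw0 : w ≠ 0)
    (hw : w ∈ wsp T.B T.M (-Pi.single none 1 + d + bsgn false • c))
    (hwc : w ∈ Submodule.span K {x | ∃ l, dg l = c ∧ app T.B false (elt T.B (f0 T.B) e) l = x})
    (hwe : ∀ i, ⁅cG T.B true i, w⁆ = 0) : c = 0 := by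
  have hB' := T.isUnit_det hB
  have hn := T.none_eq_zero hB hed he0
  obtain ⟨l₀, hl₀⟩ : ∃ l : List (Fin r), dg l = c := by
    by_contra! h
    refine hw0 ?_
    rwa [show {x | ∃ l, dg l = c ∧ app T.B false (elt T.B (f0 T.B) e) l = x} = ∅ from
      Set.eq_empty_of_forall_notMem fun x ⟨l, hl, _⟩ => h l hl, Submodule.span_empty,
      Submodule.mem_bot] at hwc
  have hc : 0 ≤ c := hl₀ ▸ dg_nonneg l₀
  set u := brk T.B hB' w (e0 T.B) with hu
  have hud : u ∈ wsp T.B (B₀ T.B) (d - c) := by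
    have := brk_mem_wsp T.B hB' hw (e0_mem T.B)
    rwa [show -Pi.single none 1 + d + bsgn false • c + Pi.single none 1 = d - c by
      rw [bsgn, neg_smul, one_smul]; abel] at this
  have hu0 : u ≠ 0 := fun h => hw0 (eq_zero_of_singular T.B hB' hwe h)
  obtain ⟨hu₁, hu₂⟩ := T.brk_singular hB hwe
  -- The singular vector is determined by `u`, so `u` is nonzero and cannot be a negative root
  -- vector.
  have hdc : 0 ≤ d - c := by
    by_contra hneg
    have hle := (T.nonneg_or_nonpos hB hud hu0).resolve_left hneg
    exact hu0 (T.eq_zero_of_nonpos hB hpm hlam hud hle (fun h => hneg h.ge) hu₁ hu₂)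
  have hSc : ∀ i, T.lam i ≠ 0 → c (some i) = 0 := fun i hi => by
    have h₁ := hdc (some i)
    have h₂ := hc (some i)
    simp only [Pi.zero_apply, Pi.sub_apply, hS i hi] at h₁ h₂
    omega
  -- Now 0 ≤ c ≤ d, so only letters of 𝔤⁻ occur and `w` is f_0 times an element obtained from `e`.
  -- This element is `u` itself, because it commutes with e_0.
  have hwN : ∃ u' ∈ words T.B {k | T.lam k = 0} false e, w = elt T.B (f0 T.B) u' := by
    have hle : Submodule.span K {x | ∃ l, dg l = c ∧ app T.B false (elt T.B (f0 T.B) e) l = x} ≤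
        (words T.B {k | T.lam k = 0} false e).map (eltL T.B (f0 T.B)) := by
      refine Submodule.span_le.2 ?_
      rintro _ ⟨l, hl, rfl⟩
      have hl' : ∀ i ∈ l, T.lam i = 0 := fun i hi => by
        by_contra h
        have := dg_some_pos.2 hi
        rw [hl, hSc i h] at this
        exact lt_irrefl _ this
      exact ⟨_, app_mem_words T.B false e hl', (T.app_elt_f0 hB e hl').symm⟩
    obtain ⟨u', hu', h⟩ := hle hwc
    exact ⟨u', hu', h.symm⟩
  obtain ⟨u', hu'w, rfl⟩ := hwN
  have heg : e ∈ T.gMinus := mem_subalg T.B hB' _ hd0 hn (fun i hi => hS i hi) hed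
  have hug := words_le_subalg T.B heg hu'w
  have huu : u = u' := T.brk_elt_f0_e0 hB u' (T.lie_gMinus hB hug).1
  rw [← huu] at hu'w
  by_cases hz : d - c = 0
  · rw [hz] at hud
    exact absurd (T.eq_zero_of_cartan hB hed he0 hd hd0 hS hek hud hu'w hu₁) hu0
  -- The ideal of 𝔤⁻ generated by `u` is spanned by lowering words applied to `u` and contains some
  -- e_k with k in the support of `d`, hence `e`. Lowering from degree d - c can reach `d` only if c
  -- ≤ 0.
  · obtain ⟨k, hk, hkw⟩ := T.exists_e_mem_words hB (S := {k | T.lam k = 0}) hud hu0 hdc hz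
      fun i hi => by simp [hS i hi, hSc i hi]
    have hkd : 0 < d (some k) := by
      have := hc (some k)
      simp only [Pi.sub_apply, Pi.zero_apply] at hk this
      omega
    have hew : e ∈ words T.B {k | T.lam k = 0} false u :=
      T.mem_of_e_mem hB (fun z hz x hx => lie_subalg_mem_words (b := false) T.B hud (fun i hi => hu₁ i hi) hz hx)
        hkw hed hd hn (fun i hi => hS i hi) hkd
    have hsp := mem_span_words T.B hB' hud hew hed
    obtain ⟨l, hl⟩ : ∃ l : List (Fin r), dg l = -c := by
      by_contra! h
      refine he0 ?_
      rwa [show {y | ∃ l : List (Fin r), (∀ i ∈ l, i ∈ {k | T.lam k = 0}) ∧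
          d - c + bsgn false • dg l = d ∧ app T.B false u l = y} = ∅ from
        Set.eq_empty_of_forall_notMem fun x ⟨l, _, hl, _⟩ => h l (by
          rw [bsgn, neg_smul, one_smul] at hl
          calc dg l = -(d - c + -dg l) + (d - c) := by abel
            _ = -c := by rw [hl]; abel), Submodule.span_empty,
        Submodule.mem_bot] at hsp
    refine le_antisymm ?_ hc
    have := dg_nonneg l
    rw [hl] at this
    exact neg_nonneg.1 this

theorem f0e_irreducible {ϑ : Fin r → K} {e : B₀ T.B} (hϑ : T.IsHighestRoot ϑ)
    (he : T.IsRootVector T.gMinus ϑ e) : LieModule.IsIrreducible K T.g (T.gen (T.f0mul e)) ∧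
      T.HasHighestWeight (T.gen (T.f0mul e)) (ϑ + T.wt) := by
  have hB' := T.isUnit_det hB
  obtain ⟨d, hd, hd0, hn, hS, hed, hlab, hek⟩ := T.highestRoot_degree hB hϑ he
  have hv0 : T.f0mul e ≠ 0 := fun h => he.ne_zero (by
    rw [← T.brk_elt_f0_e0 hB e (T.lie_gMinus hB he.mem).1, ← f0mul, h, map_zero,
      LinearMap.zero_apply])
  have hvd : T.f0mul e ∈ wsp T.B T.M (-Pi.single none 1 + d) := elt_mem_wsp T.B (f0_mem T.B) hed
  have hsing : ∀ i, ⁅cG T.B true i, T.f0mul e⁆ = 0 := T.f0e_singular hB hpm hlam hed hS hek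
  refine ⟨T.isIrreducible_gen hB hv0 fun P hP hP0 => ?_, T.f0mul e, hv0, rfl, hsing, fun i => ?_⟩
  · obtain ⟨c, w, hwP, hw0, hw, hwc, hwe⟩ := exists_singular T.B hB' false hvd hsing P hP hP0
    have hc := T.degree_eq_zero_of_singular hB hpm hlam hed he.ne_zero hd hd0 hS hek hw0 hw hwc hwe
    subst hc
    have hle : w ∈ Submodule.span K {T.f0mul e} := by
      refine Submodule.span_mono ?_ hwc
      rintro _ ⟨l, hl, rfl⟩
      rw [dg_eq_zero hl]
      rfl
    obtain ⟨a, rfl⟩ := Submodule.mem_span_singleton.1 hle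
    have ha : a ≠ 0 := by rintro rfl; simp at hw0
    have := P.smul_mem a⁻¹ hwP
    rwa [smul_smul, inv_mul_cancel₀ ha, one_smul] at this
  · rw [hvd (some i), rootVal_add, Pi.add_apply, rootVal_neg, Pi.neg_apply, rootVal_single]
    have : rootVal T.B d (some i) = ϑ i := congrFun hlab i
    rw [this]
    congr 1
    simp [B, add_comm]

end

end Triple

end Cartanification

namespace Cartanification

/-! ### Reflections and finiteness of the root system for simple 𝔤 -/

namespace Triple

variable {K : Type*} [Field K] [CharZero K] {r : ℕ} (T : Triple K r)

/-- The set of degrees of the nonzero homogeneous elements of `𝓑_0`. -/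
def degrees : Set (Option (Fin r) → ℤ) := {d | ∃ x ∈ wsp T.B (B₀ T.B) d, x ≠ 0}

/-- The integer `d(h_k)`. -/
def coroot (k : Fin r) (d : Option (Fin r) → ℤ) : ℤ := ∑ j, T.A k j * d (some j)

theorem coroot_neg (k : Fin r) (d : Option (Fin r) → ℤ) : T.coroot k (-d) = -T.coroot k d := by
  simp [coroot]

variable (hB : T.B.det ≠ 0)

include hB

theorem lie_hG_eq_coroot {d : Option (Fin r) → ℤ} {x : B₀ T.B} (hx : x ∈ wsp T.B (B₀ T.B) d)
    (k : Fin r) : ⁅hG T.B (some k), x⁆ = (T.coroot k d : K) • x := by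
  by_cases hx0 : x = 0
  · simp [hx0]
  rw [hx (some k), T.rootVal_some, T.none_eq_zero hB hx hx0, coroot]
  simp

theorem neg_mem_degrees {d : Option (Fin r) → ℤ} (hd : d ∈ T.degrees) : -d ∈ T.degrees := by
  obtain ⟨x, hx, hx0⟩ := hd
  obtain ⟨y, hy, hy0⟩ := exists_ne_zero_neg T.B (T.isUnit_det hB) T.symB_ne_zero T.symB_mul
    ((mem_wsp_zero T.B).1 hx) fun h => hx0 (Subtype.ext h)
  have hn := T.none_eq_zero hB hx hx0
  have hy' : y ∈ comp T.B 0 := by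
    have := gr_le_comp T.B (T.isUnit_det hB) (-d) hy
    simpa [hn] using this
  exact ⟨⟨y, hy'⟩, (mem_wsp_zero T.B).2 hy, fun h => hy0 (congrArg Subtype.val h)⟩

theorem pow_mem_wsp (b : Bool) (k : Fin r) {d : Option (Fin r) → ℤ} {x : B₀ T.B}
    (hx : x ∈ wsp T.B (B₀ T.B) d) (n : ℕ) :
    ((LieModule.toEnd K (B₀ T.B) (B₀ T.B) (cG T.B b k)) ^ n) x ∈
      wsp T.B (B₀ T.B) (d + (n : ℤ) • bsgn b • Pi.single (some k) 1) := by
  induction n with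
  | zero => simpa using hx
  | succ n ih =>
    rw [pow_succ', Module.End.mul_apply]
    have := lie_mem_wsp T.B (cG_mem T.B b k) ih
    rw [LieModule.toEnd_apply_apply]
    convert this using 2
    push_cast
    module

/-- The degrees are stable under the simple reflections. -/
theorem reflection_mem_degrees (k : Fin r) {d : Option (Fin r) → ℤ} (hd : d ∈ T.degrees) :
    d - T.coroot k d • Pi.single (some k) 1 ∈ T.degrees := by
  -- Negatives of degrees are degrees, and the reflection commutes with the sign.
  wlog hm : 0 ≤ T.coroot k d generalizing d
  · have h := this (T.neg_mem_degrees hB hd) (by rw [coroot_neg]; omega)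
    have h' := T.neg_mem_degrees hB h
    rwa [coroot_neg, show -(-d - -T.coroot k d • Pi.single (some k) (1 : ℤ)) =
      d - T.coroot k d • Pi.single (some k) 1 by module] at h'
  obtain ⟨x, hx, hx0⟩ := hd
  obtain ⟨a, ha, ha'⟩ := Nat.exists_not_and_succ_of_not_zero_of_exists
    (p := fun n => ((LieModule.toEnd K (B₀ T.B) (B₀ T.B) (cG T.B true k)) ^ n) x = 0)
    (by simpa using hx0) (T.exists_ad_pow_eq_zero hB true k x)
  obtain ⟨m, hm'⟩ := Int.eq_ofNat_of_zero_le hm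
  set y := ((LieModule.toEnd K (B₀ T.B) (B₀ T.B) (cG T.B true k)) ^ a) x
  have hy := T.pow_mem_wsp hB true k hx a
  have hy1 : ⁅cG T.B true k, y⁆ = 0 := by
    rw [pow_succ', Module.End.mul_apply] at ha'
    exact ha'
  have hyk : T.coroot k (d + (a : ℤ) • bsgn true • Pi.single (some k) 1) = (m + 2 * a : ℕ) := by
    have : T.coroot k (d + (a : ℤ) • bsgn true • Pi.single (some k) 1) =
        T.coroot k d + a * T.A k k := by
      simp only [coroot, bsgn, one_smul, Pi.add_apply, Pi.smul_apply, mul_add,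
        Finset.sum_add_distrib, smul_eq_mul]
      congr 1
      rw [Finset.sum_eq_single k]
      · simp [mul_comm]
      · intro j _ hj
        simp [hj]
      · simp
    rw [this, T.diag, hm']
    push_cast
    ring
  have hyh := T.lie_hG_eq_coroot hB hy k
  rw [hyk] at hyh
  have P : (T.sl2 hB k).HasPrimitiveVectorWith y ((m + 2 * a : ℕ) : K) :=
    ⟨ha, by exact_mod_cast hyh, hy1⟩
  -- The top `y` of the e_k-string through `x` has weight m + 2a. Since a + m ≤ m + 2a, descending a
  -- + m steps is nonzero, and it ends in degree d - m α_k.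
  refine ⟨_, ?_, P.pow_toEnd_f_ne_zero_of_eq_nat rfl (i := a + m) (by omega)⟩
  have := T.pow_mem_wsp hB false k hy (a + m)
  convert this using 2
  rw [hm', bsgn, bsgn]
  push_cast
  module

/-- For λ = 0 the column of `B` at the node 0 vanishes. -/
theorem lam_ne_zero : ∃ i, T.lam i ≠ 0 := by
  by_contra! h
  refine hB (Matrix.det_eq_zero_of_column_eq_zero none fun i => ?_)
  rcases i with _ | i
  · rfl
  · simp [B, wt, h]

section Simple

/-- The Dynkin diagram of a simple Kac-Moody algebra is connected. -/
theorem eq_univ_of_isSimple (hs : LieAlgebra.IsSimple K T.g) {S : Set (Fin r)} (hS : S.Nonempty)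
    (h : ∀ j ∈ S, ∀ k, T.A j k ≠ 0 → k ∈ S) : S = Set.univ := by
  have hB' := T.isUnit_det hB
  by_contra hne
  obtain ⟨i₀, hi₀⟩ := (Set.ne_univ_iff_exists_notMem S).1 hne
  obtain ⟨j₀, hj₀⟩ := hS
  have hz : ∀ j ∈ S, ∀ i, i ∉ S → T.A j i = 0 ∧ T.A i j = 0 := fun j hj i hi => by
    have : T.A j i = 0 := by
      by_contra h'
      exact hi (h j hj i h')
    exact ⟨this, T.zero _ _ this⟩
  -- The generators outside `S` commute with the subalgebra of `S`, which is therefore a nonzero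
  -- ideal. It is proper because it does not contain h_i for i outside `S`.
  have hcomm : ∀ b, ∀ i ∉ S, ∀ y ∈ subalg T.B S, ⁅cG T.B b i, y⁆ = 0 := by
    intro b i hi y hy
    induction hy using LieSubalgebra.lieSpan_induction with
    | mem y hy =>
      obtain ⟨j, hj, hy⟩ := hy
      have hij : i ≠ j := fun e => hi (e ▸ hj)
      have hc : ∀ b', ⁅cG T.B b i, cG T.B b' j⁆ = 0 := fun b' => by
        by_cases hbb : b' = b
        · subst hbb
          refine Subtype.ext ?_
          simpa using chev_mul_chev_eq_zero T.B hB' b' (i := i) (j := some j)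
            (fun e => hij (Option.some_injective _ e).symm) (T.B_diag i)
            (by simp [B, (hz j hj i hi).2]) (by simp [B, (hz j hj i hi).1])
        · rw [show b' = !b by cases b <;> cases b' <;> simp_all]
          exact lie_cG_cG_ne T.B b hij
      rcases hy with rfl | rfl | rfl
      · exact hc true
      · exact hc false
      · rw [← lie_skew, lie_hG_cG]
        simp [B, (hz j hj i hi).1]
    | zero => simp
    | add x y _ _ hx hy => rw [lie_add, hx, hy, add_zero]
    | smul a x _ hx => rw [lie_smul, hx, smul_zero]
    | lie x y _ _ hx hy => rw [leibniz_lie, hx, hy, zero_lie, lie_zero, add_zero]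
  have hle : T.g ≤ (subalg T.B S).normalizer := by
    refine LieSubalgebra.lieSpan_le.2 ?_
    have hc : ∀ b i, cG T.B b i ∈ (subalg T.B S).normalizer := fun b i => by
      refine (LieSubalgebra.mem_normalizer_iff _ _).2 fun y hy => ?_
      by_cases hi : i ∈ S
      · exact (subalg T.B S).lie_mem (cG_mem_subalg T.B b hi) hy
      · rw [hcomm b i hi y hy]
        exact zero_mem _
    rintro _ ⟨i, -, rfl | rfl | rfl⟩
    · exact hc true i
    · exact hc false i
    · rw [← (T.sl2 hB i).lie_e_f]
      exact LieSubalgebra.lie_mem _ (hc true i) (hc false i)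
  let J : LieIdeal K T.g :=
    { toSubmodule := (subalg T.B S).toSubmodule.comap T.g.toSubmodule.subtype
      lie_mem := fun {x y} hy =>
        (LieSubalgebra.mem_normalizer_iff _ _).1 (hle x.2) y hy }
  rcases hs.eq_bot_or_eq_top J with hJ | hJ
  · have hm : (⟨cG T.B true j₀, T.cG_mem_g true j₀⟩ : T.g) ∈ J := cG_mem_subalg T.B true hj₀
    rw [hJ, LieSubmodule.mem_bot] at hm
    exact (T.sl2 hB j₀).e_ne_zero (congrArg Subtype.val hm)
  · have hm : (⟨hG T.B (some i₀), T.hG_mem_g i₀⟩ : T.g) ∈ J := hJ ▸ LieSubmodule.mem_top _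
    have hm' : hG T.B (some i₀) ∈ subalg T.B S := hm
    have hsp := mem_span_of_mem_subalg T.B hB' S hm' (hG_mem T.B _)
    have hsp' := Submodule.mem_map_of_mem (f := (comp T.B 0).subtype) hsp
    rw [Submodule.map_span] at hsp'
    refine (linearIndependent_cart T.B hB').notMem_span_image (s := some '' S) (x := some i₀) ?_ ?_
    · rintro ⟨j, hj, e⟩
      exact hi₀ (Option.some_injective _ e ▸ hj)
    · refine Submodule.span_mono ?_ (by simpa using hsp')
      rintro _ ⟨_, ⟨i, hi, rfl⟩, rfl⟩
      exact ⟨some i, ⟨i, hi, rfl⟩, by simp⟩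

variable (hpm : T.IsPseudoMinuscule T.up) (hlam : T.wt = T.up)

include hpm hlam

/-- If `𝔤` is simple and admits a nonzero pseudo-minuscule weight, then it has finitely many
roots. -/
theorem finite_degrees (hs : LieAlgebra.IsSimple K T.g) : T.degrees.Finite := by
  -- Integral functionals bounded by one on all degrees: λ is one of them, and they are permuted by
  -- the reflections because the degrees are.
  let F : Set (Fin r → ℤ) := {ξ | ∀ d ∈ T.degrees, |∑ j, ξ j * d (some j)| ≤ 1}
  have hlamF : (fun j => (T.lam j : ℤ)) ∈ F := by
    rintro d ⟨x, hx, hx0⟩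
    exact T.abs_lev_le hB hpm hlam hx hx0
  have hval : ∀ (ξ : Fin r → ℤ) (k : Fin r) (d : Option (Fin r) → ℤ),
      ∑ j, ξ j * (d - T.coroot k d • Pi.single (some k) 1 : Option (Fin r) → ℤ) (some j) =
        ∑ j, ξ j * d (some j) - ξ k * T.coroot k d := by
    intro ξ k d
    simp only [Pi.sub_apply, Pi.smul_apply, mul_sub, Finset.sum_sub_distrib]
    congr 1
    rw [Finset.sum_eq_single k]
    · simp
    · intro j _ hj
      simp [hj]
    · simp
  have hrefl : ∀ ξ ∈ F, ∀ k, (fun j => ξ j - ξ k * T.A k j) ∈ F := by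
    intro ξ hξ k d hd
    have h := hξ _ (T.reflection_mem_degrees hB k hd)
    rw [hval] at h
    have e : ∑ j, (ξ j - ξ k * T.A k j) * d (some j) =
        ∑ j, ξ j * d (some j) - ξ k * T.coroot k d := by
      rw [coroot, Finset.mul_sum, ← Finset.sum_sub_distrib]
      exact Finset.sum_congr rfl fun j _ => by ring
    rw [e]
    exact h
  -- If ξ_j ≠ 0 and ξ_k = 0 for adjacent nodes, the reflection of ξ at j has k-th coordinate -ξ_j
  -- A_jk ≠ 0. By connectedness every node is reached from λ.
  have huniv : {j | ∃ ξ ∈ F, ξ j ≠ 0} = Set.univ := by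
    obtain ⟨i, hi⟩ := T.lam_ne_zero hB
    refine T.eq_univ_of_isSimple hB hs ⟨i, _, hlamF, by exact_mod_cast hi⟩ ?_
    rintro j ⟨ξ, hξ, hj⟩ k hjk
    by_cases hk : ξ k = 0
    · refine ⟨_, hrefl ξ hξ j, ?_⟩
      rw [hk, zero_sub]
      exact neg_ne_zero.2 (mul_ne_zero hj hjk)
    · exact ⟨ξ, hξ, hk⟩
  -- The values of ξ at `d` and at its reflection differ by ξ_k d(h_k), and both are at most one in
  -- absolute value; ξ_k is a nonzero integer.
  have hbound : ∀ d ∈ T.degrees, ∀ k, T.coroot k d ∈ Set.Icc (-2 : ℤ) 2 := by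
    intro d hd k
    obtain ⟨ξ, hξ, hk⟩ : k ∈ {j | ∃ ξ ∈ F, ξ j ≠ 0} := huniv ▸ trivial
    have h₁ := hξ d hd
    have h₂ := hξ _ (T.reflection_mem_degrees hB k hd)
    rw [hval] at h₂
    have h₃ : |ξ k * T.coroot k d| ≤ 2 := by
      rw [abs_le] at h₁ h₂ ⊢
      omega
    rw [abs_mul] at h₃
    have h₄ : 1 ≤ |ξ k| := Int.one_le_abs hk
    have h₅ : |T.coroot k d| ≤ 2 := by nlinarith [abs_nonneg (T.coroot k d)]
    exact abs_le.1 h₅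
  refine Set.Finite.of_finite_image (f := fun d k => T.coroot k d)
    ((Set.Finite.pi' fun _ => Set.finite_Icc (-2 : ℤ) 2).subset ?_) ?_
  · rintro _ ⟨d, hd, rfl⟩
    exact hbound d hd
  · intro d hd d' hd' h
    obtain ⟨x, hx, hx0⟩ := hd
    obtain ⟨x', hx', hx0'⟩ := hd'
    have hn := T.none_eq_zero hB hx hx0
    have hn' := T.none_eq_zero hB hx' hx0'
    refine T.rootVal_some_injective (hn.trans hn'.symm) fun k => ?_
    have := congrArg (Int.cast : ℤ → K) (congrFun h k)
    simp only [coroot] at this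
    rw [T.rootVal_some, T.rootVal_some, hn, hn']
    push_cast at this
    simpa using this

theorem single_mem_degrees (k : Fin r) : Pi.single (some k) 1 ∈ T.degrees :=
  ⟨cG T.B true k, by simpa [bsgn] using cG_mem T.B true k, (T.sl2 hB k).e_ne_zero⟩

/-- If `𝔤` is simple, then a nonzero pseudo-minuscule weight is fundamental. -/
theorem lam_eq_zero_of_ne (hs : LieAlgebra.IsSimple K T.g) {i j : Fin r} (hi : T.lam i ≠ 0)
    (hj : j ≠ i) : T.lam j = 0 := by
  obtain ⟨d, hid, ⟨x, hx, hx0⟩, hmax⟩ := (T.finite_degrees hB hpm hlam hs).exists_le_maximal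
    (T.single_mem_degrees hB hpm hlam i)
  have hd : 0 ≤ d := (Pi.single_nonneg.2 zero_le_one).trans hid
  -- The support of a maximal degree is closed under adjacency. At a node k outside it e_k
  -- annihilates `x` by maximality, so d(h_k) ≥ 0, whereas a neighbour in the support makes d(h_k)
  -- negative.
  have hfull : {k | 0 < d (some k)} = Set.univ := by
    refine T.eq_univ_of_isSimple hB hs ⟨i, ?_⟩ fun j hj k hjk => ?_
    · have := hid (some i)
      simp at this
      exact this
    · by_contra hk
      have hk0 : d (some k) = 0 := le_antisymm (not_lt.1 hk) (hd _)
      have hek : ⁅cG T.B true k, x⁆ = 0 := by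
        by_contra h0
        have hm : Pi.single (some k) 1 + d ∈ T.degrees := ⟨_, by
          simpa [bsgn] using lie_mem_wsp T.B (cG_mem T.B true k) hx, h0⟩
        have h₁ := hmax hm (le_add_of_nonneg_left (Pi.single_nonneg.2 zero_le_one)) (some k)
        simp at h₁
      obtain ⟨n, hn, -⟩ := T.exists_nat_of_singular hB k hx0 hek (T.lie_hG_eq_coroot hB hx k)
        (T.exists_ad_pow_eq_zero hB false k x)
      have hn' : T.coroot k d = n := by exact_mod_cast hn
      have hterm : ∀ m, T.A k m * d (some m) ≤ 0 := fun m => by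
        by_cases hm : k = m
        · subst hm; simp [hk0]
        · exact mul_nonpos_of_nonpos_of_nonneg (T.offDiag k m hm) (hd _)
      have hlt : T.coroot k d < 0 := by
        refine Finset.sum_neg' (fun m _ => hterm m) ⟨j, Finset.mem_univ _, ?_⟩
        have hkj : T.A k j ≠ 0 := fun h => hjk (T.zero _ _ h)
        have hne : k ≠ j := fun h => hk (h ▸ hj)
        exact mul_neg_of_neg_of_pos (lt_of_le_of_ne (T.offDiag k j hne) hkj) hj
      omega
  have hlev := T.abs_lev_le hB hpm hlam hx hx0
  by_contra hj0
  have h₁ : ∀ k, 0 < d (some k) := fun k => by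
    have : k ∈ {k | 0 < d (some k)} := hfull ▸ trivial
    exact this
  -- With full support, two nonzero coordinates of λ would give a root of level at least two.
  have h₂ : (T.lam i : ℤ) * d (some i) + T.lam j * d (some j) ≤ T.lev d := by
    rw [← Finset.sum_pair (f := fun k => (T.lam k : ℤ) * d (some k)) hj.symm]
    exact Finset.sum_le_sum_of_subset_of_nonneg (Finset.subset_univ _) fun k _ _ =>
      mul_nonneg (Nat.cast_nonneg _) (hd _)
  have h₃ : 0 < (T.lam i : ℤ) * d (some i) :=
    mul_pos (by exact_mod_cast Nat.pos_of_ne_zero hi) (h₁ i)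
  have h₄ : 0 < (T.lam j : ℤ) * d (some j) :=
    mul_pos (by exact_mod_cast Nat.pos_of_ne_zero hj0) (h₁ j)
  rw [abs_le] at hlev
  omega

end Simple

end Triple

end Cartanification

namespace Cartanification

/-! ### Generation of (𝓑^W)_{-1} for simple 𝔤 -/

namespace Triple

variable {K : Type*} [Field K] [CharZero K] {r : ℕ} (T : Triple K r)

variable (hB : T.B.det ≠ 0)

include hB

theorem isNonneg_sub_iff {d d' : Option (Fin r) → ℤ} (hd : d none = 0) (hd' : d' none = 0)
    (h : T.IsNonneg (T.lab d' - T.lab d)) : d ≤ d' := by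
  obtain ⟨n, hn⟩ := h
  let n' : Option (Fin r) → ℤ := fun k => k.elim 0 fun j => n j
  have e : d' = d + n' := by
    refine T.rootVal_some_injective (by simp [hd, hd', n']) fun i => ?_
    have h₁ := congrFun hn i
    rw [rootVal_add, Pi.add_apply, T.rootVal_some n']
    have h₂ : (∑ j, (n j : K) • T.simpleRoot j) i = ∑ j, (T.A i j : K) * (n' (some j) : K) := by
      rw [Finset.sum_apply]
      exact Finset.sum_congr rfl fun j _ => by simp [simpleRoot, n', mul_comm]
    rw [h₂] at h₁
    rw [← h₁]
    simp [n', lab]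
  rw [e]
  refine le_add_of_nonneg_right fun k => ?_
  rcases k with _ | k
  · exact le_rfl
  · exact Int.natCast_nonneg _

/-- A subspace of `𝓑_0` which is stable under `𝔤⁻` and contains a root vector for every highest root
of `𝔤⁻` contains `𝔤⁻`. -/
theorem gMinus_le (hfin : T.degrees.Finite) {e : {ϑ // T.IsHighestRoot ϑ} → B₀ T.B}
    (he : ∀ ϑ, T.IsRootVector T.gMinus ϑ.1 (e ϑ)) {S : Submodule K (B₀ T.B)}
    (hS : ∀ y ∈ T.gMinus, ∀ z ∈ S, ⁅y, z⁆ ∈ S) (heS : ∀ ϑ, e ϑ ∈ S) :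
    T.gMinus.toSubmodule ≤ S := by
  have hB' := T.isUnit_det hB
  have hgen : ∀ k, T.lam k = 0 → cG T.B true k ∈ S := by
    intro k hk
    -- By finiteness there is a maximal degree of 𝔤⁻ above α_k. Its labels form a highest root, for
    -- which a root vector is given.
    let R : Set (Option (Fin r) → ℤ) :=
      {d | d ∈ T.degrees ∧ ∀ i, T.lam i ≠ 0 → d (some i) = 0}
    obtain ⟨d, hkd, ⟨⟨x, hx, hx0⟩, hdS⟩, hmax⟩ := (hfin.subset fun _ h => h.1 : R.Finite).exists_le_maximal
      (a := Pi.single (some k) 1) ⟨⟨cG T.B true k, by simpa [bsgn] using cG_mem T.B true k,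
        (T.sl2 hB k).e_ne_zero⟩, fun i hi => by
          have : i ≠ k := fun h => hi (h ▸ hk)
          simp [this]⟩
    have hdk : 0 < d (some k) := by
      have := hkd (some k)
      simp at this
      exact this
    have hd : 0 ≤ d := (Pi.single_nonneg.2 zero_le_one).trans hkd
    have hd0 : d ≠ 0 := by rintro rfl; simp at hdk
    have hn := T.none_eq_zero hB hx hx0
    have hhigh : T.IsHighestRoot (T.lab d) := by
      obtain ⟨h₁, h₂⟩ := T.isRootVector_of_mem hB {k | T.lam k = 0} hd0 hn hdS hx hx0
      refine ⟨⟨h₁, x, h₂⟩, ?_⟩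
      rintro β ⟨-, y, hy⟩ hβ
      obtain ⟨d', hn', hS', hyd, rfl⟩ := T.exists_degree hB hy
      have hle := T.isNonneg_sub_iff hB hn hn' hβ
      rw [le_antisymm (hmax ⟨⟨y, hyd, hy.ne_zero⟩, hS'⟩ hle) hle]
    obtain ⟨d', -, -, hn', -, hed, hlab, hek⟩ := T.highestRoot_degree hB hhigh (he ⟨_, hhigh⟩)
    obtain rfl : d' = d := T.rootVal_some_injective (hn'.trans hn.symm) fun i => congrFun hlab i
    have hJS : words T.B {k | T.lam k = 0} false (e ⟨_, hhigh⟩) ≤ S := by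
      refine Submodule.span_le.2 ?_
      rintro _ ⟨l, hl, rfl⟩
      induction l with
      | nil => exact heS _
      | cons i l ih =>
        simp only [List.mem_cons, forall_eq_or_imp] at hl
        exact hS _ (T.cG_mem_gMinus hB false hl.1) _ (ih hl.2)
    have hJ : ∀ {z : B₀ T.B}, z ∈ T.gMinus → ∀ {x : B₀ T.B},
        x ∈ words T.B {k | T.lam k = 0} false (e ⟨_, hhigh⟩) →
        ⁅z, x⁆ ∈ words T.B {k | T.lam k = 0} false (e ⟨_, hhigh⟩) := @fun z hz x hx =>
      lie_subalg_mem_words (S := {k | T.lam k = 0}) (b := false) T.B hed hek hz hx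
    set J := words T.B {k | T.lam k = 0} false (e ⟨_, hhigh⟩)
    obtain ⟨k', hk', hk'J⟩ := T.exists_e_mem_words hB (S := {k | T.lam k = 0}) hed
      (he ⟨_, hhigh⟩).ne_zero hd hd0 hdS
    -- Membership of e_j in the ideal spreads along edges: e_j gives h_j, and [e_m, h_j] is a
    -- nonzero multiple of e_m for a neighbour m. The support is connected, so e_k is reached.
    have hall : {k | 0 < d' (some k) ∧ cG T.B true k ∈ J} = {k | 0 < d' (some k)} := by
      by_contra hne
      obtain ⟨j, hj, m, hm, hmZ, hjm⟩ := T.exists_adjacent hB hx hx0 hd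
        {k | 0 < d' (some k) ∧ cG T.B true k ∈ J} (fun k hk => hk.1)
        ⟨k', hk', hk'J⟩ hne
      have hK : ∀ i, 0 < d' (some i) → T.lam i = 0 := fun i hi => by
        by_contra h
        rw [hdS i h] at hi
        exact lt_irrefl _ hi
      have h₁ : hG T.B (some j) ∈ J := by
        rw [← (T.sl2 hB j).lie_e_f, ← lie_skew]
        exact neg_mem (hJ (T.cG_mem_gMinus hB false (hK j hj.1)) hj.2)
      have h₂ := hJ (T.cG_mem_gMinus hB true (hK m hm)) h₁
      rw [← lie_skew, lie_hG_cG, ← neg_smul] at h₂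
      refine hmZ ⟨hm, ?_⟩
      refine (Submodule.smul_mem_iff _ ?_).1 h₂
      simpa [bsgn, B] using hjm
    have hk'' : k ∈ {k | 0 < d' (some k) ∧ cG T.B true k ∈ J} := hall ▸ hdk
    exact hJS hk''.2
  have hh : ∀ k, T.lam k = 0 → hG T.B (some k) ∈ S := fun k hk => by
    rw [← (T.sl2 hB k).lie_e_f, ← lie_skew]
    exact neg_mem (hS _ (T.cG_mem_gMinus hB false hk) _ (hgen k hk))
  have hf : ∀ k, T.lam k = 0 → cG T.B false k ∈ S := fun k hk => by
    have h := hS _ (T.cG_mem_gMinus hB false hk) _ (hh k hk)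
    rw [← lie_skew, lie_hG_cG, ← neg_smul] at h
    refine (Submodule.smul_mem_iff _ ?_).1 h
    simp [bsgn, T.B_diag]
  let L : LieSubalgebra K (B₀ T.B) :=
    { toSubmodule := S ⊓ T.gMinus.toSubmodule
      lie_mem' := fun {x y} hx hy => ⟨hS x hx.2 y hy.1, T.gMinus.lie_mem hx.2 hy.2⟩ }
  have hle : T.gMinus ≤ L := by
    refine LieSubalgebra.lieSpan_le.2 ?_
    rintro _ ⟨k, hk, rfl | rfl | rfl⟩
    · exact ⟨hgen k hk, T.cG_mem_gMinus hB true hk⟩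
    · exact ⟨hf k hk, T.cG_mem_gMinus hB false hk⟩
    · exact ⟨hh k hk, hG_mem_subalg T.B hk⟩
  exact fun z hz => (hle hz).1

theorem eq_top_of_elt_f0_mem (Q : LieSubmodule K T.g T.M) (h : ∀ z, elt T.B (f0 T.B) z ∈ Q) :
    Q = ⊤ := by
  let S : Submodule K (Bm T.B) :=
    { carrier := {x | ∀ z, elt T.B x z ∈ Q}
      add_mem' := fun {a b} ha hb z => by
        rw [← eltL_apply, map_add, LinearMap.add_apply]
        exact add_mem (ha z) (hb z)
      zero_mem' := fun z => by
        rw [← eltL_apply, map_zero, LinearMap.zero_apply]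
        exact zero_mem _
      smul_mem' := fun c a ha z => by
        rw [← eltL_apply, map_smul, LinearMap.smul_apply]
        exact Q.smul_mem c (ha z) }
  have hS : S = ⊤ := m_eq_top T.B (T.isUnit_det hB) S h fun i x hx z => by
    have h₁ := T.lie_mem_of_g hB Q (cG T.B false i) (hx z)
    rw [lie_elt] at h₁
    exact (add_mem_cancel_right (hx _)).1 h₁
  have hle : (⊤ : Submodule K T.M) ≤ Q.toSubmodule := by
    rw [← span_elt T.B]
    refine Submodule.span_le.2 ?_
    rintro _ ⟨x, z, rfl⟩
    have : x ∈ S := hS ▸ Submodule.mem_top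
    exact this z
  exact eq_top_iff.2 fun x _ => hle Submodule.mem_top

section

variable (hpm : T.IsPseudoMinuscule T.up) (hlam : T.wt = T.up)

include hpm hlam

/-- Apply ad f_i twice to f_0 e_i = 0. Since (ad f_i)^2 f_0 = 0, this gives [f_i, f_0] h_i = -f_0
f_i, which is combined with [f_i, h_i] = 2 f_i. -/
theorem elt_f0_f_eq {i : Fin r} (hi : T.lam i = 1) : elt T.B (f0 T.B) (cG T.B false i) =
    ⁅cG T.B false i, elt T.B (f0 T.B) (hG T.B (some i))⁆ := by
  have h0 : ⁅cG T.B false i, ⁅cG T.B false i, f0 T.B⁆⁆ = 0 :=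
    Subtype.ext (by simpa using T.lie_lie_eq_zero hB false hi)
  have h₁ : ⁅cG T.B false i, cG T.B true i⁆ = -hG T.B (some i) := by
    rw [← lie_skew, (T.sl2 hB i).lie_e_f]
  have h₂ : ⁅cG T.B false i, hG T.B (some i)⁆ = (2 : K) • cG T.B false i := by
    rw [← lie_skew, lie_hG_cG, ← neg_smul]
    simp [bsgn, T.B_diag]
  have hs : ⁅cG T.B false i, ⁅cG T.B false i, elt T.B (f0 T.B) (cG T.B true i)⁆⁆ = 0 := by
    rw [T.elt_f0_e_eq_zero hB hpm hlam (by omega), lie_zero, lie_zero]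
  rw [lie_elt, h₁, lie_add, lie_elt, lie_elt, h0, h₁, lie_neg, h₂] at hs
  rw [lie_elt, h₂]
  simp only [← eltL_apply, map_zero, LinearMap.zero_apply, map_neg, map_smul, zero_add] at hs ⊢
  rw [← sub_eq_zero, ← smul_right_injective T.M (two_ne_zero (α := K)) |>.eq_iff,
    smul_zero, ← hs]
  module

/-- In row 0 of `B⁻¹` times column 0 of `B`, which is 1, only the term at `i` survives. -/
theorem inv_none_some_ne {i : Fin r} (h : ∀ j, j ≠ i → T.lam j = 0) :
    T.B⁻¹ none (some i) ≠ 0 := by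
  intro h0
  have hv : ∑ i, T.B⁻¹ none i * T.B i none = 1 := by
    rw [← Matrix.mul_apply, Matrix.nonsing_inv_mul _ (T.isUnit_det hB), Matrix.one_apply_eq]
  rw [Fintype.sum_option, Finset.sum_eq_single i (fun j _ hj => by simp [B, wt, h j hj])
    (by simp), h0] at hv
  simp [B] at hv

/-- If `𝔤` is simple, then `(𝓑^W)_{-1}` is generated by `f_0 h_0` and the elements `f_0 e_ϑ`. -/
theorem eq_top_of_generators_mem (hs : LieAlgebra.IsSimple K T.g)
    {e : {ϑ // T.IsHighestRoot ϑ} → B₀ T.B} (he : ∀ ϑ, T.IsRootVector T.gMinus ϑ.1 (e ϑ))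
    (Q : LieSubmodule K T.g T.M) (h0 : T.f0h0 ∈ Q) (hQ : ∀ ϑ, T.f0mul (e ϑ) ∈ Q) : Q = ⊤ := by
  have hB' := T.isUnit_det hB
  obtain ⟨i, hi⟩ := T.lam_ne_zero hB
  have hj : ∀ j, j ≠ i → T.lam j = 0 := fun j hj => T.lam_eq_zero_of_ne hB hpm hlam hs hi hj
  have hi1 : T.lam i = 1 := by
    have := T.lam_le_one hB hpm hlam i
    omega
  have hlev : ∀ d, T.lev d = d (some i) := fun d => by
    rw [lev, Finset.sum_eq_single i (fun j _ hj' => by simp [hj j hj']) (by simp), hi1]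
    simp
  -- The set of all z with f_0 z in `Q` is stable under 𝔤⁻; the aim is to show that it is all of
  -- 𝓑_0.
  set S : Submodule K (B₀ T.B) := Q.toSubmodule.comap (eltL T.B (f0 T.B)) with hSdef
  have hstab : ∀ y ∈ T.gMinus, ∀ z ∈ S, ⁅y, z⁆ ∈ S := fun y hy z hz => by
    change elt T.B (f0 T.B) ⁅y, z⁆ ∈ Q
    rw [← T.lie_elt_f0_of_mem_gMinus hB hy]
    exact T.lie_mem_of_g hB Q y hz
  have hgm : T.gMinus.toSubmodule ≤ S :=
    T.gMinus_le hB (T.finite_degrees hB hpm hlam hs) he hstab hQ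
  have hL : gradingElt T.B ∈ S := by
    change elt T.B (f0 T.B) (gradingElt T.B) ∈ Q
    rw [← neg_neg (elt T.B (f0 T.B) (gradingElt T.B)), ← T.f0h0_eq hB hpm hlam]
    exact neg_mem h0
  have hh : ∀ k, hG T.B k ∈ S := by
    have h₁ : ∀ j, j ≠ i → hG T.B (some j) ∈ S := fun j hj' =>
      hgm (hG_mem_subalg T.B (S := {k | T.lam k = 0}) (hj j hj'))
    rintro (_ | k)
    · exact h0
    by_cases hk : k = i
    · subst hk
      -- The remaining h_i comes from L, in which it has a nonzero coefficient, all other terms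
      -- being known to lie in `S`.
      refine (Submodule.smul_mem_iff _ (T.inv_none_some_ne hB hpm hlam hj)).1 ?_
      have e₁ : T.B⁻¹ none (some k) • hG T.B (some k) = gradingElt T.B -
          (T.B⁻¹ none none • hG T.B none +
            ∑ j ∈ Finset.univ.erase k, T.B⁻¹ none (some j) • hG T.B (some j)) := by
        rw [gradingElt, Fintype.sum_option, ← Finset.add_sum_erase _ _ (Finset.mem_univ k)]
        abel
      rw [e₁]
      refine sub_mem hL (add_mem (S.smul_mem _ h0) (sum_mem fun j hj' => S.smul_mem _ (h₁ j ?_)))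
      exact (Finset.mem_erase.1 hj').1
    · exact h₁ k hk
  have hf : cG T.B false i ∈ S := by
    change elt T.B (f0 T.B) (cG T.B false i) ∈ Q
    rw [T.elt_f0_f_eq hB hpm hlam hi1]
    exact T.lie_mem_of_g hB Q _ (hh (some i))
  -- A word with exactly one letter f_i is built from f_i by brackets with elements of 𝔤⁻, which
  -- preserve `S`.
  have hwords : ∀ (l : List (Option (Fin r))) (k : Option (Fin r)), none ∉ k :: l →
      (cnt (k :: l) (some i) = 0 → ∃ z ∈ T.gMinus, (z : ContrAlg T.B) = rn T.B false l k) ∧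
      (cnt (k :: l) (some i) = 1 → ∃ z ∈ S, (z : ContrAlg T.B) = rn T.B false l k) := by
    intro l k hl
    induction l with
    | nil =>
      rcases k with _ | k
      · simp at hl
      refine ⟨fun hc => ?_, fun hc => ?_⟩
      · refine ⟨cG T.B false k, T.cG_mem_gMinus hB false (hj k ?_), by simp [rn]⟩
        rintro rfl
        exact cnt_eq_zero.1 hc (by simp)
      · have : some i ∈ [some k] := cnt_pos.1 (by rw [hc]; exact one_pos)
        obtain rfl : i = k := by simpa using this
        exact ⟨_, hf, by simp [rn]⟩
    | cons j l ih =>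
      rcases j with _ | j
      · simp at hl
      have hl' : none ∉ k :: l := fun h => hl (by simp only [List.mem_cons] at h ⊢; tauto)
      have hcc : cnt (k :: some j :: l) (some i) =
          (Pi.single (some j) 1 : Option (Fin r) → ℤ) (some i) + cnt (k :: l) (some i) := by
        simp only [cnt_cons, Pi.add_apply]
        ring
      rw [hcc]
      by_cases hji : j = i
      · subst hji
        rw [Pi.single_eq_same]
        refine ⟨fun hc => ?_, fun hc => ?_⟩
        · have := cnt_nonneg (k :: l) (some j)
          omega
        · obtain ⟨z, hz, hz'⟩ := (ih hl').1 (by omega)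
          refine ⟨⁅cG T.B false j, z⁆, ?_, by rw [coe_lie, coe_cG, hz']; rfl⟩
          rw [← lie_skew]
          exact neg_mem (hstab z hz _ hf)
      · have hne : (some i : Option (Fin r)) ≠ some j := fun h => hji (Option.some_injective _ h).symm
        rw [Pi.single_eq_of_ne hne, zero_add]
        have hjm := T.cG_mem_gMinus hB false (hj j hji)
        refine ⟨fun hc => ?_, fun hc => ?_⟩
        · obtain ⟨z, hz, hz'⟩ := (ih hl').1 hc
          exact ⟨⁅cG T.B false j, z⁆, T.gMinus.lie_mem hjm hz, by rw [coe_lie, coe_cG, hz']; rfl⟩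
        · obtain ⟨z, hz, hz'⟩ := (ih hl').2 hc
          exact ⟨⁅cG T.B false j, z⁆, hstab _ hjm z hz, by rw [coe_lie, coe_cG, hz']; rfl⟩
  refine T.eq_top_of_elt_f0_mem hB Q fun z => ?_
  have htop : (⊤ : Submodule K (B₀ T.B)) ≤ S := by
    rw [← iSup_wsp_zero T.B hB']
    refine iSup₂_le fun d hn z hz => ?_
    by_cases hz0 : z = 0
    · rw [hz0]; exact zero_mem _
    by_cases hd0 : d = 0
    · subst hd0
      have h₁ := gr_zero_le T.B hB' ((mem_wsp_zero T.B).1 hz)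
      have h₂ : Submodule.map (comp T.B 0).subtype (Submodule.span K (Set.range (hG T.B))) =
          cartan T.B := by
        rw [Submodule.map_span, cartan, ← Set.range_comp]
        congr 1
      rw [← h₂] at h₁
      obtain ⟨z', hz', e'⟩ := h₁
      rw [← (Subtype.ext e' : z' = z)]
      refine Submodule.span_le.2 ?_ hz'
      rintro _ ⟨k, rfl⟩
      exact hh k
    have hle := T.abs_lev_le hB hpm hlam hz hz0
    rw [abs_le] at hle
    -- The level is the coordinate at the only node with λ_i ≠ 0. In level one f_0 z = 0, level zero
    -- is 𝔤⁻, and in level -1 the words contain f_i exactly once.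
    obtain h | h | h : T.lev d = 1 ∨ T.lev d = 0 ∨ T.lev d = -1 := by omega
    · change elt T.B (f0 T.B) z ∈ Q
      rw [T.elt_f0_eq_zero hB hpm hlam hz h]
      exact zero_mem _
    · refine hgm (mem_subalg T.B hB' _ hd0 hn (fun k hk => ?_) hz)
      by_cases hki : k = i
      · rw [hki, ← hlev d, h]
      · exact absurd (hj k hki) hk
    · have hdi : d (some i) = -1 := by rw [← hlev d, h]
      have hneg : d ≤ 0 := (T.nonneg_or_nonpos hB hz hz0).resolve_left fun h' => by
        have := h' (some i)
        rw [hdi] at this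
        simp at this
      have hpos : 0 < bsgn false * ∑ j, d j := by
        rw [bsgn, neg_one_mul, Left.neg_pos_iff]
        exact Finset.sum_neg' (fun j _ => hneg j) ⟨some i, Finset.mem_univ _, by rw [hdi]; simp⟩
      have h₁ := mem_span_rn T.B hB' false hpos ((mem_wsp_zero T.B).1 hz)
      have h₂ : (z : ContrAlg T.B) ∈ S.map (comp T.B 0).subtype := by
        refine Submodule.span_le.2 ?_ h₁
        rintro _ ⟨l, k, hl, rfl⟩
        have hc : ∀ m, cnt (k :: l) m = -d m := fun m => by
          rw [← hl]
          simp [bsgn]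
        obtain ⟨z, hz, e⟩ := (hwords l k (cnt_eq_zero.1 (by rw [hc, hn, neg_zero]))).2
          (by rw [hc, hdi, neg_neg])
        exact ⟨z, hz, e⟩
      obtain ⟨z', hz', e'⟩ := h₂
      rwa [← (Subtype.ext e' : z' = z)]
  exact htop Submodule.mem_top

end

end Triple

end Cartanification

/-! ### Directness of the sum -/

namespace Cartanification

theorem disjoint_of_notMem {R L M : Type*} [CommRing R] [LieRing L] [LieAlgebra R L]
    [AddCommGroup M] [Module R M] [LieRingModule L M] [LieModule R L M] {N N' : LieSubmodule R L M}
    (hN : LieModule.IsIrreducible R L N) {v : M} (hv : v ∈ N) (hv' : v ∉ N') : Disjoint N N' := by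
  rw [disjoint_iff, LieSubmodule.eq_bot_iff]
  rintro x ⟨hx, hx'⟩
  rcases hN.eq_bot_or_eq_top (N'.comap N.incl) with h | h
  · have hm : (⟨x, hx⟩ : N) ∈ N'.comap N.incl := hx'
    rw [h, LieSubmodule.mem_bot] at hm
    exact congrArg Subtype.val hm
  · have hm : (⟨v, hv⟩ : N) ∈ N'.comap N.incl := by
      rw [h]
      exact LieSubmodule.mem_top _
    exact absurd hm hv'

namespace Triple

variable {K : Type*} [Field K] [CharZero K] {r : ℕ} (T : Triple K r)
  (hB : T.B.det ≠ 0) (hpm : T.IsPseudoMinuscule T.up) (hlam : T.wt = T.up)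

include hB hpm hlam

/-- The generators of the modules in `family`. -/
def famGen (e : {ϑ // T.IsHighestRoot ϑ} → B₀ T.B) : Option {ϑ // T.IsHighestRoot ϑ} → T.M
  | none => T.f0h0
  | some ϑ => T.f0mul (e ϑ)

omit hB hpm hlam in
theorem family_eq (e : {ϑ // T.IsHighestRoot ϑ} → B₀ T.B) (s) :
    T.family e s = T.gen (T.famGen e s) := by
  cases s <;> rfl

/-- Each summand is spanned by lowering words applied to its generator, so a generator lying in the
sum of the others would be a combination of words applied to generators of higher weight. Maximality
of the highest roots and the bracket with e_0 exclude this. -/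
theorem iSupIndep_family {e : {ϑ // T.IsHighestRoot ϑ} → B₀ T.B}
    (he : ∀ ϑ, T.IsRootVector T.gMinus ϑ.1 (e ϑ)) : iSupIndep (T.family e) := by
  have hB' := T.isUnit_det hB
  choose d hd hd0 hn hS hed hlab hek using fun ϑ => T.highestRoot_degree hB ϑ.2 (he ϑ)
  let D : Option {ϑ // T.IsHighestRoot ϑ} → Option (Fin r) → ℤ := fun s => s.elim 0 d
  have hDn : ∀ s, D s none = 0 := by
    rintro (_ | ϑ)
    · rfl
    · exact hn ϑ
  have hv : ∀ s, T.famGen e s ∈ wsp T.B T.M (-Pi.single none 1 + D s) := by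
    rintro (_ | ϑ)
    · exact elt_mem_wsp T.B (f0_mem T.B) (hG_mem T.B none)
    · exact elt_mem_wsp T.B (f0_mem T.B) (hed ϑ)
  have hsing : ∀ s i, ⁅cG T.B true i, T.famGen e s⁆ = 0 := by
    rintro (_ | ϑ)
    · exact T.f0h0_singular hB hpm hlam
    · exact T.f0e_singular hB hpm hlam (hed ϑ) (hS ϑ) (hek ϑ)
  have hv0 : ∀ s, T.famGen e s ≠ 0 := by
    rintro (_ | ϑ)
    · exact T.f0h0_ne_zero hB hpm hlam
    · exact fun h => (he ϑ).ne_zero (by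
        rw [← T.brk_elt_f0_e0 hB (e ϑ) (T.lie_gMinus hB (he ϑ).mem).1]
        change brk T.B hB' (T.famGen e (some ϑ)) (e0 T.B) = 0
        rw [h, map_zero, LinearMap.zero_apply])
  have hirr : ∀ s, LieModule.IsIrreducible K T.g (T.family e s) := by
    rintro (_ | ϑ)
    · exact (T.f0h0_irreducible hB hpm hlam).1
    · exact (T.f0e_irreducible hB hpm hlam ϑ.2 (he ϑ)).1
  have hspan : ∀ s, (T.family e s).toSubmodule =
      Submodule.span K (Set.range (app T.B false (T.famGen e s))) := fun s => by
    rw [family_eq, T.gen_toSubmodule hB]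
    exact lieSpan_eq_span_app T.B hB' false (hv s) (hsing s)
  rw [iSupIndep_def]
  intro s
  rw [disjoint_iff]
  by_contra hne
  -- By irreducibility a nonzero intersection with the sum of the other submodules is the whole
  -- submodule.
  have hmem : T.famGen e s ∈ ⨆ j, ⨆ (_ : j ≠ s), T.family e j := by
    have hself : T.famGen e s ∈ T.family e s := by
      rw [family_eq]
      exact T.mem_gen_self hB _
    by_contra h
    exact hne (disjoint_iff.1 (disjoint_of_notMem (hirr s) hself h))
  let Ω := {j // j ≠ s} × List (Fin r)
  have hsp : T.famGen e s ∈ Submodule.span K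
      (Set.range fun w : Ω => app T.B false (T.famGen e w.1.1) w.2) := by
    have h : T.famGen e s ∈ (⨆ j, ⨆ (_ : j ≠ s), T.family e j).toSubmodule := hmem
    simp only [LieSubmodule.iSup_toSubmodule] at h
    have hle : (⨆ j, ⨆ (_ : j ≠ s), (T.family e j).toSubmodule) ≤ Submodule.span K
        (Set.range fun w : Ω => app T.B false (T.famGen e w.1.1) w.2) := by
      refine iSup₂_le fun j hj => ?_
      rw [hspan]
      refine Submodule.span_mono ?_
      rintro _ ⟨l, rfl⟩
      exact ⟨(⟨j, hj⟩, l), rfl⟩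
    exact hle h
  have hsp' := mem_span_of_mem_eigen (fun k => LieModule.toEnd K (B₀ T.B) T.M (hG T.B k))
    (rootVal T.B) (rootVal_injective hB') (wsp T.B T.M) (fun d x hx k => hx k)
    (fun w : Ω => app T.B false (T.famGen e w.1.1) w.2)
    (fun w => -Pi.single none 1 + D w.1.1 + bsgn false • dg w.2)
    (fun w => app_mem_wsp T.B false (hv w.1.1) w.2) (hv s) hsp
  have hdeg : ∀ (j : Option {ϑ // T.IsHighestRoot ϑ}) (l : List (Fin r)),
      -Pi.single none 1 + D j + bsgn false • dg l = -Pi.single none 1 + D s → D j = D s + dg l := by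
    intro j l h
    rw [bsgn, neg_smul, one_smul] at h
    calc D j = (-Pi.single none 1 + D j + -dg l) + Pi.single none 1 + dg l := by abel
      _ = _ := by rw [h]; abel
  rcases s with _ | ϑ
  -- In the weight of f_0 h_0 the other submodules contribute only elements f_0 z with z in 𝔤⁻.
  -- Their brackets with e_0 lie in 𝔤⁻, which does not contain h_0 = [f_0 h_0, e_0].
  · have hle : Submodule.span K {y | ∃ w : Ω, -Pi.single none 1 + D w.1.1 + bsgn false • dg w.2 =
        -Pi.single none 1 + D none ∧ app T.B false (T.famGen e w.1.1) w.2 = y} ≤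
        T.gMinus.toSubmodule.comap ((brk T.B hB').flip (e0 T.B)) := by
      refine Submodule.span_le.2 ?_
      rintro _ ⟨⟨⟨j, hj⟩, l⟩, h, rfl⟩
      have h' := hdeg j l h
      rcases j with _ | ϑ
      · exact absurd rfl hj
      have hdl : d ϑ = dg l := by simpa [D] using h'
      have hl : ∀ i ∈ l, T.lam i = 0 := fun i hi => by
        by_contra h0
        have := dg_some_pos.2 hi
        rw [← hdl, hS ϑ i h0] at this
        exact lt_irrefl _ this
      have hm := words_le_subalg T.B (he ϑ).mem
        (app_mem_words T.B (S := {k | T.lam k = 0}) false (e ϑ) hl)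
      change brk T.B hB' (app T.B false (elt T.B (f0 T.B) (e ϑ)) l) (e0 T.B) ∈ T.gMinus
      rw [T.app_elt_f0 hB (e ϑ) hl, T.brk_elt_f0_e0 hB _ (T.lie_gMinus hB hm).1]
      exact hm
    have h₁ : brk T.B hB' T.f0h0 (e0 T.B) ∈ T.gMinus := hle hsp'
    rw [T.brk_f0h0 hB hpm hlam] at h₁
    have h₂ := Submodule.mem_map_of_mem (f := (comp T.B 0).subtype)
      (mem_span_of_mem_subalg T.B hB' _ h₁ (hG_mem T.B _))
    rw [Submodule.map_span] at h₂
    refine (linearIndependent_cart T.B hB').notMem_span_image (s := Set.range some) (x := none)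
      (by simp) (Submodule.span_mono ?_ (by simpa using h₂))
    rintro _ ⟨_, ⟨i, -, rfl⟩, rfl⟩
    exact ⟨some i, ⟨i, rfl⟩, by simp⟩
  -- No other generator has a degree above that of ϑ: degree zero is too small, and another highest
  -- root above ϑ would be equal to it. So the spanning set is empty.
  · refine hv0 (some ϑ) ((Submodule.mem_bot K).1 (Submodule.span_le.2 ?_ hsp'))
    rintro _ ⟨⟨⟨j, hj⟩, l⟩, h, rfl⟩
    exfalso
    have h' := hdeg j l h
    have hle : d ϑ ≤ D j := by
      rw [h']
      exact le_add_of_nonneg_right (dg_nonneg l)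
    rcases j with _ | ϑ'
    · exact hd0 ϑ (le_antisymm hle (hd ϑ))
    · refine hj (congrArg some (Subtype.ext ?_))
      refine ϑ.2.2 ϑ'.1 ϑ'.2.1 ?_
      rw [← hlab ϑ, ← hlab ϑ']
      have e₁ : T.lab (d ϑ') - T.lab (d ϑ) = T.lab (d ϑ' - d ϑ) := by
        funext i
        simp only [lab, Pi.sub_apply]
        rw [sub_eq_add_neg (d ϑ'), rootVal_add, rootVal_neg]
        simp [sub_eq_add_neg]
      rw [e₁]
      exact T.lab_nonneg (by simp [hn]) (sub_nonneg.2 hle)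

theorem iSup_family (hs : LieAlgebra.IsSimple K T.g) {e : {ϑ // T.IsHighestRoot ϑ} → B₀ T.B}
    (he : ∀ ϑ, T.IsRootVector T.gMinus ϑ.1 (e ϑ)) : ⨆ s, T.family e s = ⊤ := by
  have hm : ∀ s, T.famGen e s ∈ ⨆ s, T.family e s := fun s => by
    refine le_iSup (T.family e) s ?_
    rw [family_eq]
    exact T.mem_gen_self hB _
  exact T.eq_top_of_generators_mem hB hpm hlam hs he _ (hm none) fun ϑ => hm (some ϑ)

end Triple

end Cartanification

end

open Cartanification in
theorem theorem3p4 {K : Type*} [Field K] [CharZero K] [IsAlgClosed K] {r : ℕ} (T : Triple K r)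
    (hB : T.B.det ≠ 0) (hpm : T.IsPseudoMinuscule T.up) (hlam : T.wt = T.up) :
    (LieModule.IsIrreducible K T.g (T.gen T.f0h0) ∧ T.HasHighestWeight (T.gen T.f0h0) T.wt) ∧
    (∀ (ϑ : Fin r → K) (eϑ : B₀ T.B), T.IsHighestRoot ϑ → T.IsRootVector T.gMinus ϑ eϑ →
      LieModule.IsIrreducible K T.g (T.gen (T.f0mul eϑ)) ∧
        T.HasHighestWeight (T.gen (T.f0mul eϑ)) (ϑ + T.wt)) ∧
    (LieAlgebra.IsSimple K T.g → ∀ e : {ϑ // T.IsHighestRoot ϑ} → B₀ T.B,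
      (∀ ϑ, T.IsRootVector T.gMinus ϑ.1 (e ϑ)) →
        iSupIndep (T.family e) ∧ ⨆ s, T.family e s = ⊤) :=
  ⟨T.f0h0_irreducible hB hpm hlam, fun _ _ h h' => T.f0e_irreducible hB hpm hlam h h',
    fun hs _ he => ⟨T.iSupIndep_family hB hpm hlam he, T.iSup_family hB hpm hlam hs he⟩⟩
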